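/- Let $X\subset\mathbb{P}^1\times\mathbb{P}^1\times\mathbb{P}^2$ be the smooth complex Fano threefold of family 3.17, given in coordinates $([x_0:x_1],[y_0:y_1],[z_0:z_1:z_2])$ by $$x_0y_0z_2+x_1y_1z_0=x_0y_1z_1+x_1y_0z_1 .$$ Let $E_1$ and $E_2$ be the surfaces contracted by the birational projections $\pi_1,\pi_2\colon X\to\mathbb{P}^1\times\mathbb{P}^2$ that keep $(x,z)$ and $(y,z)$ respectively, let $C=E_1\cap E_2$, let $\phi\colon X\to\mathbb{P}^1\times\mathbb{P}^1$ be the projection to $(x,y)$, and let $R=\phi^{-1}(\phi(C))$. Let $f\colon\widetilde X\to X$ be the blow up of the curve $C$, let $E$ be its exceptional surface, and let $\widetilde R$ be the proper transform of $R$ on $\widetilde X$. For positive integers $a,b$, let $\nu\colon Y\to\widetilde X$ be the $(a,b)$-blow up between $E$ and $\widetilde R$, i.e. the weighted blow up of the curve $E\cap\widetilde R$ in which the local equations of $E$ and $\widetilde R$ have weights $a$ and $b$, that is, $$Y=\operatorname{Proj}_{\widetilde X}\bigoplus_{n\ge 0}\ \sum_{ai+bj\ge n} I_E^{\,i}\,I_{\widetilde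 R}^{\,j}.$$ Put $\eta=f\circ\nu$. Then there is exactly one $\nu$-exceptional prime divisor $F$ on $Y$, and $$\beta(F)=A_X(F)-S_X(F)>0,$$ where $A_X(F)=1+\operatorname{ord}_F(K_Y-\eta^*K_X)$ is the log discrepancy and $$S_X(F)=\frac{1}{(-K_X)^3}\int_0^\infty\operatorname{vol}\bigl(\eta^*(-K_X)-xF\bigr)\,dx .$$ -/

import Mathlib

open IsLocalRing MeasureTheory
open scoped ENNReal

noncomputable section

namespace Fano

/-! ## Birational models of a function field

A variety over `ℂ` with function field contained in a field `K` is recorded by the set of the local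
rings of all its scheme points (closed or not), viewed inside `K`. Thus

* `P ≤ Q` in `LocalSubring K` (domination) says that `P` is the image, or centre, of the point `Q`
  of another model;
* `Q.toSubring ≤ P.toSubring`, for two points of one model, says that `Q` lies in the closure
  of `P`;
* a prime divisor on a normal model is a point whose local ring is a discrete valuation ring, and
  it coincides with its proper transform on any other normal model where it is still a divisor. -/

section General

variable {K : Type*} [Field K] [Algebra ℂ K]

variable (K) in
/-- A model over `ℂ`, given by the set of its local rings. -/
structure Model where
  points : Set (LocalSubring K)
  algebraMap_mem : ∀ P ∈ points, ∀ c : ℂ, algebraMap ℂ K c ∈ P.toSubring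

/-- The model glued from the spectra of the given `ℂ`-subalgebras of `K`: its local rings are the
localizations of these subalgebras at all their prime ideals. -/
def Model.ofCharts (𝒜 : Set (Subalgebra ℂ K)) : Model K where
  points := {P | ∃ A ∈ 𝒜, ∃ (𝔭 : Ideal A.toSubring) (_ : 𝔭.IsPrime),
    P = LocalSubring.ofPrime A.toSubring 𝔭}
  algebraMap_mem := by
    rintro _ ⟨A, -, 𝔭, h𝔭, rfl⟩ c
    exact LocalSubring.le_ofPrime _ _ (A.algebraMap_mem c)

/-- The exceptional locus of a birational morphism `V → W`: the points of `V` at which the morphism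
is not a local isomorphism. -/
def exceptionalLocus (V W : Model K) : Set (LocalSubring K) :=
  {P | P ∈ V.points ∧ P ∉ W.points}

/-- `D` is (the generic point of) a prime divisor on `V` that is exceptional over `W`. -/
def IsExceptionalPrimeDivisor (V W : Model K) (D : LocalSubring K) : Prop :=
  D ∈ exceptionalLocus V W ∧ IsDiscreteValuationRing D.toSubring

/-- The image of a set of points under a morphism to `W`. -/
def imageIn (W : Model K) (T : Set (LocalSubring K)) : Set (LocalSubring K) :=
  {P | P ∈ W.points ∧ ∃ Q ∈ T, P ≤ Q}

/-- The preimage on `V` of a set of points under a morphism. -/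
def preimageIn (V : Model K) (T : Set (LocalSubring K)) : Set (LocalSubring K) :=
  {Q | Q ∈ V.points ∧ ∃ P ∈ T, P ≤ Q}

/-- The proper transform on `V` of a closed subset `T` of a model dominated by `V`: the closure in
`V` of the set of those points of `T` at which `V` has the same local ring. -/
def properTransform (V : Model K) (T : Set (LocalSubring K)) : Set (LocalSubring K) :=
  {Q | Q ∈ V.points ∧ ∃ P ∈ T, P ∈ V.points ∧ Q.toSubring ≤ P.toSubring}

/-- The stalk at `O` of the (radical) ideal sheaf of the closed subset `T`: the germs at `O` that
vanish at every point of `T` whose closure contains `O`. -/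
def vanishingIdeal (T : Set (LocalSubring K)) (O : LocalSubring K) : Ideal O.toSubring :=
  ⨅ P ∈ T, ⨅ h : O.toSubring ≤ P.toSubring,
    (maximalIdeal P.toSubring).comap (Subring.inclusion h)

/-- `Proj_V (⨁ₙ Iₙ)` for a graded sequence of ideal sheaves on `V`, given by its stalks `I O n`.
Its affine charts over the point `O` are the degree-zero parts of the localizations of `⨁ₙ Iₙ` at
its nonzero homogeneous elements `g` of positive degree `n`. -/
def Model.proj (V : Model K) (I : (O : LocalSubring K) → ℕ → Ideal O.toSubring) : Model K :=
  Model.ofCharts {A | ∃ O ∈ V.points, ∃ n : ℕ, 0 < n ∧ ∃ g ∈ I O n, g ≠ 0 ∧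
    A = Algebra.adjoin ℂ {t : K | ∃ k : ℕ, ∃ h ∈ I O (n * k), t = (h : K) / (g : K) ^ k}}

/-- The blow up of `V` along the closed subset `T` with its reduced structure. -/
def Model.blowUp (V : Model K) (T : Set (LocalSubring K)) : Model K :=
  V.proj fun O n => vanishingIdeal T O ^ n

/-- The ideal generated by the monomials `sⁱ tʲ` of weight `a i + b j ≥ n`, for `s ∈ I`, `t ∈ J`. -/
def weightedIdeal {A : Type*} [CommRing A] (I J : Ideal A) (a b n : ℕ) : Ideal A :=
  ⨆ (i : ℕ) (j : ℕ) (_ : n ≤ a * i + b * j), I ^ i * J ^ j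

/-- The `(a,b)`-blow up of `V` between the surfaces `S` and `T`: the weighted blow up of `S ∩ T`
in which the local equations of `S` and `T` have weights `a` and `b`. -/
def Model.weightedBlowUp (V : Model K) (S T : Set (LocalSubring K)) (a b : ℕ) : Model K :=
  V.proj fun O n => weightedIdeal (vanishingIdeal S O) (vanishingIdeal T O) a b n

/-! ## Log discrepancy, volume and beta invariant on threefolds -/

variable (K) in
/-- Rational differential `3`-forms. -/
abbrev Form3 : Type _ := ⋀[K]^3 (Ω[K⁄ℂ])

/-- The stalk at `P` of the sheaf of regular `3`-forms: the image of `⋀³ Ω_{P/ℂ}` in the rational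
`3`-forms. For a regular point of a threefold this is the stalk of the canonical sheaf. -/
def regularForms (P : LocalSubring K) : Submodule P.toSubring (Form3 K) :=
  Submodule.span P.toSubring {ω | ∃ f : Fin 3 → P.toSubring,
    ω = exteriorPower.ιMulti K 3 fun i => KaehlerDifferential.D ℂ K (f i : K)}

/-- The log discrepancy `A_X(F) = 1 + ord_F (K_Y - η^* K_X)` of a prime divisor `F` on a model
`η : Y → X`, for smooth `X`: the integer `ord_F (K_Y - η^* K_X)` is the largest `n` such that the
regular `3`-forms of `X` at the centre of `F` vanish to order `n` along `F`. -/
def logDiscrepancy (X : Model K) (F : LocalSubring K) : ℕ :=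
  1 + sSup {n : ℕ | ∀ P ∈ X.points, P ≤ F →
    ∀ ω ∈ regularForms P, ω ∈ maximalIdeal F.toSubring ^ n • regularForms F}

/-- The space `H⁰(Y, η^*(-m K_X))` for a model `η : Y → X`. A rational section of `-m K_X` is a
homogeneous function of degree `m` on the `K`-line of rational `3`-forms, and it is regular at a
point `Q` of `Y` if it takes the regular `3`-forms at the image of `Q` in `X` into the local ring
of `Q`. -/
def anticanonicalSections (Y X : Model K) (m : ℕ) : Submodule ℂ (Form3 K → K) where
  carrier := {φ | (∀ (c : K) (ω : Form3 K), φ (c • ω) = c ^ m * φ ω) ∧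
    ∀ Q ∈ Y.points, ∀ P ∈ X.points, P ≤ Q → ∀ ω ∈ regularForms P, φ ω ∈ Q.toSubring}
  zero_mem' := ⟨fun c ω => by simp, fun Q _ P _ _ ω _ => Q.toSubring.zero_mem⟩
  add_mem' := by
    rintro φ ψ ⟨h1, h2⟩ ⟨h3, h4⟩
    refine ⟨fun c ω => by simp [h1, h3, mul_add], fun Q hQ P hP h ω hω => ?_⟩
    exact Q.toSubring.add_mem (h2 Q hQ P hP h ω hω) (h4 Q hQ P hP h ω hω)
  smul_mem' := by
    rintro r φ ⟨h1, h2⟩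
    refine ⟨fun c ω => by simp [h1], fun Q hQ P hP h ω hω => ?_⟩
    rw [Pi.smul_apply, Algebra.smul_def]
    exact Q.toSubring.mul_mem (Y.algebraMap_mem Q hQ r) (h2 Q hQ P hP h ω hω)

/-- The space `H⁰(Y, η^*(-m K_X) - n F)`: the sections of `η^*(-m K_X)` on `Y` that vanish to order
at least `n` along the prime divisor `F`. (These already form a subspace if `F` is a point of `Y`.) -/
def vanishingSections (Y X : Model K) (F : LocalSubring K) (m n : ℕ) :
    Submodule ℂ (Form3 K → K) :=
  Submodule.span ℂ {φ | φ ∈ anticanonicalSections Y X m ∧ ∀ P ∈ X.points, P ≤ F →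
    ∀ ω ∈ regularForms P, ∃ h ∈ maximalIdeal F.toSubring ^ n, (h : K) = φ ω}

/-- The degree `(-K_X)³` of a Fano threefold `X`: as `-K_X` is ample, it is the volume of `-K_X`. -/
def anticanonicalDegree (X : Model K) : ℝ≥0∞ :=
  Filter.limsup (fun m : ℕ =>
    (Module.finrank ℂ (anticanonicalSections X X m) : ℝ≥0∞) / ((m : ℝ≥0∞) ^ 3 / 6)) Filter.atTop

/-- The volume `vol(η^*(-K_X) - x F)`, for real `x ≥ 0`. -/
def vol (Y X : Model K) (F : LocalSubring K) (x : ℝ) : ℝ≥0∞ :=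
  Filter.limsup (fun m : ℕ =>
    (Module.finrank ℂ (vanishingSections Y X F m ⌈(m : ℝ) * x⌉₊) : ℝ≥0∞) / ((m : ℝ≥0∞) ^ 3 / 6))
    Filter.atTop

/-- `S_X(F) = (1 / (-K_X)³) ∫₀^∞ vol(η^*(-K_X) - x F) dx`. -/
def expectedVanishing (Y X : Model K) (F : LocalSubring K) : ℝ≥0∞ :=
  (∫⁻ x in Set.Ioi (0 : ℝ), vol Y X F x) / anticanonicalDegree X

/-- `β(F) = A_X(F) - S_X(F)`, equal to `-∞` if `S_X(F)` were infinite. -/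
def beta (Y X : Model K) (F : LocalSubring K) : EReal :=
  (logDiscrepancy X F : EReal) - (expectedVanishing Y X F : EReal)

end General

/-! ## The threefold `x₀y₀z₂ + x₁y₁z₀ = x₀y₁z₁ + x₁y₀z₁` in `ℙ¹ × ℙ¹ × ℙ²` -/

/-- The index type of the variables `x₀, x₁`, `y₀, y₁`, `z₀, z₁, z₂`. -/
abbrev Vars : Type := Fin 2 ⊕ Fin 2 ⊕ Fin 3

abbrev vx (i : Fin 2) : MvPolynomial Vars ℂ := MvPolynomial.X (Sum.inl i)
abbrev vy (i : Fin 2) : MvPolynomial Vars ℂ := MvPolynomial.X (Sum.inr (Sum.inl i))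
abbrev vz (i : Fin 3) : MvPolynomial Vars ℂ := MvPolynomial.X (Sum.inr (Sum.inr i))

/-- The equation of `X`. -/
def equation : MvPolynomial Vars ℂ :=
  vx 0 * vy 0 * vz 2 + vx 1 * vy 1 * vz 0 - (vx 0 * vy 1 * vz 1 + vx 1 * vy 0 * vz 1)

/-- The open subset `x₀ y₀ z₀ ≠ 0` of `X` is the graph of `z₂/z₀` as a function of
`x = x₁/x₀`, `y = y₁/y₀`, `z = z₁/z₀`; this is its coordinate ring `ℂ[x, y, z]`. -/
abbrev ChartRing : Type := MvPolynomial (Fin 3) ℂ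

/-- The coordinates `[1 : x]`, `[1 : y]`, `[1 : z : (x + y) z - x y]` of the generic point of `X`. -/
def genericX : Fin 2 → ChartRing := ![1, MvPolynomial.X 0]
def genericY : Fin 2 → ChartRing := ![1, MvPolynomial.X 1]
def genericZ : Fin 3 → ChartRing :=
  ![1, MvPolynomial.X 2, (MvPolynomial.X 0 + MvPolynomial.X 1) * MvPolynomial.X 2 -
    MvPolynomial.X 0 * MvPolynomial.X 1]

/-- Evaluation of polynomials at the generic point, the three groups of homogeneous coordinates
being scaled by independent variables. -/
def genericEval : MvPolynomial Vars ℂ →ₐ[ℂ] MvPolynomial (Fin 3) ChartRing :=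
  MvPolynomial.aeval (Sum.elim (fun i => MvPolynomial.X 0 * MvPolynomial.C (genericX i))
    (Sum.elim (fun i => MvPolynomial.X 1 * MvPolynomial.C (genericY i))
      (fun i => MvPolynomial.X 2 * MvPolynomial.C (genericZ i))))

lemma genericEval_equation : genericEval equation = 0 := by
  simp [genericEval, equation, genericX, genericY, genericZ]
  ring

abbrev FF : Type := FractionRing (MvPolynomial Vars ℂ)

/-- A one-sided inverse of `genericEval`, away from the variable `z₂`. -/
def backEval : MvPolynomial (Fin 3) ChartRing →+* FF :=
  MvPolynomial.eval₂Hom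
    (MvPolynomial.aeval (R := ℂ) ![algebraMap _ FF (vx 1) / algebraMap _ FF (vx 0),
      algebraMap _ FF (vy 1) / algebraMap _ FF (vy 0),
      algebraMap _ FF (vz 1) / algebraMap _ FF (vz 0)]).toRingHom
    ![algebraMap _ FF (vx 0), algebraMap _ FF (vy 0), algebraMap _ FF (vz 0)]

def noZ2 : Subalgebra ℂ (MvPolynomial Vars ℂ) :=
  Algebra.adjoin ℂ {vx 0, vx 1, vy 0, vy 1, vz 0, vz 1}

lemma ne_zero_FF (v : Vars) :
    algebraMap (MvPolynomial Vars ℂ) FF (MvPolynomial.X v) ≠ 0 := by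
  simp [MvPolynomial.X_ne_zero]

lemma backEval_genericEval {r : MvPolynomial Vars ℂ} (hr : r ∈ noZ2) :
    backEval (genericEval r) = algebraMap _ FF r := by
  have hx := ne_zero_FF (Sum.inl 0)
  have hy := ne_zero_FF (Sum.inr (Sum.inl 0))
  have hz := ne_zero_FF (Sum.inr (Sum.inr 0))
  induction hr using Algebra.adjoin_induction with
  | mem p hp =>
    rcases hp with rfl | rfl | rfl | rfl | rfl | rfl <;>
      simp [genericEval, backEval, genericX, genericY, genericZ] <;> field_simp
  | algebraMap c =>
    rw [AlgHom.commutes, IsScalarTower.algebraMap_apply ℂ ChartRing,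
      MvPolynomial.algebraMap_eq, ← IsScalarTower.algebraMap_apply ℂ _ FF]
    simp only [backEval, MvPolynomial.coe_eval₂Hom, MvPolynomial.eval₂_C]
    exact AlgHom.commutes _ c
  | add p q _ _ hp hq => rw [map_add, map_add, hp, hq, map_add]
  | mul p q _ _ hp hq => rw [map_mul, map_mul, hp, hq, map_mul]

lemma pseudo_division (p : MvPolynomial Vars ℂ) :
    ∃ (N : ℕ) (q : MvPolynomial Vars ℂ), ∃ r ∈ noZ2, (vx 0 * vy 0) ^ N * p = equation * q + r := by
  have hmem : ∀ v ∈ ({vx 0, vx 1, vy 0, vy 1, vz 0, vz 1} : Set (MvPolynomial Vars ℂ)),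
      v ∈ noZ2 := fun v hv => Algebra.subset_adjoin hv
  have h0 : vx 0 * vy 0 ∈ noZ2 := noZ2.mul_mem (hmem _ (by simp)) (hmem _ (by simp))
  induction p using MvPolynomial.induction_on with
  | C c => exact ⟨0, 0, _, noZ2.algebraMap_mem c, by simp [MvPolynomial.algebraMap_eq]⟩
  | add p p' hp hp' =>
    obtain ⟨N, q, r, hr, h⟩ := hp
    obtain ⟨N', q', r', hr', h'⟩ := hp'
    refine ⟨N + N', (vx 0 * vy 0) ^ N' * q + (vx 0 * vy 0) ^ N * q',
      (vx 0 * vy 0) ^ N' * r + (vx 0 * vy 0) ^ N * r',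
      noZ2.add_mem (noZ2.mul_mem (noZ2.pow_mem h0 _) hr)
        (noZ2.mul_mem (noZ2.pow_mem h0 _) hr'), ?_⟩
    linear_combination (vx 0 * vy 0) ^ N' * h + (vx 0 * vy 0) ^ N * h'
  | mul_X p v hp =>
    obtain ⟨N, q, r, hr, h⟩ := hp
    by_cases hv : (MvPolynomial.X v : MvPolynomial Vars ℂ) ∈ noZ2
    · exact ⟨N, q * MvPolynomial.X v, r * MvPolynomial.X v, noZ2.mul_mem hr hv, by
        linear_combination MvPolynomial.X v * h⟩
    · have hv2 : v = Sum.inr (Sum.inr 2) := by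
        by_contra hne
        apply hv
        apply hmem
        rcases v with i | i | i <;> fin_cases i <;> simp_all
      subst hv2
      refine ⟨N + 1, vx 0 * vy 0 * q * vz 2 + r,
        r * (vx 0 * vy 1 * vz 1 + vx 1 * vy 0 * vz 1 - vx 1 * vy 1 * vz 0), ?_, ?_⟩
      · refine noZ2.mul_mem hr (noZ2.sub_mem (noZ2.add_mem ?_ ?_) ?_) <;>
          exact noZ2.mul_mem (noZ2.mul_mem (hmem _ (by simp)) (hmem _ (by simp)))
            (hmem _ (by simp))
      · have he : equation = vx 0 * vy 0 * vz 2 + vx 1 * vy 1 * vz 0 -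
          (vx 0 * vy 1 * vz 1 + vx 1 * vy 0 * vz 1) := rfl
        linear_combination (vx 0 * vy 0 * vz 2) * h - r * he

lemma dvd_of_X_mul {v : Vars} (hv : v = Sum.inl 0 ∨ v = Sum.inr (Sum.inl 0))
    {p : MvPolynomial Vars ℂ} (h : equation ∣ MvPolynomial.X v * p) : equation ∣ p := by
  obtain ⟨q, hq⟩ := h
  have hprime : Prime (MvPolynomial.X v : MvPolynomial Vars ℂ) := MvPolynomial.X_prime
  have hnot : ¬ (MvPolynomial.X v : MvPolynomial Vars ℂ) ∣ equation := by
    rintro ⟨s, hs⟩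
    have := congrArg (MvPolynomial.eval
      (fun w => if w = v ∨ w = Sum.inr (Sum.inr 1) then (0 : ℂ) else 1)) hs
    rcases hv with rfl | rfl <;> simp [equation] at this
  obtain ⟨s, rfl⟩ := (hprime.dvd_or_dvd ⟨p, hq.symm⟩).resolve_left hnot
  exact ⟨s, mul_left_cancel₀ hprime.ne_zero (by rw [hq]; ring)⟩

/-- A polynomial vanishes at the generic point exactly if it is divisible by the equation of `X`;
so the closure of the generic point is the divisor `X` given by this equation. -/
theorem genericEval_eq_zero_iff (p : MvPolynomial Vars ℂ) :
    genericEval p = 0 ↔ equation ∣ p := by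
  refine ⟨fun hp => ?_, fun ⟨q, hq⟩ => by rw [hq, map_mul, genericEval_equation, zero_mul]⟩
  obtain ⟨N, q, r, hr, h⟩ := pseudo_division p
  have hr0 : genericEval r = 0 := by
    have := congrArg genericEval h
    rw [map_mul, map_add, map_mul, hp, genericEval_equation, zero_mul, mul_zero, zero_add] at this
    exact this.symm
  have hr1 : r = 0 := by
    have := backEval_genericEval hr
    rw [hr0, map_zero] at this
    exact (IsFractionRing.injective (MvPolynomial Vars ℂ) FF) (by rw [← this, map_zero])
  rw [hr1, add_zero] at h
  have hdvd : equation ∣ (vx 0 * vy 0) ^ N * p := ⟨q, h⟩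
  clear h hr0 hr1
  induction N with
  | zero => simpa using hdvd
  | succ N ih =>
    apply ih
    apply dvd_of_X_mul (Or.inr rfl)
    apply dvd_of_X_mul (Or.inl rfl)
    convert hdvd using 1
    ring

/-- The function field `ℂ(x, y, z)` of `X`. -/
abbrev FunctionField : Type := FractionRing ChartRing

/-- The affine coordinates `v_j / v_i` on the chart `v_i ≠ 0` of a projective space, at a point
with homogeneous coordinates `v`. -/
def ratios {n : ℕ} (v : Fin n → ChartRing) (i : Fin n) : Set FunctionField :=
  Set.range fun j => algebraMap ChartRing FunctionField (v j) / algebraMap _ _ (v i)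

/-- The threefold `X`, the closure of its generic point in `ℙ¹ × ℙ¹ × ℙ²`: it is glued from the
charts `x_i ≠ 0`, `y_j ≠ 0`, `z_k ≠ 0`. -/
def X : Model FunctionField :=
  Model.ofCharts {A | ∃ i j k,
    A = Algebra.adjoin ℂ (ratios genericX i ∪ ratios genericY j ∪ ratios genericZ k)}

/-- The product `ℙ¹ × ℙ²` of the first and third factors, target of `π₁ : X → ℙ¹ × ℙ²`. -/
def W₁ : Model FunctionField :=
  Model.ofCharts {A | ∃ i k, A = Algebra.adjoin ℂ (ratios genericX i ∪ ratios genericZ k)}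

/-- The product `ℙ¹ × ℙ²` of the second and third factors, target of `π₂ : X → ℙ¹ × ℙ²`. -/
def W₂ : Model FunctionField :=
  Model.ofCharts {A | ∃ j k, A = Algebra.adjoin ℂ (ratios genericY j ∪ ratios genericZ k)}

/-- The product `ℙ¹ × ℙ¹` of the first two factors, target of the `ℙ¹`-bundle
`φ : X → ℙ¹ × ℙ¹`. -/
def B : Model FunctionField :=
  Model.ofCharts {A | ∃ i j, A = Algebra.adjoin ℂ (ratios genericX i ∪ ratios genericY j)}

/-- The surface contracted by `π₁`. -/
def E₁ : Set (LocalSubring FunctionField) := exceptionalLocus X W₁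

/-- The surface contracted by `π₂`. -/
def E₂ : Set (LocalSubring FunctionField) := exceptionalLocus X W₂

/-- The curve `C = E₁ ∩ E₂`. -/
def C : Set (LocalSubring FunctionField) := E₁ ∩ E₂

/-- The surface `R = φ⁻¹(φ(C))`. -/
def R : Set (LocalSubring FunctionField) := preimageIn X (imageIn B C)

/-- The blow up `X̃ → X` of the curve `C`. -/
def Xtilde : Model FunctionField := X.blowUp C

/-- The exceptional surface of `X̃ → X`. -/
def E : Set (LocalSubring FunctionField) := exceptionalLocus Xtilde X

/-- The proper transform of `R` on `X̃`. -/
def Rtilde : Set (LocalSubring FunctionField) := properTransform Xtilde R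

/-- The `(a,b)`-blow up `Y → X̃` between the surfaces `E` and `R̃`. -/
def Y (a b : ℕ) : Model FunctionField := Xtilde.weightedBlowUp E Rtilde a b

end Fano

end

/-! The proof bounds the log discrepancy of `F` from below and its expected vanishing order from
above by the same number. A common factor of the two weights does not change the exceptional
divisor, so let `a`, `b` be coprime (`Weights`, `exists_weights`). In the affine coordinates `x, y,
z` put `u = z - x` and `r = x - y`. There `u = 0` is `E₁`, `r = 0` is `R`, and `C` is `u = r = 0`.
Near `E ∩ R̃` the blow up of `C` has coordinates `x, u, ρ` with `ρ = r / u`, where `E` is `u = 0`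
and `R̃` is `ρ = 0`.

The divisor. `F` is the quasi-monomial valuation with `ord u = a`, `ord ρ = b` (`divF`). The
weighted ideals are its valuation ideals, so the local ring of an exceptional prime divisor of `Y`
is contained in that of `F`, and discrete valuation rings are maximal proper subrings
(`exists_eq_divF`). The curve `C` needs two affine charts, exchanged by an involution of `X`; both
lead to the same valuation (`divF_invCoord`).

The log discrepancy. Since `dx ∧ dy ∧ dz = ± u dx ∧ du ∧ dρ`, and `du ∧ dρ` is `u ρ` times a
logarithmic form, the Jacobian has order `2a + b - 1` along `F`, whence `2a + b ≤ A_X(F)`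
(`le_logDiscrepancy`).

The sections. A section of `-m K_X` is a polynomial in `x, y, z` with poles of orders at most `m, m,
2m` along the three divisors at infinity (`sec`, `exists_polySection`, `anticanonicalSections_X`).
As `C` has codimension two, the same holds for sections on `Y`. The surface `E₁` has class `(1, -1,
1)`, so dividing by `z - x` carries bounds `(p + 1, q, c)` to `(p, q + 1, c - 1)` (`sec_of_mul`),
while the restriction to `E₁` has bounded degrees in `x, y` (`degreeOf_resE`). Induction along this
step gives generators (`sec_le_monomialSpan`) and dimension bounds (`rank_sec_le`).

From `F` to `C`. A section of `-m K_X` of multiplicity exactly `d` along `C` has order at most `a d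
+ b m` along `F` (`order_le_of_notMem`). For `d ≤ m` this is read off from a term of lowest degree
in `u, r`. For `d > m` the section is divisible by the equation of `E₁ + E₂`: restricted to `E₁` it
has degree at most `m` in `y` and vanishes more than `m` times on `x = y`. Dividing lowers the
multiplicity by `2` and the order along `F` by `2a`.

The volume. Let `D` be the anticanonical degree. Beyond `a + b`, `2a + b`, `3a + b` the sections
counted by the volume have multiplicity at least `m`, `2m`, `3m + 1` along `C`. Multiplicity `m`
imposes at least `13 m³ / 6` conditions (`thirteen_le_finrank`). Sections of multiplicity `2m`
contain about `m / 2` copies of `E₁ + E₂`, and what remains has dimension about `2 m³`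
(`finrank_jetSec_two_mul`). Multiplicity above `3m` forces zero (`jetSec_eq_bot`). So the volume is
at most `D`, `D - 13`, `25/2`, `0` on the successive intervals, its integral is at most `D (a + b) +
(D - 13) a + (25/2) a = D (2a + b) - a / 2`, and `S_X(F) < 2a + b` (`expectedVanishing_lt`). The
exact value of `D` plays no role. -/

noncomputable section

namespace Fano

/-! ### Local subrings of a field: domination, localization and centres. -/

section LocalSubrings

variable {K : Type*} [Field K]

/-- The maximal ideal of a local subring, as a subset of the field. -/
def mx (P : LocalSubring K) : Set K := {k | k ∈ P.toSubring ∧ (k = 0 ∨ k⁻¹ ∉ P.toSubring)}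

lemma mem_mx_iff {P : LocalSubring K} (k : P.toSubring) :
    k ∈ maximalIdeal P.toSubring ↔ (k : K) ∈ mx P := by
  rw [mem_maximalIdeal, mem_nonunits_iff, mx, Set.mem_ofPred_eq]
  simp only [SetLike.coe_mem, true_and]
  constructor
  · intro h
    by_contra! hc
    exact h (IsUnit.of_mul_eq_one ⟨_, hc.2⟩ (Subtype.ext (mul_inv_cancel₀ hc.1)))
  · rintro h hu
    obtain ⟨l, hl⟩ := hu.exists_right_inv
    have hl' : (k : K) * l = 1 := congrArg Subtype.val hl
    rcases h with h | h
    · rw [h, zero_mul] at hl'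
      exact zero_ne_one hl'
    · apply h
      rw [inv_eq_of_mul_eq_one_right hl']
      exact l.2

lemma zero_mem_mx (P : LocalSubring K) : (0 : K) ∈ mx P := ⟨P.toSubring.zero_mem, Or.inl rfl⟩

lemma one_notMem_mx (P : LocalSubring K) : (1 : K) ∉ mx P := by
  rintro ⟨-, h | h⟩
  · exact one_ne_zero h
  · exact h (by simp)

lemma add_mem_mx {P : LocalSubring K} {k l : K} (hk : k ∈ mx P) (hl : l ∈ mx P) :
    k + l ∈ mx P := by
  have h1 := (mem_mx_iff ⟨k, hk.1⟩).2 hk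
  have h2 := (mem_mx_iff ⟨l, hl.1⟩).2 hl
  exact (mem_mx_iff _).1 (add_mem h1 h2)

lemma mul_mem_mx {P : LocalSubring K} {k l : K} (hk : k ∈ P.toSubring) (hl : l ∈ mx P) :
    k * l ∈ mx P := by
  have h2 := (mem_mx_iff ⟨l, hl.1⟩).2 hl
  exact (mem_mx_iff (⟨k, hk⟩ * ⟨l, hl.1⟩)).1 (Ideal.mul_mem_left _ _ h2)

lemma mul_mem_mx' {P : LocalSubring K} {k l : K} (hk : k ∈ mx P) (hl : l ∈ P.toSubring) :
    k * l ∈ mx P := mul_comm l k ▸ mul_mem_mx hl hk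

lemma neg_mem_mx {P : LocalSubring K} {k : K} (hk : k ∈ mx P) : -k ∈ mx P := by
  have := mul_mem_mx (P.toSubring.neg_mem P.toSubring.one_mem) hk
  simpa using this

lemma sub_mem_mx {P : LocalSubring K} {k l : K} (hk : k ∈ mx P) (hl : l ∈ mx P) :
    k - l ∈ mx P := sub_eq_add_neg k l ▸ add_mem_mx hk (neg_mem_mx hl)

lemma mem_or_mem_of_mul_mem_mx {P : LocalSubring K} {k l : K} (hk : k ∈ P.toSubring)
    (hl : l ∈ P.toSubring) (h : k * l ∈ mx P) : k ∈ mx P ∨ l ∈ mx P := by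
  have := (mem_mx_iff ((⟨k, hk⟩ : P.toSubring) * ⟨l, hl⟩)).2 h
  rcases (inferInstance : (maximalIdeal P.toSubring).IsPrime).mem_or_mem this with h | h
  · exact Or.inl ((mem_mx_iff _).1 h)
  · exact Or.inr ((mem_mx_iff _).1 h)

lemma mem_mx_of_pow_mem {P : LocalSubring K} {k : K} (hk : k ∈ P.toSubring) {n : ℕ}
    (h : k ^ n ∈ mx P) : k ∈ mx P := by
  have := (mem_mx_iff ((⟨k, hk⟩ : P.toSubring) ^ n)).2 h
  exact (mem_mx_iff _).1 ((inferInstance : (maximalIdeal P.toSubring).IsPrime).mem_of_pow_mem _ this)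

lemma pow_mem_mx {P : LocalSubring K} {k : K} (hk : k ∈ mx P) {n : ℕ} (hn : n ≠ 0) :
    k ^ n ∈ mx P := by
  obtain ⟨n, rfl⟩ := Nat.exists_eq_succ_of_ne_zero hn
  rw [pow_succ]
  exact mul_mem_mx (P.toSubring.pow_mem hk.1 _) hk

lemma inv_mem_of_notMem_mx {P : LocalSubring K} {k : K} (hk : k ∈ P.toSubring) (h : k ∉ mx P) :
    k⁻¹ ∈ P.toSubring := by
  by_contra hc
  exact h ⟨hk, Or.inr hc⟩

lemma notMem_mx_of_inv_mem {P : LocalSubring K} {k : K} (h0 : k ≠ 0) (h : k⁻¹ ∈ P.toSubring) :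
    k ∉ mx P := fun hc => hc.2.elim h0 (fun h' => h' h)

lemma div_mem_of_inv_mem {P : LocalSubring K} {a s : K} (ha : a ∈ P.toSubring)
    (hs : s⁻¹ ∈ P.toSubring) : a / s ∈ P.toSubring := by
  rw [div_eq_mul_inv]
  exact P.toSubring.mul_mem ha hs

lemma ne_zero_of_notMem_mx {P : LocalSubring K} {k : K} (h : k ∉ mx P) : k ≠ 0 :=
  fun hc => h (hc ▸ zero_mem_mx P)

/-- An element congruent to a unit is a unit. -/
lemma notMem_mx_add {P : LocalSubring K} {k l : K} (hk : k ∉ mx P) (hl : l ∈ mx P) :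
    k + l ∉ mx P := fun h => hk (by simpa using sub_mem_mx h hl)

lemma mul_notMem_mx {P : LocalSubring K} {k l : K} (hk : k ∈ P.toSubring) (hl : l ∈ P.toSubring)
    (hk' : k ∉ mx P) (hl' : l ∉ mx P) : k * l ∉ mx P :=
  fun h => (mem_or_mem_of_mul_mem_mx hk hl h).elim hk' hl'

/-- Centres are compared below as subsets of `K`, so the local homomorphism hidden in the order on
`LocalSubring` is unfolded once and for all. -/
lemma domination_iff {P Q : LocalSubring K} :
    P ≤ Q ↔ P.toSubring ≤ Q.toSubring ∧ mx P ⊆ mx Q := by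
  constructor
  · rintro ⟨h, hl⟩
    refine ⟨h, fun k hk => ?_⟩
    have h1 := (mem_mx_iff ⟨k, hk.1⟩).2 hk
    have h2 : Subring.inclusion h ⟨k, hk.1⟩ ∈ maximalIdeal Q.toSubring := by
      rw [mem_maximalIdeal, mem_nonunits_iff] at h1 ⊢
      exact fun hu => h1 (hl.map_nonunit _ hu)
    exact (mem_mx_iff _).1 h2
  · rintro ⟨h, hm⟩
    refine ⟨h, ⟨fun k hu => ?_⟩⟩
    by_contra hc
    have h1 : k ∈ maximalIdeal P.toSubring := hc
    have h2 := (mem_mx_iff (Subring.inclusion h k)).2 (hm ((mem_mx_iff k).1 h1))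
    exact h2 hu

/-- A unit of `P` remains a unit in `Q`. -/
lemma mem_mx_of_dominated {P Q : LocalSubring K} (h : P ≤ Q) {k : K} (hk : k ∈ P.toSubring)
    (hQ : k ∈ mx Q) : k ∈ mx P := by
  by_contra hc
  exact notMem_mx_of_inv_mem (ne_zero_of_notMem_mx hc)
    ((domination_iff.1 h).1 (inv_mem_of_notMem_mx hk hc)) hQ

/-- `P` is the localization of its subring `A` at a prime ideal. -/
def LocOf (A : Subring K) (P : LocalSubring K) : Prop :=
  A ≤ P.toSubring ∧ ∀ k ∈ P.toSubring, ∃ a ∈ A, ∃ s ∈ A, s ≠ 0 ∧ s⁻¹ ∈ P.toSubring ∧ k = a / s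

lemma LocOf.mono {A A' : Subring K} {P : LocalSubring K} (h : LocOf A P) (hA : A ≤ A')
    (hP : A' ≤ P.toSubring) : LocOf A' P := by
  refine ⟨hP, fun k hk => ?_⟩
  obtain ⟨a, ha, s, hs, h0, h1, h2⟩ := h.2 k hk
  exact ⟨a, hA ha, s, hA hs, h0, h1, h2⟩

/-- The localization of `A` at the elements that are units in `P`. -/
def locSubring (A : Subring K) (P : LocalSubring K) : Subring K where
  carrier := {k | ∃ a ∈ A, ∃ s ∈ A, s ≠ 0 ∧ s⁻¹ ∈ P.toSubring ∧ k = a / s}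
  mul_mem' := by
    rintro _ _ ⟨a, ha, s, hs, h0, h1, rfl⟩ ⟨b, hb, t, ht, h0', h1', rfl⟩
    exact ⟨a * b, A.mul_mem ha hb, s * t, A.mul_mem hs ht, mul_ne_zero h0 h0',
      by rw [mul_inv]; exact P.toSubring.mul_mem h1 h1', by field_simp⟩
  one_mem' := ⟨1, A.one_mem, 1, A.one_mem, one_ne_zero, by simp, by simp⟩
  add_mem' := by
    rintro _ _ ⟨a, ha, s, hs, h0, h1, rfl⟩ ⟨b, hb, t, ht, h0', h1', rfl⟩
    exact ⟨a * t + b * s, A.add_mem (A.mul_mem ha ht) (A.mul_mem hb hs), s * t, A.mul_mem hs ht,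
      mul_ne_zero h0 h0', by rw [mul_inv]; exact P.toSubring.mul_mem h1 h1', by field_simp⟩
  zero_mem' := ⟨0, A.zero_mem, 1, A.one_mem, one_ne_zero, by simp,
    by simp⟩
  neg_mem' := by
    rintro _ ⟨a, ha, s, hs, h0, h1, rfl⟩
    exact ⟨-a, A.neg_mem ha, s, hs, h0, h1, by ring⟩

lemma le_locSubring (A : Subring K) (P : LocalSubring K) : A ≤ locSubring A P := fun a ha =>
  ⟨a, ha, 1, A.one_mem, one_ne_zero, by simp, by simp⟩

lemma inv_mem_locSubring {A : Subring K} {P : LocalSubring K} {s : K} (hs : s ∈ A) (h0 : s ≠ 0)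
    (h1 : s⁻¹ ∈ P.toSubring) : s⁻¹ ∈ locSubring A P :=
  ⟨1, A.one_mem, s, hs, h0, h1, by simp⟩

lemma div_mem_locSubring {A : Subring K} {P : LocalSubring K} {a s : K} (ha : a ∈ A) (hs : s ∈ A)
    (h0 : s ≠ 0) (h1 : s⁻¹ ∈ P.toSubring) : a / s ∈ locSubring A P :=
  ⟨a, ha, s, hs, h0, h1, rfl⟩

lemma inv_mem_locSubring' {A : Subring K} {P : LocalSubring K} {s : K}
    (hs : s ∈ locSubring A P) (h1 : s⁻¹ ∈ P.toSubring) : s⁻¹ ∈ locSubring A P := by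
  obtain ⟨a, ha, t, ht, h0, h2, rfl⟩ := hs
  by_cases ha0 : a = 0
  · simp [ha0, (locSubring A P).zero_mem]
  · refine ⟨t, ht, a, ha, ha0, ?_, by rw [inv_div]⟩
    have := P.toSubring.mul_mem h1 h2
    rwa [inv_div, div_mul_eq_mul_div, mul_inv_cancel₀ h0, one_div] at this

/-- If `P` is a localization of `A'`, it is a localization of any subring `A` that has the same
localization. -/
lemma LocOf.of_le {A A' : Subring K} {P : LocalSubring K} (h : LocOf A' P)
    (hA : A ≤ P.toSubring) (hA' : A' ≤ locSubring A P) : LocOf A P := by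
  refine ⟨hA, fun k hk => ?_⟩
  obtain ⟨a, ha, s, hs, h0, h1, rfl⟩ := h.2 k hk
  rw [div_eq_mul_inv]
  exact (locSubring A P).mul_mem (hA' ha) (inv_mem_locSubring' (hA' hs) h1)

lemma locSubring_trans {A : Subring K} {O P : LocalSubring K} (h : LocOf A O)
    (h' : LocOf O.toSubring P) : LocOf A P := by
  refine h'.of_le (h.1.trans h'.1) fun k hk => ?_
  obtain ⟨a, ha, s, hs, h0, h1, rfl⟩ := h.2 k hk
  exact ⟨a, ha, s, hs, h0, h'.1 h1, rfl⟩

lemma mem_ofPrime {A : Subring K} {𝔭 : Ideal A} [𝔭.IsPrime] {k : K} :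
    k ∈ (LocalSubring.ofPrime A 𝔭).toSubring ↔ ∃ a s : A, s ∉ 𝔭 ∧ k = a / s := by
  have hinj : Function.Injective (algebraMap (LocalSubring.ofPrime A 𝔭).toSubring K) :=
    Subtype.val_injective
  constructor
  · intro hk
    obtain ⟨⟨a, s⟩, h⟩ := IsLocalization.surj 𝔭.primeCompl
      (⟨k, hk⟩ : (LocalSubring.ofPrime A 𝔭).toSubring)
    refine ⟨a, s, s.2, ?_⟩
    have h' : k * (s : A) = (a : K) := congrArg Subtype.val h
    rw [← h', mul_div_assoc, div_self, mul_one]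
    intro h0
    exact s.2 (by rw [show (s : A) = 0 from Subtype.ext h0]; exact 𝔭.zero_mem)
  · rintro ⟨a, s, hs, rfl⟩
    have h0 : (s : K) ≠ 0 := fun h0 => hs (by
      rw [show s = 0 from Subtype.ext h0]; exact 𝔭.zero_mem)
    obtain ⟨l, hl⟩ := (IsLocalization.map_units (LocalSubring.ofPrime A 𝔭).toSubring
      (⟨s, hs⟩ : 𝔭.primeCompl)).exists_right_inv
    have hl' : (s : K) * l = 1 := congrArg Subtype.val hl
    rw [div_eq_mul_inv, ← eq_inv_of_mul_eq_one_right hl']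
    exact Subring.mul_mem _ (LocalSubring.le_ofPrime A 𝔭 a.2) l.2

lemma locOf_ofPrime (A : Subring K) (𝔭 : Ideal A) [𝔭.IsPrime] :
    LocOf A (LocalSubring.ofPrime A 𝔭) := by
  refine ⟨LocalSubring.le_ofPrime A 𝔭, fun k hk => ?_⟩
  obtain ⟨a, s, hs, rfl⟩ := mem_ofPrime.1 hk
  refine ⟨a, a.2, s, s.2, fun h0 => hs ?_, mem_ofPrime.2 ⟨1, s, hs, by simp⟩, rfl⟩
  rw [show s = 0 from Subtype.ext h0]; exact 𝔭.zero_mem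

/-- The centre on `Spec A` of a local ring containing `A`. -/
def center (A : Subring K) (P : LocalSubring K) (h : A ≤ P.toSubring) : LocalSubring K :=
  LocalSubring.ofPrime A ((maximalIdeal P.toSubring).comap (Subring.inclusion h))

lemma mem_center {A : Subring K} {P : LocalSubring K} (h : A ≤ P.toSubring) {k : K} :
    k ∈ (center A P h).toSubring ↔ ∃ a ∈ A, ∃ s ∈ A, s ∉ mx P ∧ k = a / s := by
  rw [center, mem_ofPrime]
  constructor
  · rintro ⟨a, s, hs, rfl⟩
    exact ⟨a, a.2, s, s.2, fun hc => hs ((mem_mx_iff (Subring.inclusion h s)).2 hc), rfl⟩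
  · rintro ⟨a, ha, s, hs, hs', rfl⟩
    exact ⟨⟨a, ha⟩, ⟨s, hs⟩, fun hc => hs' ((mem_mx_iff _).1 (Ideal.mem_comap.1 hc)), rfl⟩

lemma center_le {A : Subring K} {P : LocalSubring K} (h : A ≤ P.toSubring) :
    center A P h ≤ P := by
  refine domination_iff.2 ⟨fun k hk => ?_, fun k hk => ?_⟩
  · obtain ⟨a, ha, s, hs, hs', rfl⟩ := (mem_center h).1 hk
    exact div_mem_of_inv_mem (h ha) (inv_mem_of_notMem_mx (h hs) hs')
  · obtain ⟨a, ha, s, hs, hs', rfl⟩ := (mem_center h).1 hk.1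
    by_contra hc
    have hsP := inv_mem_of_notMem_mx (h hs) hs'
    have ha' : a ∉ mx P := fun ha' => hc (by
      rw [div_eq_mul_inv]; exact mul_mem_mx' ha' hsP)
    rcases hk.2 with h0 | h0
    · rcases div_eq_zero_iff.1 h0 with h0 | h0
      · exact ha' (h0 ▸ zero_mem_mx P)
      · exact hs' (h0 ▸ zero_mem_mx P)
    · exact h0 ((mem_center h).2 ⟨s, hs, a, ha, ha', by rw [inv_div]⟩)

lemma locOf_center {A : Subring K} {P : LocalSubring K} (h : A ≤ P.toSubring) :
    LocOf A (center A P h) := locOf_ofPrime _ _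

/-- A localization of `A` is recovered from its denominators, the elements of `A` outside the
maximal ideal. -/
lemma LocOf.eq_of_le {A : Subring K} {P Q : LocalSubring K} (hP : LocOf A P) (hQ : LocOf A Q)
    (h : ∀ a ∈ A, a ∈ mx P ↔ a ∈ mx Q) : P = Q := by
  apply LocalSubring.toSubring_injective
  apply le_antisymm
  · intro k hk
    obtain ⟨a, ha, s, hs, h0, h1, rfl⟩ := hP.2 k hk
    have : s ∉ mx Q := fun hc => notMem_mx_of_inv_mem h0 h1 ((h s hs).2 hc)
    exact div_mem_of_inv_mem (hQ.1 ha) (inv_mem_of_notMem_mx (hQ.1 hs) this)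
  · intro k hk
    obtain ⟨a, ha, s, hs, h0, h1, rfl⟩ := hQ.2 k hk
    have : s ∉ mx P := fun hc => notMem_mx_of_inv_mem h0 h1 ((h s hs).1 hc)
    exact div_mem_of_inv_mem (hP.1 ha) (inv_mem_of_notMem_mx (hP.1 hs) this)

/-- Both maximal ideals contract to the same prime of `A`, namely that of `V`. This is separatedness
of an affine chart; separatedness of `X` is reduced to it. -/
lemma LocOf.eq_of_dominated {A : Subring K} {P Q V : LocalSubring K} (hP : LocOf A P)
    (hQ : LocOf A Q) (hPV : P ≤ V) (hQV : Q ≤ V) : P = Q :=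
  hP.eq_of_le hQ fun _ ha =>
    ⟨fun h => mem_mx_of_dominated hQV (hQ.1 ha) ((domination_iff.1 hPV).2 h),
      fun h => mem_mx_of_dominated hPV (hP.1 ha) ((domination_iff.1 hQV).2 h)⟩

lemma LocOf.eq_center {A : Subring K} {P : LocalSubring K} (hP : LocOf A P) :
    center A P hP.1 = P := (locOf_center hP.1).eq_of_dominated hP (center_le _) le_rfl

variable [Algebra ℂ K]

lemma adjoin_le_locSubring {S : Set K} {A : Subalgebra ℂ K} {P : LocalSubring K}
    (h : ∀ s ∈ S, s ∈ locSubring A.toSubring P) :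
    (Algebra.adjoin ℂ S).toSubring ≤ locSubring A.toSubring P := by
  intro k hk
  induction hk using Algebra.adjoin_induction with
  | mem s hs => exact h s hs
  | algebraMap c => exact le_locSubring _ _ (A.algebraMap_mem c)
  | add _ _ _ _ h1 h2 => exact Subring.add_mem _ h1 h2
  | mul _ _ _ _ h1 h2 => exact Subring.mul_mem _ h1 h2

lemma adjoin_le_of {S : Set K} {A : Subring K} (hc : ∀ c : ℂ, algebraMap ℂ K c ∈ A)
    (h : ∀ s ∈ S, s ∈ A) : (Algebra.adjoin ℂ S).toSubring ≤ A := by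
  intro k hk
  induction hk using Algebra.adjoin_induction with
  | mem s hs => exact h s hs
  | algebraMap c => exact hc c
  | add _ _ _ _ h1 h2 => exact Subring.add_mem _ h1 h2
  | mul _ _ _ _ h1 h2 => exact Subring.mul_mem _ h1 h2

/-- The prime ideal is recoverable as the centre of `P`, so points of models can be handled through
`LocOf` alone, with no ideals to transport between charts. -/
lemma mem_ofCharts {𝒜 : Set (Subalgebra ℂ K)} {P : LocalSubring K} :
    P ∈ (Model.ofCharts 𝒜).points ↔ ∃ A ∈ 𝒜, LocOf A.toSubring P := by
  constructor
  · rintro ⟨A, hA, 𝔭, h𝔭, rfl⟩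
    exact ⟨A, hA, locOf_ofPrime _ _⟩
  · rintro ⟨A, hA, h⟩
    exact ⟨A, hA, _, inferInstance, h.eq_center.symm⟩

lemma ofCharts_of_locOf {𝒜 : Set (Subalgebra ℂ K)} {O P : LocalSubring K}
    (hO : O ∈ (Model.ofCharts 𝒜).points) (h : LocOf O.toSubring P) :
    P ∈ (Model.ofCharts 𝒜).points := by
  obtain ⟨A, hA, hAO⟩ := mem_ofCharts.1 hO
  exact mem_ofCharts.2 ⟨A, hA, locSubring_trans hAO h⟩

lemma mem_vanishingIdeal {T : Set (LocalSubring K)} {O : LocalSubring K} (h : O.toSubring) :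
    h ∈ vanishingIdeal T O ↔ ∀ P ∈ T, O.toSubring ≤ P.toSubring → (h : K) ∈ mx P := by
  simp only [vanishingIdeal, Submodule.mem_iInf]
  refine forall₂_congr fun P _ => forall_congr' fun hOP => ?_
  rw [Ideal.mem_comap, mem_mx_iff]
  rfl

lemma vanishingIdeal_eq_top {T : Set (LocalSubring K)} {O : LocalSubring K}
    (h : ∀ P ∈ T, ¬ O.toSubring ≤ P.toSubring) : vanishingIdeal T O = ⊤ := by
  rw [eq_top_iff]
  intro k _
  exact (mem_vanishingIdeal k).2 fun P hP hOP => (h P hP hOP).elim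

lemma exists_of_vanishingIdeal_ne_top {T : Set (LocalSubring K)} {O : LocalSubring K}
    (h : vanishingIdeal T O ≠ ⊤) : ∃ P ∈ T, O.toSubring ≤ P.toSubring := by
  by_contra! hc
  exact h (vanishingIdeal_eq_top hc)

end LocalSubrings

end Fano
end

noncomputable section

namespace Fano

/-! ### Rational coordinate systems and their coordinate subspaces. -/

section Coordinates

/-- The ideal of polynomials vanishing on a coordinate subspace. -/
def coordIdeal (S : Set (Fin 3)) : Ideal ChartRing := Ideal.span (MvPolynomial.X '' S)

lemma mem_coordIdeal {S : Set (Fin 3)} {f : ChartRing} :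
    f ∈ coordIdeal S ↔ ∀ d ∈ f.support, ∃ i ∈ S, d i ≠ 0 :=
  MvPolynomial.mem_ideal_span_X_image

open Classical in
-- Exhibiting the ideal as the kernel of a map into a domain is what makes it prime.
lemma coordIdeal_eq_ker (S : Set (Fin 3)) : coordIdeal S =
    RingHom.ker (MvPolynomial.aeval (R := ℂ)
      (fun i => if i ∈ S then 0 else MvPolynomial.X i : Fin 3 → ChartRing)) := by
  apply le_antisymm
  · refine Ideal.span_le.2 ?_
    rintro _ ⟨i, hi, rfl⟩
    simp [RingHom.mem_ker, hi]
  · intro f hf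
    -- Setting the variables in `S` to zero changes a polynomial only by an element of the ideal.
    have key : ∀ f : ChartRing, f - MvPolynomial.aeval (R := ℂ)
      (fun i => if i ∈ S then 0 else MvPolynomial.X i : Fin 3 → ChartRing) f ∈ coordIdeal S := by
      intro f
      induction f using MvPolynomial.induction_on with
      | C c => simp [MvPolynomial.algebraMap_eq]
      | add p q hp hq =>
        rw [map_add]
        convert add_mem hp hq using 1
        ring
      | mul_X p i hp =>
        rw [map_mul, MvPolynomial.aeval_X]
        split_ifs with h
        · rw [mul_zero, sub_zero]
          exact Ideal.mul_mem_left _ _ (Ideal.subset_span ⟨i, h, rfl⟩)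
        · rw [← sub_mul]
          exact Ideal.mul_mem_right _ _ hp
    have := key f
    rwa [RingHom.mem_ker.1 hf, sub_zero] at this

instance (S : Set (Fin 3)) : (coordIdeal S).IsPrime := by
  rw [coordIdeal_eq_ker]
  exact RingHom.ker_isPrime _

lemma X_pow_dvd_iff {i : Fin 3} {n : ℕ} {f : ChartRing} :
    (MvPolynomial.X i : ChartRing) ^ n ∣ f ↔ ∀ d ∈ f.support, n ≤ d i := by
  rw [← Ideal.mem_span_singleton, MvPolynomial.X_pow_eq_monomial,
    show ({(MvPolynomial.monomial (Finsupp.single i n)) 1} : Set ChartRing) =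
      (fun s => MvPolynomial.monomial s (1 : ℂ)) '' {Finsupp.single i n} by simp,
    MvPolynomial.mem_ideal_span_monomial_image]
  simp

lemma mem_coordIdeal_singleton {i : Fin 3} {f : ChartRing} :
    f ∈ coordIdeal {i} ↔ (MvPolynomial.X i : ChartRing) ∣ f := by
  rw [coordIdeal, Set.image_singleton, Ideal.mem_span_singleton]

variable {K : Type*} [Field K] [Algebra ℂ K]

/-- Three algebraically independent elements that generate the field `K`. -/
structure IsCoord (τ : Fin 3 → K) : Prop where
  indep : AlgebraicIndependent ℂ τ
  frac : ∀ k : K, ∃ f g : ChartRing, MvPolynomial.aeval τ g ≠ 0 ∧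
    k = MvPolynomial.aeval τ f / MvPolynomial.aeval τ g

/-- The field has transcendence degree three, so three elements that generate it are automatically
independent. Every later change of coordinates only has to check generation. -/
lemma IsCoord.of_mem {τ σ : Fin 3 → K} (hτ : IsCoord τ)
    (h : ∀ i, τ i ∈ IntermediateField.adjoin ℂ (Set.range σ)) : IsCoord σ := by
  have hfrac : ∀ k : K, ∃ f g : ChartRing, MvPolynomial.aeval σ g ≠ 0 ∧
      k = MvPolynomial.aeval σ f / MvPolynomial.aeval σ g := by
    intro k
    have hk : k ∈ IntermediateField.adjoin ℂ (Set.range σ) := by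
      obtain ⟨f, g, hg, rfl⟩ := hτ.frac k
      have hp : ∀ p : ChartRing,
          MvPolynomial.aeval τ p ∈ IntermediateField.adjoin ℂ (Set.range σ) := by
        intro p
        induction p using MvPolynomial.induction_on with
        | C c => simp
        | add p q hp hq => rw [map_add]; exact add_mem hp hq
        | mul_X p i hp => rw [map_mul, MvPolynomial.aeval_X]; exact mul_mem hp (h i)
      exact div_mem (hp f) (hp g)
    obtain ⟨f, g, rfl⟩ := (IntermediateField.mem_adjoin_range_iff ℂ σ k).1 hk
    by_cases hg : MvPolynomial.aeval σ g = 0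
    · exact ⟨0, 1, by simp, by simp [hg]⟩
    · exact ⟨f, g, hg, rfl⟩
  refine ⟨?_, hfrac⟩
  have hmem : ∀ p : ChartRing, MvPolynomial.aeval σ p ∈ Algebra.adjoin ℂ (Set.range σ) := by
    intro p
    rw [Algebra.adjoin_range_eq_range_aeval]
    exact ⟨p, rfl⟩
  have hfr : IsFractionRing (Algebra.adjoin ℂ (Set.range σ)) K := by
    refine IsFractionRing.of_field _ _ fun k => ?_
    obtain ⟨f, g, hg, rfl⟩ := hfrac k
    exact ⟨⟨_, hmem f⟩, ⟨_, hmem g⟩, rfl⟩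
  have halg : Algebra.IsAlgebraic (Algebra.adjoin ℂ (Set.range σ)) K :=
    IsLocalization.isAlgebraic _ (nonZeroDivisors (Algebra.adjoin ℂ (Set.range σ)))
  have htb : IsTranscendenceBasis ℂ τ := by
    rw [hτ.indep.isTranscendenceBasis_iff_isAlgebraic]
    have hfr : IsFractionRing (Algebra.adjoin ℂ (Set.range τ)) K := by
      refine IsFractionRing.of_field _ _ fun k => ?_
      obtain ⟨f, g, hg, rfl⟩ := hτ.frac k
      have hmem : ∀ p : ChartRing, MvPolynomial.aeval τ p ∈ Algebra.adjoin ℂ (Set.range τ) := by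
        intro p
        rw [Algebra.adjoin_range_eq_range_aeval]
        exact ⟨p, rfl⟩
      exact ⟨⟨_, hmem f⟩, ⟨_, hmem g⟩, rfl⟩
    exact IsLocalization.isAlgebraic _ (nonZeroDivisors (Algebra.adjoin ℂ (Set.range τ)))
  exact (Algebra.IsAlgebraic.isTranscendenceBasis_of_lift_le_trdeg_of_finite ℂ σ
    htb.lift_cardinalMk_eq_trdeg.le).1

variable {τ : Fin 3 → K}

lemma IsCoord.aeval_ne_zero (hτ : IsCoord τ) {f : ChartRing} (hf : f ≠ 0) :
    MvPolynomial.aeval τ f ≠ 0 := fun h => hf (hτ.indep (by rw [h, map_zero]))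

lemma IsCoord.ne_zero (hτ : IsCoord τ) (i : Fin 3) : τ i ≠ 0 := by
  simpa using hτ.aeval_ne_zero (MvPolynomial.X_ne_zero i)

lemma aeval_mem_adjoin (τ : Fin 3 → K) (f : ChartRing) :
    MvPolynomial.aeval τ f ∈ Algebra.adjoin ℂ (Set.range τ) := by
  rw [Algebra.adjoin_range_eq_range_aeval]
  exact ⟨f, rfl⟩

lemma exists_aeval {a : K} (ha : a ∈ (Algebra.adjoin ℂ (Set.range τ)).toSubring) :
    ∃ f : ChartRing, MvPolynomial.aeval τ f = a := by
  have ha' : a ∈ Algebra.adjoin ℂ (Set.range τ) := ha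
  rw [Algebra.adjoin_range_eq_range_aeval] at ha'
  exact ha'

/-- The local ring of the affine space with coordinates `τ` at a prime ideal. -/
def pt (hτ : IsCoord τ) (𝔭 : Ideal ChartRing) [𝔭.IsPrime] : LocalSubring K :=
  LocalSubring.range (IsLocalization.lift (M := 𝔭.primeCompl) (S := Localization.AtPrime 𝔭)
    (g := (MvPolynomial.aeval τ : ChartRing →ₐ[ℂ] K).toRingHom) (fun s => by
      refine IsUnit.mk0 _ (hτ.aeval_ne_zero ?_)
      intro h0
      exact s.2 (h0 ▸ 𝔭.zero_mem)))

variable (hτ : IsCoord τ) (𝔭 : Ideal ChartRing) [𝔭.IsPrime]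

lemma mem_pt {k : K} : k ∈ (pt hτ 𝔭).toSubring ↔
    ∃ f g : ChartRing, g ∉ 𝔭 ∧ k = MvPolynomial.aeval τ f / MvPolynomial.aeval τ g := by
  have hne : ∀ g : ChartRing, g ∉ 𝔭 → MvPolynomial.aeval τ g ≠ 0 := fun g hg =>
    hτ.aeval_ne_zero fun h0 => hg (h0 ▸ 𝔭.zero_mem)
  change k ∈ Set.range _ ↔ _
  constructor
  · rintro ⟨l, rfl⟩
    obtain ⟨f, g, rfl⟩ := IsLocalization.exists_mk'_eq 𝔭.primeCompl l
    refine ⟨f, g, g.2, ?_⟩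
    rw [IsLocalization.lift_mk'_spec]
    exact (mul_div_cancel₀ _ (hne g g.2)).symm
  · rintro ⟨f, g, hg, rfl⟩
    refine ⟨IsLocalization.mk' _ f (⟨g, hg⟩ : 𝔭.primeCompl), ?_⟩
    rw [IsLocalization.lift_mk'_spec]
    exact (mul_div_cancel₀ _ (hne g hg)).symm

lemma aeval_mem_pt (f : ChartRing) : MvPolynomial.aeval τ f ∈ (pt hτ 𝔭).toSubring :=
  (mem_pt hτ 𝔭).2 ⟨f, 1, (Ideal.ne_top_iff_one _).1 (Ideal.IsPrime.ne_top'), by simp⟩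

lemma coord_mem_pt (i : Fin 3) : τ i ∈ (pt hτ 𝔭).toSubring := by
  simpa using aeval_mem_pt hτ 𝔭 (MvPolynomial.X i)

lemma inv_aeval_mem_pt {f : ChartRing} (hf : f ∉ 𝔭) :
    (MvPolynomial.aeval τ f)⁻¹ ∈ (pt hτ 𝔭).toSubring :=
  (mem_pt hτ 𝔭).2 ⟨1, f, hf, by simp⟩

lemma aeval_mem_mx_pt {f : ChartRing} : MvPolynomial.aeval τ f ∈ mx (pt hτ 𝔭) ↔ f ∈ 𝔭 := by
  constructor
  · intro h
    by_contra hf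
    exact notMem_mx_of_inv_mem (hτ.aeval_ne_zero (by rintro rfl; exact hf 𝔭.zero_mem))
      (inv_aeval_mem_pt hτ 𝔭 hf) h
  · intro hf
    by_contra h
    obtain ⟨a, g, hg, hk⟩ := (mem_pt hτ 𝔭).1 (inv_mem_of_notMem_mx (aeval_mem_pt hτ 𝔭 f) h)
    have hg0 : MvPolynomial.aeval τ g ≠ 0 :=
      hτ.aeval_ne_zero fun h0 => hg (h0 ▸ 𝔭.zero_mem)
    have hf0 := ne_zero_of_notMem_mx h
    apply hg
    have : g = a * f := hτ.indep (by
      rw [map_mul]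
      field_simp at hk
      rw [hk, mul_comm])
    rw [this]
    exact Ideal.mul_mem_left _ _ hf

lemma locOf_pt : LocOf (Algebra.adjoin ℂ (Set.range τ)).toSubring (pt hτ 𝔭) := by
  constructor
  · intro a ha
    obtain ⟨f, rfl⟩ := exists_aeval ha
    exact aeval_mem_pt hτ 𝔭 f
  · intro k hk
    obtain ⟨f, g, hg, rfl⟩ := (mem_pt hτ 𝔭).1 hk
    exact ⟨_, aeval_mem_adjoin τ f, _, aeval_mem_adjoin τ g,
      hτ.aeval_ne_zero fun h0 => hg (h0 ▸ 𝔭.zero_mem), inv_aeval_mem_pt hτ 𝔭 hg, rfl⟩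

lemma algebraMap_mem_pt (c : ℂ) : algebraMap ℂ K c ∈ (pt hτ 𝔭).toSubring :=
  (locOf_pt hτ 𝔭).1 (Subalgebra.algebraMap_mem _ c)

variable {𝔭}

/-- Distinct coordinates that vanish at `P` have no common factors there. -/
lemma IsCoord.div_notMem (hτ : IsCoord τ) {P : LocalSubring K}
    (hP : LocOf (Algebra.adjoin ℂ (Set.range τ)).toSubring P) {i j : Fin 3} (hij : i ≠ j)
    (hi : τ i ∈ mx P) {l : ℕ} (hl : l ≠ 0) (k : ℕ) : τ j ^ k / τ i ^ l ∉ P.toSubring := by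
  intro h
  obtain ⟨a, ha, s, hs, h0, h1, h2⟩ := hP.2 _ h
  obtain ⟨f, rfl⟩ := exists_aeval ha
  obtain ⟨g, rfl⟩ := exists_aeval hs
  have hi0 := hτ.ne_zero i
  have h3 : MvPolynomial.X j ^ k * g = MvPolynomial.X i ^ l * f := hτ.indep (by
    simp only [map_mul, map_pow, MvPolynomial.aeval_X]
    field_simp at h2
    linear_combination h2)
  have hp : Prime (MvPolynomial.X i : ChartRing) := MvPolynomial.X_prime
  -- The prime `X i` divides `X j ^ k * g` but not `X j`, hence it divides the denominator `g`,
  -- which is then no unit at `P`.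
  have h4 : (MvPolynomial.X i : ChartRing) ∣ g := by
    have h6 : (MvPolynomial.X i : ChartRing) ∣ MvPolynomial.X j ^ k * g := by
      rw [h3]
      exact Dvd.dvd.mul_right (dvd_pow_self _ hl) _
    refine (hp.dvd_or_dvd h6).resolve_left ?_
    · intro h5
      have := hp.dvd_of_dvd_pow h5
      rw [MvPolynomial.X_dvd_X] at this
      exact hij this
  obtain ⟨q, rfl⟩ := h4
  refine notMem_mx_of_inv_mem h0 h1 ?_
  rw [map_mul, MvPolynomial.aeval_X]
  exact mul_mem_mx' hi (hP.1 (aeval_mem_adjoin τ q))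

/-! ### Divisorial points -/

/-- The divisor at which the coordinate `τ 1` vanishes. -/
def divPt (hτ : IsCoord τ) : LocalSubring K := pt hτ (coordIdeal {1})

lemma coord_one_mem_mx : τ 1 ∈ mx (divPt hτ) := by
  have := (aeval_mem_mx_pt hτ (coordIdeal {1}) (f := MvPolynomial.X 1)).2
    (mem_coordIdeal_singleton.2 dvd_rfl)
  rwa [MvPolynomial.aeval_X] at this

lemma coord_mem_divPt (i : Fin 3) : τ i ∈ (divPt hτ).toSubring := coord_mem_pt hτ _ i

lemma coord_inv_mem_divPt {i : Fin 3} (hi : i ≠ 1) : (τ i)⁻¹ ∈ (divPt hτ).toSubring := by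
  have := inv_aeval_mem_pt hτ (coordIdeal {1}) (f := MvPolynomial.X i) (by
    rw [mem_coordIdeal_singleton, MvPolynomial.X_dvd_X]
    exact fun h => hi h.symm)
  rwa [MvPolynomial.aeval_X] at this

lemma coord_notMem_mx_divPt {i : Fin 3} (hi : i ≠ 1) : τ i ∉ mx (divPt hτ) :=
  notMem_mx_of_inv_mem (hτ.ne_zero i) (coord_inv_mem_divPt hτ hi)

lemma zpow_mem_of_inv_mem {A : Subring K} {k : K} (h : k ∈ A) (h' : k⁻¹ ∈ A) (n : ℤ) :
    k ^ n ∈ A := by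
  obtain ⟨n, rfl | rfl⟩ := n.eq_nat_or_neg
  · rw [zpow_natCast]; exact A.pow_mem h n
  · rw [zpow_neg, zpow_natCast, ← inv_pow]; exact A.pow_mem h' n

lemma zpow_mem_of_nonneg {A : Subring K} {k : K} (h : k ∈ A) {n : ℤ} (hn : 0 ≤ n) :
    k ^ n ∈ A := by
  lift n to ℕ using hn
  rw [zpow_natCast]; exact A.pow_mem h n

lemma pow_dvd_of_mem_divPt {f : ChartRing} {n : ℕ} {k : K} (hk : k ∈ (divPt hτ).toSubring)
    (h : MvPolynomial.aeval τ f = τ 1 ^ n * k) : MvPolynomial.X 1 ^ n ∣ f := by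
  obtain ⟨a, g, hg, rfl⟩ := (mem_pt hτ _).1 hk
  have hg0 : MvPolynomial.aeval τ g ≠ 0 :=
    hτ.aeval_ne_zero fun h0 => hg (h0 ▸ Ideal.zero_mem _)
  have h3 : f * g = MvPolynomial.X 1 ^ n * a := hτ.indep (by
    simp only [map_mul, map_pow, MvPolynomial.aeval_X]
    rw [h]
    field_simp)
  rw [mem_coordIdeal_singleton] at hg
  exact (MvPolynomial.X_prime (R := ℂ) (i := (1 : Fin 3))).pow_dvd_of_dvd_mul_right n hg
    (Dvd.intro _ h3.symm)

/-- The order along a divisor of a polynomial in monomials of the coordinates is the least order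
of its terms. -/
theorem monomial_order (hτ : IsCoord τ) {α : Fin 3 → K} {M : Matrix (Fin 3) (Fin 3) ℤ}
    (hM : M.det ≠ 0) (hα : ∀ i, α i = ∏ j, τ j ^ M i j) (G : ChartRing) (N : ℤ) :
    τ 1 ^ (-N) * MvPolynomial.aeval α G ∈ (divPt hτ).toSubring ↔
      ∀ d ∈ G.support, N ≤ ∑ i, d i * M i 1 := by
  set A : (Fin 3 →₀ ℕ) → Fin 3 → ℤ := fun d j => ∑ i, d i * M i j with hA
  have hprod : ∀ d : Fin 3 →₀ ℕ, ∏ i, α i ^ d i = ∏ j, τ j ^ A d j := by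
    intro d
    simp only [hα, ← Finset.prod_pow]
    rw [Finset.prod_comm]
    refine Finset.prod_congr rfl fun j _ => ?_
    rw [hA]
    simp only
    simp only [Fin.prod_univ_three, Fin.sum_univ_three, zpow_add₀ (hτ.ne_zero j),
      ← zpow_natCast, ← zpow_mul, mul_comm]
  -- The determinant makes distinct exponents of `α` give distinct exponents of `τ`, so no terms can
  -- cancel.
  have hinj : Function.Injective A := by
    intro d e h
    have h1 : Matrix.vecMul (fun i => (d i : ℤ) - e i) M = 0 := by
      ext j
      have := congrFun h j
      simp only [hA] at this
      simp only [Matrix.vecMul, dotProduct, sub_mul, Finset.sum_sub_distrib, Pi.zero_apply]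
      rw [this, sub_self]
    have h2 := Matrix.eq_zero_of_vecMul_eq_zero hM h1
    ext i
    have := congrFun h2 i
    simp only [Pi.zero_apply] at this
    omega
  have hsum : MvPolynomial.aeval α G =
      ∑ d ∈ G.support, algebraMap ℂ K (G.coeff d) * ∏ j, τ j ^ A d j := by
    rw [MvPolynomial.aeval_def, MvPolynomial.eval₂_eq']
    exact Finset.sum_congr rfl fun d _ => by rw [hprod]
  constructor
  · intro h
    -- Multiplying by the power `B` of every coordinate clears the negative exponents and turns the
    -- claim into divisibility of a polynomial by a power of `X 1`.
    obtain ⟨B, hB⟩ : ∃ B : ℕ, 0 ≤ N + B ∧ ∀ d ∈ G.support, ∀ j, 0 ≤ A d j + B := by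
      refine ⟨N.natAbs + ∑ d ∈ G.support, ∑ j, (A d j).natAbs, by omega, fun d hd j => ?_⟩
      have h1 : (A d j).natAbs ≤ ∑ j, (A d j).natAbs :=
        Finset.single_le_sum (f := fun j => (A d j).natAbs) (fun _ _ => Nat.zero_le _)
          (Finset.mem_univ j)
      have h2 : ∑ j, (A d j).natAbs ≤ ∑ d ∈ G.support, ∑ j, (A d j).natAbs :=
        Finset.single_le_sum (f := fun d => ∑ j, (A d j).natAbs) (fun _ _ => Nat.zero_le _) hd
      omega
    obtain ⟨hBN, hB⟩ := hB
    set e : (Fin 3 →₀ ℕ) → (Fin 3 →₀ ℕ) :=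
      fun d => Finsupp.equivFunOnFinite.symm fun j => (A d j + B).toNat with he
    have hej : ∀ d ∈ G.support, ∀ j, ((e d j : ℕ) : ℤ) = A d j + B := fun d hd j => by
      simp only [he, Finsupp.equivFunOnFinite_symm_apply_apply]
      exact Int.toNat_of_nonneg (hB d hd j)
    set f : ChartRing := ∑ d ∈ G.support, MvPolynomial.monomial (e d) (G.coeff d) with hf
    have hfe : MvPolynomial.aeval τ f = (∏ j, τ j ^ (B : ℤ)) * MvPolynomial.aeval α G := by
      rw [hsum, hf, map_sum, Finset.mul_sum]
      refine Finset.sum_congr rfl fun d hd => ?_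
      rw [MvPolynomial.aeval_monomial, mul_left_comm, ← Finset.prod_mul_distrib,
        Finsupp.prod_fintype _ _ (fun i => pow_zero _)]
      congr 1
      refine Finset.prod_congr rfl fun j _ => ?_
      rw [← zpow_natCast, hej d hd, zpow_add₀ (hτ.ne_zero j), mul_comm]
    obtain ⟨n, hn⟩ := Int.eq_ofNat_of_zero_le hBN
    have hdvd : MvPolynomial.X 1 ^ n ∣ f := by
      refine pow_dvd_of_mem_divPt hτ (k := τ 0 ^ B * τ 2 ^ B *
        (τ 1 ^ (-N) * MvPolynomial.aeval α G)) ?_ ?_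
      · exact Subring.mul_mem _ (Subring.mul_mem _ (Subring.pow_mem _ (coord_mem_divPt hτ 0) _)
          (Subring.pow_mem _ (coord_mem_divPt hτ 2) _)) h
      · rw [hfe, Fin.prod_univ_three]
        simp only [zpow_natCast]
        have h1 : τ 1 ^ n * τ 1 ^ (-N) = τ 1 ^ B := by
          rw [← zpow_natCast, ← zpow_natCast, ← zpow_add₀ (hτ.ne_zero 1)]
          congr 1
          omega
        linear_combination -(τ 0 ^ B * τ 2 ^ B * MvPolynomial.aeval α G) * h1
    intro d hd
    have hcoeff : f.coeff (e d) = G.coeff d := by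
      rw [hf, MvPolynomial.coeff_sum, Finset.sum_eq_single d]
      · rw [MvPolynomial.coeff_monomial, if_pos rfl]
      · intro d' hd' hne
        rw [MvPolynomial.coeff_monomial, if_neg]
        intro h'
        apply hne
        apply hinj
        funext j
        have := congrArg (fun v : Fin 3 →₀ ℕ => ((v j : ℕ) : ℤ)) h'
        simp only [hej d hd, hej d' hd'] at this
        omega
      · intro h'
        exact (h' hd).elim
    have h1 := X_pow_dvd_iff.1 hdvd (e d) (by
      rw [MvPolynomial.mem_support_iff, hcoeff]
      exact MvPolynomial.mem_support_iff.1 hd)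
    have h2 := hej d hd 1
    have h3 : A d 1 = ∑ i, d i * M i 1 := rfl
    omega
  · intro h
    rw [hsum, Finset.mul_sum]
    refine Subring.sum_mem _ fun d hd => ?_
    rw [mul_left_comm]
    refine Subring.mul_mem _ (algebraMap_mem_pt hτ _ _) ?_
    rw [Fin.prod_univ_three]
    have h1 : τ 1 ^ (-N) * (τ 0 ^ A d 0 * τ 1 ^ A d 1 * τ 2 ^ A d 2) =
        τ 0 ^ A d 0 * τ 2 ^ A d 2 * τ 1 ^ (A d 1 - N) := by
      rw [sub_eq_add_neg, zpow_add₀ (hτ.ne_zero 1)]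
      ring
    rw [h1]
    have h2 := h d hd
    exact Subring.mul_mem _ (Subring.mul_mem _
      (zpow_mem_of_inv_mem (coord_mem_divPt hτ 0) (coord_inv_mem_divPt hτ (by decide)) _)
      (zpow_mem_of_inv_mem (coord_mem_divPt hτ 2) (coord_inv_mem_divPt hτ (by decide)) _))
      (zpow_mem_of_nonneg (coord_mem_divPt hτ 1) (sub_nonneg.2 h2))

lemma exists_eq_pow_mul_unit {k : K} (hk : k ∈ (divPt hτ).toSubring) (h0 : k ≠ 0) :
    ∃ (n : ℕ) (l : K), l ∈ (divPt hτ).toSubring ∧ l ∉ mx (divPt hτ) ∧ k = τ 1 ^ n * l := by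
  obtain ⟨f, g, hg, rfl⟩ := (mem_pt hτ _).1 hk
  have hf : f ≠ 0 := fun h => h0 (by simp [h])
  have hp : Prime (MvPolynomial.X 1 : ChartRing) := MvPolynomial.X_prime
  obtain ⟨n, q, hq, hfq⟩ := WfDvdMonoid.max_power_factor hf hp.irreducible
  have hqm : q ∉ coordIdeal {1} := fun h => hq (mem_coordIdeal_singleton.1 h)
  refine ⟨n, MvPolynomial.aeval τ q / MvPolynomial.aeval τ g, (mem_pt hτ _).2 ⟨q, g, hg, rfl⟩,
    ?_, by rw [hfq, map_mul, map_pow, MvPolynomial.aeval_X, mul_div_assoc]⟩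
  refine notMem_mx_of_inv_mem (div_ne_zero ?_ ?_) ?_
  · exact hτ.aeval_ne_zero fun h => hqm (h ▸ Ideal.zero_mem _)
  · exact hτ.aeval_ne_zero fun h => hg (h ▸ Ideal.zero_mem _)
  · rw [inv_div]
    exact (mem_pt hτ _).2 ⟨g, q, hqm, rfl⟩

lemma mem_mx_divPt {k : K} : k ∈ mx (divPt hτ) ↔ (τ 1)⁻¹ * k ∈ (divPt hτ).toSubring := by
  have h1 := hτ.ne_zero 1
  constructor
  · intro hk
    by_cases h0 : k = 0
    · simp [h0]
    obtain ⟨n, l, hl, hl', rfl⟩ := exists_eq_pow_mul_unit hτ hk.1 h0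
    rcases n with _ | n
    · rw [pow_zero, one_mul] at hk
      exact (hl' hk).elim
    · rw [pow_succ', mul_assoc, ← mul_assoc, inv_mul_cancel₀ h1, one_mul]
      exact Subring.mul_mem _ (Subring.pow_mem _ (coord_mem_divPt hτ 1) _) hl
  · intro h
    have := mul_mem_mx' (coord_one_mem_mx hτ) h
    rwa [mul_inv_cancel_left₀ h1] at this

lemma mem_maximalIdeal_pow {n : ℕ} (k : (divPt hτ).toSubring) :
    k ∈ maximalIdeal (divPt hτ).toSubring ^ n ↔ τ 1 ^ (-n : ℤ) * k ∈ (divPt hτ).toSubring := by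
  have h1 := hτ.ne_zero 1
  have hmax : maximalIdeal (divPt hτ).toSubring =
      Ideal.span {(⟨τ 1, coord_mem_divPt hτ 1⟩ : (divPt hτ).toSubring)} := by
    ext l
    rw [mem_mx_iff, mem_mx_divPt, Ideal.mem_span_singleton]
    constructor
    · intro h
      exact ⟨⟨_, h⟩, Subtype.ext (mul_inv_cancel_left₀ h1 _).symm⟩
    · rintro ⟨m, rfl⟩
      simp only [Subring.coe_mul]
      rw [inv_mul_cancel_left₀ h1]
      exact m.2
  rw [hmax, Ideal.span_singleton_pow, Ideal.mem_span_singleton, zpow_neg, zpow_natCast]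
  constructor
  · rintro ⟨m, rfl⟩
    simp only [Subring.coe_mul, Subring.coe_pow]
    rw [inv_mul_cancel_left₀ (pow_ne_zero _ h1)]
    exact m.2
  · intro h
    exact ⟨⟨_, h⟩, Subtype.ext (by
      simp only [Subring.coe_mul, Subring.coe_pow]
      rw [mul_inv_cancel_left₀ (pow_ne_zero _ h1)])⟩

lemma isDiscreteValuationRing_divPt : IsDiscreteValuationRing (divPt hτ).toSubring := by
  apply IsDiscreteValuationRing.ofHasUnitMulPowIrreducibleFactorization
  have hun : ∀ k : (divPt hτ).toSubring, (k : K) ∉ mx (divPt hτ) → IsUnit k := fun k hk => by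
    by_contra h
    exact hk ((mem_mx_iff k).1 h)
  refine ⟨⟨τ 1, coord_mem_divPt hτ 1⟩, ⟨?_, ?_⟩, ?_⟩
  · exact (mem_mx_iff _).2 (coord_one_mem_mx hτ)
  · intro a b hab
    by_contra! hc
    have ha : (a : K) ∈ mx (divPt hτ) := (mem_mx_iff a).1 hc.1
    have hb : (b : K) ∈ mx (divPt hτ) := (mem_mx_iff b).1 hc.2
    have h1 := (mem_mx_divPt hτ).1 ha
    have h3 : (τ 1)⁻¹ * (a : K) * b = 1 := by
      rw [mul_assoc, ← Subring.coe_mul, ← hab, inv_mul_cancel₀ (hτ.ne_zero 1)]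
    exact one_notMem_mx _ (h3 ▸ mul_mem_mx h1 hb)
  · intro k hk
    obtain ⟨n, l, hl, hl', h⟩ := exists_eq_pow_mul_unit hτ k.2
      (fun h => hk (Subtype.ext h))
    obtain ⟨v, hv⟩ := hun ⟨l, hl⟩ hl'
    refine ⟨n, v, Subtype.ext ?_⟩
    rw [hv, h]
    rfl

/-- A discrete valuation ring with fraction field `K` is a maximal proper subring. -/
lemma eq_of_le_of_isDiscreteValuationRing {P Q : LocalSubring K}
    [IsDiscreteValuationRing P.toSubring]
    (hfrac : ∀ k : K, ∃ a ∈ P.toSubring, ∃ s ∈ P.toSubring, k = a / s)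
    (h : P.toSubring ≤ Q.toSubring) {u : K} (hu : u ∈ P.toSubring) (huQ : u ∈ mx Q) (hu0 : u ≠ 0) :
    P = Q := by
  obtain ⟨ϖ, hϖ⟩ := IsDiscreteValuationRing.exists_irreducible P.toSubring
  have hfac : ∀ k ∈ P.toSubring, k ≠ 0 → ∃ (n : ℕ) (l : K), l ∈ P.toSubring ∧ l⁻¹ ∈ P.toSubring ∧
      l ≠ 0 ∧ k = (ϖ : K) ^ n * l := by
    intro k hk h0
    obtain ⟨n, v, hv⟩ := IsDiscreteValuationRing.eq_unit_mul_pow_irreducible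
      (x := (⟨k, hk⟩ : P.toSubring)) (fun h => h0 (congrArg Subtype.val h)) hϖ
    have h1 : ((v : P.toSubring) : K) * ((v⁻¹ : P.toSubringˣ) : P.toSubring) = 1 :=
      congrArg Subtype.val (v.mul_inv)
    refine ⟨n, ((v : P.toSubring) : K), (v : P.toSubring).2, ?_, left_ne_zero_of_mul_eq_one h1, ?_⟩
    · rw [inv_eq_of_mul_eq_one_right h1]
      exact ((v⁻¹ : P.toSubringˣ) : P.toSubring).2
    · have := congrArg Subtype.val hv
      rw [mul_comm]
      exact this
  -- Up to a unit, `u` is a power of the uniformizer, so if the latter were invertible in `Q`, then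
  -- `u` would be too.
  have hϖQ : (ϖ : K) ∈ mx Q := by
    obtain ⟨n, l, hl, hl', hl0, hul⟩ := hfac u hu hu0
    by_contra hc
    have h1 := inv_mem_of_notMem_mx (h ϖ.2) hc
    refine notMem_mx_of_inv_mem hu0 ?_ huQ
    rw [hul, mul_inv, ← inv_pow]
    exact Q.toSubring.mul_mem (Q.toSubring.pow_mem h1 _) (h hl')
  have hϖ0 : (ϖ : K) ≠ 0 := fun h0 => hϖ.ne_zero (Subtype.ext h0)
  apply LocalSubring.toSubring_injective
  refine le_antisymm h fun k hk => ?_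
  by_cases hk0 : k = 0
  · exact hk0 ▸ P.toSubring.zero_mem
  obtain ⟨a, ha, s, hs, rfl⟩ := hfrac k
  have ha0 : a ≠ 0 := fun h0 => hk0 (by simp [h0])
  have hs0 : s ≠ 0 := fun h0 => hk0 (by simp [h0])
  obtain ⟨n, l, hl, hl', hl0, rfl⟩ := hfac a ha ha0
  obtain ⟨m, l₂, hl₂, hl₂', hl₂0, rfl⟩ := hfac s hs hs0
  rcases le_or_gt m n with hmn | hmn
  · have : (ϖ : K) ^ n * l / (ϖ ^ m * l₂) = ϖ ^ (n - m) * (l * l₂⁻¹) := by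
      rw [← Nat.sub_add_cancel hmn, pow_add, Nat.add_sub_cancel]
      field_simp
    rw [this]
    exact P.toSubring.mul_mem (P.toSubring.pow_mem ϖ.2 _) (P.toSubring.mul_mem hl hl₂')
  -- An element of negative valuation in `Q` would make `1` a multiple of a positive power of the
  -- uniformizer, a nonunit of `Q`.
  · exfalso
    have h1 : (ϖ : K) ^ (m - n) ∈ mx Q := pow_mem_mx hϖQ (by omega)
    have h2 : (ϖ : K) ^ (m - n) * ((ϖ : K) ^ n * l / (ϖ ^ m * l₂)) * (l₂ * l⁻¹) = 1 := by
      rw [← Nat.sub_add_cancel hmn.le, pow_add, Nat.add_sub_cancel]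
      field_simp
    exact one_notMem_mx Q (h2 ▸ mul_mem_mx' (mul_mem_mx' h1 hk)
      (Q.toSubring.mul_mem (h hl₂) (h hl')))

end Coordinates

end Fano
end

noncomputable section

namespace Fano

/-! ### Rational differential forms and Jacobians. -/

section Forms

variable {K : Type*} [Field K] [Algebra ℂ K]

local notation "d" => KaehlerDifferential.D ℂ K

/-- The Leibniz and quotient rules reduce the differential of any function of `P` to those of the
algebra generators of a chart. -/
lemma differential_mem {S : Set K} {P : LocalSubring K}
    (hP : LocOf (Algebra.adjoin ℂ S).toSubring P) (N : Submodule P.toSubring (Form3 K))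
    (L : Ω[K⁄ℂ] →ₗ[K] Form3 K) (h : ∀ s ∈ S, L (d s) ∈ N) {f : K} (hf : f ∈ P.toSubring) :
    L (d f) ∈ N := by
  have hsmul : ∀ {c : K} {ω : Form3 K}, c ∈ P.toSubring → ω ∈ N → c • ω ∈ N :=
    fun {c ω} hc hω => N.smul_mem (⟨c, hc⟩ : P.toSubring) hω
  have h1 : ∀ a ∈ (Algebra.adjoin ℂ S).toSubring, L (d a) ∈ N := by
    intro a ha
    induction ha using Algebra.adjoin_induction with
    | mem s hs => exact h s hs
    | algebraMap c => simp
    | add a b _ _ ha hb => rw [map_add, map_add]; exact N.add_mem ha hb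
    | mul a b ha' hb' ha hb =>
      rw [Derivation.leibniz, map_add, map_smul, map_smul]
      exact N.add_mem (hsmul (hP.1 ha') hb) (hsmul (hP.1 hb') ha)
  obtain ⟨a, ha, s, hs, h0, h2, rfl⟩ := hP.2 f hf
  rw [Derivation.leibniz_div, map_smul, map_sub, map_smul, map_smul]
  exact hsmul (P.toSubring.pow_mem h2 2) (N.sub_mem (hsmul (hP.1 hs) (h1 a ha))
    (hsmul (hP.1 ha) (h1 s hs)))

/-- The form `dτ₀ ∧ dτ₁ ∧ dτ₂`. -/
def coordForm (τ : Fin 3 → K) : Form3 K := exteriorPower.ιMulti K 3 fun i => d (τ i)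

/-- The entries of the wedge product are replaced by generators one slot at a time, each slot being
linear in its differential. -/
lemma regularForms_le {S : Set K} {P : LocalSubring K}
    (hP : LocOf (Algebra.adjoin ℂ S).toSubring P) (N : Submodule P.toSubring (Form3 K))
    (h : ∀ s : Fin 3 → K, (∀ i, s i ∈ S) → coordForm s ∈ N) : regularForms P ≤ N := by
  -- `T` is the set of slots still filled with arbitrary functions of `P`.
  have key : ∀ T : Finset (Fin 3), ∀ f : Fin 3 → K, (∀ i ∈ T, f i ∈ P.toSubring) →
      (∀ i ∉ T, f i ∈ S) → coordForm f ∈ N := by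
    intro T
    induction T using Finset.induction_on with
    | empty => exact fun f _ hf => h f fun i => hf i (Finset.notMem_empty i)
    | insert j T hj ih =>
      intro f hf1 hf2
      have hL : ∀ g : K, (exteriorPower.ιMulti K 3).toMultilinearMap.toLinearMap
          (fun i => d (f i)) j (d g) = coordForm (Function.update f j g) := by
        intro g
        change exteriorPower.ιMulti K 3 _ = exteriorPower.ιMulti K 3 _
        congr 1
        funext i
        by_cases hij : i = j
        · subst hij; simp
        · simp [hij]
      have := differential_mem hP N ((exteriorPower.ιMulti K 3).toMultilinearMap.toLinearMap
        (fun i => d (f i)) j) (fun s hs => ?_) (hf1 j (Finset.mem_insert_self j T))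
      · rw [hL, Function.update_eq_self] at this
        exact this
      · rw [hL]
        refine ih _ (fun i hi => ?_) (fun i hi => ?_)
        · rw [Function.update_of_ne (by rintro rfl; exact hj hi)]
          exact hf1 i (Finset.mem_insert_of_mem hi)
        · by_cases hij : i = j
          · subst hij; simpa using hs
          · rw [Function.update_of_ne hij]
            exact hf2 i (by simp [hij, hi])
  refine Submodule.span_le.2 ?_
  rintro _ ⟨f, rfl⟩
  exact key Finset.univ (fun i => f i) (fun i _ => (f i).2) (fun i hi => (hi (Finset.mem_univ i)).elim)

lemma coordForm_mem_regularForms {τ : Fin 3 → K} {P : LocalSubring K}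
    (h : ∀ i, τ i ∈ P.toSubring) : coordForm τ ∈ regularForms P :=
  Submodule.subset_span ⟨fun i => ⟨τ i, h i⟩, rfl⟩

/-- A wedge of three of the generators `dτᵢ` is either zero or, up to sign, the coordinate form. -/
lemma exists_smul_of_mem_regularForms {τ : Fin 3 → K} {P : LocalSubring K}
    (hP : LocOf (Algebra.adjoin ℂ (Set.range τ)).toSubring P) {ω : Form3 K}
    (hω : ω ∈ regularForms P) : ∃ c ∈ P.toSubring, ω = c • coordForm τ := by
  have hle : regularForms P ≤ Submodule.span P.toSubring {coordForm τ} := by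
    refine regularForms_le hP _ fun s hs => ?_
    choose σ hσ using hs
    have hs : coordForm s = exteriorPower.ιMulti K 3 (fun i => d (τ (σ i))) := by
      simp only [coordForm, hσ]
    rw [hs]
    by_cases hinj : Function.Injective σ
    · have hb : Function.Bijective σ := Finite.injective_iff_bijective.1 hinj
      have := AlternatingMap.map_perm (exteriorPower.ιMulti K 3 (M := Ω[K⁄ℂ])) (fun i => d (τ i))
        (Equiv.ofBijective σ hb)
      rw [show (fun i => d (τ (σ i))) = (fun i => d (τ i)) ∘ (Equiv.ofBijective σ hb) from rfl,
        this]
      exact (Submodule.span P.toSubring {coordForm τ}).smul_of_tower_mem _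
        (Submodule.mem_span_singleton_self _)
    · rw [Function.Injective] at hinj
      push Not at hinj
      obtain ⟨i, j, hij, hne⟩ := hinj
      rw [AlternatingMap.map_eq_zero_of_eq _ _ (by rw [hij]) hne]
      exact Submodule.zero_mem _
  obtain ⟨c, rfl⟩ := Submodule.mem_span_singleton.1 (hle hω)
  exact ⟨c, c.2, rfl⟩

lemma alternatingMap_ext {M N : Type*} [AddCommGroup M] [Module K M] [AddCommGroup N] [Module K N]
    {f g : M [⋀^Fin 3]→ₗ[K] N} (b : Module.Basis (Fin 3) K M) (h : f b = g b) : f = g := by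
  refine Module.Basis.ext_alternating b fun v hv => ?_
  have hb : Function.Bijective v := Finite.injective_iff_bijective.1 hv
  have hf := f.map_perm b (Equiv.ofBijective v hb)
  have hg := g.map_perm b (Equiv.ofBijective v hb)
  have e : (fun i => b (v i)) = b ∘ (Equiv.ofBijective v hb) := rfl
  rw [e, hf, hg, h]

/-- Pulling `ιMulti` back to `K³` gives an alternating map in three variables on a three-dimensional
space, hence a multiple of the determinant. All changes of coordinates of forms go through this. -/
lemma coordForm_eq_det_smul {τ σ : Fin 3 → K} (M : Matrix (Fin 3) (Fin 3) K)
    (h : ∀ i, d (τ i) = ∑ j, M i j • d (σ j)) : coordForm τ = M.det • coordForm σ := by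
  let g : (Fin 3 → K) →ₗ[K] Ω[K⁄ℂ] := Fintype.linearCombination K fun j => d (σ j)
  have key : (exteriorPower.ιMulti K 3).compLinearMap g =
      (LinearMap.toSpanSingleton K _ (coordForm σ)).compAlternatingMap
        (Pi.basisFun K (Fin 3)).det := by
    refine alternatingMap_ext (Pi.basisFun K (Fin 3)) ?_
    rw [AlternatingMap.compLinearMap_apply, LinearMap.compAlternatingMap_apply,
      Module.Basis.det_self, LinearMap.toSpanSingleton_apply, one_smul, coordForm]
    congr 1
    funext i
    simp [g, Fintype.linearCombination_apply, Pi.single_apply]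
  have := DFunLike.congr_fun key (fun i j => M i j)
  rw [AlternatingMap.compLinearMap_apply, LinearMap.compAlternatingMap_apply,
    LinearMap.toSpanSingleton_apply, Pi.basisFun_det_apply] at this
  change _ = M.det • _ at this
  rw [← this, coordForm]
  congr 1
  funext i
  rw [h i]
  simp [g, Fintype.linearCombination_apply]

end Forms

/-! ### The function field and its line of `3`-forms. -/

section FunctionField

/-- The coordinates `x, y, z` as elements of the function field. -/
def xi : Fin 3 → FunctionField := fun i => algebraMap ChartRing FunctionField (MvPolynomial.X i)

lemma isCoord_xi : IsCoord xi := by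
  have h : ∀ f : ChartRing, MvPolynomial.aeval xi f = algebraMap ChartRing FunctionField f := by
    intro f
    have : (MvPolynomial.aeval xi : ChartRing →ₐ[ℂ] FunctionField) =
        IsScalarTower.toAlgHom ℂ ChartRing FunctionField := by
      ext i
      simp [xi]
    rw [this]
    rfl
  refine ⟨?_, fun k => ?_⟩
  · intro f g hfg
    have hfg' : MvPolynomial.aeval xi f = MvPolynomial.aeval xi g := hfg
    rw [h, h] at hfg'
    exact IsFractionRing.injective _ _ hfg'
  · obtain ⟨f, g, hg, rfl⟩ := IsFractionRing.div_surjective (A := ChartRing) k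
    refine ⟨f, g, ?_, by rw [h, h]⟩
    rw [h]
    exact IsFractionRing.to_map_ne_zero_of_mem_nonZeroDivisors hg

/-- The basis `dx, dy, dz` of the differentials of the function field. -/
def differentialBasis : Module.Basis (Fin 3) FunctionField (Ω[FunctionField⁄ℂ]) :=
  (KaehlerDifferential.mvPolynomialBasis ℂ (Fin 3)).ofIsLocalizedModule FunctionField
    (nonZeroDivisors ChartRing) (KaehlerDifferential.map ℂ ℂ ChartRing FunctionField)

lemma differentialBasis_apply (i : Fin 3) :
    differentialBasis i = KaehlerDifferential.D ℂ FunctionField (xi i) := by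
  rw [differentialBasis, Module.Basis.ofIsLocalizedModule_apply,
    KaehlerDifferential.mvPolynomialBasis_apply, KaehlerDifferential.map_D]
  rfl

/-- The coefficient of a `3`-form with respect to `dx ∧ dy ∧ dz`. -/
def coeffForm : Form3 FunctionField →ₗ[FunctionField] FunctionField :=
  exteriorPower.alternatingMapLinearEquiv differentialBasis.det

lemma coeffForm_coordForm_xi : coeffForm (coordForm xi) = 1 := by
  rw [coeffForm, coordForm, exteriorPower.alternatingMapLinearEquiv_apply_ιMulti]
  simp only [← differentialBasis_apply]
  exact differentialBasis.det_self

/-- Since `dx, dy, dz` is a basis of the differentials, a linear map on `Form3` is determined by its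
value at one form. -/
lemma eq_coeffForm_smul (ω : Form3 FunctionField) : ω = coeffForm ω • coordForm xi := by
  have : (LinearMap.id : Form3 FunctionField →ₗ[FunctionField] _) =
      coeffForm.smulRight (coordForm xi) := by
    apply exteriorPower.linearMap_ext
    refine alternatingMap_ext differentialBasis ?_
    have e : (exteriorPower.ιMulti FunctionField 3) differentialBasis = coordForm xi := by
      rw [coordForm]
      congr 1
      funext i
      exact differentialBasis_apply i
    change (exteriorPower.ιMulti FunctionField 3) differentialBasis =
      coeffForm ((exteriorPower.ιMulti FunctionField 3) differentialBasis) • coordForm xi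
    rw [e, coeffForm_coordForm_xi, one_smul]
  exact LinearMap.congr_fun this ω

end FunctionField
end Fano
end

noncomputable section

namespace Fano

/-! ### Points of `X`, the contracted surfaces, `C` and `R` in charts. -/

section Threefold

variable {K : Type*} [Field K] [Algebra ℂ K]

/-- The affine coordinates `w j / w i` of the point with homogeneous coordinates `w`. -/
def quotients {n : ℕ} (w : Fin n → K) (i : Fin n) : Set K := Set.range fun j => w j / w i

/-- The homogeneous coordinates of the generic point of `X`, from the affine coordinates. -/
def vee (ξ : Fin 3 → K) : K := (ξ 0 + ξ 1) * ξ 2 - ξ 0 * ξ 1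
def hx (ξ : Fin 3 → K) : Fin 2 → K := ![1, ξ 0]
def hy (ξ : Fin 3 → K) : Fin 2 → K := ![1, ξ 1]
def hz (ξ : Fin 3 → K) : Fin 3 → K := ![1, ξ 2, vee ξ]

/-- The points of `X`, of `ℙ¹ × ℙ²` and of `ℙ¹ × ℙ¹`, from the affine coordinates of the generic
point. -/
def IsX (ξ : Fin 3 → K) (P : LocalSubring K) : Prop := ∃ i j k, LocOf
  (Algebra.adjoin ℂ (quotients (hx ξ) i ∪ quotients (hy ξ) j ∪ quotients (hz ξ) k)).toSubring P
def IsW (ξ : Fin 3 → K) (P : LocalSubring K) : Prop := ∃ i k, LocOf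
  (Algebra.adjoin ℂ (quotients (hx ξ) i ∪ quotients (hz ξ) k)).toSubring P
def IsB (ξ : Fin 3 → K) (P : LocalSubring K) : Prop := ∃ i j, LocOf
  (Algebra.adjoin ℂ (quotients (hx ξ) i ∪ quotients (hy ξ) j)).toSubring P

/-- The two involutions of `X`: the interchange of the first two factors, and the reversal of all
homogeneous coordinates. -/
def swapCoord (ξ : Fin 3 → K) : Fin 3 → K := ![ξ 1, ξ 0, ξ 2]
def invCoord (ξ : Fin 3 → K) : Fin 3 → K := ![(ξ 0)⁻¹, (ξ 1)⁻¹, ξ 2 / vee ξ]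

/-- No equations enter here: the curve consists of the points at which neither projection is a local
isomorphism. Equations are derived in `IsC.mem_mx` and `IsX.isC_of_mem_mx`. -/
def IsC (ξ : Fin 3 → K) (P : LocalSubring K) : Prop :=
  IsX ξ P ∧ ¬ IsW ξ P ∧ ¬ IsW (swapCoord ξ) P
def IsR (ξ : Fin 3 → K) (P : LocalSubring K) : Prop :=
  IsX ξ P ∧ ∃ P', IsB ξ P' ∧ (∃ Q, IsC ξ Q ∧ P' ≤ Q) ∧ P' ≤ P

/-- The point of projective space with homogeneous coordinates `w` specializes over `P` into the
chart `w i ≠ 0`. -/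
def RegAt {n : ℕ} (w : Fin n → K) (i : Fin n) (P : LocalSubring K) : Prop :=
  ∀ j, w j / w i ∈ P.toSubring

def HasConst (P : LocalSubring K) : Prop := ∀ c : ℂ, algebraMap ℂ K c ∈ P.toSubring

lemma LocOf.hasConst {A : Subalgebra ℂ K} {P : LocalSubring K} (h : LocOf A.toSubring P) :
    HasConst P := fun c => h.1 (A.algebraMap_mem c)

lemma regAt_iff_quotients {n : ℕ} {w : Fin n → K} {i : Fin n} {P : LocalSubring K} :
    RegAt w i P ↔ ∀ s ∈ quotients w i, s ∈ P.toSubring := by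
  simp [RegAt, quotients]

lemma quotient_mem_locSubring {n : ℕ} {w : Fin n → K} {i i' : Fin n} {P : LocalSubring K}
    {A : Subring K} (hw : ∀ l, w l ≠ 0) (hA : ∀ l, w l / w i ∈ A) (h' : RegAt w i' P) (l : Fin n) :
    w l / w i' ∈ locSubring A P := by
  have h1 : w l / w i' = w l / w i / (w i' / w i) := by
    have := hw i; have := hw i'; field_simp
  rw [h1]
  refine div_mem_locSubring (hA l) (hA i') (div_ne_zero (hw _) (hw _)) ?_
  rw [inv_div]
  exact h' i

/-- A homogeneous coordinate that vanishes at `P` also vanishes at every local ring dominating `P`.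
-/
lemma RegAt.of_dominated {n : ℕ} {w : Fin n → K} {i i' : Fin n} {P Q : LocalSubring K}
    (hw : ∀ l, w l ≠ 0) (hPQ : P ≤ Q) (hQ : RegAt w i Q) (hP : RegAt w i' P) : RegAt w i P := by
  intro l
  have h1 : w l / w i = w l / w i' * (w i / w i')⁻¹ := by
    have := hw i; have := hw i'; field_simp
  rw [h1]
  refine P.toSubring.mul_mem (hP l) (inv_mem_of_notMem_mx (hP i) fun hc => ?_)
  refine notMem_mx_of_inv_mem (div_ne_zero (hw i) (hw i')) ?_ ((domination_iff.1 hPQ).2 hc)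
  rw [inv_div]
  exact hQ i'

variable {ξ : Fin 3 → K}

lemma IsCoord.vee_ne_zero (hξ : IsCoord ξ) : vee ξ ≠ 0 := by
  have : vee ξ = MvPolynomial.aeval ξ ((MvPolynomial.X 0 + MvPolynomial.X 1) * MvPolynomial.X 2 -
      MvPolynomial.X 0 * MvPolynomial.X 1 : ChartRing) := by simp [vee]
  rw [this]
  refine hξ.aeval_ne_zero fun h => ?_
  have := congrArg (MvPolynomial.eval fun _ => 1) h
  norm_num at this

lemma IsCoord.hx_ne_zero (hξ : IsCoord ξ) (i : Fin 2) : hx ξ i ≠ 0 := by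
  fin_cases i <;> simp [hx, hξ.ne_zero]

lemma IsCoord.hy_ne_zero (hξ : IsCoord ξ) (i : Fin 2) : hy ξ i ≠ 0 := by
  fin_cases i <;> simp [hy, hξ.ne_zero]

lemma IsCoord.hz_ne_zero (hξ : IsCoord ξ) (i : Fin 3) : hz ξ i ≠ 0 := by
  fin_cases i <;> simp [hz, hξ.ne_zero, hξ.vee_ne_zero]

lemma vee_swapCoord : vee (swapCoord ξ) = vee ξ := by
  simp [vee, swapCoord]; ring

lemma hx_swapCoord : hx (swapCoord ξ) = hy ξ := rfl
lemma hy_swapCoord : hy (swapCoord ξ) = hx ξ := rfl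
lemma hz_swapCoord : hz (swapCoord ξ) = hz ξ := by
  simp only [hz, vee_swapCoord]; rfl

lemma vee_invCoord (hξ : IsCoord ξ) : vee (invCoord ξ) = (vee ξ)⁻¹ := by
  have h0 := hξ.ne_zero 0
  have h1 := hξ.ne_zero 1
  have h2 := hξ.vee_ne_zero
  have hv : vee ξ = (ξ 0 + ξ 1) * ξ 2 - ξ 0 * ξ 1 := rfl
  change ((ξ 0)⁻¹ + (ξ 1)⁻¹) * (ξ 2 / vee ξ) - (ξ 0)⁻¹ * (ξ 1)⁻¹ = _
  field_simp
  linear_combination -hv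

lemma swapCoord_invCoord : swapCoord (invCoord ξ) = invCoord (swapCoord ξ) := by
  simp only [invCoord, vee_swapCoord]
  rfl

lemma swapCoord_swapCoord : swapCoord (swapCoord ξ) = ξ := by
  funext i; fin_cases i <;> rfl

lemma invCoord_invCoord (hξ : IsCoord ξ) : invCoord (invCoord ξ) = ξ := by
  have h2 := hξ.vee_ne_zero
  funext i
  fin_cases i
  · simp [invCoord]
  · simp [invCoord]
  · change (ξ 2 / vee ξ) / vee (invCoord ξ) = ξ 2
    rw [vee_invCoord hξ]
    field_simp

lemma coord_mem_adjoin (τ : Fin 3 → K) (i : Fin 3) :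
    τ i ∈ IntermediateField.adjoin ℂ (Set.range τ) :=
  IntermediateField.subset_adjoin _ _ ⟨i, rfl⟩

lemma IsCoord.swap (hξ : IsCoord ξ) : IsCoord (swapCoord ξ) := by
  refine hξ.of_mem fun i => ?_
  fin_cases i
  · exact coord_mem_adjoin (swapCoord ξ) 1
  · exact coord_mem_adjoin (swapCoord ξ) 0
  · exact coord_mem_adjoin (swapCoord ξ) 2

lemma IsCoord.inv (hξ : IsCoord ξ) : IsCoord (invCoord ξ) := by
  have h : ∀ i, invCoord (invCoord ξ) i ∈
      IntermediateField.adjoin ℂ (Set.range (invCoord ξ)) := by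
    have h0 := coord_mem_adjoin (invCoord ξ) 0
    have h1 := coord_mem_adjoin (invCoord ξ) 1
    have h2 := coord_mem_adjoin (invCoord ξ) 2
    have hv : vee (invCoord ξ) ∈ IntermediateField.adjoin ℂ (Set.range (invCoord ξ)) :=
      sub_mem (mul_mem (add_mem h0 h1) h2) (mul_mem h0 h1)
    intro i
    fin_cases i
    · exact inv_mem h0
    · exact inv_mem h1
    · exact div_mem h2 hv
  rw [invCoord_invCoord hξ] at h
  exact hξ.of_mem h

lemma quotients_rev {n : ℕ} {w w' : Fin n → K} {c : K} (hc : c ≠ 0)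
    (h : ∀ l, w' l = c * w (Fin.rev l)) (i : Fin n) : quotients w' i = quotients w (Fin.rev i) := by
  ext k
  simp only [quotients, Set.mem_range, h]
  constructor
  · rintro ⟨j, rfl⟩
    exact ⟨Fin.rev j, by rw [mul_div_mul_left _ _ hc]⟩
  · rintro ⟨j, rfl⟩
    exact ⟨Fin.rev j, by rw [mul_div_mul_left _ _ hc, Fin.rev_rev]⟩

lemma hx_invCoord (hξ : IsCoord ξ) (l : Fin 2) :
    hx (invCoord ξ) l = (ξ 0)⁻¹ * hx ξ (Fin.rev l) := by
  have := hξ.ne_zero 0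
  fin_cases l <;> simp [hx, invCoord, Fin.rev, this]

lemma hy_invCoord (hξ : IsCoord ξ) (l : Fin 2) :
    hy (invCoord ξ) l = (ξ 1)⁻¹ * hy ξ (Fin.rev l) := by
  have := hξ.ne_zero 1
  fin_cases l <;> simp [hy, invCoord, Fin.rev, this]

lemma hz_invCoord (hξ : IsCoord ξ) (l : Fin 3) :
    hz (invCoord ξ) l = (vee ξ)⁻¹ * hz ξ (Fin.rev l) := by
  have := hξ.vee_ne_zero
  fin_cases l
  · simp [hz, Fin.rev, this]
  · simp [hz, invCoord, Fin.rev]; ring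
  · simp [hz, vee_invCoord hξ, Fin.rev]

lemma isX_swapCoord {P : LocalSubring K} : IsX (swapCoord ξ) P ↔ IsX ξ P := by
  simp only [IsX, hx_swapCoord, hy_swapCoord, hz_swapCoord]
  constructor
  · rintro ⟨i, j, k, h⟩
    exact ⟨j, i, k, by rwa [Set.union_comm (quotients (hx ξ) j)]⟩
  · rintro ⟨i, j, k, h⟩
    exact ⟨j, i, k, by rwa [Set.union_comm (quotients (hy ξ) j)]⟩

lemma isX_invCoord (hξ : IsCoord ξ) {P : LocalSubring K} : IsX (invCoord ξ) P ↔ IsX ξ P := by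
  simp only [IsX, quotients_rev (inv_ne_zero (hξ.ne_zero 0)) (hx_invCoord hξ),
    quotients_rev (inv_ne_zero (hξ.ne_zero 1)) (hy_invCoord hξ),
    quotients_rev (inv_ne_zero hξ.vee_ne_zero) (hz_invCoord hξ)]
  constructor
  · rintro ⟨i, j, k, h⟩
    exact ⟨_, _, _, h⟩
  · rintro ⟨i, j, k, h⟩
    exact ⟨Fin.rev i, Fin.rev j, Fin.rev k, by simpa only [Fin.rev_rev] using h⟩

lemma isW_invCoord (hξ : IsCoord ξ) {P : LocalSubring K} : IsW (invCoord ξ) P ↔ IsW ξ P := by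
  simp only [IsW, quotients_rev (inv_ne_zero (hξ.ne_zero 0)) (hx_invCoord hξ),
    quotients_rev (inv_ne_zero hξ.vee_ne_zero) (hz_invCoord hξ)]
  constructor
  · rintro ⟨i, k, h⟩
    exact ⟨_, _, h⟩
  · rintro ⟨i, k, h⟩
    exact ⟨Fin.rev i, Fin.rev k, by simpa only [Fin.rev_rev] using h⟩

lemma isB_invCoord (hξ : IsCoord ξ) {P : LocalSubring K} : IsB (invCoord ξ) P ↔ IsB ξ P := by
  simp only [IsB, quotients_rev (inv_ne_zero (hξ.ne_zero 0)) (hx_invCoord hξ),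
    quotients_rev (inv_ne_zero (hξ.ne_zero 1)) (hy_invCoord hξ)]
  constructor
  · rintro ⟨i, k, h⟩
    exact ⟨_, _, h⟩
  · rintro ⟨i, k, h⟩
    exact ⟨Fin.rev i, Fin.rev k, by simpa only [Fin.rev_rev] using h⟩

lemma isC_invCoord (hξ : IsCoord ξ) {P : LocalSubring K} : IsC (invCoord ξ) P ↔ IsC ξ P := by
  rw [IsC, IsC, isX_invCoord hξ, isW_invCoord hξ, swapCoord_invCoord, isW_invCoord hξ.swap]

lemma isR_invCoord (hξ : IsCoord ξ) {P : LocalSubring K} : IsR (invCoord ξ) P ↔ IsR ξ P := by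
  simp only [IsR, isX_invCoord hξ, isB_invCoord hξ, isC_invCoord hξ]

lemma regAt_invCoord {n : ℕ} {w w' : Fin n → K} {c : K} (hc : c ≠ 0)
    (h : ∀ l, w' l = c * w (Fin.rev l)) {i : Fin n} {P : LocalSubring K} :
    RegAt w' i P ↔ RegAt w (Fin.rev i) P := by
  rw [regAt_iff_quotients, regAt_iff_quotients, quotients_rev hc h]

lemma IsX.hasConst {P : LocalSubring K} (h : IsX ξ P) : HasConst P := by
  obtain ⟨i, j, k, h⟩ := h
  exact h.hasConst

lemma IsX.exists_regAt {P : LocalSubring K} (h : IsX ξ P) :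
    ∃ i j k, RegAt (hx ξ) i P ∧ RegAt (hy ξ) j P ∧ RegAt (hz ξ) k P := by
  obtain ⟨i, j, k, h⟩ := h
  refine ⟨i, j, k, fun l => ?_, fun l => ?_, fun l => ?_⟩ <;>
    refine h.1 (Algebra.subset_adjoin ?_)
  · exact Or.inl (Or.inl ⟨l, rfl⟩)
  · exact Or.inl (Or.inr ⟨l, rfl⟩)
  · exact Or.inr ⟨l, rfl⟩

/-- The chart chosen in the definition of a point is immaterial: ratios of homogeneous coordinates
invertible at `P` pass from one chart to another without changing the localization. -/
lemma IsX.locOf (hξ : IsCoord ξ) {P : LocalSubring K} (h : IsX ξ P) {i j k}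
    (hi : RegAt (hx ξ) i P) (hj : RegAt (hy ξ) j P) (hk : RegAt (hz ξ) k P) : LocOf
    (Algebra.adjoin ℂ (quotients (hx ξ) i ∪ quotients (hy ξ) j ∪ quotients (hz ξ) k)).toSubring
    P := by
  have hc := h.hasConst
  obtain ⟨i', j', k', h⟩ := h
  have hreg : ∀ {n : ℕ} {w : Fin n → K} {i : Fin n}, quotients w i ⊆ (Algebra.adjoin ℂ
      (quotients (hx ξ) i' ∪ quotients (hy ξ) j' ∪ quotients (hz ξ) k') : Set K) →
      RegAt w i P := by
    rintro n w i hs l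
    exact h.1 (hs ⟨l, rfl⟩)
  have hi' : RegAt (hx ξ) i' P := hreg fun _ hs => Algebra.subset_adjoin (Or.inl (Or.inl hs))
  have hj' : RegAt (hy ξ) j' P := hreg fun _ hs => Algebra.subset_adjoin (Or.inl (Or.inr hs))
  have hk' : RegAt (hz ξ) k' P := hreg fun _ hs => Algebra.subset_adjoin (Or.inr hs)
  refine h.of_le (adjoin_le_of hc ?_) (adjoin_le_locSubring ?_)
  · rintro _ ((⟨l, rfl⟩ | ⟨l, rfl⟩) | ⟨l, rfl⟩)
    exacts [hi l, hj l, hk l]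
  · rintro _ ((⟨l, rfl⟩ | ⟨l, rfl⟩) | ⟨l, rfl⟩)
    · refine quotient_mem_locSubring (i := i) hξ.hx_ne_zero (fun m => ?_) hi' l
      exact Algebra.subset_adjoin (Or.inl (Or.inl ⟨m, rfl⟩))
    · refine quotient_mem_locSubring (i := j) hξ.hy_ne_zero (fun m => ?_) hj' l
      exact Algebra.subset_adjoin (Or.inl (Or.inr ⟨m, rfl⟩))
    · refine quotient_mem_locSubring (i := k) hξ.hz_ne_zero (fun m => ?_) hk' l
      exact Algebra.subset_adjoin (Or.inr ⟨m, rfl⟩)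

lemma IsW.locOf (hξ : IsCoord ξ) {P : LocalSubring K} (h : IsW ξ P) {i k}
    (hi : RegAt (hx ξ) i P) (hk : RegAt (hz ξ) k P) : LocOf
    (Algebra.adjoin ℂ (quotients (hx ξ) i ∪ quotients (hz ξ) k)).toSubring P := by
  obtain ⟨i', k', h⟩ := h
  have hi' : RegAt (hx ξ) i' P := fun l => h.1 (Algebra.subset_adjoin (Or.inl ⟨l, rfl⟩))
  have hk' : RegAt (hz ξ) k' P := fun l => h.1 (Algebra.subset_adjoin (Or.inr ⟨l, rfl⟩))
  refine h.of_le (adjoin_le_of h.hasConst ?_) (adjoin_le_locSubring ?_)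
  · rintro _ (⟨l, rfl⟩ | ⟨l, rfl⟩)
    exacts [hi l, hk l]
  · rintro _ (⟨l, rfl⟩ | ⟨l, rfl⟩)
    · refine quotient_mem_locSubring (i := i) hξ.hx_ne_zero (fun m => ?_) hi' l
      exact Algebra.subset_adjoin (Or.inl ⟨m, rfl⟩)
    · refine quotient_mem_locSubring (i := k) hξ.hz_ne_zero (fun m => ?_) hk' l
      exact Algebra.subset_adjoin (Or.inr ⟨m, rfl⟩)

lemma regAt_hx_zero {P : LocalSubring K} : RegAt (hx ξ) 0 P ↔ ξ 0 ∈ P.toSubring := by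
  simp [RegAt, hx, Fin.forall_fin_two]

lemma regAt_hy_zero {P : LocalSubring K} : RegAt (hy ξ) 0 P ↔ ξ 1 ∈ P.toSubring := by
  simp [RegAt, hy, Fin.forall_fin_two]

lemma regAt_hz_zero {P : LocalSubring K} :
    RegAt (hz ξ) 0 P ↔ ξ 2 ∈ P.toSubring ∧ vee ξ ∈ P.toSubring := by
  simp [RegAt, hz, Fin.forall_fin_succ]

lemma vee_mem {A : Subring K} (h : ∀ i, ξ i ∈ A) : vee ξ ∈ A :=
  A.sub_mem (A.mul_mem (A.add_mem (h 0) (h 1)) (h 2)) (A.mul_mem (h 0) (h 1))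

/-- `P` is a point of `X` in the affine chart with coordinates `ξ` exactly if the coordinates are
regular. -/
lemma IsX.locOf_adjoin (hξ : IsCoord ξ) {P : LocalSubring K} (h : IsX ξ P)
    (hP : ∀ i, ξ i ∈ P.toSubring) : LocOf (Algebra.adjoin ℂ (Set.range ξ)).toSubring P := by
  have h1 := h.locOf hξ (i := 0) (j := 0) (k := 0) (regAt_hx_zero.2 (hP 0))
    (regAt_hy_zero.2 (hP 1)) (regAt_hz_zero.2 ⟨hP 2, vee_mem hP⟩)
  have hm : ∀ i, ξ i ∈ (Algebra.adjoin ℂ (Set.range ξ)).toSubring :=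
    fun i => Algebra.subset_adjoin ⟨i, rfl⟩
  refine h1.mono (adjoin_le_of (Subalgebra.algebraMap_mem _) ?_) (adjoin_le_of h.hasConst ?_)
  · rintro _ ((⟨l, rfl⟩ | ⟨l, rfl⟩) | ⟨l, rfl⟩) <;> fin_cases l <;>
      simp [hx, hy, hz, hm, vee_mem hm]
  · rintro _ ⟨i, rfl⟩
    exact hP i

lemma isX_of_locOf {P : LocalSubring K} (h : LocOf (Algebra.adjoin ℂ (Set.range ξ)).toSubring P) :
    IsX ξ P := by
  have hm : ∀ i, ξ i ∈ P.toSubring := fun i => h.1 (Algebra.subset_adjoin ⟨i, rfl⟩)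
  refine ⟨0, 0, 0, h.mono (adjoin_le_of (Subalgebra.algebraMap_mem _) ?_)
    (adjoin_le_of h.hasConst ?_)⟩
  · rintro _ ⟨i, rfl⟩
    refine Algebra.subset_adjoin ?_
    fin_cases i
    · exact Or.inl (Or.inl ⟨1, by simp [hx]⟩)
    · exact Or.inl (Or.inr ⟨1, by simp [hy]⟩)
    · exact Or.inr ⟨1, by simp [hz]⟩
  · rintro _ ((⟨l, rfl⟩ | ⟨l, rfl⟩) | ⟨l, rfl⟩) <;> fin_cases l <;>
      simp [hx, hy, hz, hm, vee_mem hm]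

/-- The equations of the exceptional surface of `X → ℙ¹ × ℙ²`. -/
lemma IsX.mem_mx_of_not_isW (hξ : IsCoord ξ) {P : LocalSubring K} (h : IsX ξ P) (hW : ¬ IsW ξ P)
    {i k} (hi : RegAt (hx ξ) i P) (hk : RegAt (hz ξ) k P) :
    (ξ 2 - ξ 0) / (hx ξ i * hz ξ k) ∈ mx P ∧ (vee ξ - ξ 0 * ξ 2) / (hx ξ i * hz ξ k) ∈ mx P := by
  obtain ⟨-, j, -, -, hj, -⟩ := h.exists_regAt
  have hloc := h.locOf hξ hi hj hk
  set A := Algebra.adjoin ℂ (quotients (hx ξ) i ∪ quotients (hz ξ) k) with hA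
  have hxA : ∀ l, hx ξ l / hx ξ i ∈ A.toSubring := fun l => Algebra.subset_adjoin (Or.inl ⟨l, rfl⟩)
  have hzA : ∀ l, hz ξ l / hz ξ k ∈ A.toSubring := fun l => Algebra.subset_adjoin (Or.inr ⟨l, rfl⟩)
  have hAP : A.toSubring ≤ P.toSubring := adjoin_le_of h.hasConst (by
    rintro _ (⟨l, rfl⟩ | ⟨l, rfl⟩)
    exacts [hi l, hk l])
  have hxi := hξ.hx_ne_zero i
  have hzk := hξ.hz_ne_zero k
  have hαA : (ξ 2 - ξ 0) / (hx ξ i * hz ξ k) ∈ A.toSubring := by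
    have : (ξ 2 - ξ 0) / (hx ξ i * hz ξ k) = hx ξ 0 / hx ξ i * (hz ξ 1 / hz ξ k) -
        hx ξ 1 / hx ξ i * (hz ξ 0 / hz ξ k) := by
      field_simp
      simp [hx, hz]
    rw [this]
    exact Subring.sub_mem _ (Subring.mul_mem _ (hxA _) (hzA _)) (Subring.mul_mem _ (hxA _) (hzA _))
  have hβA : (vee ξ - ξ 0 * ξ 2) / (hx ξ i * hz ξ k) ∈ A.toSubring := by
    have : (vee ξ - ξ 0 * ξ 2) / (hx ξ i * hz ξ k) = hx ξ 0 / hx ξ i * (hz ξ 2 / hz ξ k) -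
        hx ξ 1 / hx ξ i * (hz ξ 1 / hz ξ k) := by
      field_simp
      simp [hx, hz]
    rw [this]
    exact Subring.sub_mem _ (Subring.mul_mem _ (hxA _) (hzA _)) (Subring.mul_mem _ (hxA _) (hzA _))
  set α := (ξ 2 - ξ 0) / (hx ξ i * hz ξ k) with hα
  set β := (vee ξ - ξ 0 * ξ 2) / (hx ξ i * hz ξ k) with hβ
  -- The equation of `X` reads `y (z - x) = v - x z`. Thus `y` is a ratio of functions on `ℙ¹ × ℙ²`,
  -- and the projection is a local isomorphism wherever the relevant one of them is invertible.
  have hβα : β = ξ 1 * α := by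
    rw [hβ, hα, vee]; ring
  have hy0 := hξ.ne_zero 1
  have hisW : (∀ l, hy ξ l / hy ξ j ∈ locSubring A.toSubring P) → IsW ξ P := by
    intro hl
    refine ⟨i, k, hloc.of_le hAP (adjoin_le_locSubring ?_)⟩
    rintro _ ((⟨l, rfl⟩ | ⟨l, rfl⟩) | ⟨l, rfl⟩)
    exacts [le_locSubring _ _ (hxA l), hl l, le_locSubring _ _ (hzA l)]
  fin_cases j
  · have hα' : α ∈ mx P := by
      by_contra hc
      refine hW (hisW fun l => ?_)
      fin_cases l
      · simp [hy]
      · have : hy ξ 1 / hy ξ 0 = β / α := by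
          rw [hβα]
          have := ne_zero_of_notMem_mx hc
          field_simp
          simp [hy]
        exact this ▸ div_mem_locSubring hβA hαA (ne_zero_of_notMem_mx hc)
          (inv_mem_of_notMem_mx (hAP hαA) hc)
    exact ⟨hα', hβα ▸ mul_mem_mx (regAt_hy_zero.1 hj) hα'⟩
  · have hβ' : β ∈ mx P := by
      by_contra hc
      refine hW (hisW fun l => ?_)
      fin_cases l
      · have : hy ξ 0 / hy ξ 1 = α / β := by
          have := ne_zero_of_notMem_mx hc
          have h3 : α ≠ 0 := by rintro h3; exact this (by rw [hβα, h3, mul_zero])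
          rw [hβα]
          simp [hy]
          field_simp
        exact this ▸ div_mem_locSubring hαA hβA (ne_zero_of_notMem_mx hc)
          (inv_mem_of_notMem_mx (hAP hβA) hc)
      · simp [hy, hy0]
    have h5 : (ξ 1)⁻¹ ∈ P.toSubring := by simpa [hy] using hj 0
    refine ⟨?_, hβ'⟩
    have : α = (ξ 1)⁻¹ * β := by rw [hβα, inv_mul_cancel_left₀ hy0]
    exact this ▸ mul_mem_mx h5 hβ'

lemma inv_mem_of_mul_sub_one_mem {P : LocalSubring K} {k l : K} (hk : k ∈ P.toSubring)
    (hl : l ∈ P.toSubring) (h : k * l - 1 ∈ mx P) : l⁻¹ ∈ P.toSubring := by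
  refine inv_mem_of_notMem_mx hl fun hc => one_notMem_mx P ?_
  have := sub_mem_mx (mul_mem_mx hk hc) h
  simpa using this

/-- On `E₁` one has `x₀ z₁ = x₁ z₀`, so `x₀` cannot vanish where `z₀` does not. -/
lemma IsX.regAt_hx_zero_of_regAt_hz_zero (hξ : IsCoord ξ) {P : LocalSubring K} (h : IsX ξ P)
    (hW : ¬ IsW ξ P) (hk : RegAt (hz ξ) 0 P) : RegAt (hx ξ) 0 P := by
  obtain ⟨i, -, -, hi, -, -⟩ := h.exists_regAt
  fin_cases i
  · exact hi
  · have h1 := (h.mem_mx_of_not_isW hξ hW hi hk).1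
    have h0 := hξ.ne_zero 0
    have h2 : (ξ 0)⁻¹ ∈ P.toSubring := by simpa [hx] using hi 0
    have h3 : ξ 2 * (ξ 0)⁻¹ - 1 ∈ mx P := by
      convert h1 using 1
      simp [hx, hz]
      field_simp
    rw [regAt_hx_zero]
    simpa using inv_mem_of_mul_sub_one_mem (regAt_hz_zero.1 hk).1 h2 h3

/-- The curve `C` is covered by two affine charts. -/
lemma IsC.coord_mem (hξ : IsCoord ξ) {P : LocalSubring K} (h : IsC ξ P) :
    (∀ i, ξ i ∈ P.toSubring) ∨ ∀ i, invCoord ξ i ∈ P.toSubring := by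
  have key : ∀ {ξ : Fin 3 → K}, IsCoord ξ → IsC ξ P → RegAt (hz ξ) 0 P →
      ∀ i, ξ i ∈ P.toSubring := by
    rintro ξ hξ ⟨hX, hW, hW'⟩ hk i
    have h2 := hX.regAt_hx_zero_of_regAt_hz_zero hξ hW hk
    have h3 := (isX_swapCoord.2 hX).regAt_hx_zero_of_regAt_hz_zero hξ.swap hW'
      (by rwa [hz_swapCoord])
    rw [hx_swapCoord] at h3
    fin_cases i
    exacts [regAt_hx_zero.1 h2, regAt_hy_zero.1 h3, (regAt_hz_zero.1 hk).1]
  obtain ⟨i, j, k, hi, hj, hk⟩ := h.1.exists_regAt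
  -- On `C` the last coordinates are `(1 : x : x²)`; where the middle one is nonzero, so is the
  -- first.
  have hk' : RegAt (hz ξ) 0 P ∨ RegAt (hz ξ) 2 P := by
    fin_cases k
    · exact Or.inl hk
    · have hz0 := hξ.ne_zero 2
      have h1 : (ξ 2)⁻¹ ∈ P.toSubring := by simpa [hz] using hk 0
      have h2 : vee ξ / ξ 2 ∈ P.toSubring := by simpa [hz] using hk 2
      have h0 := hξ.ne_zero 0
      obtain ⟨hα, hβ⟩ := h.1.mem_mx_of_not_isW hξ h.2.1 hi hk
      have hz' : ξ 0 ∈ P.toSubring → ξ 2 * (ξ 2)⁻¹ - ξ 0 * (ξ 2)⁻¹ ∈ mx P →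
          ξ 2 ∈ P.toSubring := by
        intro h3 h4
        have := inv_mem_of_mul_sub_one_mem h3 h1 (by
          rw [mul_inv_cancel₀ hz0] at h4
          have := neg_mem_mx h4
          rwa [neg_sub] at this)
        simpa using this
      left
      rw [regAt_hz_zero]
      suffices h5 : ξ 2 ∈ P.toSubring from
        ⟨h5, by simpa [div_mul_cancel₀ _ hz0] using P.toSubring.mul_mem h2 h5⟩
      fin_cases i
      · refine hz' (regAt_hx_zero.1 hi) ?_
        convert hα using 1
        simp [hx, hz]
        field_simp
      · have h3 : (ξ 0)⁻¹ ∈ P.toSubring := by simpa [hx] using hi 0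
        have h6 : ξ 0 ∈ P.toSubring := by
          have := inv_mem_of_mul_sub_one_mem h2 h3 (by
            convert hβ using 1
            simp [hx, hz]
            field_simp)
          simpa using this
        refine hz' h6 ?_
        have := mul_mem_mx h6 hα
        convert this using 1
        simp [hx, hz]
        field_simp
    · exact Or.inr hk
  rcases hk' with hk' | hk'
  · exact Or.inl (key hξ h hk')
  · refine Or.inr (key hξ.inv ((isC_invCoord hξ).2 h) ?_)
    exact (regAt_invCoord (inv_ne_zero hξ.vee_ne_zero) (hz_invCoord hξ)).2 hk'

lemma IsC.mem_mx (hξ : IsCoord ξ) {P : LocalSubring K} (h : IsC ξ P)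
    (hP : ∀ i, ξ i ∈ P.toSubring) : ξ 2 - ξ 0 ∈ mx P ∧ ξ 0 - ξ 1 ∈ mx P := by
  have hk : RegAt (hz ξ) 0 P := regAt_hz_zero.2 ⟨hP 2, vee_mem hP⟩
  have h1 := (h.1.mem_mx_of_not_isW hξ h.2.1 (regAt_hx_zero.2 (hP 0)) hk).1
  have h2 := ((isX_swapCoord.2 h.1).mem_mx_of_not_isW hξ.swap h.2.2
    (i := 0) (k := 0) (regAt_hx_zero.2 (hP 1)) (by rwa [hz_swapCoord])).1
  have h1' : ξ 2 - ξ 0 ∈ mx P := by simpa [hx, hz] using h1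
  have h2' : ξ 2 - ξ 1 ∈ mx P := by simpa [hx, hz, swapCoord] using h2
  exact ⟨h1', by simpa using sub_mem_mx h2' h1'⟩

/-- Otherwise `x`, `z - x`, `v - x z` would be coordinates at `P`, and the quotient `y` of the last
two could not be regular where `z - x` vanishes. -/
lemma IsX.not_isW (hξ : IsCoord ξ) {P : LocalSubring K} 
    (hP : ∀ i, ξ i ∈ P.toSubring) (hu : ξ 2 - ξ 0 ∈ mx P) : ¬ IsW ξ P := by
  intro hW
  have hu0 : ξ 2 - ξ 0 ≠ 0 := by
    intro h0
    have := hξ.aeval_ne_zero (f := MvPolynomial.X 2 - MvPolynomial.X 0) (fun h => by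
      have := congrArg (MvPolynomial.eval fun i => if i = 2 then 1 else 0) h
      simp at this)
    simp [h0] at this
  set τ : Fin 3 → K := ![ξ 0, ξ 2 - ξ 0, vee ξ - ξ 0 * ξ 2] with hτ
  have hvu : vee ξ - ξ 0 * ξ 2 = ξ 1 * (ξ 2 - ξ 0) := by rw [vee]; ring
  have hcoord : IsCoord τ := by
    refine hξ.of_mem fun i => ?_
    have h0 := coord_mem_adjoin τ 0
    have h1 := coord_mem_adjoin τ 1
    have h2 := coord_mem_adjoin τ 2
    have e1 : τ 1 = ξ 2 - ξ 0 := rfl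
    have e2 : τ 2 = ξ 1 * (ξ 2 - ξ 0) := hvu
    fin_cases i
    · exact h0
    · have := div_mem h2 h1
      rwa [e2, e1, mul_div_cancel_right₀ _ hu0] at this
    · have := add_mem h1 h0
      rwa [e1, show τ 0 = ξ 0 from rfl, sub_add_cancel] at this
  have hloc := hW.locOf hξ (regAt_hx_zero.2 (hP 0)) (regAt_hz_zero.2 ⟨hP 2, vee_mem hP⟩)
  have hloc' : LocOf (Algebra.adjoin ℂ (Set.range τ)).toSubring P := by
    have hm : ∀ i, τ i ∈ (Algebra.adjoin ℂ (Set.range τ)).toSubring :=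
      fun i => Algebra.subset_adjoin ⟨i, rfl⟩
    have h0 : ξ 0 ∈ (Algebra.adjoin ℂ (Set.range τ)).toSubring := hm 0
    have h2 : ξ 2 ∈ (Algebra.adjoin ℂ (Set.range τ)).toSubring := by
      simpa [hτ] using Subring.add_mem _ (hm 1) h0
    have h3 : vee ξ ∈ (Algebra.adjoin ℂ (Set.range τ)).toSubring := by
      simpa [hτ] using Subring.add_mem _ (hm 2) (Subring.mul_mem _ h0 h2)
    refine hloc.mono (adjoin_le_of (Subalgebra.algebraMap_mem _) ?_)
      (adjoin_le_of hloc.hasConst ?_)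
    · rintro _ (⟨l, rfl⟩ | ⟨l, rfl⟩) <;> fin_cases l <;>
        simp [hx, hz, h0, h2, h3]
    · rintro _ ⟨i, rfl⟩
      fin_cases i
      · exact hP 0
      · exact P.toSubring.sub_mem (hP 2) (hP 0)
      · exact P.toSubring.sub_mem (vee_mem hP) (P.toSubring.mul_mem (hP 0) (hP 2))
  refine hcoord.div_notMem hloc' (i := 1) (j := 2) (by decide) hu one_ne_zero 1 ?_
  simp only [hτ, Matrix.cons_val, pow_one, hvu]
  rw [mul_div_cancel_right₀ _ hu0]
  exact hP 1

lemma IsX.isC_of_mem_mx (hξ : IsCoord ξ) {P : LocalSubring K} (h : IsX ξ P)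
    (hP : ∀ i, ξ i ∈ P.toSubring) (hu : ξ 2 - ξ 0 ∈ mx P) (hr : ξ 0 - ξ 1 ∈ mx P) : IsC ξ P := by
  refine ⟨h, IsX.not_isW hξ hP hu, IsX.not_isW hξ.swap ?_ ?_⟩
  · intro i
    fin_cases i
    exacts [hP 1, hP 0, hP 2]
  · simpa [swapCoord] using add_mem_mx hu hr

lemma IsX.coord_mem_of_dominated (hξ : IsCoord ξ) {P Q : LocalSubring K} (h : IsX ξ P)
    (hPQ : P ≤ Q) (hQ : ∀ i, ξ i ∈ Q.toSubring) : ∀ i, ξ i ∈ P.toSubring := by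
  obtain ⟨i, j, k, hi, hj, hk⟩ := h.exists_regAt
  have h1 := (regAt_hx_zero.2 (hQ 0)).of_dominated hξ.hx_ne_zero hPQ hi
  have h2 := (regAt_hy_zero.2 (hQ 1)).of_dominated hξ.hy_ne_zero hPQ hj
  have h3 := (regAt_hz_zero.2 ⟨hQ 2, vee_mem hQ⟩).of_dominated hξ.hz_ne_zero hPQ hk
  intro i
  fin_cases i
  exacts [regAt_hx_zero.1 h1, regAt_hy_zero.1 h2, (regAt_hz_zero.1 h3).1]

/-- `X` is separated. -/
lemma IsX.eq_of_dominated (hξ : IsCoord ξ) {P P' Q : LocalSubring K} (h : IsX ξ P) (h' : IsX ξ P')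
    (hP : P ≤ Q) (hP' : P' ≤ Q) : P = P' := by
  obtain ⟨i, j, k, hi, hj, hk⟩ := h.exists_regAt
  obtain ⟨i', j', k', hi', hj', hk'⟩ := h'.exists_regAt
  have hle := (domination_iff.1 hP).1
  exact (h.locOf hξ hi hj hk).eq_of_dominated (h'.locOf hξ
    (RegAt.of_dominated hξ.hx_ne_zero hP' (fun l => hle (hi l)) hi')
    (RegAt.of_dominated hξ.hy_ne_zero hP' (fun l => hle (hj l)) hj')
    (RegAt.of_dominated hξ.hz_ne_zero hP' (fun l => hle (hk l)) hk')) hP hP'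

lemma IsX.of_locOf {O P : LocalSubring K} (h : IsX ξ O) (hP : LocOf O.toSubring P) : IsX ξ P := by
  obtain ⟨i, j, k, h⟩ := h
  exact ⟨i, j, k, locSubring_trans h hP⟩

/-- The centre of `P` on the spectrum of `O` is a point of `X` dominated by `P`, so by separatedness
it is `P`. -/
lemma IsX.locOf_of_le (hξ : IsCoord ξ) {O P : LocalSubring K} (h : IsX ξ O) (h' : IsX ξ P)
    (hOP : O.toSubring ≤ P.toSubring) : LocOf O.toSubring P := by
  have h1 := h.of_locOf (locOf_center hOP)
  have h2 : center O.toSubring P hOP = P := h1.eq_of_dominated hξ h' (center_le hOP) le_rfl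
  exact h2 ▸ locOf_center hOP

/-- `C` is closed in `X`. -/
lemma IsC.of_le (hξ : IsCoord ξ) {O P : LocalSubring K} (hO : IsX ξ O) (hP : IsC ξ P)
    (hOP : O.toSubring ≤ P.toSubring) : IsC ξ O := by
  have hloc := hO.locOf_of_le hξ hP.1 hOP
  refine ⟨hO, ?_, ?_⟩
  · rintro ⟨i, k, h⟩
    exact hP.2.1 ⟨i, k, locSubring_trans h hloc⟩
  · rintro ⟨i, k, h⟩
    exact hP.2.2 ⟨i, k, locSubring_trans h hloc⟩

/-- The function `x - y` vanishes on `C`, hence on its image in `ℙ¹ × ℙ¹` and on the preimage of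
that image. -/
lemma IsR.mem_mx (hξ : IsCoord ξ) {P : LocalSubring K} (h : IsR ξ P)
    (hP : ∀ i, ξ i ∈ P.toSubring) : ξ 0 - ξ 1 ∈ mx P := by
  obtain ⟨-, P', ⟨i, j, hB⟩, ⟨Q, hC, hPQ⟩, hle⟩ := h
  have hi : RegAt (hx ξ) i P' := fun l => hB.1 (Algebra.subset_adjoin (Or.inl ⟨l, rfl⟩))
  have hj : RegAt (hy ξ) j P' := fun l => hB.1 (Algebra.subset_adjoin (Or.inr ⟨l, rfl⟩))
  have h1 := regAt_hx_zero.1 ((regAt_hx_zero.2 (hP 0)).of_dominated hξ.hx_ne_zero hle hi)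
  have h2 := regAt_hy_zero.1 ((regAt_hy_zero.2 (hP 1)).of_dominated hξ.hy_ne_zero hle hj)
  have h1' := (domination_iff.1 hPQ).1 h1
  have h2' := (domination_iff.1 hPQ).1 h2
  have h3 : ξ 0 - ξ 1 ∈ mx Q := by
    rcases hC.coord_mem hξ with hQ | hQ
    · exact (hC.mem_mx hξ hQ).2
    · have h4 := (((isC_invCoord hξ).2 hC).mem_mx hξ.inv hQ).2
      have h5 := mul_mem_mx (Q.toSubring.mul_mem h1' h2') (neg_mem_mx h4)
      have e0 := hξ.ne_zero 0
      have e1 := hξ.ne_zero 1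
      convert h5 using 1
      simp [invCoord]
      field_simp
  exact (domination_iff.1 hle).2 (mem_mx_of_dominated hPQ (P'.toSubring.sub_mem h1 h2) h3)

end Threefold

/-! ### The concrete models in terms of the chart predicates. -/

section Concrete

lemma ratios_genericX (i : Fin 2) : ratios genericX i = quotients (hx xi) i := by
  have h : ∀ j, algebraMap ChartRing FunctionField (genericX j) = hx xi j := by
    intro j; fin_cases j <;> simp [genericX, hx, xi]
  simp only [ratios, quotients, h]

lemma ratios_genericY (i : Fin 2) : ratios genericY i = quotients (hy xi) i := by
  have h : ∀ j, algebraMap ChartRing FunctionField (genericY j) = hy xi j := by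
    intro j; fin_cases j <;> simp [genericY, hy, xi]
  simp only [ratios, quotients, h]

lemma ratios_genericZ (i : Fin 3) : ratios genericZ i = quotients (hz xi) i := by
  have h : ∀ j, algebraMap ChartRing FunctionField (genericZ j) = hz xi j := by
    intro j; fin_cases j <;> simp [genericZ, hz, vee, xi]
  simp only [ratios, quotients, h]

lemma mem_X {P : LocalSubring FunctionField} : P ∈ X.points ↔ IsX xi P := by
  rw [X, mem_ofCharts]
  simp only [ratios_genericX, ratios_genericY, ratios_genericZ, IsX]
  constructor
  · rintro ⟨_, ⟨i, j, k, rfl⟩, h⟩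
    exact ⟨i, j, k, h⟩
  · rintro ⟨i, j, k, h⟩
    exact ⟨_, ⟨i, j, k, rfl⟩, h⟩

lemma mem_W₁ {P : LocalSubring FunctionField} : P ∈ W₁.points ↔ IsW xi P := by
  rw [W₁, mem_ofCharts]
  simp only [ratios_genericX, ratios_genericZ, IsW]
  constructor
  · rintro ⟨_, ⟨i, k, rfl⟩, h⟩
    exact ⟨i, k, h⟩
  · rintro ⟨i, k, h⟩
    exact ⟨_, ⟨i, k, rfl⟩, h⟩

lemma mem_W₂ {P : LocalSubring FunctionField} : P ∈ W₂.points ↔ IsW (swapCoord xi) P := by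
  rw [W₂, mem_ofCharts]
  simp only [ratios_genericY, ratios_genericZ, IsW, hx_swapCoord, hz_swapCoord]
  constructor
  · rintro ⟨_, ⟨i, k, rfl⟩, h⟩
    exact ⟨i, k, h⟩
  · rintro ⟨i, k, h⟩
    exact ⟨_, ⟨i, k, rfl⟩, h⟩

lemma mem_B {P : LocalSubring FunctionField} : P ∈ B.points ↔ IsB xi P := by
  rw [B, mem_ofCharts]
  simp only [ratios_genericX, ratios_genericY, IsB]
  constructor
  · rintro ⟨_, ⟨i, j, rfl⟩, h⟩
    exact ⟨i, j, h⟩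
  · rintro ⟨i, j, h⟩
    exact ⟨_, ⟨i, j, rfl⟩, h⟩

lemma mem_C {P : LocalSubring FunctionField} : P ∈ C ↔ IsC xi P := by
  rw [C, E₁, E₂, Set.mem_inter_iff, exceptionalLocus, exceptionalLocus]
  simp only [Set.mem_ofPred_eq, mem_X, mem_W₁, mem_W₂, IsC]
  tauto

lemma mem_R {P : LocalSubring FunctionField} : P ∈ R ↔ IsR xi P := by
  rw [R, preimageIn, imageIn]
  simp only [Set.mem_ofPred_eq, mem_X, mem_B, mem_C, IsR, and_assoc]

end Concrete

end Fano
end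

noncomputable section

namespace Fano

/-! ### Affine charts of `Proj`. -/

section Blowup

variable {K : Type*} [Field K] [Algebra ℂ K]

/-- The affine chart of `Proj` where `g`, of degree `n`, does not vanish. -/
def projChart {O : LocalSubring K} (I : ℕ → Ideal O.toSubring) (n : ℕ) (g : O.toSubring) :
    Subalgebra ℂ K :=
  Algebra.adjoin ℂ {t : K | ∃ k : ℕ, ∃ h ∈ I (n * k), t = (h : K) / (g : K) ^ k}

lemma mem_proj {V : Model K} {I : (O : LocalSubring K) → ℕ → Ideal O.toSubring}
    {P : LocalSubring K} : P ∈ (V.proj I).points ↔ ∃ O ∈ V.points, ∃ n : ℕ, 0 < n ∧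
      ∃ g ∈ I O n, g ≠ 0 ∧ LocOf (projChart (I O) n g).toSubring P := by
  rw [Model.proj, mem_ofCharts]
  constructor
  · rintro ⟨_, ⟨O, hO, n, hn, g, hg, hg0, rfl⟩, h⟩
    exact ⟨O, hO, n, hn, g, hg, hg0, h⟩
  · rintro ⟨O, hO, n, hn, g, hg, hg0, h⟩
    exact ⟨_, ⟨O, hO, n, hn, g, hg, hg0, rfl⟩, h⟩

lemma proj_of_locOf {V : Model K} {I : (O : LocalSubring K) → ℕ → Ideal O.toSubring}
    {O P : LocalSubring K} (hO : O ∈ (V.proj I).points) (h : LocOf O.toSubring P) :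
    P ∈ (V.proj I).points := ofCharts_of_locOf hO h

section

variable {O : LocalSubring K} {I : ℕ → Ideal O.toSubring} {n : ℕ} {g : O.toSubring}

lemma div_pow_mem_projChart {k : ℕ} {h : O.toSubring} (hh : h ∈ I (n * k)) :
    (h : K) / (g : K) ^ k ∈ (projChart I n g).toSubring :=
  Algebra.subset_adjoin ⟨k, h, hh, rfl⟩

lemma div_mem_projChart {h : O.toSubring} (hh : h ∈ I n) :
    (h : K) / (g : K) ∈ (projChart I n g).toSubring := by
  have := div_pow_mem_projChart (I := I) (g := g) (n := n) (k := 1) (h := h) (by rwa [mul_one])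
  rwa [pow_one] at this

lemma le_projChart (h0 : I 0 = ⊤) : O.toSubring ≤ (projChart I n g).toSubring := by
  intro k hk
  have := div_pow_mem_projChart (I := I) (g := g) (n := n) (k := 0) (h := ⟨k, hk⟩)
    (by rw [mul_zero, h0]; exact Submodule.mem_top)
  rwa [pow_zero, div_one] at this

lemma projChart_le {A : Subring K} (hc : ∀ c : ℂ, algebraMap ℂ K c ∈ A)
    (h : ∀ k, ∀ h ∈ I (n * k), (h : K) / (g : K) ^ k ∈ A) :
    (projChart I n g).toSubring ≤ A := by
  refine adjoin_le_of hc ?_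
  rintro _ ⟨k, t, ht, rfl⟩
  exact h k t ht

/-- The elements of an affine chart of `Proj` are homogeneous fractions of degree zero. -/
lemma exists_of_mem_projChart (hO : HasConst O) (h0 : I 0 = ⊤)
    (hI : ∀ m l, ∀ s ∈ I m, ∀ t ∈ I l, s * t ∈ I (m + l)) (hg : g ∈ I n) (hg0 : g ≠ 0) {t : K}
    (ht : t ∈ (projChart I n g).toSubring) : ∃ k, ∃ h ∈ I (n * k), t = (h : K) / (g : K) ^ k := by
  have hgk : (g : K) ≠ 0 := fun h => hg0 (Subtype.ext h)
  have hpow : ∀ k, g ^ k ∈ I (n * k) := by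
    intro k
    induction k with
    | zero => rw [mul_zero, h0]; exact Submodule.mem_top
    | succ k ih => rw [pow_succ, mul_add, mul_one]; exact hI _ _ _ ih _ hg
  induction ht using Algebra.adjoin_induction with
  | mem t ht => exact ht
  | algebraMap c =>
    exact ⟨0, ⟨_, hO c⟩, by rw [mul_zero, h0]; exact Submodule.mem_top, by simp⟩
  | add s t _ _ hs ht =>
    obtain ⟨k, a, ha, rfl⟩ := hs
    obtain ⟨l, b, hb, rfl⟩ := ht
    refine ⟨k + l, a * g ^ l + b * g ^ k, ?_, ?_⟩
    · rw [mul_add]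
      refine add_mem (hI _ _ _ ha _ (hpow l)) ?_
      rw [add_comm]
      exact hI _ _ _ hb _ (hpow k)
    · push_cast
      field_simp
      ring
  | mul s t _ _ hs ht =>
    obtain ⟨k, a, ha, rfl⟩ := hs
    obtain ⟨l, b, hb, rfl⟩ := ht
    refine ⟨k + l, a * b, ?_, ?_⟩
    · rw [mul_add]
      exact hI _ _ _ ha _ hb
    · push_cast
      field_simp
      ring

/-- Where the denominator is invertible, `Proj` is isomorphic to its base. -/
lemma LocOf.of_projChart {P : LocalSubring K} (h : LocOf (projChart I n g).toSubring P)
    (hO : HasConst O) (h0 : I 0 = ⊤) (hg0 : g ≠ 0) (hg : (g : K)⁻¹ ∈ P.toSubring) :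
    LocOf O.toSubring P := by
  have hgk : (g : K) ≠ 0 := fun h => hg0 (Subtype.ext h)
  refine h.of_le ((le_projChart h0).trans h.1)
    (projChart_le (fun c => le_locSubring _ _ (hO c)) fun k t _ => ?_)
  refine div_mem_locSubring t.2 (O.toSubring.pow_mem g.2 k) (pow_ne_zero _ hgk) ?_
  rw [← inv_pow]
  exact P.toSubring.pow_mem hg k

end

lemma mem_proj_of_eq_top {V : Model K} {I : (O : LocalSubring K) → ℕ → Ideal O.toSubring}
    {O : LocalSubring K} (hO : O ∈ V.points) {n : ℕ} (hn : 0 < n) (h0 : I O 0 = ⊤)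
    (hI : I O n = ⊤) : O ∈ (V.proj I).points := by
  refine mem_proj.2 ⟨O, hO, n, hn, 1, by rw [hI]; exact Submodule.mem_top, one_ne_zero, ?_⟩
  have hOO : LocOf O.toSubring O := ⟨le_rfl, fun k hk => ⟨k, hk, 1, O.toSubring.one_mem,
    one_ne_zero, by simp, by simp⟩⟩
  refine hOO.mono (le_projChart h0) (projChart_le (V.algebraMap_mem O hO) ?_)
  rintro k h -
  simp

lemma HasConst.adjoin_le {P : LocalSubring K} (h : HasConst P) {τ : Fin 3 → K}
    (hτ : ∀ i, τ i ∈ P.toSubring) : (Algebra.adjoin ℂ (Set.range τ)).toSubring ≤ P.toSubring := by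
  refine adjoin_le_of h ?_
  rintro _ ⟨i, rfl⟩
  exact hτ i

lemma mem_adjoin_range (τ : Fin 3 → K) (i : Fin 3) :
    τ i ∈ (Algebra.adjoin ℂ (Set.range τ)).toSubring := Algebra.subset_adjoin ⟨i, rfl⟩

lemma adjoin_range_le {τ : Fin 3 → K} {A : Subalgebra ℂ K} (hτ : ∀ i, τ i ∈ A.toSubring) :
    (Algebra.adjoin ℂ (Set.range τ)).toSubring ≤ A.toSubring := by
  refine adjoin_le_of A.algebraMap_mem ?_
  rintro _ ⟨i, rfl⟩
  exact hτ i

lemma adjoin_range_le_locSubring {τ : Fin 3 → K} {A : Subalgebra ℂ K} {P : LocalSubring K}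
    (hτ : ∀ i, τ i ∈ locSubring A.toSubring P) :
    (Algebra.adjoin ℂ (Set.range τ)).toSubring ≤ locSubring A.toSubring P := by
  refine adjoin_le_locSubring ?_
  rintro _ ⟨i, rfl⟩
  exact hτ i

/-! ### Germs vanishing on a coordinate subspace -/

variable {τ : Fin 3 → K}

lemma coordIdeal_aeval_mem_mx {O : LocalSubring K} (hO : ∀ i, τ i ∈ O.toSubring)
    (hc : HasConst O) {S : Set (Fin 3)} (hS : ∀ i ∈ S, τ i ∈ mx O) {f : ChartRing}
    (hf : f ∈ coordIdeal S) : MvPolynomial.aeval τ f ∈ mx O := by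
  have hall : ∀ f : ChartRing, MvPolynomial.aeval τ f ∈ O.toSubring := fun f =>
    hc.adjoin_le hO (aeval_mem_adjoin τ f)
  refine Submodule.span_induction ?_ ?_ ?_ ?_ hf
  · rintro _ ⟨i, hi, rfl⟩
    simpa using hS i hi
  · simpa using zero_mem_mx O
  · intro f g _ _ hf hg
    rw [map_add]
    exact add_mem_mx hf hg
  · intro a f _ hf
    rw [smul_eq_mul, map_mul]
    exact mul_mem_mx (hall a) hf

lemma LocOf.le_pt (hτ : IsCoord τ) {O : LocalSubring K}
    (hO : LocOf (Algebra.adjoin ℂ (Set.range τ)).toSubring O) {S : Set (Fin 3)}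
    (hS : ∀ i ∈ S, τ i ∈ mx O) : O.toSubring ≤ (pt hτ (coordIdeal S)).toSubring := by
  intro k hk
  obtain ⟨a, ha, s, hs, h0, h1, rfl⟩ := hO.2 k hk
  obtain ⟨f, rfl⟩ := exists_aeval ha
  obtain ⟨g, rfl⟩ := exists_aeval hs
  exact (mem_pt hτ _).2 ⟨f, g, fun hg => notMem_mx_of_inv_mem h0 h1
    (coordIdeal_aeval_mem_mx (fun i => hO.1 (mem_adjoin_range τ i)) hO.hasConst hS hg), rfl⟩

lemma LocOf.exists_of_mem_mx_pt (hτ : IsCoord τ) {O : LocalSubring K}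
    (hO : LocOf (Algebra.adjoin ℂ (Set.range τ)).toSubring O) {S : Set (Fin 3)}
    {h : K} (hh : h ∈ O.toSubring)
    (hm : h ∈ mx (pt hτ (coordIdeal S))) : ∃ f ∈ coordIdeal S, ∃ s : K, s⁻¹ ∈ O.toSubring ∧
      h = MvPolynomial.aeval τ f / s := by
  obtain ⟨a, ha, s, hs, h0, h1, rfl⟩ := hO.2 h hh
  obtain ⟨f, rfl⟩ := exists_aeval ha
  refine ⟨f, ?_, s, h1, rfl⟩
  rw [← aeval_mem_mx_pt hτ (coordIdeal S)]
  have := mul_mem_mx ((locOf_pt hτ (coordIdeal S)).1 hs) hm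
  rwa [mul_div_cancel₀ _ h0] at this

lemma exists_of_mem_coordIdeal_singleton {i : Fin 3} {f : ChartRing} (hf : f ∈ coordIdeal {i}) :
    ∃ q : ChartRing, f = MvPolynomial.X i * q := mem_coordIdeal_singleton.1 hf

lemma exists_of_mem_coordIdeal_pair {i j : Fin 3} {f : ChartRing} (hf : f ∈ coordIdeal {i, j}) :
    ∃ p q : ChartRing, f = p * MvPolynomial.X i + q * MvPolynomial.X j := by
  rw [coordIdeal, Set.image_pair] at hf
  obtain ⟨p, q, h⟩ := Ideal.mem_span_pair.1 hf
  exact ⟨p, q, h.symm⟩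

/-! ### The charts of the blow up of an ideal with two generators -/

lemma mem_span_of_mem_pow {O : LocalSubring K} {I : Ideal O.toSubring} {p q : K}
    (hI : ∀ h ∈ I, ∃ a ∈ O.toSubring, ∃ b ∈ O.toSubring, (h : K) = a * p + b * q) (n : ℕ) :
    ∀ h ∈ I ^ n, (h : K) ∈ Submodule.span O.toSubring {t : K | ∃ i j, i + j = n ∧ t = p ^ i * q ^ j} := by
  induction n with
  | zero =>
    intro h _
    have : (h : K) = h • (1 : K) := (mul_one _).symm
    rw [this]
    exact Submodule.smul_mem _ _ (Submodule.subset_span ⟨0, 0, rfl, by simp⟩)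
  | succ n ih =>
    intro h hh
    rw [pow_succ] at hh
    refine Submodule.mul_induction_on hh ?_ ?_
    · intro s hs t ht
      obtain ⟨a, ha, b, hb, hab⟩ := hI t ht
      rw [Subring.coe_mul]
      refine Submodule.span_induction (p := fun x _ => x * (t : K) ∈ _) ?_ ?_ ?_ ?_ (ih s hs)
      · rintro _ ⟨i, j, hij, rfl⟩
        have : p ^ i * q ^ j * (t : K) = (⟨a, ha⟩ : O.toSubring) • (p ^ (i + 1) * q ^ j) +
            (⟨b, hb⟩ : O.toSubring) • (p ^ i * q ^ (j + 1)) := by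
          rw [hab]
          change _ = a * _ + b * _
          ring
        rw [this]
        exact Submodule.add_mem _
          (Submodule.smul_mem _ _ (Submodule.subset_span ⟨i + 1, j, by omega, rfl⟩))
          (Submodule.smul_mem _ _ (Submodule.subset_span ⟨i, j + 1, by omega, rfl⟩))
      · simp
      · intro x y _ _ hx hy
        rw [add_mul]
        exact Submodule.add_mem _ hx hy
      · intro c x _ hx
        rw [smul_mul_assoc]
        exact Submodule.smul_mem _ _ hx
    · intro s t hs ht
      exact Submodule.add_mem _ hs ht

/-- The affine coordinates on the chart of the blow up of `p = q = 0` where `p` generates the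
exceptional ideal. -/
def blowCoord (x p q : K) : Fin 3 → K := ![x, p, q / p]

/-- Elements of the `N`-th power of the ideal are `p ^ N` times polynomials in `q / p` over `O`.
Once `p ^ n / g` is regular at `P`, the fractions over powers of `g` lie in the localization of the
coordinate ring. -/
lemma LocOf.blowCoord {O P : LocalSubring K} {I : Ideal O.toSubring} {x p q : K}
    (hO : LocOf (Algebra.adjoin ℂ (Set.range ![x, p, q])).toSubring O)
    (hI : ∀ h ∈ I, ∃ a ∈ O.toSubring, ∃ b ∈ O.toSubring, (h : K) = a * p + b * q)
    {n : ℕ} {g : O.toSubring} (hg : g ∈ I ^ n) (hg0 : g ≠ 0) (hp0 : p ≠ 0)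
    (h : LocOf (projChart (fun n => I ^ n) n g).toSubring P)
    (hgp' : (g : K)⁻¹ * p ^ n ∈ P.toSubring)
    (hqp : q / p ∈ P.toSubring) :
    LocOf (Algebra.adjoin ℂ (Set.range (blowCoord x p q))).toSubring P := by
  have hgk : (g : K) ≠ 0 := fun h => hg0 (Subtype.ext h)
  have hOP : O.toSubring ≤ P.toSubring := (le_projChart (by simp)).trans h.1
  have hm := mem_adjoin_range (Fano.blowCoord x p q)
  set A := Algebra.adjoin ℂ (Set.range (Fano.blowCoord x p q)) with hA
  have hxO : ∀ i, (![x, p, q] : Fin 3 → K) i ∈ O.toSubring := fun i => hO.1 (mem_adjoin_range _ i)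
  have hAP : A.toSubring ≤ P.toSubring := by
    refine HasConst.adjoin_le h.hasConst fun i => ?_
    fin_cases i
    exacts [hOP (hxO 0), hOP (hxO 1), hqp]
  have hqA : q ∈ A.toSubring := by
    have := A.toSubring.mul_mem (hm 1) (hm 2)
    rwa [show Fano.blowCoord x p q 1 * Fano.blowCoord x p q 2 = q from mul_div_cancel₀ _ hp0]
      at this
  have hOA : O.toSubring ≤ locSubring A.toSubring P := by
    intro k hk
    obtain ⟨a, ha, s, hs, h0, h1, rfl⟩ := hO.2 k hk
    have hle : (Algebra.adjoin ℂ (Set.range ![x, p, q])).toSubring ≤ A.toSubring :=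
      adjoin_range_le fun i => by
        fin_cases i
        exacts [hm 0, hm 1, hqA]
    exact ⟨a, hle ha, s, hle hs, h0, hOP h1, rfl⟩
  have hpow : ∀ N, ∀ t ∈ I ^ N, (t : K) / p ^ N ∈ locSubring A.toSubring P := by
    intro N t ht
    refine Submodule.span_induction (p := fun y _ => y / p ^ N ∈ locSubring A.toSubring P)
      ?_ ?_ ?_ ?_ (mem_span_of_mem_pow hI N t ht)
    · rintro _ ⟨i, j, rfl, rfl⟩
      have : p ^ i * q ^ j / p ^ (i + j) = (q / p) ^ j := by
        rw [pow_add, div_pow]; field_simp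
      rw [this]
      exact le_locSubring _ _ (A.toSubring.pow_mem (hm 2) j)
    · simp [Subring.zero_mem]
    · intro y z _ _ hy hz
      rw [add_div]
      exact Subring.add_mem _ hy hz
    · intro c y _ hy
      change (c : K) * y / p ^ N ∈ _
      rw [mul_div_assoc]
      exact Subring.mul_mem _ (hOA c.2) hy
  refine h.of_le hAP (adjoin_le_locSubring ?_)
  rintro _ ⟨k, t, ht, rfl⟩
  have h1 : ((g : K) / p ^ n)⁻¹ ∈ locSubring A.toSubring P := by
    refine inv_mem_locSubring' (hpow n g hg) ?_
    rwa [inv_div, div_eq_inv_mul]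
  have h2 : (t : K) / g ^ k = t / p ^ (n * k) * (((g : K) / p ^ n)⁻¹) ^ k := by
    rw [pow_mul, inv_div, div_pow]
    field_simp
  rw [h2]
  simp only [← pow_mul] at ht
  exact Subring.mul_mem _ (hpow _ t (by rwa [pow_mul] at ht ⊢)) (Subring.pow_mem _ h1 k)

end Blowup

end Fano
end

noncomputable section

namespace Fano

/-! ### Equations of `C` and coordinates on its blow up. -/

section CurveCoord

variable {K : Type*} [Field K] [Algebra ℂ K] {ξ : Fin 3 → K}

/-- The equations `z = x` of the surface `E₁` and `x = y` of the surface `R`; together they define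
the curve `C`. -/
def uu (ξ : Fin 3 → K) : K := ξ 2 - ξ 0
def rr (ξ : Fin 3 → K) : K := ξ 0 - ξ 1

def curveCoord (ξ : Fin 3 → K) : Fin 3 → K := ![ξ 0, uu ξ, rr ξ]
-- The other order serves the chart of the blow up in which `r` generates the exceptional ideal.
def curveCoord' (ξ : Fin 3 → K) : Fin 3 → K := ![ξ 0, rr ξ, uu ξ]

lemma adjoin_curveCoord (ξ : Fin 3 → K) :
    Algebra.adjoin ℂ (Set.range (curveCoord ξ)) = Algebra.adjoin ℂ (Set.range ξ) := by
  apply le_antisymm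
  · refine adjoin_range_le (A := Algebra.adjoin ℂ (Set.range ξ)) fun i => ?_
    have h := mem_adjoin_range ξ
    fin_cases i
    exacts [h 0, Subring.sub_mem _ (h 2) (h 0), Subring.sub_mem _ (h 0) (h 1)]
  · refine adjoin_range_le (A := Algebra.adjoin ℂ (Set.range (curveCoord ξ))) fun i => ?_
    have h := mem_adjoin_range (curveCoord ξ)
    have h1 := Subring.sub_mem _ (h 0) (h 2)
    have h2 := Subring.add_mem _ (h 0) (h 1)
    fin_cases i
    · exact h 0
    · rwa [show curveCoord ξ 0 - curveCoord ξ 2 = ξ 1 by simp [curveCoord, rr]] at h1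
    · rwa [show curveCoord ξ 0 + curveCoord ξ 1 = ξ 2 by simp [curveCoord, uu]] at h2

lemma adjoin_curveCoord' (ξ : Fin 3 → K) :
    Algebra.adjoin ℂ (Set.range (curveCoord' ξ)) = Algebra.adjoin ℂ (Set.range ξ) := by
  rw [← adjoin_curveCoord ξ]
  congr 1
  ext k
  simp only [Set.mem_range, Fin.exists_fin_succ, Fin.succ_zero_eq_one, curveCoord, curveCoord',
    Matrix.cons_val, IsEmpty.exists_iff, or_false]
  simp only [Fin.succ_one_eq_two, Matrix.cons_val]
  tauto

lemma mem_field_of_mem_adjoin {τ : Fin 3 → K} {k : K} (h : k ∈ Algebra.adjoin ℂ (Set.range τ)) :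
    k ∈ IntermediateField.adjoin ℂ (Set.range τ) :=
  IntermediateField.algebra_adjoin_le_adjoin ℂ _ h

lemma IsCoord.curve (hξ : IsCoord ξ) : IsCoord (curveCoord ξ) :=
  hξ.of_mem fun i => mem_field_of_mem_adjoin (by
    rw [adjoin_curveCoord]; exact Algebra.subset_adjoin ⟨i, rfl⟩)

lemma IsCoord.uu_ne_zero (hξ : IsCoord ξ) : uu ξ ≠ 0 := hξ.curve.ne_zero 1
lemma IsCoord.rr_ne_zero (hξ : IsCoord ξ) : rr ξ ≠ 0 := hξ.curve.ne_zero 2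

/-- The coordinates on the two charts of the blow up of `C`. -/
def blowE (ξ : Fin 3 → K) : Fin 3 → K := blowCoord (ξ 0) (uu ξ) (rr ξ)
def blowR (ξ : Fin 3 → K) : Fin 3 → K := blowCoord (ξ 0) (rr ξ) (uu ξ)

lemma blowE_eq : blowE ξ = ![ξ 0, uu ξ, rr ξ / uu ξ] := rfl

lemma IsCoord.blowE (hξ : IsCoord ξ) : IsCoord (blowE ξ) := by
  have hm := coord_mem_adjoin (Fano.blowE ξ)
  refine hξ.curve.of_mem fun i => ?_
  fin_cases i
  · exact hm 0
  · exact hm 1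
  · have := mul_mem (hm 1) (hm 2)
    rwa [show Fano.blowE ξ 1 * Fano.blowE ξ 2 = rr ξ from mul_div_cancel₀ _ hξ.uu_ne_zero] at this

lemma mem_of_blowE {A : Subring K} (hξ : IsCoord ξ) (h : ∀ i, blowE ξ i ∈ A) :
    (∀ i, ξ i ∈ A) ∧ uu ξ ∈ A ∧ rr ξ ∈ A := by
  have h0 : ξ 0 ∈ A := h 0
  have h1 : uu ξ ∈ A := h 1
  have h2 : rr ξ ∈ A := by
    have := A.mul_mem (h 1) (h 2)
    rwa [show blowE ξ 1 * blowE ξ 2 = rr ξ from mul_div_cancel₀ _ hξ.uu_ne_zero] at this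
  refine ⟨fun i => ?_, h1, h2⟩
  fin_cases i
  · exact h0
  · simpa [rr] using A.sub_mem h0 h2
  · simpa [uu] using A.add_mem h1 h0

lemma mem_of_blowR {A : Subring K} (hξ : IsCoord ξ) (h : ∀ i, blowR ξ i ∈ A) :
    (∀ i, ξ i ∈ A) ∧ uu ξ ∈ A ∧ rr ξ ∈ A := by
  have h0 : ξ 0 ∈ A := h 0
  have h2 : rr ξ ∈ A := h 1
  have h1 : uu ξ ∈ A := by
    have := A.mul_mem (h 1) (h 2)
    rwa [show blowR ξ 1 * blowR ξ 2 = uu ξ from mul_div_cancel₀ _ hξ.rr_ne_zero] at this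
  refine ⟨fun i => ?_, h1, h2⟩
  fin_cases i
  · exact h0
  · simpa [rr] using A.sub_mem h0 h2
  · simpa [uu] using A.add_mem h1 h0

/-- Where the exceptional ideal is trivial, the blow up of `C` is an isomorphism. -/
lemma LocOf.of_blowE (hξ : IsCoord ξ) {Q : LocalSubring K}
    (h : LocOf (Algebra.adjoin ℂ (Set.range (blowE ξ))).toSubring Q) (hu : uu ξ ∉ mx Q) :
    LocOf (Algebra.adjoin ℂ (Set.range ξ)).toSubring Q := by
  have hQ := mem_of_blowE hξ (fun i => h.1 (mem_adjoin_range (blowE ξ) i))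
  rw [← adjoin_curveCoord]
  have hm := mem_adjoin_range (curveCoord ξ)
  refine h.of_le (h.hasConst.adjoin_le fun i => ?_) (adjoin_range_le_locSubring fun i => ?_)
  · fin_cases i
    exacts [hQ.1 0, hQ.2.1, hQ.2.2]
  · fin_cases i
    · exact le_locSubring _ _ (hm 0)
    · exact le_locSubring _ _ (hm 1)
    · exact div_mem_locSubring (hm 2) (hm 1) hξ.uu_ne_zero (inv_mem_of_notMem_mx hQ.2.1 hu)

lemma LocOf.of_blowR (hξ : IsCoord ξ) {Q : LocalSubring K}
    (h : LocOf (Algebra.adjoin ℂ (Set.range (blowR ξ))).toSubring Q) (hu : rr ξ ∉ mx Q) :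
    LocOf (Algebra.adjoin ℂ (Set.range ξ)).toSubring Q := by
  have hQ := mem_of_blowR hξ (fun i => h.1 (mem_adjoin_range (blowR ξ) i))
  rw [← adjoin_curveCoord]
  have hm := mem_adjoin_range (curveCoord ξ)
  refine h.of_le (h.hasConst.adjoin_le fun i => ?_) (adjoin_range_le_locSubring fun i => ?_)
  · fin_cases i
    exacts [hQ.1 0, hQ.2.1, hQ.2.2]
  · fin_cases i
    · exact le_locSubring _ _ (hm 0)
    · exact le_locSubring _ _ (hm 2)
    · exact div_mem_locSubring (hm 1) (hm 2) hξ.rr_ne_zero (inv_mem_of_notMem_mx hQ.2.2 hu)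

end CurveCoord

/-! ### The blow up of `C` -/

/-- The two affine charts of `X` that cover `C`. -/
def IsChart (ξ : Fin 3 → FunctionField) : Prop := ξ = xi ∨ ξ = invCoord xi

section

variable {ξ : Fin 3 → FunctionField} {O P Q : LocalSubring FunctionField}

lemma IsChart.isCoord (h : IsChart ξ) : IsCoord ξ := by
  rcases h with rfl | rfl
  exacts [isCoord_xi, isCoord_xi.inv]

lemma IsChart.mem_X (h : IsChart ξ) : P ∈ X.points ↔ IsX ξ P := by
  rcases h with rfl | rfl
  · exact Fano.mem_X
  · rw [isX_invCoord isCoord_xi, Fano.mem_X]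

lemma IsChart.mem_C (h : IsChart ξ) : P ∈ C ↔ IsC ξ P := by
  rcases h with rfl | rfl
  · exact Fano.mem_C
  · rw [isC_invCoord isCoord_xi, Fano.mem_C]

lemma IsChart.mem_R (h : IsChart ξ) : P ∈ R ↔ IsR ξ P := by
  rcases h with rfl | rfl
  · exact Fano.mem_R
  · rw [isR_invCoord isCoord_xi, Fano.mem_R]

lemma exists_isChart (h : P ∈ C) : ∃ ξ, IsChart ξ ∧ ∀ i, ξ i ∈ P.toSubring := by
  rcases (mem_C.1 h).coord_mem isCoord_xi with h | h
  exacts [⟨_, Or.inl rfl, h⟩, ⟨_, Or.inr rfl, h⟩]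

lemma IsChart.mem_C_iff (h : IsChart ξ) (hP : P ∈ X.points) (hc : ∀ i, ξ i ∈ P.toSubring) :
    P ∈ C ↔ uu ξ ∈ mx P ∧ rr ξ ∈ mx P :=
  ⟨fun hC => (h.mem_C.1 hC).mem_mx h.isCoord hc,
    fun hC => h.mem_C.2 ((h.mem_X.1 hP).isC_of_mem_mx h.isCoord hc hC.1 hC.2)⟩

lemma mem_X_of_mem_C (h : P ∈ C) : P ∈ X.points := h.1.1

lemma IsChart.mem_X_of_locOf (h : IsChart ξ)
    (hP : LocOf (Algebra.adjoin ℂ (Set.range ξ)).toSubring P) : P ∈ X.points :=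
  h.mem_X.2 (isX_of_locOf hP)

lemma IsChart.locOf (h : IsChart ξ) (hP : P ∈ X.points) (hc : ∀ i, ξ i ∈ P.toSubring) :
    LocOf (Algebra.adjoin ℂ (Set.range ξ)).toSubring P := (h.mem_X.1 hP).locOf_adjoin h.isCoord hc

/-- The generic point of `C`. -/
def curvePt (hξ : IsCoord ξ) : LocalSubring FunctionField := pt hξ.curve (coordIdeal {1, 2})

lemma X_mem_coordIdeal {S : Set (Fin 3)} {i : Fin 3} (hi : i ∈ S) :
    (MvPolynomial.X i : ChartRing) ∈ coordIdeal S := Ideal.subset_span ⟨i, hi, rfl⟩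

lemma coord_mem_mx_pt {K : Type*} [Field K] [Algebra ℂ K] {τ : Fin 3 → K} (hτ : IsCoord τ)
    {S : Set (Fin 3)} {i : Fin 3} (hi : i ∈ S) : τ i ∈ mx (pt hτ (coordIdeal S)) := by
  have := (aeval_mem_mx_pt hτ (coordIdeal S)).2 (X_mem_coordIdeal hi)
  rwa [MvPolynomial.aeval_X] at this

lemma locOf_curvePt (hξ : IsCoord ξ) :
    LocOf (Algebra.adjoin ℂ (Set.range ξ)).toSubring (curvePt hξ) := by
  rw [← adjoin_curveCoord]
  exact locOf_pt _ _

lemma IsChart.curvePt_mem (h : IsChart ξ) : curvePt h.isCoord ∈ C := by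
  have hl := locOf_curvePt h.isCoord
  exact (h.mem_C_iff (h.mem_X_of_locOf hl) fun i => hl.1 (mem_adjoin_range ξ i)).2
    ⟨coord_mem_mx_pt (i := 1) _ (by simp), coord_mem_mx_pt (i := 2) _ (by simp)⟩

/-- Vanishing at the generic point of `C` alone already puts a germ into the ideal `(u, r)`, after
clearing a denominator that is a unit at `O`. -/
lemma IsChart.exists_of_mem_vanishingIdeal (h : IsChart ξ) (hO : O ∈ C)
    (hc : ∀ i, ξ i ∈ O.toSubring) {k : O.toSubring} (hk : k ∈ vanishingIdeal C O) :
    ∃ a ∈ O.toSubring, ∃ b ∈ O.toSubring, (k : FunctionField) = a * uu ξ + b * rr ξ := by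
  have hl := h.locOf (mem_X_of_mem_C hO) hc
  rw [← adjoin_curveCoord] at hl
  obtain ⟨hu, hr⟩ := (h.mem_C_iff (mem_X_of_mem_C hO) hc).1 hO
  have hle : O.toSubring ≤ (curvePt h.isCoord).toSubring :=
    hl.le_pt h.isCoord.curve (by
      rintro i (rfl | rfl)
      exacts [hu, hr])
  obtain ⟨f, hf, s, hs, hk'⟩ := hl.exists_of_mem_mx_pt h.isCoord.curve k.2
    ((mem_vanishingIdeal k).1 hk _ h.curvePt_mem hle)
  obtain ⟨p, q, rfl⟩ := exists_of_mem_coordIdeal_pair hf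
  refine ⟨_, div_mem_of_inv_mem (hl.1 (aeval_mem_adjoin _ p)) hs, _,
    div_mem_of_inv_mem (hl.1 (aeval_mem_adjoin _ q)) hs, ?_⟩
  rw [hk', map_add, map_mul, map_mul, MvPolynomial.aeval_X, MvPolynomial.aeval_X]
  change (_ * uu ξ + _ * rr ξ) / s = _
  ring

lemma IsChart.mem_vanishingIdeal_C (h : IsChart ξ) (hO : O ∈ C) (hc : ∀ i, ξ i ∈ O.toSubring) :
    (∃ k ∈ vanishingIdeal C O, (k : FunctionField) = uu ξ) ∧
      ∃ k ∈ vanishingIdeal C O, (k : FunctionField) = rr ξ := by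
  obtain ⟨hu, hr⟩ := (h.mem_C_iff (mem_X_of_mem_C hO) hc).1 hO
  refine ⟨⟨⟨_, hu.1⟩, (mem_vanishingIdeal _).2 fun P hP hOP => ?_, rfl⟩,
    ⟨⟨_, hr.1⟩, (mem_vanishingIdeal _).2 fun P hP hOP => ?_, rfl⟩⟩
  · exact ((h.mem_C_iff (mem_X_of_mem_C hP) fun i => hOP (hc i)).1 hP).1
  · exact ((h.mem_C_iff (mem_X_of_mem_C hP) fun i => hOP (hc i)).1 hP).2

lemma mem_C_of_le (hO : O ∈ X.points) (hP : P ∈ C) (hOP : O.toSubring ≤ P.toSubring) : O ∈ C :=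
  mem_C.2 (IsC.of_le isCoord_xi (mem_X.1 hO) (mem_C.1 hP) hOP)

lemma vanishingIdeal_C_eq_top (hO : O ∈ X.points) (hC : O ∉ C) : vanishingIdeal C O = ⊤ :=
  vanishingIdeal_eq_top fun _ hP hOP => hC (mem_C_of_le hO hP hOP)

lemma mem_Xtilde_of_notMem_C (hO : O ∈ X.points) (hC : O ∉ C) : O ∈ Xtilde.points :=
  mem_proj_of_eq_top hO one_pos (by simp) (by simp [vanishingIdeal_C_eq_top hO hC])

lemma HasConst.of_mem_X (hO : O ∈ X.points) : HasConst O := X.algebraMap_mem O hO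

/-- The affine charts of the blow up of `C` along its exceptional surface. -/
lemma IsChart.locOf_blow (h : IsChart ξ) (hO : O ∈ C) (hc : ∀ i, ξ i ∈ O.toSubring) {n : ℕ}
    {g : O.toSubring} (hg : g ∈ vanishingIdeal C O ^ n) (hg0 : g ≠ 0)
    (hQ : LocOf (projChart (fun n => vanishingIdeal C O ^ n) n g).toSubring Q) :
    (rr ξ / uu ξ ∈ Q.toSubring →
      LocOf (Algebra.adjoin ℂ (Set.range (blowE ξ))).toSubring Q) ∧
    (uu ξ / rr ξ ∈ Q.toSubring →
      LocOf (Algebra.adjoin ℂ (Set.range (blowR ξ))).toSubring Q) := by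
  have hl := h.locOf (mem_X_of_mem_C hO) hc
  obtain ⟨⟨u, hu, hu'⟩, ⟨r, hr, hr'⟩⟩ := h.mem_vanishingIdeal_C hO hc
  constructor
  · intro hq
    refine LocOf.blowCoord (by rwa [← adjoin_curveCoord] at hl)
      (fun k hk => h.exists_of_mem_vanishingIdeal hO hc hk) hg hg0 h.isCoord.uu_ne_zero hQ ?_ hq
    have := hQ.1 (div_mem_projChart (I := fun n => vanishingIdeal C O ^ n) (g := g)
      (Ideal.pow_mem_pow hu n))
    rwa [SubmonoidClass.coe_pow, hu', div_eq_inv_mul] at this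
  · intro hq
    refine LocOf.blowCoord (by rwa [← adjoin_curveCoord'] at hl)
      (fun k hk => ?_) hg hg0 h.isCoord.rr_ne_zero hQ ?_ hq
    · obtain ⟨a, ha, b, hb, hab⟩ := h.exists_of_mem_vanishingIdeal hO hc hk
      exact ⟨b, hb, a, ha, by rw [hab, add_comm]⟩
    have := hQ.1 (div_mem_projChart (I := fun n => vanishingIdeal C O ^ n) (g := g)
      (Ideal.pow_mem_pow hr n))
    rwa [SubmonoidClass.coe_pow, hr', div_eq_inv_mul] at this

/-- On the blow up of `C`, one of the two equations of `C` divides the other. -/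
lemma IsChart.div_mem_or (h : IsChart ξ) (hO : O ∈ C) (hc : ∀ i, ξ i ∈ O.toSubring) {n : ℕ}
    (hn : 0 < n) {g : O.toSubring} (hg : g ∈ vanishingIdeal C O ^ n) (hg0 : g ≠ 0)
    (hQ : LocOf (projChart (fun n => vanishingIdeal C O ^ n) n g).toSubring Q) :
    rr ξ / uu ξ ∈ Q.toSubring ∨ uu ξ / rr ξ ∈ Q.toSubring := by
  have hgk : (g : FunctionField) ≠ 0 := fun h => hg0 (Subtype.ext h)
  have hu0 := h.isCoord.uu_ne_zero
  have hr0 := h.isCoord.rr_ne_zero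
  obtain ⟨⟨u, hu, hu'⟩, ⟨r, hr, hr'⟩⟩ := h.mem_vanishingIdeal_C hO hc
  have hmem : ∀ i j, i + j = n → uu ξ ^ i * rr ξ ^ j / g ∈ Q.toSubring := by
    rintro i j rfl
    have := hQ.1 (div_mem_projChart (I := fun n => vanishingIdeal C O ^ n) (g := g) (h := u ^ i * r ^ j)
      (by rw [pow_add]; exact Ideal.mul_mem_mul (Ideal.pow_mem_pow hu i) (Ideal.pow_mem_pow hr j)))
    rwa [Subring.coe_mul, SubmonoidClass.coe_pow, SubmonoidClass.coe_pow, hu', hr'] at this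
  -- Otherwise `g / g = 1`, a combination of these quotients over `O`, would be a nonunit.
  have hex : ∃ i j, i + j = n ∧ uu ξ ^ i * rr ξ ^ j / g ∉ mx Q := by
    by_contra! hcon
    have hOQ : O.toSubring ≤ Q.toSubring := (le_projChart (by simp)).trans hQ.1
    have : (g : FunctionField) / g ∈ mx Q := by
      refine Submodule.span_induction (p := fun y _ => y / (g : FunctionField) ∈ mx Q)
        ?_ ?_ ?_ ?_ (mem_span_of_mem_pow
          (fun k hk => h.exists_of_mem_vanishingIdeal hO hc hk) n g hg)
      · rintro _ ⟨i, j, hij, rfl⟩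
        exact hcon i j hij
      · simpa using zero_mem_mx Q
      · intro y z _ _ hy hz
        rw [add_div]
        exact add_mem_mx hy hz
      · intro c y _ hy
        change (c : FunctionField) * y / g ∈ _
        rw [mul_div_assoc]
        exact mul_mem_mx (hOQ c.2) hy
    rw [div_self hgk] at this
    exact one_notMem_mx Q this
  obtain ⟨i, j, hij, hunit⟩ := hex
  have hinv := inv_mem_of_notMem_mx (hmem i j hij) hunit
  -- Trading one factor of the invertible monomial for the other variable produces the wanted ratio.
  cases i with
  | zero =>
    right
    obtain ⟨j, rfl⟩ : ∃ k, j = k + 1 := ⟨j - 1, by omega⟩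
    have := Q.toSubring.mul_mem (hmem 1 j (by omega)) hinv
    convert this using 1
    field_simp
    ring
  | succ i =>
    left
    have := Q.toSubring.mul_mem (hmem i (j + 1) (by omega)) hinv
    convert this using 1
    field_simp
    ring

/-- The points of the exceptional surface, by charts. -/
def IsE (ξ : Fin 3 → FunctionField) (Q : LocalSubring FunctionField) : Prop :=
  (LocOf (Algebra.adjoin ℂ (Set.range (blowE ξ))).toSubring Q ∧ uu ξ ∈ mx Q) ∨
    (LocOf (Algebra.adjoin ℂ (Set.range (blowR ξ))).toSubring Q ∧ rr ξ ∈ mx Q)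

lemma IsE.mem (hξ : IsCoord ξ) (h : IsE ξ Q) :
    (∀ i, ξ i ∈ Q.toSubring) ∧ uu ξ ∈ mx Q ∧ rr ξ ∈ mx Q ∧ HasConst Q := by
  rcases h with ⟨h, hm⟩ | ⟨h, hm⟩
  · have h1 := fun i => h.1 (mem_adjoin_range (blowE ξ) i)
    refine ⟨(mem_of_blowE hξ h1).1, hm, ?_, h.hasConst⟩
    have := mul_mem_mx' hm (h1 2)
    rwa [show uu ξ * blowE ξ 2 = rr ξ from mul_div_cancel₀ _ hξ.uu_ne_zero] at this
  · have h1 := fun i => h.1 (mem_adjoin_range (blowR ξ) i)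
    refine ⟨(mem_of_blowR hξ h1).1, ?_, hm, h.hasConst⟩
    have := mul_mem_mx' hm (h1 2)
    rwa [show rr ξ * blowR ξ 2 = uu ξ from mul_div_cancel₀ _ hξ.rr_ne_zero] at this

/-- At a point of `X` where `u` and `r` both vanish they are independent coordinates, so neither of
their ratios is regular. -/
lemma IsE.notMem_X (hχ : IsChart ξ) (h : IsE ξ Q) : Q ∉ X.points := by
  intro hX
  have hm := h.mem hχ.isCoord
  have hl := hχ.locOf hX hm.1
  rcases h with ⟨h, -⟩ | ⟨h, -⟩
  · rw [← adjoin_curveCoord] at hl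
    refine hχ.isCoord.curve.div_notMem hl (i := 1) (j := 2) (by decide) hm.2.1 one_ne_zero 1 ?_
    rw [pow_one, pow_one]
    exact h.1 (mem_adjoin_range (blowE ξ) 2)
  · rw [← adjoin_curveCoord] at hl
    refine hχ.isCoord.curve.div_notMem hl (i := 2) (j := 1) (by decide) hm.2.2.1 one_ne_zero 1 ?_
    rw [pow_one, pow_one]
    exact h.1 (mem_adjoin_range (blowR ξ) 2)

/-- A point of the exceptional surface lies over a point of `C`. -/
lemma IsE.exists_center (hχ : IsChart ξ) (h : IsE ξ Q) : ∃ O ∈ C, O ≤ Q ∧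
    ∃ g ∈ vanishingIdeal C O, g ≠ 0 ∧
      LocOf (projChart (fun n => vanishingIdeal C O ^ n) 1 g).toSubring Q := by
  obtain ⟨hc, hu, hr, hconst⟩ := h.mem hχ.isCoord
  have hle := hconst.adjoin_le hc
  set O := center _ Q hle with hO
  have hOQ : O ≤ Q := center_le hle
  have hl : LocOf _ O := locOf_center hle
  have hX := hχ.mem_X_of_locOf hl
  have hcO : ∀ i, ξ i ∈ O.toSubring := fun i => hl.1 (mem_adjoin_range ξ i)
  have huO : uu ξ ∈ O.toSubring := Subring.sub_mem _ (hcO 2) (hcO 0)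
  have hrO : rr ξ ∈ O.toSubring := Subring.sub_mem _ (hcO 0) (hcO 1)
  have hC : O ∈ C := (hχ.mem_C_iff hX hcO).2
    ⟨mem_mx_of_dominated hOQ huO hu, mem_mx_of_dominated hOQ hrO hr⟩
  refine ⟨O, hC, hOQ, ?_⟩
  obtain ⟨⟨u, huI, hu'⟩, ⟨r, hrI, hr'⟩⟩ := hχ.mem_vanishingIdeal_C hC hcO
  have hOle := (domination_iff.1 hOQ).1
  have hu0 := hχ.isCoord.uu_ne_zero
  have hr0 := hχ.isCoord.rr_ne_zero
  have hspan : ∀ (g : FunctionField), uu ξ / g ∈ Q.toSubring → rr ξ / g ∈ Q.toSubring →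
      ∀ k, ∀ t ∈ vanishingIdeal C O ^ k, (t : FunctionField) / g ^ k ∈ Q.toSubring := by
    intro g h1 h2 k t ht
    refine Submodule.span_induction (p := fun y _ => y / g ^ k ∈ Q.toSubring)
        ?_ ?_ ?_ ?_ (mem_span_of_mem_pow
          (fun k hk => hχ.exists_of_mem_vanishingIdeal hC hcO hk) k t ht)
    · rintro _ ⟨i, j, rfl, rfl⟩
      rw [pow_add, mul_div_mul_comm, ← div_pow, ← div_pow]
      exact Subring.mul_mem _ (Subring.pow_mem _ h1 i) (Subring.pow_mem _ h2 j)
    · simp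
    · intro y z _ _ hy hz
      rw [add_div]
      exact Subring.add_mem _ hy hz
    · intro c y _ hy
      change (c : FunctionField) * y / g ^ k ∈ _
      rw [mul_div_assoc]
      exact Subring.mul_mem _ (hOle c.2) hy
  have hOl : ∀ g : O.toSubring, O.toSubring ≤
      (projChart (fun n => vanishingIdeal C O ^ n) 1 g).toSubring :=
    fun g => le_projChart (by simp)
  rcases h with ⟨h, -⟩ | ⟨h, -⟩
  · have h2 : rr ξ / uu ξ ∈ Q.toSubring := h.1 (mem_adjoin_range (blowE ξ) 2)
    refine ⟨u, huI, fun h0 => hu0 (by rw [← hu', h0]; rfl), h.mono (adjoin_range_le fun i => ?_)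
      (projChart_le hconst fun k t ht => ?_)⟩
    · fin_cases i
      · exact hOl u (hcO 0)
      · exact hOl u huO
      · have := div_mem_projChart (I := fun n => vanishingIdeal C O ^ n) (n := 1) (g := u) (h := r)
          (by simpa using hrI)
        rwa [hu', hr'] at this
    · rw [hu']
      exact hspan _ (by simp [hu0]) h2 k t (by simpa using ht)
  · have h2 : uu ξ / rr ξ ∈ Q.toSubring := h.1 (mem_adjoin_range (blowR ξ) 2)
    refine ⟨r, hrI, fun h0 => hr0 (by rw [← hr', h0]; rfl), h.mono (adjoin_range_le fun i => ?_)
      (projChart_le hconst fun k t ht => ?_)⟩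
    · fin_cases i
      · exact hOl r (hcO 0)
      · exact hOl r hrO
      · have := div_mem_projChart (I := fun n => vanishingIdeal C O ^ n) (n := 1) (g := r) (h := u)
          (by simpa using huI)
        rwa [hu', hr'] at this
    · rw [hr']
      exact hspan _ h2 (by simp [hr0]) k t (by simpa using ht)

lemma IsE.mem_Xtilde (hχ : IsChart ξ) (h : IsE ξ Q) : Q ∈ Xtilde.points := by
  obtain ⟨O, hO, -, g, hg, hg0, hl⟩ := h.exists_center hχ
  exact mem_proj.2 ⟨O, mem_X_of_mem_C hO, 1, one_pos, g, by simpa using hg, hg0, hl⟩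

lemma IsE.mem_E (hχ : IsChart ξ) (h : IsE ξ Q) : Q ∈ E := ⟨h.mem_Xtilde hχ, h.notMem_X hχ⟩

/-- The points of the blow up of `C`. -/
lemma mem_Xtilde_cases (hQ : Q ∈ Xtilde.points) :
    (Q ∈ X.points ∧ Q ∉ C) ∨ ∃ ξ, IsChart ξ ∧ IsE ξ Q := by
  obtain ⟨O, hO, n, hn, g, hg, hg0, hl⟩ := mem_proj.1 hQ
  by_cases hC : O ∈ C
  · obtain ⟨ξ, hχ, hc⟩ := exists_isChart hC
    have key : ∀ {τ : LocOf (Algebra.adjoin ℂ (Set.range ξ)).toSubring Q}, ¬ (uu ξ ∈ mx Q ∧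
        rr ξ ∈ mx Q) → Q ∈ X.points ∧ Q ∉ C := by
      intro hQ hne
      have hX := hχ.mem_X_of_locOf hQ
      exact ⟨hX, fun hC => hne ((hχ.mem_C_iff hX fun i => hQ.1 (mem_adjoin_range ξ i)).1 hC)⟩
    rcases hχ.div_mem_or hC hc hn hg hg0 hl with h | h
    · have h1 := (hχ.locOf_blow hC hc hg hg0 hl).1 h
      by_cases hu : uu ξ ∈ mx Q
      · exact Or.inr ⟨ξ, hχ, Or.inl ⟨h1, hu⟩⟩
      · exact Or.inl (key (τ := h1.of_blowE hχ.isCoord hu) fun h => hu h.1)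
    · have h1 := (hχ.locOf_blow hC hc hg hg0 hl).2 h
      by_cases hu : rr ξ ∈ mx Q
      · exact Or.inr ⟨ξ, hχ, Or.inr ⟨h1, hu⟩⟩
      · exact Or.inl (key (τ := h1.of_blowR hχ.isCoord hu) fun h => hu h.2)
  · left
    have hI := vanishingIdeal_C_eq_top hO hC
    have hginv : (g : FunctionField)⁻¹ ∈ Q.toSubring := by
      have := hl.1 (div_mem_projChart (I := fun n => vanishingIdeal C O ^ n) (n := n) (g := g)
        (h := 1) (by simp [hI, Ideal.top_pow]))
      simpa using this
    have hOQ := hl.of_projChart (HasConst.of_mem_X hO) (by simp) hg0 hginv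
    have hX : Q ∈ X.points := ofCharts_of_locOf hO hOQ
    exact ⟨hX, fun hQC => hC (mem_C_of_le hO hQC hOQ.1)⟩

lemma exists_isE_of_mem_E (hQ : Q ∈ E) : ∃ ξ, IsChart ξ ∧ IsE ξ Q :=
  (mem_Xtilde_cases hQ.1).resolve_left fun h => hQ.2 h.1

lemma notMem_C_of_mem_Xtilde (hQ : Q ∈ Xtilde.points) (hX : Q ∈ X.points) : Q ∉ C := by
  rcases mem_Xtilde_cases hQ with h | ⟨ξ, hχ, h⟩
  · exact h.2
  · exact absurd hX (h.notMem_X hχ)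

lemma exists_center_of_mem_E (hQ : Q ∈ E) : ∃ O ∈ C, O ≤ Q ∧ ∃ g ∈ vanishingIdeal C O, g ≠ 0 ∧
    LocOf (projChart (fun n => vanishingIdeal C O ^ n) 1 g).toSubring Q := by
  obtain ⟨ξ, hχ, h⟩ := exists_isE_of_mem_E hQ
  exact h.exists_center hχ

lemma IsChart.mem_of_dominated (h : IsChart ξ) (hO : O ∈ X.points) (hOQ : O ≤ Q)
    (hQ : ∀ i, ξ i ∈ Q.toSubring) : ∀ i, ξ i ∈ O.toSubring :=
  (h.mem_X.1 hO).coord_mem_of_dominated h.isCoord hOQ hQ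

lemma IsChart.mem_mx_of_mem_E (h : IsChart ξ) (hQ : Q ∈ E) (hc : ∀ i, ξ i ∈ Q.toSubring) :
    uu ξ ∈ mx Q ∧ rr ξ ∈ mx Q := by
  obtain ⟨O, hO, hOQ, -⟩ := exists_center_of_mem_E hQ
  have hX := mem_X_of_mem_C hO
  have := (h.mem_C_iff hX (h.mem_of_dominated hX hOQ hc)).1 hO
  exact ⟨(domination_iff.1 hOQ).2 this.1, (domination_iff.1 hOQ).2 this.2⟩

lemma IsChart.locOf_blowE (h : IsChart ξ) (hQ : Q ∈ E) (hc : ∀ i, blowE ξ i ∈ Q.toSubring) :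
    LocOf (Algebra.adjoin ℂ (Set.range (blowE ξ))).toSubring Q := by
  obtain ⟨O, hO, hOQ, g, hg, hg0, hl⟩ := exists_center_of_mem_E hQ
  have hX := mem_X_of_mem_C hO
  refine (h.locOf_blow hO (h.mem_of_dominated hX hOQ (mem_of_blowE h.isCoord hc).1)
    (n := 1) (by simpa using hg) hg0 hl).1 (hc 2)

/-- The exceptional surface is closed. -/
lemma notMem_X_of_le (hO : O ∈ Xtilde.points) (hP : P ∈ E) (hOP : O.toSubring ≤ P.toSubring) :
    O ∉ X.points := by
  intro hX
  obtain ⟨P0, hP0, hle, -⟩ := exists_center_of_mem_E hP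
  have h1 : center O.toSubring P hOP ∈ X.points := ofCharts_of_locOf hX (locOf_center hOP)
  have h2 := (mem_X.1 h1).eq_of_dominated isCoord_xi (mem_X.1 (mem_X_of_mem_C hP0))
    (center_le hOP) hle
  exact notMem_C_of_mem_Xtilde hO hX (mem_C_of_le hX hP0 (h2 ▸ (locOf_center hOP).1))

end

end Fano
end

noncomputable section

namespace Fano

/-! ### Weighted ideals -/

section WeightedIdeal

variable {A : Type*} [CommRing A] {I J : Ideal A} {a b : ℕ}

lemma pow_mul_pow_le_weightedIdeal {i j n : ℕ} (h : n ≤ a * i + b * j) :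
    I ^ i * J ^ j ≤ weightedIdeal I J a b n :=
  le_iSup_of_le i (le_iSup_of_le j (le_iSup_of_le h le_rfl))

lemma weightedIdeal_le {n : ℕ} {L : Ideal A} (h : ∀ i j, n ≤ a * i + b * j → I ^ i * J ^ j ≤ L) :
    weightedIdeal I J a b n ≤ L := iSup_le fun i => iSup_le fun j => iSup_le fun hij => h i j hij

lemma weightedIdeal_zero : weightedIdeal I J a b 0 = ⊤ := by
  rw [eq_top_iff]
  refine le_trans ?_ (pow_mul_pow_le_weightedIdeal (i := 0) (j := 0) (Nat.zero_le _))
  simp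

lemma weightedIdeal_anti {m n : ℕ} (h : n ≤ m) :
    weightedIdeal I J a b m ≤ weightedIdeal I J a b n :=
  weightedIdeal_le fun _ _ hij => pow_mul_pow_le_weightedIdeal (h.trans hij)

lemma weightedIdeal_mul {m n : ℕ} {s t : A} (hs : s ∈ weightedIdeal I J a b m)
    (ht : t ∈ weightedIdeal I J a b n) : s * t ∈ weightedIdeal I J a b (m + n) := by
  suffices h : weightedIdeal I J a b m * weightedIdeal I J a b n ≤ weightedIdeal I J a b (m + n)
    from h (Ideal.mul_mem_mul hs ht)
  simp only [weightedIdeal, Submodule.iSup_mul, Submodule.mul_iSup]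
  refine iSup_le fun i => iSup_le fun j => iSup_le fun hij => iSup_le fun k => iSup_le fun l =>
    iSup_le fun hkl => ?_
  rw [show I ^ k * J ^ l * (I ^ i * J ^ j) = I ^ (k + i) * J ^ (l + j) by ring]
  exact pow_mul_pow_le_weightedIdeal (by nlinarith)

lemma weightedIdeal_pow {n : ℕ} {s : A} (hs : s ∈ weightedIdeal I J a b n) (k : ℕ) :
    s ^ k ∈ weightedIdeal I J a b (n * k) := by
  induction k with
  | zero => simp [weightedIdeal_zero]
  | succ k ih =>
    rw [pow_succ, mul_add, mul_one]
    exact weightedIdeal_mul ih hs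

/-- A monomial of positive weight has a factor from `I` or `J`, and removing it costs at most `a +
b`. -/
lemma weightedIdeal_add_le (ha : 0 < a) (n : ℕ) : weightedIdeal I J a b (n + (a + b)) ≤
    I * weightedIdeal I J a b n ⊔ J * weightedIdeal I J a b n := by
  refine weightedIdeal_le fun i j hij => ?_
  rcases i with _ | i
  · rcases j with _ | j
    · omega
    · refine le_trans ?_ le_sup_right
      rw [pow_succ, ← mul_assoc, mul_comm _ J]
      exact Ideal.mul_mono_right (pow_mul_pow_le_weightedIdeal (by nlinarith))
  · refine le_trans ?_ le_sup_left
    rw [pow_succ, mul_comm _ I, mul_assoc]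
    exact Ideal.mul_mono_right (pow_mul_pow_le_weightedIdeal (by nlinarith))

lemma weightedIdeal_top_left (ha : 0 < a) (n : ℕ) : weightedIdeal ⊤ J a b n = ⊤ := by
  rw [eq_top_iff]
  refine le_trans ?_ (pow_mul_pow_le_weightedIdeal (i := n) (j := 0) (by nlinarith))
  simp [Ideal.top_pow]

lemma weightedIdeal_top_right (hb : 0 < b) (n : ℕ) : weightedIdeal I ⊤ a b n = ⊤ := by
  rw [eq_top_iff]
  refine le_trans ?_ (pow_mul_pow_le_weightedIdeal (i := 0) (j := n) (by nlinarith))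
  simp [Ideal.top_pow]

lemma weightedIdeal_span (s t : A) (n : ℕ) :
    weightedIdeal (Ideal.span {s}) (Ideal.span {t}) a b n =
      Ideal.span {x | ∃ i j, n ≤ a * i + b * j ∧ x = s ^ i * t ^ j} := by
  have h : ∀ i j, Ideal.span {s} ^ i * Ideal.span {t} ^ j = Ideal.span {s ^ i * t ^ j} := by
    intro i j
    rw [Ideal.span_singleton_pow, Ideal.span_singleton_pow, Ideal.span_singleton_mul_span_singleton]
  apply le_antisymm
  · refine weightedIdeal_le fun i j hij => ?_
    rw [h]
    exact Ideal.span_mono (Set.singleton_subset_iff.2 ⟨i, j, hij, rfl⟩)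
  · rw [Ideal.span_le]
    rintro _ ⟨i, j, hij, rfl⟩
    refine pow_mul_pow_le_weightedIdeal hij ?_
    rw [h]
    exact Ideal.mem_span_singleton_self _

end WeightedIdeal

/-! ### The surfaces `E` and `R̃` near their intersection -/

section

variable {K : Type*} [Field K] [Algebra ℂ K] {ξ : Fin 3 → K}

def rho (ξ : Fin 3 → K) : K := rr ξ / uu ξ

lemma IsCoord.rho_ne_zero (hξ : IsCoord ξ) : rho ξ ≠ 0 := div_ne_zero hξ.rr_ne_zero hξ.uu_ne_zero

lemma uu_mul_rho (hξ : IsCoord ξ) : uu ξ * rho ξ = rr ξ := mul_div_cancel₀ _ hξ.uu_ne_zero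

end

section

variable {ξ : Fin 3 → FunctionField} {O P Q : LocalSubring FunctionField}

/-- The points of the curve `E ∩ R̃`, in the chart with coordinates `x, u, ρ`. -/
structure IsGood (ξ : Fin 3 → FunctionField) (O : LocalSubring FunctionField) : Prop where
  locOf : LocOf (Algebra.adjoin ℂ (Set.range (blowE ξ))).toSubring O
  uu_mem : uu ξ ∈ mx O
  rho_mem : rho ξ ∈ mx O

lemma IsGood.isE (h : IsGood ξ O) : IsE ξ O := Or.inl ⟨h.locOf, h.uu_mem⟩

lemma IsGood.coord_mem (hξ : IsCoord ξ) (h : IsGood ξ O) : ∀ i, ξ i ∈ O.toSubring :=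
  (h.isE.mem hξ).1

/-- The generic points of `E` and of `R̃`. -/
lemma IsChart.genericE_mem (h : IsChart ξ) : divPt h.isCoord.blowE ∈ E :=
  IsE.mem_E h (Or.inl ⟨locOf_pt _ _, coord_one_mem_mx _⟩)

/-- Restriction of a function of `x, y` to the diagonal, with an explicit remainder; it identifies
two centres on `ℙ¹ × ℙ¹` in `IsChart.genericR_mem`. -/
lemma algebraMap_add_mul_of_mem_adjoin {x y : FunctionField} {k : FunctionField}
    (hk : k ∈ Algebra.adjoin ℂ {x, y}) : ∃ (φ : Polynomial ℂ) (c : FunctionField),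
      c ∈ Algebra.adjoin ℂ {x, y} ∧ k = Polynomial.aeval x φ + (x - y) * c := by
  have hx : ∀ φ : Polynomial ℂ, Polynomial.aeval x φ ∈ Algebra.adjoin ℂ {x, y} := fun φ =>
    Algebra.adjoin_mono (by simp) (Polynomial.aeval_mem_adjoin_singleton ℂ x)
  have hr : x - y ∈ Algebra.adjoin ℂ {x, y} :=
    sub_mem (Algebra.subset_adjoin (by simp)) (Algebra.subset_adjoin (by simp))
  induction hk using Algebra.adjoin_induction with
  | mem k hk =>
    rcases hk with rfl | rfl
    · exact ⟨Polynomial.X, 0, zero_mem _, by simp⟩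
    · exact ⟨Polynomial.X, -1, neg_mem (one_mem _), by simp⟩
  | algebraMap c => exact ⟨Polynomial.C c, 0, zero_mem _, by simp⟩
  | add k l _ _ hk hl =>
    obtain ⟨φ, c, hc, rfl⟩ := hk
    obtain ⟨ψ, e, he, rfl⟩ := hl
    exact ⟨φ + ψ, c + e, add_mem hc he, by rw [map_add]; ring⟩
  | mul k l _ _ hk hl =>
    obtain ⟨φ, c, hc, rfl⟩ := hk
    obtain ⟨ψ, e, he, rfl⟩ := hl
    refine ⟨φ * ψ, Polynomial.aeval x φ * e + c * Polynomial.aeval x ψ + (x - y) * (c * e),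
      add_mem (add_mem (mul_mem (hx φ) he) (mul_mem hc (hx ψ))) (mul_mem hr (mul_mem hc he)), ?_⟩
    rw [map_mul]; ring

lemma aeval_notMem_mx_pt {τ : Fin 3 → FunctionField} (hτ : IsCoord τ) {S : Set (Fin 3)}
    (hS : (0 : Fin 3) ∉ S) {φ : Polynomial ℂ} :
    Polynomial.aeval (τ 0) φ ∈ mx (pt hτ (coordIdeal S)) ↔ φ = 0 := by
  have h1 : Polynomial.aeval (τ 0) φ =
      MvPolynomial.aeval τ (Polynomial.aeval (MvPolynomial.X 0 : ChartRing) φ) := by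
    rw [← Polynomial.aeval_algHom_apply, MvPolynomial.aeval_X]
  rw [h1, aeval_mem_mx_pt, coordIdeal_eq_ker, RingHom.mem_ker]
  constructor
  · intro h
    have h2 : Polynomial.aeval (MvPolynomial.X 0 : ChartRing) φ = 0 := by
      rw [← h]
      change _ = MvPolynomial.aeval _ _
      rw [← Polynomial.aeval_algHom_apply, MvPolynomial.aeval_X, if_neg hS]
    exact transcendental_iff.1 (MvPolynomial.transcendental_X ℂ (0 : Fin 3)) φ h2
  · rintro rfl
    simp

def genericR (hξ : IsCoord ξ) : LocalSubring FunctionField := pt hξ.blowE (coordIdeal {2})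

lemma locOf_genericR (hξ : IsCoord ξ) :
    LocOf (Algebra.adjoin ℂ (Set.range ξ)).toSubring (genericR hξ) := by
  refine LocOf.of_blowE hξ (locOf_pt _ _) fun h => ?_
  have h1 : MvPolynomial.aeval (blowE ξ) (MvPolynomial.X 1 : ChartRing) ∈ mx (genericR hξ) := by
    rw [MvPolynomial.aeval_X]
    exact h
  rw [genericR, aeval_mem_mx_pt, mem_coordIdeal_singleton, MvPolynomial.X_dvd_X] at h1
  simp at h1

/-- The generic point of `ρ = 0` lies over the generic point of the diagonal of `ℙ¹ × ℙ¹`, which is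
also the image of the generic point of `C`. It is off `C` because `u` does not vanish there. -/
lemma IsChart.genericR_mem (h : IsChart ξ) :
    genericR h.isCoord ∈ R ∧ genericR h.isCoord ∈ Xtilde.points := by
  have hl := locOf_genericR h.isCoord
  have hX := h.mem_X_of_locOf hl
  have hc : ∀ i, ξ i ∈ (genericR h.isCoord).toSubring := fun i => hl.1 (mem_adjoin_range ξ i)
  have hC : genericR h.isCoord ∉ C := by
    intro hC
    have h0 := ((h.mem_C_iff hX hc).1 hC).1
    have h1 : MvPolynomial.aeval (blowE ξ) (MvPolynomial.X 1 : ChartRing) ∈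
        mx (genericR h.isCoord) := by
      rw [MvPolynomial.aeval_X]
      exact h0
    rw [genericR, aeval_mem_mx_pt, mem_coordIdeal_singleton, MvPolynomial.X_dvd_X] at h1
    simp at h1
  refine ⟨h.mem_R.2 ⟨h.mem_X.1 hX, ?_⟩, mem_Xtilde_of_notMem_C hX hC⟩
  have hlC := locOf_curvePt h.isCoord
  have hcC : ∀ i, ξ i ∈ (curvePt h.isCoord).toSubring := fun i => hlC.1 (mem_adjoin_range ξ i)
  set A := Algebra.adjoin ℂ {ξ 0, ξ 1} with hA
  have hAle : ∀ P : LocalSubring FunctionField, HasConst P → (∀ i, ξ i ∈ P.toSubring) →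
      A.toSubring ≤ P.toSubring := by
    intro P hP hc
    refine adjoin_le_of hP ?_
    rintro _ (rfl | rfl)
    exacts [hc 0, hc 1]
  have h1 := hAle _ hl.hasConst hc
  have h2 := hAle _ hlC.hasConst hcC
  have hB : IsB ξ (center A.toSubring _ h1) := by
    refine ⟨0, 0, (locOf_center h1).mono (adjoin_le_of (Subalgebra.algebraMap_mem _) ?_)
      (adjoin_le_of (locOf_center h1).hasConst ?_)⟩
    · rintro _ (rfl | rfl)
      · exact Algebra.subset_adjoin (Or.inl ⟨1, by simp [hx]⟩)
      · exact Algebra.subset_adjoin (Or.inr ⟨1, by simp [hy]⟩)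
    · have h0 : ∀ i : Fin 2, ![ξ 0, ξ 1] i ∈ (center A.toSubring _ h1).toSubring := by
        intro i
        refine (locOf_center h1).1 (Algebra.subset_adjoin ?_)
        fin_cases i <;> simp
      have h01 := h0 0
      have h02 := h0 1
      rintro _ (⟨l, rfl⟩ | ⟨l, rfl⟩) <;> fin_cases l <;> simp [hx, hy] <;> assumption
  -- At both points `x - y` vanishes while a nonzero polynomial in `x` alone does not, so both cut
  -- out the same prime of `ℂ[x, y]`.
  have heq : center A.toSubring _ h1 = center A.toSubring _ h2 := by
    refine (locOf_center h1).eq_of_le (locOf_center h2) fun k hk => ?_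
    obtain ⟨φ, c, hc', rfl⟩ := algebraMap_add_mul_of_mem_adjoin hk
    have key : ∀ (P : LocalSubring FunctionField) (hP : A.toSubring ≤ P.toSubring),
        rr ξ ∈ mx P → (Polynomial.aeval (ξ 0) φ ∈ mx P ↔ φ = 0) →
        (Polynomial.aeval (ξ 0) φ + (ξ 0 - ξ 1) * c ∈ mx (center A.toSubring P hP) ↔ φ = 0) := by
      intro P hP hr hφ
      rw [← hφ]
      have e : Polynomial.aeval (ξ 0) φ + (ξ 0 - ξ 1) * c ∈ mx (center A.toSubring P hP) ↔
          Polynomial.aeval (ξ 0) φ + (ξ 0 - ξ 1) * c ∈ mx P :=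
        ⟨fun h => (domination_iff.1 (center_le hP)).2 h,
          fun h => mem_mx_of_dominated (center_le hP) ((locOf_center hP).1 hk) h⟩
      rw [e]
      have hr' : (ξ 0 - ξ 1) * c ∈ mx P := mul_mem_mx' hr (hP hc')
      exact ⟨fun h => by simpa using sub_mem_mx h hr', fun h => add_mem_mx h hr'⟩
    rw [key _ h1 ?_ (aeval_notMem_mx_pt h.isCoord.blowE (by simp)),
      key _ h2 ?_ (aeval_notMem_mx_pt h.isCoord.curve (by simp))]
    · exact coord_mem_mx_pt (i := 2) h.isCoord.curve (by simp)
    · rw [← uu_mul_rho h.isCoord]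
      exact mul_mem_mx (coord_mem_pt h.isCoord.blowE _ 1)
        (coord_mem_mx_pt (i := 2) h.isCoord.blowE (by simp))
  exact ⟨_, hB, ⟨_, h.mem_C.1 h.curvePt_mem, heq ▸ center_le h2⟩, center_le h1⟩

/-- The equation of `R̃` at a point of `R` outside `C`. -/
lemma IsChart.rho_mem_mx (h : IsChart ξ) (hR : P ∈ R) (hX : P ∈ Xtilde.points)
    (hc : ∀ i, ξ i ∈ P.toSubring) : rr ξ ∈ mx P ∧ uu ξ ∉ mx P ∧ rho ξ ∈ mx P := by
  have h1 : rr ξ ∈ mx P := (h.mem_R.1 hR).mem_mx h.isCoord hc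
  have h2 : uu ξ ∉ mx P := fun hu =>
    notMem_C_of_mem_Xtilde hX hR.1 ((h.mem_C_iff hR.1 hc).2 ⟨hu, h1⟩)
  refine ⟨h1, h2, ?_⟩
  rw [rho, div_eq_mul_inv]
  exact mul_mem_mx' h1 (inv_mem_of_notMem_mx (P.toSubring.sub_mem (hc 2) (hc 0)) h2)

lemma IsGood.vanishingIdeal_E (hχ : IsChart ξ) (h : IsGood ξ O) :
    vanishingIdeal E O = Ideal.span {⟨uu ξ, h.uu_mem.1⟩} := by
  have hc := h.coord_mem hχ.isCoord
  apply le_antisymm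
  · intro k hk
    have hle : O.toSubring ≤ (divPt hχ.isCoord.blowE).toSubring :=
      h.locOf.le_pt hχ.isCoord.blowE (by rintro i rfl; exact h.uu_mem)
    obtain ⟨f, hf, s, hs, hk'⟩ := h.locOf.exists_of_mem_mx_pt hχ.isCoord.blowE k.2
      ((mem_vanishingIdeal k).1 hk _ hχ.genericE_mem hle)
    obtain ⟨q, rfl⟩ := exists_of_mem_coordIdeal_singleton hf
    rw [Ideal.mem_span_singleton]
    refine ⟨⟨_, div_mem_of_inv_mem (h.locOf.1 (aeval_mem_adjoin _ q)) hs⟩, Subtype.ext ?_⟩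
    rw [hk', map_mul, MvPolynomial.aeval_X, mul_div_assoc]
    rfl
  · rw [Ideal.span_singleton_le_iff_mem]
    exact (mem_vanishingIdeal _).2 fun P hP hOP =>
      (hχ.mem_mx_of_mem_E hP fun i => hOP (hc i)).1

lemma IsGood.vanishingIdeal_Rtilde (hχ : IsChart ξ) (h : IsGood ξ O) :
    vanishingIdeal Rtilde O = Ideal.span {⟨rho ξ, h.rho_mem.1⟩} := by
  have hc := h.coord_mem hχ.isCoord
  apply le_antisymm
  · intro k hk
    have hle : O.toSubring ≤ (genericR hχ.isCoord).toSubring :=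
      h.locOf.le_pt hχ.isCoord.blowE (by rintro i rfl; exact h.rho_mem)
    have hmem : genericR hχ.isCoord ∈ Rtilde := ⟨hχ.genericR_mem.2, _, hχ.genericR_mem.1,
      hχ.genericR_mem.2, le_rfl⟩
    obtain ⟨f, hf, s, hs, hk'⟩ := h.locOf.exists_of_mem_mx_pt hχ.isCoord.blowE k.2
      ((mem_vanishingIdeal k).1 hk _ hmem hle)
    obtain ⟨q, rfl⟩ := exists_of_mem_coordIdeal_singleton hf
    rw [Ideal.mem_span_singleton]
    refine ⟨⟨_, div_mem_of_inv_mem (h.locOf.1 (aeval_mem_adjoin _ q)) hs⟩, Subtype.ext ?_⟩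
    rw [hk', map_mul, MvPolynomial.aeval_X, mul_div_assoc]
    rfl
  · rw [Ideal.span_singleton_le_iff_mem]
    refine (mem_vanishingIdeal _).2 fun P hP hOP => ?_
    obtain ⟨-, P', hR, hX, hPP'⟩ := hP
    have h1 := (hχ.rho_mem_mx hR hX fun i => hPP' (hOP (hc i))).2.2
    -- A unit at `P` stays a unit at the generalization `P'`, where `ρ` vanishes.
    by_contra hcon
    exact notMem_mx_of_inv_mem hχ.isCoord.rho_ne_zero
      (hPP' (inv_mem_of_notMem_mx (hOP h.rho_mem.1) hcon)) h1

lemma vanishingIdeal_E_eq_top (hO : O ∈ Xtilde.points) (hX : O ∈ X.points) :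
    vanishingIdeal E O = ⊤ :=
  vanishingIdeal_eq_top fun _ hP hOP => notMem_X_of_le hO hP hOP hX

/-- Away from `E ∩ R̃`, one of the two ideals is trivial. -/
lemma eq_top_or_isGood (hO : O ∈ Xtilde.points) : vanishingIdeal E O = ⊤ ∨
    vanishingIdeal Rtilde O = ⊤ ∨ ∃ ξ, IsChart ξ ∧ IsGood ξ O := by
  rcases mem_Xtilde_cases hO with h | ⟨ξ, hχ, h⟩
  · exact Or.inl (vanishingIdeal_E_eq_top hO h.1)
  right
  by_cases htop : vanishingIdeal Rtilde O = ⊤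
  · exact Or.inl htop
  right
  obtain ⟨P', ⟨-, P, hR, hX, hPP'⟩, hOP'⟩ := exists_of_vanishingIdeal_ne_top htop
  have hOP := hOP'.trans hPP'
  obtain ⟨hr, hu, hρ⟩ := hχ.rho_mem_mx hR hX fun i => hOP ((h.mem hχ.isCoord).1 i)
  refine ⟨ξ, hχ, ?_⟩
  rcases h with ⟨h, hm⟩ | ⟨h, hm⟩
  · refine ⟨h, hm, ?_⟩
    by_contra hcon
    exact notMem_mx_of_inv_mem hχ.isCoord.rho_ne_zero
      (hOP (inv_mem_of_notMem_mx (h.1 (mem_adjoin_range (blowE ξ) 2)) hcon)) hρ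
  -- In this chart `u = r · (u / r)` would vanish at a point of `R` off `C`; so `R̃` does not meet
  -- `E` here.
  · refine absurd ?_ hu
    have := mul_mem_mx' hr (hOP (h.1 (mem_adjoin_range (blowR ξ) 2)))
    rwa [show rr ξ * blowR ξ 2 = uu ξ from mul_div_cancel₀ _ hχ.isCoord.rr_ne_zero] at this

end

end Fano
end

/-! ### The quasi-monomial divisor `F` and its valuation ideals. -/

noncomputable section

namespace Fano

/-- Coprime weights `a`, `b`, the common factor `g`, and a solution of `a q - b p = 1`. -/
structure Weights where
  (g a b p q : ℕ)
  g_pos : 0 < g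
  a_pos : 0 < a
  b_pos : 0 < b
  bezout : a * q = b * p + 1

/-- Bézout is solved in natural numbers, so that `u` and `ρ` become monomials with nonnegative
exponents in the coordinates `t, θ` adapted to the divisor. -/
lemma exists_weights {a b : ℕ} (ha : 0 < a) (hb : 0 < b) :
    ∃ w : Weights, w.g * w.a = a ∧ w.g * w.b = b := by
  obtain ⟨g, a', b', hg, hco, rfl, rfl⟩ := Nat.exists_coprime' (m := a) (n := b)
    (Nat.gcd_pos_of_pos_left _ ha)
  have ha' : 0 < a' := Nat.pos_of_mul_pos_right ha
  have hb' : 0 < b' := Nat.pos_of_mul_pos_right hb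
  obtain ⟨p, q, h⟩ : ∃ p q : ℕ, a' * q = b' * p + 1 := by
    rcases Nat.lt_or_ge 1 b' with h1 | h1
    · obtain ⟨q, -, hq⟩ := Nat.exists_mul_mod_eq_one_of_coprime hco h1
      exact ⟨a' * q / b', q, by rw [← hq]; exact (Nat.div_add_mod _ _).symm⟩
    · exact ⟨a' - 1, 1, by rw [show b' = 1 by omega]; omega⟩
  exact ⟨⟨g, a', b', p, q, hg, ha', hb', h⟩, mul_comm _ _, mul_comm _ _⟩

section

variable {K : Type*} [Field K] [Algebra ℂ K] {ξ : Fin 3 → K} (w : Weights)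

/-- The coordinates `x, t, θ` with `u = t ^ a θ ^ p` and `ρ = t ^ b θ ^ q`. -/
def divCoord (ξ : Fin 3 → K) : Fin 3 → K :=
  ![ξ 0, uu ξ ^ w.q / rho ξ ^ w.p, rho ξ ^ w.a / uu ξ ^ w.b]

lemma uu_eq (hξ : IsCoord ξ) : uu ξ = divCoord w ξ 1 ^ w.a * divCoord w ξ 2 ^ w.p := by
  have hu := hξ.uu_ne_zero
  have hr := hξ.rho_ne_zero
  change _ = (uu ξ ^ w.q / rho ξ ^ w.p) ^ w.a * (rho ξ ^ w.a / uu ξ ^ w.b) ^ w.p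
  rw [div_pow, div_pow, ← pow_mul, ← pow_mul, ← pow_mul, ← pow_mul, mul_comm w.q, w.bezout, pow_succ,
    mul_comm w.p w.a]
  field_simp

lemma rho_eq (hξ : IsCoord ξ) : rho ξ = divCoord w ξ 1 ^ w.b * divCoord w ξ 2 ^ w.q := by
  have hu := hξ.uu_ne_zero
  have hr := hξ.rho_ne_zero
  change _ = (uu ξ ^ w.q / rho ξ ^ w.p) ^ w.b * (rho ξ ^ w.a / uu ξ ^ w.b) ^ w.q
  rw [div_pow, div_pow, ← pow_mul, ← pow_mul, ← pow_mul, ← pow_mul, w.bezout, pow_succ,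
    mul_comm w.p w.b, mul_comm w.q w.b]
  field_simp

lemma IsCoord.div (hξ : IsCoord ξ) : IsCoord (divCoord w ξ) := by
  have hm := coord_mem_adjoin (divCoord w ξ)
  refine hξ.blowE.of_mem fun i => ?_
  fin_cases i
  · exact hm 0
  · change uu ξ ∈ _
    rw [uu_eq w hξ]
    exact mul_mem (pow_mem (hm 1) _) (pow_mem (hm 2) _)
  · change rho ξ ∈ _
    rw [rho_eq w hξ]
    exact mul_mem (pow_mem (hm 1) _) (pow_mem (hm 2) _)

/-- The prime divisor of the quasi-monomial valuation with weights `a`, `b` along `u`, `ρ`. -/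
def divF (hξ : IsCoord ξ) : LocalSubring K := divPt (hξ.div w)

local notation "tt" => divCoord w ξ 1

lemma tt_ne_zero (hξ : IsCoord ξ) : tt ≠ 0 := (hξ.div w).ne_zero 1

variable (hξ : IsCoord ξ)

/-- The exponents of `x, u, ρ` in terms of `x, t, θ` form a matrix of determinant `a q - b p = 1`,
so `monomial_order` applies. -/
lemma order_aeval_blowE (G : ChartRing) (N : ℕ) :
    tt ^ (-N : ℤ) * MvPolynomial.aeval (blowE ξ) G ∈ (divF w hξ).toSubring ↔
      ∀ d ∈ G.support, N ≤ w.a * d 1 + w.b * d 2 := by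
  have hM : (!![1, 0, 0; 0, (w.a : ℤ), (w.p : ℤ); 0, (w.b : ℤ), (w.q : ℤ)]).det ≠ 0 := by
    rw [Matrix.det_fin_three]
    have := w.bezout
    zify at this
    simp
    linarith
  have hα : ∀ i, blowE ξ i = ∏ j, divCoord w ξ j ^
      (!![1, 0, 0; 0, (w.a : ℤ), (w.p : ℤ); 0, (w.b : ℤ), (w.q : ℤ)]) i j := by
    intro i
    rw [Fin.prod_univ_three]
    fin_cases i
    · simp [blowE, blowCoord, divCoord]
    · simpa [blowE, blowCoord] using uu_eq w hξ
    · simpa [blowE, blowCoord, rho] using rho_eq w hξ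
  rw [divF, monomial_order (hξ.div w) hM hα]
  refine forall₂_congr fun d _ => ?_
  simp only [Fin.sum_univ_three, Matrix.of_apply, Matrix.cons_val]
  zify
  constructor <;> intro h <;> linarith

/-- Both weights are positive, so a monomial has positive order exactly when it involves `u` or `ρ`:
the centre of `F` is the generic point of `E ∩ R̃`. -/
lemma aeval_blowE_mem_mx {G : ChartRing} :
    MvPolynomial.aeval (blowE ξ) G ∈ mx (divF w hξ) ↔ G ∈ coordIdeal {1, 2} := by
  have h := order_aeval_blowE w hξ G 1
  rw [divF, mem_mx_divPt, mem_coordIdeal]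
  simp only [Nat.cast_one, zpow_neg, zpow_one] at h
  rw [divF] at h
  rw [h]
  refine forall₂_congr fun d _ => ?_
  have := w.a_pos
  have := w.b_pos
  simp only [Set.mem_insert_iff, Set.mem_singleton_iff, exists_eq_or_imp, exists_eq_left]
  constructor
  · intro h
    by_contra! hc
    simp [hc] at h
  · rintro (h | h)
    · have := Nat.mul_pos w.a_pos (Nat.pos_of_ne_zero h); omega
    · have := Nat.mul_pos w.b_pos (Nat.pos_of_ne_zero h); omega

lemma order_uu : tt ^ (-w.a : ℤ) * uu ξ ∈ (divF w hξ).toSubring ∧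
    (tt ^ (-w.a : ℤ) * uu ξ)⁻¹ ∈ (divF w hξ).toSubring := by
  have h : tt ^ (-w.a : ℤ) * uu ξ = divCoord w ξ 2 ^ w.p := by
    conv_lhs => rw [uu_eq w hξ]
    have := tt_ne_zero w hξ
    rw [zpow_neg, zpow_natCast]
    field_simp
  rw [h, ← inv_pow]
  exact ⟨Subring.pow_mem _ (coord_mem_divPt (hξ.div w) 2) _,
    Subring.pow_mem _ (coord_inv_mem_divPt (hξ.div w) (by decide)) _⟩

lemma aeval_blowE_mem (G : ChartRing) :
    MvPolynomial.aeval (blowE ξ) G ∈ (divF w hξ).toSubring := by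
  simpa using (order_aeval_blowE w hξ G 0).2 (by simp)

lemma hasConst_divF : HasConst (divF w hξ) := (locOf_pt (hξ.div w) _).hasConst

lemma uu_mem_mx_divF : uu ξ ∈ mx (divF w hξ) := by
  have := (aeval_blowE_mem_mx w hξ (G := MvPolynomial.X 1)).2 (X_mem_coordIdeal (by simp))
  rwa [MvPolynomial.aeval_X] at this

lemma rho_mem_mx_divF : rho ξ ∈ mx (divF w hξ) := by
  have := (aeval_blowE_mem_mx w hξ (G := MvPolynomial.X 2)).2 (X_mem_coordIdeal (by simp))
  rwa [MvPolynomial.aeval_X] at this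

lemma blowE_mem_divF (i : Fin 3) : blowE ξ i ∈ (divF w hξ).toSubring := by
  have := aeval_blowE_mem w hξ (MvPolynomial.X i)
  rwa [MvPolynomial.aeval_X] at this

lemma coord_mem_divF (i : Fin 3) : ξ i ∈ (divF w hξ).toSubring :=
  (mem_of_blowE hξ (blowE_mem_divF w hξ)).1 i

variable {w}

lemma notMem_mx_of_sum {N : ℕ} {k : K}
    (h : tt ^ (-N : ℤ) * k ∈ (divF w hξ).toSubring)
    (h' : tt ^ (-(N + 1 : ℕ) : ℤ) * k ∉ (divF w hξ).toSubring) :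
    (tt ^ (-N : ℤ) * k)⁻¹ ∈ (divF w hξ).toSubring := by
  refine inv_mem_of_notMem_mx h fun hc => h' ?_
  rw [divF, mem_mx_divPt] at hc
  rw [← mul_assoc, ← zpow_neg_one, ← zpow_add₀ (tt_ne_zero w hξ)] at hc
  have e : (-1 + -N : ℤ) = -(N + 1 : ℕ) := by push_cast; ring
  rwa [e] at hc

end

section

variable {ξ : Fin 3 → FunctionField} {O P Q : LocalSubring FunctionField} {w : Weights}

local notation "tt" => divCoord w ξ 1

lemma IsGood.le_divF (hξ : IsCoord ξ) (h : IsGood ξ O) : O.toSubring ≤ (divF w hξ).toSubring := by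
  intro k hk
  obtain ⟨a, ha, s, hs, h0, h1, rfl⟩ := h.locOf.2 k hk
  obtain ⟨f, rfl⟩ := exists_aeval ha
  obtain ⟨g, rfl⟩ := exists_aeval hs
  refine div_mem_of_inv_mem (aeval_blowE_mem w hξ f)
    (inv_mem_of_notMem_mx (aeval_blowE_mem w hξ g) fun hc => ?_)
  rw [aeval_blowE_mem_mx] at hc
  refine notMem_mx_of_inv_mem h0 h1 (coordIdeal_aeval_mem_mx
    (fun i => h.locOf.1 (mem_adjoin_range _ i)) h.locOf.hasConst ?_ hc)
  rintro i (rfl | rfl)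
  exacts [h.uu_mem, h.rho_mem]

/-- The stalk of the weighted ideal sheaf. -/
abbrev wIdeal (w : Weights) (O : LocalSubring FunctionField) (n : ℕ) : Ideal O.toSubring :=
  weightedIdeal (vanishingIdeal E O) (vanishingIdeal Rtilde O) (w.g * w.a) (w.g * w.b) n

lemma IsGood.wIdeal_eq (hχ : IsChart ξ) (h : IsGood ξ O) (n : ℕ) :
    wIdeal w O n = Ideal.span {x | ∃ i j, n ≤ w.g * w.a * i + w.g * w.b * j ∧
      x = (⟨uu ξ, h.uu_mem.1⟩ : O.toSubring) ^ i * ⟨rho ξ, h.rho_mem.1⟩ ^ j} := by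
  rw [wIdeal, h.vanishingIdeal_E hχ, h.vanishingIdeal_Rtilde hχ, weightedIdeal_span]

lemma IsGood.exists_mem_wIdeal_of_aeval (hχ : IsChart ξ) (h : IsGood ξ O) {n : ℕ} {G : ChartRing}
    (hG : ∀ d ∈ G.support, n ≤ w.g * w.a * d 1 + w.g * w.b * d 2) :
    ∃ k ∈ wIdeal w O n, (k : FunctionField) = MvPolynomial.aeval (blowE ξ) G := by
  have key : MvPolynomial.aeval (blowE ξ) G ∈
      (wIdeal w O n).toAddSubgroup.map O.toSubring.subtype.toAddMonoidHom := by
    rw [← MvPolynomial.support_sum_monomial_coeff G, map_sum]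
    refine sum_mem fun d hd => ?_
    rw [MvPolynomial.aeval_monomial]
    refine ⟨⟨algebraMap ℂ _ (MvPolynomial.coeff d G), h.locOf.hasConst _⟩ *
      ⟨ξ 0, h.coord_mem hχ.isCoord 0⟩ ^ d 0 *
      ((⟨uu ξ, h.uu_mem.1⟩ : O.toSubring) ^ d 1 * ⟨rho ξ, h.rho_mem.1⟩ ^ d 2), ?_, ?_⟩
    · refine Ideal.mul_mem_left _ _ ?_
      rw [h.wIdeal_eq hχ]
      exact Ideal.subset_span ⟨_, _, hG d hd, rfl⟩
    · rw [Finsupp.prod_fintype _ _ (by simp), Fin.prod_univ_three]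
      change algebraMap ℂ FunctionField _ * ξ 0 ^ d 0 * (uu ξ ^ d 1 * rho ξ ^ d 2) =
        _ * (ξ 0 ^ d 0 * uu ξ ^ d 1 * rho ξ ^ d 2)
      ring
  obtain ⟨k, hk, hk'⟩ := key
  exact ⟨k, hk, hk'⟩

/-- The weighted ideals are the valuation ideals of the divisor. -/
lemma IsGood.mem_wIdeal_of_order (hχ : IsChart ξ) (h : IsGood ξ O) {n N : ℕ} (hn : n ≤ w.g * N)
    {k : O.toSubring} (hk : tt ^ (-N : ℤ) * (k : FunctionField) ∈ (divF w hχ.isCoord).toSubring) :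
    k ∈ wIdeal w O n := by
  obtain ⟨a, ha, s, hs, h0, h1, hks⟩ := h.locOf.2 k k.2
  obtain ⟨G, rfl⟩ := exists_aeval ha
  have hsF := h.le_divF (w := w) hχ.isCoord (h.locOf.1 hs)
  have hG := (order_aeval_blowE w hχ.isCoord G N).1 (by
    have := Subring.mul_mem _ hk hsF
    rwa [hks, mul_assoc, div_mul_cancel₀ _ h0] at this)
  obtain ⟨l, hl, hl'⟩ := h.exists_mem_wIdeal_of_aeval (w := w) (n := n) hχ (G := G) (fun d hd => by
    have := Nat.mul_le_mul_left w.g (hG d hd)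
    nlinarith)
  have : k = ⟨s⁻¹, h1⟩ * l := by
    apply Subtype.ext
    rw [hks, Subring.coe_mul, hl', div_eq_inv_mul]
  rw [this]
  exact Ideal.mul_mem_left _ _ hl

lemma IsGood.order_of_mem_wIdeal (hχ : IsChart ξ) (h : IsGood ξ O) {n : ℕ} {k : O.toSubring}
    (hk : k ∈ wIdeal w O n) : ∃ N, n ≤ w.g * N ∧
      tt ^ (-N : ℤ) * (k : FunctionField) ∈ (divF w hχ.isCoord).toSubring := by
  -- Orders along `F` use the coprime weights, the ideals use these times `g`; hence `n / g` rounded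
  -- up.
  refine ⟨(n + w.g - 1) / w.g, ?_, ?_⟩
  · have h1 := Nat.div_add_mod (n + w.g - 1) w.g
    have h2 := Nat.mod_lt (n + w.g - 1) w.g_pos
    omega
  set N := (n + w.g - 1) / w.g with hN
  rw [h.wIdeal_eq hχ] at hk
  refine Submodule.span_induction (p := fun (k : O.toSubring) _ =>
    tt ^ (-N : ℤ) * (k : FunctionField) ∈ (divF w hχ.isCoord).toSubring) ?_ ?_ ?_ ?_ hk
  · rintro _ ⟨i, j, hij, rfl⟩
    have h1 := (order_aeval_blowE w hχ.isCoord (MvPolynomial.X 1 ^ i * MvPolynomial.X 2 ^ j) N).2 ?_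
    · simpa [blowE, blowCoord, rho] using h1
    intro d hd
    have hd' : d = Finsupp.single 1 i + Finsupp.single 2 j := by
      rw [MvPolynomial.X_pow_eq_monomial, MvPolynomial.X_pow_eq_monomial,
        MvPolynomial.monomial_mul] at hd
      exact Finset.mem_singleton.1 (MvPolynomial.support_monomial_subset hd)
    subst hd'
    have h3 : N * w.g ≤ n + w.g - 1 := Nat.div_mul_le_self _ _
    have h4 : w.g * N < w.g * (w.a * i + w.b * j + 1) := by
      have := w.g_pos
      have h5 : w.g * (w.a * i + w.b * j + 1) = w.g * w.a * i + w.g * w.b * j + w.g := by ring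
      rw [h5, mul_comm]
      omega
    have h6 := Nat.lt_of_mul_lt_mul_left h4
    simp
    omega
  · simp
  · intro x y _ _ hx hy
    rw [Subring.coe_add, mul_add]
    exact Subring.add_mem _ hx hy
  · intro c x _ hx
    rw [smul_eq_mul, Subring.coe_mul, mul_left_comm]
    exact Subring.mul_mem _ (h.le_divF hχ.isCoord c.2) hx

end

end Fano
end

/-! ### The exceptional prime divisor of `Y` over `X̃`. -/

noncomputable section

namespace Fano

section

variable {ξ : Fin 3 → FunctionField} {O P Q : LocalSubring FunctionField} {w : Weights}

local notation "tt" => divCoord w ξ 1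

lemma Weights.ga_pos (w : Weights) : 0 < w.g * w.a := Nat.mul_pos w.g_pos w.a_pos
lemma Weights.gb_pos (w : Weights) : 0 < w.g * w.b := Nat.mul_pos w.g_pos w.b_pos

lemma mem_Y : P ∈ (Y (w.g * w.a) (w.g * w.b)).points ↔ ∃ O ∈ Xtilde.points, ∃ n : ℕ, 0 < n ∧
    ∃ g ∈ wIdeal w O n, g ≠ 0 ∧ LocOf (projChart (wIdeal w O) n g).toSubring P := mem_proj

lemma wIdeal_zero : wIdeal w O 0 = ⊤ := weightedIdeal_zero

lemma wIdeal_eq_top (h : vanishingIdeal E O = ⊤ ∨ vanishingIdeal Rtilde O = ⊤) (n : ℕ) :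
    wIdeal w O n = ⊤ := by
  rcases h with h | h
  · rw [wIdeal, h, weightedIdeal_top_left w.ga_pos]
  · rw [wIdeal, h, weightedIdeal_top_right w.gb_pos]

lemma mem_Y_of_mem_X (hX : P ∈ X.points) (hC : P ∉ C) :
    P ∈ (Y (w.g * w.a) (w.g * w.b)).points := by
  have h := mem_Xtilde_of_notMem_C hX hC
  exact mem_proj_of_eq_top h one_pos (wIdeal_zero (w := w))
    (wIdeal_eq_top (w := w) (Or.inl (vanishingIdeal_E_eq_top h hX)) 1)

/-- The new points of `Y` lie over the curve `E ∩ R̃`. -/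
lemma exists_isGood (hP : P ∈ (Y (w.g * w.a) (w.g * w.b)).points) (hP' : P ∉ Xtilde.points) :
    ∃ ξ, IsChart ξ ∧ ∃ O, IsGood ξ O ∧ ∃ n : ℕ, 0 < n ∧ ∃ g ∈ wIdeal w O n, g ≠ 0 ∧
      LocOf (projChart (wIdeal w O) n g).toSubring P ∧ uu ξ ∈ mx P ∧ rho ξ ∈ mx P := by
  obtain ⟨O, hO, n, hn, g, hg, hg0, hl⟩ := mem_Y.1 hP
  have hgk : (g : FunctionField) ≠ 0 := fun h => hg0 (Subtype.ext h)
  have hginv : (g : FunctionField)⁻¹ ∉ P.toSubring := fun h => hP'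
    (proj_of_locOf hO (hl.of_projChart (Xtilde.algebraMap_mem O hO) wIdeal_zero hg0 h))
  have htop : ¬ (vanishingIdeal E O = ⊤ ∨ vanishingIdeal Rtilde O = ⊤) := fun h => hginv (by
    have := hl.1 (div_mem_projChart (g := g) (n := n) (h := 1) (by rw [wIdeal_eq_top h]; trivial))
    simpa using this)
  obtain ⟨ξ, hχ, hgood⟩ : ∃ ξ, IsChart ξ ∧ IsGood ξ O := by
    rcases eq_top_or_isGood hO with h | h | h
    exacts [absurd (Or.inl h) htop, absurd (Or.inr h) htop, h]
  have hOP := (le_projChart wIdeal_zero).trans hl.1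
  -- If `s` were a unit at `P`, then regularity of `s ^ n / g` would make `1 / g` regular, and `P`
  -- would already be a point of `X̃`.
  have key : ∀ s : O.toSubring, s ^ n ∈ wIdeal w O n → (s : FunctionField) ≠ 0 →
      (s : FunctionField) ∈ mx P := by
    intro s hs h0
    by_contra hc
    have h1 := hl.1 (div_mem_projChart (g := g) hs)
    have h2 := Subring.pow_mem _ (inv_mem_of_notMem_mx (hOP s.2) hc) n
    have h3 := Subring.mul_mem _ h1 h2
    refine hginv ?_
    convert h3 using 1
    have := pow_ne_zero n h0
    rw [SubmonoidClass.coe_pow, inv_pow]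
    field_simp
  refine ⟨ξ, hχ, O, hgood, n, hn, g, hg, hg0, hl, ?_, ?_⟩
  · refine key ⟨uu ξ, hgood.uu_mem.1⟩ ?_ hχ.isCoord.uu_ne_zero
    rw [hgood.wIdeal_eq hχ]
    exact Ideal.subset_span ⟨n, 0, by have := w.ga_pos; nlinarith, by simp⟩
  · refine key ⟨rho ξ, hgood.rho_mem.1⟩ ?_ hχ.isCoord.rho_ne_zero
    rw [hgood.wIdeal_eq hχ]
    exact Ideal.subset_span ⟨0, n, by have := w.gb_pos; nlinarith, by simp⟩

/-- Elements of excessive weight vanish on the exceptional locus. -/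
lemma IsGood.div_pow_mem_mx (hχ : IsChart ξ) (h : IsGood ξ O) {n : ℕ} {g : O.toSubring}
    (hl : LocOf (projChart (wIdeal w O) n g).toSubring P) (hu : uu ξ ∈ mx P) (hρ : rho ξ ∈ mx P)
    {k : ℕ} {s : O.toSubring} (hs : s ∈ wIdeal w O (n * k + 1)) :
    (s : FunctionField) / (g : FunctionField) ^ k ∈ mx P := by
  -- The `N`-th power multiplies the excess weight `1` to `N`, which is enough to split off a factor
  -- `u` or `ρ`.
  set N := w.g * w.a + w.g * w.b with hN
  have h1 : (s : FunctionField) / (g : FunctionField) ^ k ∈ P.toSubring :=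
    hl.1 (div_pow_mem_projChart (weightedIdeal_anti (Nat.le_succ _) hs))
  refine mem_mx_of_pow_mem h1 (n := N) ?_
  have h2 := weightedIdeal_pow hs N
  rw [show (n * k + 1) * N = n * (k * N) + N by ring] at h2
  have h3 := weightedIdeal_add_le w.ga_pos _ h2
  rw [h.vanishingIdeal_E hχ, h.vanishingIdeal_Rtilde hχ] at h3
  obtain ⟨x, hx, y, hy, hxy⟩ := Submodule.mem_sup.1 h3
  obtain ⟨x', hx', rfl⟩ := Ideal.mem_span_singleton_mul.1 hx
  obtain ⟨y', hy', rfl⟩ := Ideal.mem_span_singleton_mul.1 hy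
  rw [← h.vanishingIdeal_E hχ, ← h.vanishingIdeal_Rtilde hχ] at hx' hy'
  have e : ((s : FunctionField) / (g : FunctionField) ^ k) ^ N =
      uu ξ * (x' / (g : FunctionField) ^ (k * N)) + rho ξ * (y' / (g : FunctionField) ^ (k * N)) := by
    rw [div_pow, ← pow_mul, ← SubmonoidClass.coe_pow, ← hxy]
    push_cast
    ring
  rw [e]
  exact add_mem_mx (mul_mem_mx' hu (hl.1 (div_pow_mem_projChart hx')))
    (mul_mem_mx' hρ (hl.1 (div_pow_mem_projChart hy')))

lemma isDiscreteValuationRing_divF (hξ : IsCoord ξ) :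
    IsDiscreteValuationRing (divF w hξ).toSubring := isDiscreteValuationRing_divPt _

lemma IsGood.exists_div (hξ : IsCoord ξ) (h : IsGood ξ O) (k : FunctionField) :
    ∃ a ∈ O.toSubring, ∃ s ∈ O.toSubring, k = a / s := by
  obtain ⟨f, g, -, hk⟩ := hξ.blowE.frac k
  exact ⟨_, h.locOf.1 (aeval_mem_adjoin _ f), _, h.locOf.1 (aeval_mem_adjoin _ g), hk⟩

/-- The weighted ideals are the valuation ideals of `F`, so lying in degree `n` but not in degree `n
+ 1` pins the order to `n / g`. -/
lemma IsGood.unit_of_notMem (hχ : IsChart ξ) (h : IsGood ξ O) {n M : ℕ} (hn : n = w.g * M)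
    {k : O.toSubring} (hk : k ∈ wIdeal w O n) (hk' : k ∉ wIdeal w O (n + 1)) :
    tt ^ (-M : ℤ) * (k : FunctionField) ∈ (divF w hχ.isCoord).toSubring ∧
    (tt ^ (-M : ℤ) * (k : FunctionField))⁻¹ ∈ (divF w hχ.isCoord).toSubring := by
  obtain ⟨N, hN, h1⟩ := h.order_of_mem_wIdeal hχ hk
  have hNM : N = M := by
    have h2 : ¬ (n + 1 ≤ w.g * N) := fun h3 => hk' (h.mem_wIdeal_of_order hχ h3 h1)
    have h3 : w.g * N = w.g * M := by omega
    exact Nat.eq_of_mul_eq_mul_left w.g_pos h3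
  subst hNM
  refine ⟨h1, notMem_mx_of_sum hχ.isCoord h1 fun h4 => hk' ?_⟩
  refine h.mem_wIdeal_of_order hχ (N := N + 1) ?_ h4
  have := w.g_pos
  rw [hn, mul_add]
  omega

/-- There is no other exceptional prime divisor. -/
lemma exists_eq_divF (hP : P ∈ (Y (w.g * w.a) (w.g * w.b)).points) (hP' : P ∉ Xtilde.points)
    [IsDiscreteValuationRing P.toSubring] : ∃ ξ, ∃ hχ : IsChart ξ, P = divF w hχ.isCoord := by
  obtain ⟨ξ, hχ, O, hO, n, hn, g, hg, hg0, hl, hu, hρ⟩ := exists_isGood hP hP'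
  refine ⟨ξ, hχ, ?_⟩
  have hgk : (g : FunctionField) ≠ 0 := fun h => hg0 (Subtype.ext h)
  have hOP := (le_projChart wIdeal_zero).trans hl.1
  have ht := tt_ne_zero w hχ.isCoord
  refine eq_of_le_of_isDiscreteValuationRing (u := uu ξ) (fun k => ?_) ?_
    (hOP hO.uu_mem.1) (uu_mem_mx_divF w hχ.isCoord) hχ.isCoord.uu_ne_zero
  · obtain ⟨a, ha, s, hs, h⟩ := hO.exists_div hχ.isCoord k
    exact ⟨a, hOP ha, s, hOP hs, h⟩
  -- Excess weight of `g` would make `g / g = 1` a nonunit at `P`.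
  have hg1 : g ∉ wIdeal w O (n + 1) := fun hc => one_notMem_mx P (by
    have := hO.div_pow_mem_mx hχ hl hu hρ (k := 1) (s := g) (by rwa [mul_one])
    rwa [pow_one, div_self hgk] at this)
  obtain ⟨M, hM⟩ : ∃ M, n = w.g * M := by
    obtain ⟨M, hM, h1⟩ := hO.order_of_mem_wIdeal hχ hg
    refine ⟨M, ?_⟩
    have h2 : ¬ (n + 1 ≤ w.g * M) := fun h3 => hg1 (hO.mem_wIdeal_of_order hχ h3 h1)
    omega
  obtain ⟨hgF, hgF'⟩ := hO.unit_of_notMem hχ hM hg hg1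
  have hnum : ∀ k (s : O.toSubring), s ∈ wIdeal w O (n * k) →
      (s : FunctionField) / (g : FunctionField) ^ k ∈ (divF w hχ.isCoord).toSubring := by
    intro k s hs
    obtain ⟨N, hN, h1⟩ := hO.order_of_mem_wIdeal hχ hs
    have hMN : M * k ≤ N := by
      rw [hM, mul_assoc] at hN
      exact Nat.le_of_mul_le_mul_left hN w.g_pos
    have e : (s : FunctionField) / (g : FunctionField) ^ k =
        divCoord w ξ 1 ^ (N - M * k) * (divCoord w ξ 1 ^ (-N : ℤ) * s) * ((divCoord w ξ 1 ^ (-M : ℤ) * g)⁻¹) ^ k := by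
      rw [inv_pow, mul_pow, ← zpow_natCast (divCoord w ξ 1 ^ (-M : ℤ)), ← zpow_mul, zpow_neg,
        zpow_natCast, neg_mul, zpow_neg, ← Nat.cast_mul, zpow_natCast,
        show divCoord w ξ 1 ^ N = divCoord w ξ 1 ^ (N - M * k) * divCoord w ξ 1 ^ (M * k) by rw [← pow_add]; congr 1; omega]
      field_simp
    rw [e]
    exact Subring.mul_mem _ (Subring.mul_mem _ (Subring.pow_mem _
      (coord_mem_divPt (hχ.isCoord.div w) 1) _) h1) (Subring.pow_mem _ hgF' k)
  intro z hz
  obtain ⟨α, hα, β, hβ, h0, h1, rfl⟩ := hl.2 z hz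
  have hmul : ∀ m l, ∀ s ∈ wIdeal w O m, ∀ t ∈ wIdeal w O l, s * t ∈ wIdeal w O (m + l) :=
    fun m l s hs t ht => weightedIdeal_mul hs ht
  obtain ⟨k, s, hs, rfl⟩ := exists_of_mem_projChart hO.locOf.hasConst wIdeal_zero hmul hg hg0 hβ
  obtain ⟨l, t, ht', rfl⟩ := exists_of_mem_projChart hO.locOf.hasConst wIdeal_zero hmul hg hg0 hα
  refine div_mem_of_inv_mem (hnum l t ht') ?_
  -- A denominator invertible at `P` has no excess weight, so it stays invertible along `F`; this
  -- gives the inclusion of local rings.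
  have hs1 : s ∉ wIdeal w O (n * k + 1) := fun hc =>
    notMem_mx_of_inv_mem h0 h1 (hO.div_pow_mem_mx hχ hl hu hρ hc)
  obtain ⟨hsF, hsF'⟩ := hO.unit_of_notMem hχ (M := M * k) (by rw [hM, mul_assoc]) hs hs1
  have e : ((s : FunctionField) / (g : FunctionField) ^ k)⁻¹ =
      (divCoord w ξ 1 ^ (-M : ℤ) * g) ^ k * (divCoord w ξ 1 ^ (-(M * k : ℕ) : ℤ) * s)⁻¹ := by
    rw [mul_pow, ← zpow_natCast (divCoord w ξ 1 ^ (-M : ℤ)), ← zpow_mul, neg_mul, ← Nat.cast_mul, mul_inv]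
    have := zpow_ne_zero (-((M * k : ℕ) : ℤ)) ht
    field_simp
  rw [e]
  exact Subring.mul_mem _ (Subring.pow_mem _ hgF k) hsF'

/-- The generic point of `E ∩ R̃`. -/
lemma isGood_pt (hξ : IsCoord ξ) : IsGood ξ (pt hξ.blowE (coordIdeal {1, 2})) :=
  ⟨locOf_pt _ _, coord_mem_mx_pt (i := 1) hξ.blowE (by simp),
    coord_mem_mx_pt (i := 2) hξ.blowE (by simp)⟩

/-- The chart of `u ^ b`, of weight `g a b`, contains the divisor. Raising a denominator to the
power `a b` makes its order along `F` a multiple of `a b`, the order of `u ^ b`, so every fraction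
regular along `F` becomes a quotient of elements of the chart. -/
lemma divF_mem_Y (hχ : IsChart ξ) :
    divF w hχ.isCoord ∈ (Y (w.g * w.a) (w.g * w.b)).points := by
  set O := pt hχ.isCoord.blowE (coordIdeal {1, 2}) with hO
  have hgood : IsGood ξ O := isGood_pt hχ.isCoord
  set g : O.toSubring := ⟨uu ξ, hgood.uu_mem.1⟩ ^ w.b with hg
  have hu0 := hχ.isCoord.uu_ne_zero
  have hgu : (g : FunctionField) = uu ξ ^ w.b := rfl
  have hg0 : g ≠ 0 := fun h => pow_ne_zero w.b hu0 (by rw [← hgu, h]; rfl)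
  have ht := tt_ne_zero w hχ.isCoord
  have hordg : ∀ k : ℕ, tt ^ (-(w.a * w.b * k : ℕ) : ℤ) * (g : FunctionField) ^ k ∈
      (divF w hχ.isCoord).toSubring ∧ (tt ^ (-(w.a * w.b * k : ℕ) : ℤ) * (g : FunctionField) ^ k)⁻¹ ∈
      (divF w hχ.isCoord).toSubring := by
    intro k
    obtain ⟨h1, h2⟩ := order_uu w hχ.isCoord
    have e : tt ^ (-(w.a * w.b * k : ℕ) : ℤ) * (g : FunctionField) ^ k =
        (tt ^ (-w.a : ℤ) * uu ξ) ^ (w.b * k) := by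
      rw [hgu, mul_pow, ← zpow_natCast (tt ^ (-w.a : ℤ)), ← zpow_mul, ← pow_mul]
      congr 2
      push_cast
      ring
    rw [e, ← inv_pow]
    exact ⟨Subring.pow_mem _ h1 _, Subring.pow_mem _ h2 _⟩
  refine mem_Y.2 ⟨O, hgood.isE.mem_Xtilde hχ, w.g * (w.a * w.b),
    Nat.mul_pos w.g_pos (Nat.mul_pos w.a_pos w.b_pos), g, ?_, hg0, ?_, ?_⟩
  · rw [hgood.wIdeal_eq hχ]
    exact Ideal.subset_span ⟨w.b, 0, by rw [mul_zero, add_zero, mul_assoc], by simp [hg]⟩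
  · refine projChart_le (hasConst_divF w hχ.isCoord) fun k s hs => ?_
    obtain ⟨N, hN, h1⟩ := hgood.order_of_mem_wIdeal hχ hs
    have hMN : w.a * w.b * k ≤ N := by
      rw [mul_assoc w.g] at hN
      exact Nat.le_of_mul_le_mul_left hN w.g_pos
    have e : (s : FunctionField) / (g : FunctionField) ^ k = tt ^ (N - w.a * w.b * k) *
        (tt ^ (-N : ℤ) * s) * (tt ^ (-(w.a * w.b * k : ℕ) : ℤ) * (g : FunctionField) ^ k)⁻¹ := by
      have hgk : (g : FunctionField) ≠ 0 := fun h => hg0 (Subtype.ext h)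
      rw [zpow_neg, zpow_natCast, zpow_neg, zpow_natCast,
        show tt ^ N = tt ^ (N - w.a * w.b * k) * tt ^ (w.a * w.b * k) by
          rw [← pow_add]; congr 1; omega]
      field_simp
    rw [e]
    exact Subring.mul_mem _ (Subring.mul_mem _ (Subring.pow_mem _
      (coord_mem_divPt (hχ.isCoord.div w) 1) _) h1) (hordg k).2
  · intro z hz
    obtain ⟨f, h, hh0, rfl⟩ := hχ.isCoord.blowE.frac z
    have hF := aeval_blowE_mem w hχ.isCoord h
    obtain ⟨M, l, hl, hl', hh⟩ := exists_eq_pow_mul_unit (hχ.isCoord.div w) hF hh0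
    -- The fraction `ζ / η` will be rewritten as `ζ η ^ c / η ^ (a b)`.
    obtain ⟨c, hc⟩ : ∃ c, w.a * w.b = c + 1 :=
      ⟨w.a * w.b - 1, by have := Nat.mul_pos w.a_pos w.b_pos; omega⟩
    have hlinv := inv_mem_of_notMem_mx hl hl'
    have hl0 : l ≠ 0 := ne_zero_of_notMem_mx hl'
    have hOm : ∀ G : ChartRing, MvPolynomial.aeval (blowE ξ) G ∈ O.toSubring := fun G =>
      hgood.locOf.1 (aeval_mem_adjoin _ G)
    set η := MvPolynomial.aeval (blowE ξ) h with hη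
    set ζ := MvPolynomial.aeval (blowE ξ) f with hζ
    have hA : ∀ G : O.toSubring, tt ^ (-(w.a * w.b * M : ℕ) : ℤ) * (G : FunctionField) ∈
        (divF w hχ.isCoord).toSubring → (G : FunctionField) / (g : FunctionField) ^ M ∈
        (projChart (wIdeal w O) (w.g * (w.a * w.b)) g).toSubring := by
      intro G hG
      exact div_pow_mem_projChart (hgood.mem_wIdeal_of_order hχ (by rw [mul_assoc]) hG)
    have hηl : tt ^ (-(w.a * w.b * M : ℕ) : ℤ) * η ^ (w.a * w.b) = l ^ (w.a * w.b) := by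
      rw [hh, mul_pow, ← pow_mul, zpow_neg, zpow_natCast, mul_comm M]
      field_simp
    have e1 := hA ⟨η ^ (w.a * w.b), Subring.pow_mem _ (hOm h) _⟩ (by
      change _ * η ^ (w.a * w.b) ∈ _
      rw [hηl]
      exact Subring.pow_mem _ hl _)
    have hz' : ζ * η ^ c = (ζ / η) * η ^ (w.a * w.b) := by
      rw [hc, pow_succ]
      field_simp
    have e2 := hA ⟨ζ * η ^ c, Subring.mul_mem _ (hOm f) (Subring.pow_mem _ (hOm h) _)⟩ (by
      change _ * (ζ * η ^ c) ∈ _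
      rw [hz', mul_left_comm, hηl]
      exact Subring.mul_mem _ hz (Subring.pow_mem _ hl _))
    have hgk : (g : FunctionField) ≠ 0 := fun h => hg0 (Subtype.ext h)
    refine ⟨_, e2, _, e1, ?_, ?_, ?_⟩
    · exact div_ne_zero (pow_ne_zero _ hh0) (pow_ne_zero _ hgk)
    · have e3 : (η ^ (w.a * w.b) / (g : FunctionField) ^ M)⁻¹ =
          tt ^ (-(w.a * w.b * M : ℕ) : ℤ) * (g : FunctionField) ^ M * l⁻¹ ^ (w.a * w.b) := by
        rw [inv_pow, ← hηl, mul_inv]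
        have := zpow_ne_zero (-((w.a * w.b * M : ℕ) : ℤ)) ht
        field_simp
      change (η ^ (w.a * w.b) / (g : FunctionField) ^ M)⁻¹ ∈ _
      rw [e3]
      exact Subring.mul_mem _ (hordg M).1 (Subring.pow_mem _ hlinv _)
    · change ζ / η = ζ * η ^ c / (g : FunctionField) ^ M / (η ^ (w.a * w.b) / (g : FunctionField) ^ M)
      rw [hc, pow_succ]
      field_simp

/-- Along `F` the functions `r / u` and `θ = ρ ^ a / u ^ b` are regular. The first excludes points
of `X`, the second points of `E`, because `u` vanishes along `F`. -/
lemma divF_notMem_Xtilde (hχ : IsChart ξ) : divF w hχ.isCoord ∉ Xtilde.points := by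
  intro hmem
  have hc := coord_mem_divF w hχ.isCoord
  have hb := blowE_mem_divF w hχ.isCoord
  have hX : divF w hχ.isCoord ∉ X.points := by
    intro hX
    have hl := hχ.locOf hX hc
    rw [← adjoin_curveCoord] at hl
    refine hχ.isCoord.curve.div_notMem hl (i := 1) (j := 2) (by decide)
      (uu_mem_mx_divF w hχ.isCoord) one_ne_zero 1 ?_
    rw [pow_one, pow_one]
    exact hb 2
  refine hχ.isCoord.blowE.div_notMem (hχ.locOf_blowE ⟨hmem, hX⟩ hb) (i := 1) (j := 2) (by decide)
    (uu_mem_mx_divF w hχ.isCoord) w.b_pos.ne' w.a ?_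
  exact coord_mem_divPt (hχ.isCoord.div w) 2

end

/-! ### The two charts give the same divisor -/

section

variable {K : Type*} [Field K] [Algebra ℂ K] {ξ : Fin 3 → K} {w : Weights}

lemma uu_invCoord (hξ : IsCoord ξ) : uu (invCoord ξ) = uu ξ * (-ξ 1 / (ξ 0 * vee ξ)) := by
  have h0 := hξ.ne_zero 0
  have hv := hξ.vee_ne_zero
  have hv' : vee ξ = (ξ 0 + ξ 1) * ξ 2 - ξ 0 * ξ 1 := rfl
  change ξ 2 / vee ξ - (ξ 0)⁻¹ = (ξ 2 - ξ 0) * _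
  field_simp
  linear_combination -hv'

lemma rr_invCoord (hξ : IsCoord ξ) : rr (invCoord ξ) = rr ξ * (-1 / (ξ 0 * ξ 1)) := by
  have h0 := hξ.ne_zero 0
  have h1 := hξ.ne_zero 1
  change (ξ 0)⁻¹ - (ξ 1)⁻¹ = (ξ 0 - ξ 1) * _
  field_simp
  ring

lemma rho_invCoord (hξ : IsCoord ξ) : rho (invCoord ξ) = rho ξ * (vee ξ / ξ 1 ^ 2) := by
  have h0 := hξ.ne_zero 0
  have h1 := hξ.ne_zero 1
  have hv := hξ.vee_ne_zero
  have hu := hξ.uu_ne_zero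
  rw [rho, uu_invCoord hξ, rr_invCoord hξ, rho]
  field_simp

/-- Modulo the maximal ideal `y = x` and `v = x²`, and `x` is a unit, being a coordinate other than
`t`. -/
lemma units_divF (hξ : IsCoord ξ) : ∀ s ∈ ({ξ 0, ξ 1, vee ξ} : Set K),
    s ∈ (divF w hξ).toSubring ∧ s⁻¹ ∈ (divF w hξ).toSubring := by
  have hc := coord_mem_divF w hξ
  have h0 : ξ 0 ∉ mx (divF w hξ) := coord_notMem_mx_divPt (hξ.div w) (i := 0) (by decide)
  have hu := uu_mem_mx_divF w hξ
  have hr : rr ξ ∈ mx (divF w hξ) := by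
    rw [← uu_mul_rho hξ]
    exact mul_mem_mx hu.1 (rho_mem_mx_divF w hξ)
  have h1 : ξ 1 ∉ mx (divF w hξ) := by
    have := notMem_mx_add h0 (neg_mem_mx hr)
    rwa [show ξ 0 + -rr ξ = ξ 1 by rw [rr]; ring] at this
  have hv : vee ξ ∉ mx (divF w hξ) := by
    have := notMem_mx_add (mul_notMem_mx (hc 0) (hc 0) h0 h0)
      (sub_mem_mx (mul_mem_mx (Subring.add_mem _ (hc 0) (hc 0)) hu) (mul_mem_mx hr.1 hu))
    rwa [show ξ 0 * ξ 0 + ((ξ 0 + ξ 0) * uu ξ - rr ξ * uu ξ) = vee ξ by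
      rw [rr, uu, vee]; ring] at this
  rintro s (rfl | rfl | rfl)
  · exact ⟨hc 0, inv_mem_of_notMem_mx (hc 0) h0⟩
  · exact ⟨hc 1, inv_mem_of_notMem_mx (hc 1) h1⟩
  · exact ⟨vee_mem hc, inv_mem_of_notMem_mx (vee_mem hc) hv⟩

/-- The reversal multiplies `u` and `ρ` by products of `±1`, `x`, `y`, `v` and their inverses, units
along the divisor, so `t` and `θ` change by units as well. The new valuation ring is then a
localization of the old coordinate ring, contained in the old valuation ring, and maximality gives
equality. -/
lemma divF_invCoord (hξ : IsCoord ξ) : divF w hξ.inv = divF w hξ := by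
  set F := divF w hξ.inv with hF
  set A := Algebra.adjoin ℂ (Set.range (divCoord w ξ)) with hA
  have h0 := hξ.ne_zero 0
  have h1 := hξ.ne_zero 1
  have hv := hξ.vee_ne_zero
  have hu := hξ.uu_ne_zero
  have hρ := hξ.rho_ne_zero
  have hunit : ∀ s ∈ ({ξ 0, ξ 1, vee ξ} : Set K), s ∈ F.toSubring ∧ s⁻¹ ∈ F.toSubring := by
    have h := units_divF (w := w) hξ.inv
    rintro s (rfl | rfl | rfl)
    · have := h ((ξ 0)⁻¹) (by simp [invCoord])
      rwa [inv_inv, and_comm] at this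
    · have := h ((ξ 1)⁻¹) (by simp [invCoord])
      rwa [inv_inv, and_comm] at this
    · have := h ((vee ξ)⁻¹) (by simp [vee_invCoord hξ])
      rwa [inv_inv, and_comm] at this
  have hα : ∀ B : Subring K, (∀ s ∈ ({ξ 0, ξ 1, vee ξ} : Set K), s ∈ B ∧ s⁻¹ ∈ B) →
      (-ξ 1 / (ξ 0 * vee ξ) ∈ B ∧ (-ξ 1 / (ξ 0 * vee ξ))⁻¹ ∈ B) ∧
      (vee ξ / ξ 1 ^ 2 ∈ B ∧ (vee ξ / ξ 1 ^ 2)⁻¹ ∈ B) := by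
    intro B hB
    obtain ⟨a0, b0⟩ := hB (ξ 0) (by simp)
    obtain ⟨a1, b1⟩ := hB (ξ 1) (by simp)
    obtain ⟨av, bv⟩ := hB (vee ξ) (by simp)
    refine ⟨⟨?_, ?_⟩, ?_, ?_⟩
    · rw [div_eq_mul_inv, mul_inv]
      exact B.mul_mem (B.neg_mem a1) (B.mul_mem b0 bv)
    · rw [inv_div, div_eq_mul_inv, inv_neg]
      exact B.mul_mem (B.mul_mem a0 av) (B.neg_mem b1)
    · rw [div_eq_mul_inv, ← inv_pow]
      exact B.mul_mem av (B.pow_mem b1 2)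
    · rw [inv_div, div_eq_mul_inv]
      exact B.mul_mem (B.pow_mem a1 2) bv
  set α := -ξ 1 / (ξ 0 * vee ξ) with hαdef
  set β := vee ξ / ξ 1 ^ 2 with hβdef
  have hα0 : α ≠ 0 := div_ne_zero (neg_ne_zero.2 h1) (mul_ne_zero h0 hv)
  have hβ0 : β ≠ 0 := div_ne_zero hv (pow_ne_zero _ h1)
  have e1 : divCoord w (invCoord ξ) 1 = divCoord w ξ 1 * (α ^ w.q * β⁻¹ ^ w.p) := by
    change uu (invCoord ξ) ^ w.q / rho (invCoord ξ) ^ w.p = uu ξ ^ w.q / rho ξ ^ w.p * _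
    rw [uu_invCoord hξ, rho_invCoord hξ, mul_pow, mul_pow, mul_div_mul_comm, inv_pow,
      div_eq_mul_inv (α ^ w.q)]
  have e2 : divCoord w (invCoord ξ) 2 = divCoord w ξ 2 * (β ^ w.a * α⁻¹ ^ w.b) := by
    change rho (invCoord ξ) ^ w.a / uu (invCoord ξ) ^ w.b = rho ξ ^ w.a / uu ξ ^ w.b * _
    rw [uu_invCoord hξ, rho_invCoord hξ, mul_pow, mul_pow, mul_div_mul_comm, inv_pow,
      div_eq_mul_inv (β ^ w.a)]
  obtain ⟨⟨hαF, hαF'⟩, hβF, hβF'⟩ := hα _ hunit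
  have hcF : ∀ i, divCoord w (invCoord ξ) i ∈ F.toSubring := coord_mem_divPt (hξ.inv.div w)
  have f1 : divCoord w ξ 1 = divCoord w (invCoord ξ) 1 * (α⁻¹ ^ w.q * β ^ w.p) := by
    rw [e1, inv_pow, inv_pow]
    field_simp
  have f2 : divCoord w ξ 2 = divCoord w (invCoord ξ) 2 * (β⁻¹ ^ w.a * α ^ w.b) := by
    rw [e2, inv_pow, inv_pow]
    field_simp
  have hf1 : α⁻¹ ^ w.q * β ^ w.p ∈ F.toSubring :=
    Subring.mul_mem _ (Subring.pow_mem _ hαF' _) (Subring.pow_mem _ hβF _)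
  have hAF : A.toSubring ≤ F.toSubring := by
    refine (hasConst_divF w hξ.inv).adjoin_le fun i => ?_
    fin_cases i
    · exact (hunit (ξ 0) (by simp)).1
    · change divCoord w ξ 1 ∈ _
      rw [f1]
      exact Subring.mul_mem _ (hcF 1) hf1
    · change divCoord w ξ 2 ∈ _
      rw [f2]
      exact Subring.mul_mem _ (hcF 2)
        (Subring.mul_mem _ (Subring.pow_mem _ hβF' _) (Subring.pow_mem _ hαF _))
  have hm := mem_adjoin_range (divCoord w ξ)
  have hξA : ∀ i, ξ i ∈ A.toSubring := by
    refine (mem_of_blowE hξ fun i => ?_).1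
    fin_cases i
    · exact hm 0
    · change uu ξ ∈ _
      rw [uu_eq w hξ]
      exact Subring.mul_mem _ (Subring.pow_mem _ (hm 1) _) (Subring.pow_mem _ (hm 2) _)
    · change rho ξ ∈ _
      rw [rho_eq w hξ]
      exact Subring.mul_mem _ (Subring.pow_mem _ (hm 1) _) (Subring.pow_mem _ (hm 2) _)
  have hL : ∀ s ∈ ({ξ 0, ξ 1, vee ξ} : Set K),
      s ∈ locSubring A.toSubring F ∧ s⁻¹ ∈ locSubring A.toSubring F := by
    have key : ∀ s ∈ A.toSubring, s ≠ 0 → s⁻¹ ∈ F.toSubring →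
        s ∈ locSubring A.toSubring F ∧ s⁻¹ ∈ locSubring A.toSubring F :=
      fun s hs h0 h => ⟨le_locSubring _ _ hs, inv_mem_locSubring hs h0 h⟩
    rintro s (rfl | rfl | rfl)
    · exact key _ (hξA 0) h0 (hunit _ (by simp)).2
    · exact key _ (hξA 1) h1 (hunit _ (by simp)).2
    · exact key _ (vee_mem hξA) hv (hunit _ (by simp)).2
  obtain ⟨⟨hαL, hαL'⟩, hβL, hβL'⟩ := hα _ hL
  have hloc : LocOf A.toSubring F := by
    refine (locOf_pt (hξ.inv.div w) (coordIdeal {1})).of_le hAF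
      (adjoin_range_le_locSubring fun i => ?_)
    fin_cases i
    · exact (hL (ξ 0) (by simp)).2
    · change divCoord w (invCoord ξ) 1 ∈ _
      rw [e1]
      exact Subring.mul_mem _ (le_locSubring _ _ (hm 1))
        (Subring.mul_mem _ (Subring.pow_mem _ hαL _) (Subring.pow_mem _ hβL' _))
    · change divCoord w (invCoord ξ) 2 ∈ _
      rw [e2]
      exact Subring.mul_mem _ (le_locSubring _ _ (hm 2))
        (Subring.mul_mem _ (Subring.pow_mem _ hβL _) (Subring.pow_mem _ hαL' _))
  have h1F : divCoord w ξ 1 ∈ mx F := by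
    rw [f1]
    exact mul_mem_mx' (coord_one_mem_mx (hξ.inv.div w)) hf1
  have : IsDiscreteValuationRing F.toSubring := isDiscreteValuationRing_divPt (hξ.inv.div w)
  refine eq_of_le_of_isDiscreteValuationRing (P := F) (fun k => ?_)
    (hloc.le_pt (hξ.div w) (by rintro i rfl; exact h1F)) h1F.1
    (coord_one_mem_mx (hξ.div w)) ((hξ.div w).ne_zero 1)
  obtain ⟨f, g, -, hk⟩ := (hξ.inv.div w).frac k
  exact ⟨_, (locOf_pt (hξ.inv.div w) (coordIdeal {1})).1 (aeval_mem_adjoin _ f), _,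
    (locOf_pt (hξ.inv.div w) (coordIdeal {1})).1 (aeval_mem_adjoin _ g), hk⟩

end

theorem isExceptionalPrimeDivisor_iff {w : Weights} {P : LocalSubring FunctionField} :
    IsExceptionalPrimeDivisor (Y (w.g * w.a) (w.g * w.b)) Xtilde P ↔ P = divF w isCoord_xi := by
  constructor
  · rintro ⟨⟨hY, hX⟩, hD⟩
    obtain ⟨ξ, hχ, rfl⟩ := exists_eq_divF hY hX
    rcases hχ with rfl | rfl
    · rfl
    · exact divF_invCoord isCoord_xi
  · rintro rfl
    exact ⟨⟨divF_mem_Y (Or.inl rfl), divF_notMem_Xtilde (Or.inl rfl)⟩,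
      isDiscreteValuationRing_divF _⟩

end Fano
end

/-! ### The log discrepancy. -/

noncomputable section

namespace Fano

section

variable {K : Type*} [Field K] [Algebra ℂ K] {ξ : Fin 3 → K} {w : Weights}

/-- The coefficient `n * t ^ n / t` avoids the natural subtraction `n - 1`. -/
lemma D_pow (t : K) (n : ℕ) (ht : t ≠ 0) : KaehlerDifferential.D ℂ K (t ^ n) =
    (n * t ^ n / t) • KaehlerDifferential.D ℂ K t := by
  rw [Derivation.leibniz_pow, ← Nat.cast_smul_eq_nsmul K, smul_smul]
  congr 1
  cases n with
  | zero => simp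
  | succ n => rw [Nat.add_sub_cancel, pow_succ]; field_simp

lemma D_pow_mul_pow (t s : K) (n m : ℕ) (ht : t ≠ 0) (hs : s ≠ 0) :
    KaehlerDifferential.D ℂ K (t ^ n * s ^ m) =
      (n * (t ^ n * s ^ m) / t) • KaehlerDifferential.D ℂ K t +
      (m * (t ^ n * s ^ m) / s) • KaehlerDifferential.D ℂ K s := by
  rw [Derivation.leibniz, D_pow t n ht, D_pow s m hs, smul_smul, smul_smul, add_comm]
  congr 2 <;> ring

lemma coordForm_curveCoord (ξ : Fin 3 → K) : coordForm ξ = coordForm (curveCoord ξ) := by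
  rw [coordForm_eq_det_smul (τ := ξ) (σ := curveCoord ξ) !![1, 0, 0; 1, 0, -1; 1, 1, 0]]
  · rw [Matrix.det_fin_three]
    simp
  · have h1 : ξ 1 = ξ 0 - rr ξ := by rw [rr]; ring
    have h2 : ξ 2 = ξ 0 + uu ξ := by rw [uu]; ring
    intro i
    rw [Fin.sum_univ_three]
    fin_cases i
    · simp [curveCoord]
    · simp only [Fin.mk_one, curveCoord]
      conv_lhs => rw [h1, map_sub]
      simp [sub_eq_add_neg]
    · simp only [Fin.reduceFinMk, curveCoord]
      conv_lhs => rw [h2, map_add]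
      simp

lemma coordForm_blowE (hξ : IsCoord ξ) : coordForm (curveCoord ξ) = uu ξ • coordForm (blowE ξ) := by
  rw [coordForm_eq_det_smul (τ := curveCoord ξ) (σ := blowE ξ) !![1, 0, 0; 0, 1, 0; 0, rho ξ, uu ξ]]
  · rw [Matrix.det_fin_three]
    simp
  · intro i
    rw [Fin.sum_univ_three]
    fin_cases i
    · simp [curveCoord, blowE, blowCoord]
    · simp [curveCoord, blowE, blowCoord]
    · simp only [Fin.reduceFinMk, curveCoord, Matrix.cons_val, ← uu_mul_rho hξ, Derivation.leibniz]
      simp [blowE, blowCoord, rho, add_comm]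

/-- Logarithmically, `du/u ∧ dρ/ρ = (a q - b p) dt/t ∧ dθ/θ`, and the coefficient is `1`. -/
lemma coordForm_divCoord (hξ : IsCoord ξ) : coordForm (blowE ξ) =
    (uu ξ * rho ξ / (divCoord w ξ 1 * divCoord w ξ 2)) • coordForm (divCoord w ξ) := by
  have h1 := (hξ.div w).ne_zero 1
  have h2 := (hξ.div w).ne_zero 2
  set t := divCoord w ξ 1 with ht
  set s := divCoord w ξ 2 with hs
  rw [coordForm_eq_det_smul (τ := blowE ξ) (σ := divCoord w ξ) !![1, 0, 0;
    0, w.a * uu ξ / t, w.p * uu ξ / s; 0, w.b * rho ξ / t, w.q * rho ξ / s]]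
  · congr 1
    rw [Matrix.det_fin_three]
    have hb : (w.a : K) * w.q = w.b * w.p + 1 := by exact_mod_cast congrArg (Nat.cast (R := K)) w.bezout
    simp only [Matrix.of_apply, Matrix.cons_val]
    field_simp
    linear_combination (rho ξ * uu ξ) * hb
  · intro i
    rw [Fin.sum_univ_three]
    fin_cases i
    · simp [blowE, blowCoord, divCoord]
    · have := D_pow_mul_pow t s w.a w.p h1 h2
      rw [← uu_eq w hξ] at this
      simpa [blowE, blowCoord] using this
    · have := D_pow_mul_pow t s w.b w.q h1 h2
      rw [← rho_eq w hξ] at this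
      simpa [blowE, blowCoord, rho] using this

/-- The Jacobian determinant of the coordinates `x, t, θ`. -/
lemma coordForm_eq_smul (hξ : IsCoord ξ) : ∃ ε ∈ (divF w hξ).toSubring,
    ε⁻¹ ∈ (divF w hξ).toSubring ∧ ε ≠ 0 ∧
    coordForm ξ = (divCoord w ξ 1 ^ (2 * w.a + w.b - 1) * ε) • coordForm (divCoord w ξ) := by
  have h1 := (hξ.div w).ne_zero 1
  have h2 := (hξ.div w).ne_zero 2
  have hs := coord_mem_divPt (hξ.div w) 2
  have hs' := coord_inv_mem_divPt (hξ.div w) (i := 2) (by decide)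
  refine ⟨divCoord w ξ 2 ^ (2 * w.p + w.q) * (divCoord w ξ 2)⁻¹,
    Subring.mul_mem _ (Subring.pow_mem _ hs _) hs', ?_,
    mul_ne_zero (pow_ne_zero _ h2) (inv_ne_zero h2), ?_⟩
  · rw [mul_inv, inv_inv, ← inv_pow]
    exact Subring.mul_mem _ (Subring.pow_mem _ hs' _) hs
  · rw [coordForm_curveCoord, coordForm_blowE hξ, coordForm_divCoord (w := w) hξ, smul_smul]
    congr 1
    obtain ⟨c, hc⟩ : ∃ c, 2 * w.a + w.b = c + 1 := ⟨2 * w.a + w.b - 1, by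
      have := w.a_pos; omega⟩
    have h3 : uu ξ * (uu ξ * rho ξ) = divCoord w ξ 1 ^ (2 * w.a + w.b) *
        divCoord w ξ 2 ^ (2 * w.p + w.q) := by
      rw [uu_eq w hξ, rho_eq w hξ]
      ring
    rw [mul_div_assoc', h3, hc, Nat.add_sub_cancel, pow_succ]
    field_simp

end

section

variable {w : Weights}

lemma locOf_of_le_divF {P : LocalSubring FunctionField} (hP : P ∈ X.points)
    (hle : P ≤ divF w isCoord_xi) : LocOf (Algebra.adjoin ℂ (Set.range xi)).toSubring P :=
  (mem_X.1 hP).locOf_adjoin isCoord_xi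
    ((mem_X.1 hP).coord_mem_of_dominated isCoord_xi hle (coord_mem_divF w isCoord_xi))

lemma mem_pow_smul_regularForms {n : ℕ} {ω : Form3 FunctionField}
    (h : ω ∈ maximalIdeal (divF w isCoord_xi).toSubring ^ n •
      regularForms (divF w isCoord_xi)) :
    ∃ c ∈ (divF w isCoord_xi).toSubring, ω = (divCoord w xi 1 ^ n * c) • coordForm (divCoord w xi) := by
  refine Submodule.smul_induction_on h ?_ ?_
  · intro k hk η hη
    obtain ⟨c, hc, rfl⟩ := exists_smul_of_mem_regularForms (locOf_pt (isCoord_xi.div w) _) hη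
    have h1 := (mem_maximalIdeal_pow (isCoord_xi.div w) k).1 hk
    refine ⟨_, Subring.mul_mem _ h1 hc, ?_⟩
    change (k : FunctionField) • c • coordForm (divCoord w xi) = _
    have := (isCoord_xi.div w).ne_zero 1
    rw [smul_smul, zpow_neg, zpow_natCast]
    congr 1
    field_simp
  · rintro _ _ ⟨c, hc, rfl⟩ ⟨e, he, rfl⟩
    exact ⟨c + e, Subring.add_mem _ hc he, by rw [← add_smul, mul_add]⟩

/-- The log discrepancy of the divisor. -/
theorem le_logDiscrepancy : 2 * w.a + w.b ≤ logDiscrepancy X (divF w isCoord_xi) := by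
  set F := divF w isCoord_xi with hF
  obtain ⟨ε, hε, hε', hε0, hω⟩ := coordForm_eq_smul (w := w) isCoord_xi
  set N := 2 * w.a + w.b - 1 with hN
  have ht : divCoord w xi 1 ≠ 0 := (isCoord_xi.div w).ne_zero 1
  have hne : coordForm (divCoord w xi) ≠ 0 := by
    intro h0
    have h1 := coeffForm_coordForm_xi
    rw [hω, h0, smul_zero, map_zero] at h1
    exact zero_ne_one h1
  have hmem : N ∈ {n : ℕ | ∀ P ∈ X.points, P ≤ F →
      ∀ ω ∈ regularForms P, ω ∈ maximalIdeal F.toSubring ^ n • regularForms F} := by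
    intro P hP hle ω hωP
    obtain ⟨c, hc, rfl⟩ := exists_smul_of_mem_regularForms (locOf_of_le_divF hP hle) hωP
    have htF : divCoord w xi 1 ^ N * (ε * c) ∈ F.toSubring := Subring.mul_mem _
      (Subring.pow_mem _ (coord_mem_divPt (isCoord_xi.div w) 1) _)
      (Subring.mul_mem _ hε ((domination_iff.1 hle).1 hc))
    have h1 : (⟨_, htF⟩ : F.toSubring) ∈ maximalIdeal F.toSubring ^ N := by
      refine (mem_maximalIdeal_pow (isCoord_xi.div w) _).2 ?_
      rw [zpow_neg, zpow_natCast, inv_mul_cancel_left₀ (pow_ne_zero _ ht)]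
      exact Subring.mul_mem _ hε ((domination_iff.1 hle).1 hc)
    have h2 := Submodule.smul_mem_smul h1
      (coordForm_mem_regularForms (P := F) (coord_mem_divPt (isCoord_xi.div w)))
    convert h2 using 1
    rw [hω, smul_smul]
    change _ = (divCoord w xi 1 ^ N * (ε * c)) • coordForm (divCoord w xi)
    congr 1
    ring
  -- The supremum of an unbounded set of natural numbers is `0` by convention, so even the lower
  -- estimate needs boundedness. It follows by testing `dx ∧ dy ∧ dz`, whose order is exactly `N`.
  have hbdd : BddAbove {n : ℕ | ∀ P ∈ X.points, P ≤ F →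
      ∀ ω ∈ regularForms P, ω ∈ maximalIdeal F.toSubring ^ n • regularForms F} := by
    refine ⟨N, fun n hn => ?_⟩
    have hle := (hasConst_divF w isCoord_xi).adjoin_le (coord_mem_divF w isCoord_xi)
    have hl : LocOf _ (center _ _ hle) := locOf_center hle
    obtain ⟨c, hc, h1⟩ := mem_pow_smul_regularForms (hn _ (mem_X.2 (isX_of_locOf hl))
      (center_le hle) (coordForm xi)
      (coordForm_mem_regularForms fun i => hl.1 (mem_adjoin_range xi i)))
    rw [hω] at h1
    have h2 := smul_left_injective _ hne h1
    by_contra! hlt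
    obtain ⟨k, rfl⟩ := Nat.exists_eq_add_of_lt hlt
    have h3 : divCoord w xi 1 * (divCoord w xi 1 ^ k * c * ε⁻¹) = 1 := by
      have h4 : divCoord w xi 1 ^ N * ε = divCoord w xi 1 ^ N * (divCoord w xi 1 *
          (divCoord w xi 1 ^ k * c)) := by
        refine h2.trans ?_
        ring
      have h5 := mul_left_cancel₀ (pow_ne_zero _ ht) h4
      rw [← mul_assoc, ← mul_assoc, ← h5.trans (mul_assoc _ _ _).symm, mul_inv_cancel₀ hε0]
    refine one_notMem_mx F (h3 ▸ mul_mem_mx' (coord_one_mem_mx (isCoord_xi.div w)) ?_)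
    exact Subring.mul_mem _ (Subring.mul_mem _ (Subring.pow_mem _
      (coord_mem_divPt (isCoord_xi.div w) 1) _) hc) hε'
  have := le_csSup hbdd hmem
  rw [logDiscrepancy]
  omega

end

end Fano
end

noncomputable section

namespace Fano

local notation "𝕏" => MvPolynomial.X (R := ℂ) (σ := Fin 3)

/-! ### Substitutions in polynomials -/

section Polynomial

open MvPolynomial

lemma aeval_aeval {B : Type*} [CommRing B] [Algebra ℂ B] (α : Fin 3 → B) (v : Fin 3 → ChartRing)
    (f : ChartRing) : aeval α (aeval v f) = aeval (fun i => aeval α (v i)) f :=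
  comp_aeval_apply v (aeval α) f

lemma degreeOf_aeval_le {v : Fin 3 → ChartRing} {n : Fin 3} {N : ℕ} {f : ChartRing}
    (h : ∀ d ∈ f.support, (∃ i, d i ≠ 0 ∧ v i = 0) ∨ ∑ i, d i * degreeOf n (v i) ≤ N) :
    degreeOf n (aeval v f) ≤ N := by
  rw [aeval_def, eval₂_eq']
  refine (degreeOf_sum_le _ _ _).trans (Finset.sup_le fun d hd => ?_)
  rcases h d hd with ⟨i, hi, hv⟩ | h
  · rw [Finset.prod_eq_zero (Finset.mem_univ i) (by rw [hv, zero_pow hi]), mul_zero]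
    simp
  · rw [algebraMap_eq]
    refine (degreeOf_C_mul_le _ _ _).trans ((degreeOf_prod_le _ _ _).trans (le_trans ?_ h))
    exact Finset.sum_le_sum fun i _ => degreeOf_pow_le _ _ _

/-- The polynomials of degree at most `c` in the last variable. -/
def zDegreeLE (c : ℤ) : Submodule ℂ ChartRing where
  carrier := {f | ∀ d ∈ f.support, (d 2 : ℤ) ≤ c}
  zero_mem' := by simp
  add_mem' := by
    intro f g hf hg d hd
    rcases Finset.mem_union.1 (support_add hd) with h | h
    exacts [hf d h, hg d h]
  smul_mem' := fun c f hf d hd => hf d (support_smul hd)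

lemma mem_zDegreeLE_iff {c : ℕ} {f : ChartRing} : f ∈ zDegreeLE c ↔ degreeOf 2 f ≤ c := by
  rw [degreeOf_le_iff]
  exact forall₂_congr fun d _ => Int.ofNat_le

/-- The degree bound is an integer so that repeated divisions can drive it below zero and end in
this vanishing. -/
lemma zDegreeLE_neg {c : ℤ} (hc : c < 0) {f : ChartRing} (hf : f ∈ zDegreeLE c) : f = 0 := by
  by_contra h
  obtain ⟨d, hd⟩ := Finset.nonempty_of_ne_empty (mt support_eq_empty.1 h)
  have := hf d hd
  omega

lemma zDegreeLE_of_mul {c : ℤ} {g f : ChartRing} (hg : degreeOf 2 g = 1)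
    (h : g * f ∈ zDegreeLE c) : f ∈ zDegreeLE (c - 1) := by
  by_cases hf : f = 0
  · rw [hf]; exact zero_mem _
  have hg0 : g ≠ 0 := by rintro rfl; simp at hg
  rcases lt_or_ge c 0 with hc | hc
  · exact absurd (zDegreeLE_neg hc h) (mul_ne_zero hg0 hf)
  lift c to ℕ using hc
  rw [mem_zDegreeLE_iff, degreeOf_mul_eq hg0 hf, hg] at h
  obtain ⟨c, rfl⟩ : ∃ k, c = k + 1 := ⟨c - 1, by omega⟩
  rw [show ((c + 1 : ℕ) : ℤ) - 1 = (c : ℕ) by push_cast; ring, mem_zDegreeLE_iff]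
  omega

lemma zDegreeLE_mul {c e : ℕ} {g f : ChartRing} (hg : g ∈ zDegreeLE c) (hf : f ∈ zDegreeLE e) :
    g * f ∈ zDegreeLE (c + e : ℕ) := by
  rw [mem_zDegreeLE_iff] at *
  exact (degreeOf_mul_le _ _ _).trans (by omega)

lemma zDegreeLE_pow {c : ℕ} {g : ChartRing} (hg : g ∈ zDegreeLE c) (k : ℕ) :
    g ^ k ∈ zDegreeLE (k * c : ℕ) := by
  rw [mem_zDegreeLE_iff] at *
  exact (degreeOf_pow_le _ _ _).trans (Nat.mul_le_mul_left _ hg)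

/-- The interchange of the first two variables. -/
def swapVars : ChartRing ≃ₐ[ℂ] ChartRing := renameEquiv ℂ (Equiv.swap 0 1)

@[simp] lemma swapVars_X0 : swapVars (𝕏 0) = 𝕏 1 := by simp [swapVars]
@[simp] lemma swapVars_X1 : swapVars (𝕏 1) = 𝕏 0 := by simp [swapVars]
@[simp] lemma swapVars_X2 : swapVars (𝕏 2) = 𝕏 2 := by
  simp [swapVars, Equiv.swap_apply_of_ne_of_ne]

lemma swapVars_swapVars (f : ChartRing) : swapVars (swapVars f) = f := by
  simp [swapVars, rename_rename]
  convert rename_id_apply f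
  funext i
  simp

lemma swapVars_mem_zDegreeLE {c : ℤ} {f : ChartRing} (hf : f ∈ zDegreeLE c) :
    swapVars f ∈ zDegreeLE c := by
  intro d hd
  rw [swapVars, renameEquiv_apply, support_rename_of_injective (Equiv.injective _),
    Finset.mem_image] at hd
  obtain ⟨e, he, rfl⟩ := hd
  rw [Finsupp.mapDomain_equiv_apply]
  simpa [Equiv.swap_apply_of_ne_of_ne] using hf e he

/-- The restriction to the surface `z = x`. -/
def resE : ChartRing →ₐ[ℂ] ChartRing := aeval ![𝕏 0, 𝕏 1, 𝕏 0]

lemma dvd_sub_resE (f : ChartRing) : (𝕏 2 - 𝕏 0 : ChartRing) ∣ f - resE f := by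
  induction f using MvPolynomial.induction_on with
  | C c => simp [resE]
  | add f g hf hg =>
    rw [map_add, add_sub_add_comm]
    exact dvd_add hf hg
  | mul_X f i hf =>
    have h1 : f * 𝕏 i - resE (f * 𝕏 i) = (f - resE f) * 𝕏 i + resE f * (𝕏 i - resE (𝕏 i)) := by
      rw [map_mul]; ring
    rw [h1]
    refine dvd_add (hf.mul_right _) (Dvd.dvd.mul_left ?_ _)
    fin_cases i <;> simp [resE]

lemma exists_eq_mul_of_resE_eq_zero {f : ChartRing} (h : resE f = 0) :
    ∃ g, f = (𝕏 2 - 𝕏 0) * g := by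
  have := dvd_sub_resE f
  rwa [h, sub_zero] at this

end Polynomial

/-! ### Polynomials with bounded poles along the divisors at infinity -/

section Sections

open MvPolynomial

variable {K : Type*} [Field K] [Algebra ℂ K] {ξ : Fin 3 → K}

lemma aeval_swapVars {B : Type*} [CommRing B] [Algebra ℂ B] (α : Fin 3 → B) (f : ChartRing) :
    aeval α (swapVars f) = aeval ![α 1, α 0, α 2] f := by
  rw [swapVars, renameEquiv_apply, aeval_rename]
  congr 2
  funext i
  fin_cases i <;> simp [Equiv.swap_apply_of_ne_of_ne]

/-- The coordinates on the chart of `X` that meets the divisor `y = ∞`. -/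
def yCoord (ξ : Fin 3 → K) : Fin 3 → K := ![ξ 0, (ξ 1)⁻¹, ξ 1 * uu ξ]

lemma IsCoord.y (hξ : IsCoord ξ) : IsCoord (yCoord ξ) := by
  have h1 := hξ.ne_zero 1
  have hm := coord_mem_adjoin (yCoord ξ)
  have hm1 : ξ 1 ∈ IntermediateField.adjoin ℂ (Set.range (yCoord ξ)) := by
    have := inv_mem (hm 1)
    rwa [show (yCoord ξ 1)⁻¹ = ξ 1 from inv_inv _] at this
  refine hξ.of_mem fun i => ?_
  fin_cases i
  · exact hm 0
  · exact hm1
  · have := add_mem (mul_mem (hm 1) (hm 2)) (hm 0)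
    rwa [show yCoord ξ 1 * yCoord ξ 2 + yCoord ξ 0 = ξ 2 by
      simp [yCoord, uu, h1]] at this

lemma divPt_congr {τ σ : Fin 3 → K} (h : τ = σ) (hτ : IsCoord τ) (hσ : IsCoord σ) :
    divPt hτ = divPt hσ := by
  subst h
  rfl

lemma inv_coord_mem_yPt (hξ : IsCoord ξ) : (ξ 1)⁻¹ ∈ mx (divPt hξ.y) := coord_one_mem_mx hξ.y

lemma mem_yPt (hξ : IsCoord ξ) : ξ 0 ∈ (divPt hξ.y).toSubring ∧ ξ 2 ∈ (divPt hξ.y).toSubring ∧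
    vee ξ ∈ (divPt hξ.y).toSubring := by
  have h := coord_mem_divPt hξ.y
  have h1 := hξ.ne_zero 1
  have h2 : ξ 2 ∈ (divPt hξ.y).toSubring := by
    have := Subring.add_mem _ (Subring.mul_mem _ (h 1) (h 2)) (h 0)
    rwa [show yCoord ξ 1 * yCoord ξ 2 + yCoord ξ 0 = ξ 2 by simp [yCoord, uu, h1]] at this
  refine ⟨h 0, h2, ?_⟩
  have := Subring.add_mem _ (h 2) (Subring.mul_mem _ (h 0) h2)
  rwa [show yCoord ξ 2 + yCoord ξ 0 * ξ 2 = vee ξ by simp [yCoord, uu, vee]; ring] at this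

/-- After substituting `z = u + x`, a monomial `xⁱ yʲ uᵏ` has a pole of order `j - k` along `y = ∞`,
since `y u` is a coordinate there. -/
lemma mem_yPt_iff (hξ : IsCoord ξ) (q : ℤ) (f : ChartRing) :
    ξ 1 ^ (-q) * aeval ξ f ∈ (divPt hξ.y).toSubring ↔
      ∀ d ∈ (aeval ![𝕏 0, 𝕏 1, 𝕏 2 + 𝕏 0] f : ChartRing).support, (d 1 : ℤ) ≤ q + d 2 := by
  have hM : (!![1, 0, 0; 0, -1, 0; 0, 1, 1] : Matrix (Fin 3) (Fin 3) ℤ).det ≠ 0 := by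
    rw [Matrix.det_fin_three]
    simp
  have h1 := hξ.ne_zero 1
  have hα : ∀ i, ![ξ 0, ξ 1, uu ξ] i = ∏ j, yCoord ξ j ^
      (!![1, 0, 0; 0, -1, 0; 0, 1, 1] : Matrix (Fin 3) (Fin 3) ℤ) i j := by
    intro i
    rw [Fin.prod_univ_three]
    fin_cases i <;> simp [yCoord, h1]
  have h2 : aeval ξ f = aeval ![ξ 0, ξ 1, uu ξ] (aeval ![𝕏 0, 𝕏 1, 𝕏 2 + 𝕏 0] f : ChartRing) := by
    rw [aeval_aeval]
    congr 2
    funext i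
    fin_cases i <;> simp [uu]
  have h3 := monomial_order hξ.y hM hα (aeval ![𝕏 0, 𝕏 1, 𝕏 2 + 𝕏 0] f) (-q)
  rw [← h2, neg_neg, show yCoord ξ 1 ^ q = ξ 1 ^ (-q) by simp [yCoord]] at h3
  rw [h3]
  refine forall₂_congr fun d _ => ?_
  rw [Fin.sum_univ_three]
  simp only [Matrix.of_apply, Matrix.cons_val]
  constructor <;> intro h <;> linarith

/-- The polynomials in `x, y, z` with poles of orders at most `p, q, c` along the three divisors at
infinity. -/
def sec (hξ : IsCoord ξ) (p q : ℕ) (c : ℤ) : Submodule ℂ ChartRing where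
  carrier := {f | ξ 1 ^ (-q : ℤ) * aeval ξ f ∈ (divPt hξ.y).toSubring ∧
    ξ 0 ^ (-p : ℤ) * aeval ξ f ∈ (divPt hξ.swap.y).toSubring ∧ f ∈ zDegreeLE c}
  zero_mem' := by simp
  add_mem' := by
    rintro f g ⟨h1, h2, h3⟩ ⟨h4, h5, h6⟩
    refine ⟨?_, ?_, add_mem h3 h6⟩ <;> rw [map_add, mul_add]
    exacts [Subring.add_mem _ h1 h4, Subring.add_mem _ h2 h5]
  smul_mem' := by
    rintro k f ⟨h1, h2, h3⟩
    refine ⟨?_, ?_, Submodule.smul_mem _ _ h3⟩ <;> rw [map_smul, Algebra.smul_def, mul_left_comm]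
    exacts [Subring.mul_mem _ (algebraMap_mem_pt _ _ k) h1,
      Subring.mul_mem _ (algebraMap_mem_pt _ _ k) h2]

variable {p q : ℕ} {c : ℤ} {f : ChartRing} (hξ : IsCoord ξ)

lemma sec_swap : f ∈ sec hξ.swap q p c ↔ swapVars f ∈ sec hξ p q c := by
  have h1 : divPt hξ.swap.swap.y = divPt hξ.y := divPt_congr (by rw [swapCoord_swapCoord]) _ _
  have h2 : f ∈ zDegreeLE c ↔ swapVars f ∈ zDegreeLE c := ⟨swapVars_mem_zDegreeLE, fun h => by
    simpa [swapVars_swapVars] using swapVars_mem_zDegreeLE h⟩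
  change _ ∧ _ ∧ _ ↔ _ ∧ _ ∧ _
  rw [h1, aeval_swapVars, h2]
  exact and_left_comm

/-- Division by the equation of the surface `E₁`. -/
lemma sec_of_mul (h : (𝕏 2 - 𝕏 0) * f ∈ sec hξ (p + 1) q c) : f ∈ sec hξ p (q + 1) (c - 1) := by
  obtain ⟨h1, h2, h3⟩ := h
  have hu : aeval ξ (𝕏 2 - 𝕏 0 : ChartRing) = uu ξ := by simp [uu]
  have h0 := hξ.ne_zero 0
  have h10 := hξ.ne_zero 1
  have hu0 := hξ.uu_ne_zero
  refine ⟨?_, ?_, zDegreeLE_of_mul ?_ h3⟩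
  -- Along `y = ∞` the factor `z - x` has a simple zero, so the allowed pole order rises by one.
  · have h4 : (ξ 1 * uu ξ)⁻¹ ∈ (divPt hξ.y).toSubring := coord_inv_mem_divPt hξ.y (i := 2) (by decide)
    have h5 := Subring.mul_mem _ h4 h1
    convert h5 using 1
    rw [map_mul, hu, Nat.cast_add, neg_add, zpow_add₀ h10]
    simp
    field_simp
  -- Along `x = ∞` the function `z` is regular, so `z - x` has a simple pole.
  · have hx := inv_coord_mem_yPt hξ.swap
    have hy := mem_yPt hξ.swap
    have h4 : (uu ξ * (ξ 0)⁻¹)⁻¹ ∈ (divPt hξ.swap.y).toSubring := by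
      have h5 : ξ 2 * (ξ 0)⁻¹ ∈ mx (divPt hξ.swap.y) := mul_mem_mx hy.2.1 hx
      have h6 : uu ξ * (ξ 0)⁻¹ = ξ 2 * (ξ 0)⁻¹ - 1 := by rw [uu, sub_mul, mul_inv_cancel₀ h0]
      rw [h6]
      refine inv_mem_of_notMem_mx (Subring.sub_mem _ h5.1 (Subring.one_mem _)) fun hc => ?_
      exact one_notMem_mx _ (by simpa using sub_mem_mx h5 hc)
    have h5 := Subring.mul_mem _ h4 h2
    convert h5 using 1
    rw [map_mul, hu, Nat.cast_add, neg_add, zpow_add₀ h0]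
    simp
    field_simp
  · apply le_antisymm
    · refine (degreeOf_sub_le _ _ _).trans ?_
      simp [degreeOf_X]
    · have : Finsupp.single 2 1 ∈ (𝕏 2 - 𝕏 0 : ChartRing).support := by
        simp [coeff_X, Finsupp.single_left_inj]
      simpa using le_degreeOf_of_mem_support 2 this

/-- The degrees of the restriction to the surface `z = x`. -/
lemma degreeOf_resE {c : ℕ} (h : f ∈ sec hξ p q c) : degreeOf 2 (resE f) ≤ 0 ∧
    degreeOf 1 (resE f) ≤ q ∧ degreeOf 0 (resE f) ≤ p + 2 * c := by
  obtain ⟨h1, h2, h3⟩ := h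
  have e1 : resE f = aeval ![𝕏 0, 𝕏 1, 0] (aeval ![𝕏 0, 𝕏 1, 𝕏 2 + 𝕏 0] f : ChartRing) := by
    rw [aeval_aeval, resE]
    congr 2
    funext i
    fin_cases i <;> simp
  have hfs : f = swapVars (swapVars f) := (swapVars_swapVars f).symm
  have e2 : resE f = aeval ![𝕏 1, 𝕏 0, 𝕏 0 - 𝕏 1]
      (aeval ![𝕏 0, 𝕏 1, 𝕏 2 + 𝕏 0] (swapVars f) : ChartRing) := by
    conv_lhs => rw [hfs]
    rw [aeval_aeval, resE, aeval_swapVars]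
    congr 2
    funext i
    fin_cases i <;> simp
  refine ⟨?_, ?_, ?_⟩
  · rw [resE]
    refine degreeOf_aeval_le fun d _ => Or.inr ?_
    simp [Fin.sum_univ_three, degreeOf_X]
  -- Terms with a positive power of `u` vanish on `z = x`; the others have degree at most `q` in
  -- `y`.
  · rw [e1]
    refine degreeOf_aeval_le fun d hd => ?_
    have := (mem_yPt_iff hξ q f).1 h1 d hd
    by_cases h0 : d 2 = 0
    · right
      simp [Fin.sum_univ_three, degreeOf_X]
      omega
    · exact Or.inl ⟨2, h0, rfl⟩
  -- On `z = x` the function `z - y` becomes `x - y`. A term `xⁱ (z - y)ᵏ` has `i ≤ p + k` and `k ≤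
  -- c`, so its degree in `x` is at most `i + k ≤ p + 2c`.
  · rw [e2]
    refine degreeOf_aeval_le fun d hd => Or.inr ?_
    have h4 : aeval (swapCoord ξ) (swapVars f) = aeval ξ f := by
      rw [aeval_swapVars]
      exact congrArg (fun τ => aeval τ f) swapCoord_swapCoord
    have h5 := (mem_yPt_iff hξ.swap p (swapVars f)).1 (by rw [h4]; exact h2) d hd
    have h6 : degreeOf 2 (aeval ![𝕏 0, 𝕏 1, 𝕏 2 + 𝕏 0] (swapVars f) : ChartRing) ≤ c := by
      refine degreeOf_aeval_le fun d hd => Or.inr ?_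
      have h7 : degreeOf 2 (𝕏 2 + 𝕏 0 : ChartRing) ≤ 1 :=
        (degreeOf_add_le _ _ _).trans (by simp [degreeOf_X])
      have h8 := swapVars_mem_zDegreeLE h3 d hd
      rw [Fin.sum_univ_three]
      simp only [Matrix.cons_val, degreeOf_X]
      simp
      nlinarith
    have h9 := degreeOf_le_iff.1 h6 d hd
    have h10 : degreeOf 0 (𝕏 0 - 𝕏 1 : ChartRing) ≤ 1 :=
      (degreeOf_sub_le _ _ _).trans (by simp [degreeOf_X])
    rw [Fin.sum_univ_three]
    simp only [Matrix.cons_val, degreeOf_X]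
    simp
    nlinarith

end Sections

end Fano
end

noncomputable section

namespace Fano

local notation "𝕏" => MvPolynomial.X (R := ℂ) (σ := Fin 3)

/-! ### Generators of the spaces of sections -/

section Generators

open MvPolynomial

variable {K : Type*} [Field K] [Algebra ℂ K] {ξ : Fin 3 → K}

/-- The polynomial `v = (x + y) z - x y`. -/
def veePoly : ChartRing := (𝕏 0 + 𝕏 1) * 𝕏 2 - 𝕏 0 * 𝕏 1

lemma aeval_veePoly : aeval ξ veePoly = vee ξ := by simp [veePoly, vee]

lemma inv_pow_mul_pow {y : K} (hy : y ≠ 0) {q j i b s : ℕ} (h : q + j = i + b + s) :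
    (y ^ q)⁻¹ * y ^ b = y⁻¹ ^ s * y⁻¹ ^ i * y ^ j := by
  rw [inv_pow, inv_pow]
  field_simp
  rw [← pow_add, ← pow_add, ← pow_add]
  congr 1
  omega

variable (hξ : IsCoord ξ)

/-- The hypotheses add up the poles of the factors: `x - y` has simple poles along `x = ∞` and `y =
∞`; `z - x` has simple poles along `x = ∞` and at infinity of the third factor, and a zero along `y
= ∞`; `z` and `v` have a pole only at infinity of the third factor. -/
lemma prod_mem_sec {e i j b k l p q c : ℕ} (hp : e + i + j ≤ p) (hq : i + b ≤ q + j)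
    (hc : j + k + l ≤ c) :
    𝕏 0 ^ e * (𝕏 0 - 𝕏 1) ^ i * (𝕏 2 - 𝕏 0) ^ j * 𝕏 1 ^ b * 𝕏 2 ^ k * veePoly ^ l ∈
      sec hξ p q c := by
  have h0 := hξ.ne_zero 0
  have h1 := hξ.ne_zero 1
  refine ⟨?_, ?_, ?_⟩
  · obtain ⟨s, hs⟩ := Nat.exists_eq_add_of_le hq
    obtain ⟨hx, hz, hv⟩ := mem_yPt hξ
    have hy := (inv_coord_mem_yPt hξ).1
    have hu : ξ 1 * uu ξ ∈ (divPt hξ.y).toSubring := coord_mem_divPt hξ.y 2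
    have hr : ξ 0 * (ξ 1)⁻¹ - 1 ∈ (divPt hξ.y).toSubring :=
      Subring.sub_mem _ (Subring.mul_mem _ hx hy) (Subring.one_mem _)
    convert Subring.mul_mem _ (Subring.mul_mem _ (Subring.mul_mem _ (Subring.mul_mem _
      (Subring.mul_mem _ (Subring.pow_mem _ hx e) (Subring.pow_mem _ hr i))
      (Subring.pow_mem _ hu j)) (Subring.pow_mem _ hy s)) (Subring.pow_mem _ hz k))
      (Subring.pow_mem _ hv l) using 1
    have h2 := inv_pow_mul_pow h1 hs
    have h3 : ξ 0 * (ξ 1)⁻¹ - 1 = rr ξ * (ξ 1)⁻¹ := by rw [rr, sub_mul, mul_inv_cancel₀ h1]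
    rw [h3]
    simp only [map_mul, map_pow, map_sub, aeval_X, aeval_veePoly, zpow_neg, zpow_natCast]
    simp only [mul_pow]
    rw [show ξ 0 - ξ 1 = rr ξ from rfl, show ξ 2 - ξ 0 = uu ξ from rfl]
    linear_combination ξ 0 ^ e * rr ξ ^ i * uu ξ ^ j * ξ 2 ^ k * vee ξ ^ l * h2
  · obtain ⟨s, hs⟩ := Nat.exists_eq_add_of_le hp
    obtain ⟨hy, hz, hv⟩ := mem_yPt hξ.swap
    have hx := (inv_coord_mem_yPt hξ.swap).1
    have hu : ξ 2 * (ξ 0)⁻¹ - 1 ∈ (divPt hξ.swap.y).toSubring :=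
      Subring.sub_mem _ (Subring.mul_mem _ hz hx) (Subring.one_mem _)
    have hr : 1 - ξ 1 * (ξ 0)⁻¹ ∈ (divPt hξ.swap.y).toSubring :=
      Subring.sub_mem _ (Subring.one_mem _) (Subring.mul_mem _ hy hx)
    convert Subring.mul_mem _ (Subring.mul_mem _ (Subring.mul_mem _ (Subring.mul_mem _
      (Subring.mul_mem _ (Subring.pow_mem _ hx s) (Subring.pow_mem _ hr i))
      (Subring.pow_mem _ hu j)) (Subring.pow_mem _ hy b)) (Subring.pow_mem _ hz k))
      (Subring.pow_mem _ hv l) using 1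
    have h2 : (ξ 0 ^ p)⁻¹ * ξ 0 ^ e = (ξ 0)⁻¹ ^ s * (ξ 0)⁻¹ ^ (i + j) * ξ 0 ^ 0 :=
      inv_pow_mul_pow h0 (by omega)
    have h3 : 1 - ξ 1 * (ξ 0)⁻¹ = rr ξ * (ξ 0)⁻¹ := by rw [rr, sub_mul, mul_inv_cancel₀ h0]
    have h4 : ξ 2 * (ξ 0)⁻¹ - 1 = uu ξ * (ξ 0)⁻¹ := by rw [uu, sub_mul, mul_inv_cancel₀ h0]
    have h5 : vee (swapCoord ξ) = vee ξ := by simp [vee, swapCoord]; ring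
    change _ = (ξ 0)⁻¹ ^ s * _ * _ * ξ 1 ^ b * ξ 2 ^ k * _
    rw [h3, h4, h5]
    simp only [map_mul, map_pow, map_sub, aeval_X, aeval_veePoly, zpow_neg, zpow_natCast]
    simp only [mul_pow]
    rw [show ξ 0 - ξ 1 = rr ξ from rfl, show ξ 2 - ξ 0 = uu ξ from rfl]
    rw [pow_add] at h2
    linear_combination rr ξ ^ i * uu ξ ^ j * ξ 1 ^ b * ξ 2 ^ k * vee ξ ^ l * h2
  · have hX : ∀ n, 𝕏 n ∈ zDegreeLE (if n = 2 then 1 else 0 : ℕ) := fun n => by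
      rw [mem_zDegreeLE_iff, degreeOf_X]
      split_ifs <;> simp_all
    have hu : 𝕏 2 - 𝕏 0 ∈ zDegreeLE (1 : ℕ) := by
      rw [mem_zDegreeLE_iff]
      exact (degreeOf_sub_le _ _ _).trans (by simp [degreeOf_X])
    have hr : 𝕏 0 - 𝕏 1 ∈ zDegreeLE (0 : ℕ) := sub_mem (hX 0) (hX 1)
    have hv : veePoly ∈ zDegreeLE (1 : ℕ) := by
      rw [mem_zDegreeLE_iff, veePoly]
      refine (degreeOf_sub_le _ _ _).trans (max_le ?_ ?_)
      · refine (degreeOf_mul_le _ _ _).trans ?_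
        have : degreeOf 2 (𝕏 0 + 𝕏 1) ≤ 0 := mem_zDegreeLE_iff.1 (add_mem (hX 0) (hX 1))
        simp only [degreeOf_X]
        simp
        omega
      · refine (degreeOf_mul_le _ _ _).trans ?_
        simp [degreeOf_X]
    have := zDegreeLE_mul (zDegreeLE_mul (zDegreeLE_mul (zDegreeLE_mul (zDegreeLE_mul
      (zDegreeLE_pow (hX 0) e) (zDegreeLE_pow hr i)) (zDegreeLE_pow hu j))
      (zDegreeLE_pow (hX 1) b)) (zDegreeLE_pow (hX 2) k)) (zDegreeLE_pow hv l)
    rw [mem_zDegreeLE_iff] at this ⊢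
    refine this.trans ?_
    simp
    omega

/-- The span of the monomials in `x, y, z, v` of degrees at most `p` and `q` in `x` and `y`, and at
most `c` in `z, v`. -/
def monomialSpan (p q c : ℕ) : Submodule ℂ ChartRing :=
  Submodule.span ℂ {f | ∃ i j k l : ℕ, i ≤ p ∧ j ≤ q ∧ k + l ≤ c ∧
    f = 𝕏 0 ^ i * 𝕏 1 ^ j * 𝕏 2 ^ k * veePoly ^ l}

lemma monomial_mem_monomialSpan {p q c i j k l : ℕ} (hi : i ≤ p) (hj : j ≤ q) (hk : k + l ≤ c) :
    𝕏 0 ^ i * 𝕏 1 ^ j * 𝕏 2 ^ k * veePoly ^ l ∈ monomialSpan p q c :=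
  Submodule.subset_span ⟨i, j, k, l, hi, hj, hk, rfl⟩

lemma monomialSpan_le_sec (p q c : ℕ) : monomialSpan p q c ≤ sec hξ p q c := by
  refine Submodule.span_le.2 ?_
  rintro _ ⟨i, j, k, l, hi, hj, hk, rfl⟩
  have := prod_mem_sec hξ (e := i) (i := 0) (j := 0) (b := j) (k := k) (l := l) (p := p) (q := q)
    (c := c) (by omega) (by omega) (by omega)
  simpa using this

lemma finite_monomialSpan (p q c : ℕ) : Module.Finite ℂ (monomialSpan p q c) := by
  refine Module.Finite.span_of_finite ℂ ?_
  refine Set.Finite.subset (((Finset.range (p + 1) ×ˢ Finset.range (q + 1) ×ˢ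
    Finset.range (c + 1) ×ˢ Finset.range (c + 1)).image fun t : ℕ × ℕ × ℕ × ℕ =>
    𝕏 0 ^ t.1 * 𝕏 1 ^ t.2.1 * 𝕏 2 ^ t.2.2.1 * veePoly ^ t.2.2.2).finite_toSet) ?_
  rintro _ ⟨i, j, k, l, hi, hj, hk, rfl⟩
  rw [Finset.mem_coe, Finset.mem_image]
  refine ⟨(i, j, k, l), ?_, rfl⟩
  simp only [Finset.mem_product, Finset.mem_range]
  omega

lemma swapVars_mem_monomialSpan {p q c : ℕ} {f : ChartRing} (hf : f ∈ monomialSpan p q c) :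
    swapVars f ∈ monomialSpan q p c := by
  have : monomialSpan p q c ≤ (monomialSpan q p c).comap swapVars.toLinearMap := by
    refine Submodule.span_le.2 ?_
    rintro _ ⟨i, j, k, l, hi, hj, hk, rfl⟩
    have hv : swapVars veePoly = veePoly := by simp [veePoly]; ring
    have := monomial_mem_monomialSpan hj hi hk
    simpa [hv, mul_comm (𝕏 0 ^ j)] using this
  exact this hf

/-- When the exponent of `y` is the excessive `q + 1`, the relation `y (z - x) = v - x z` removes
one factor `y`. -/
lemma mul_mem_monomialSpan {p q c : ℕ} {f : ChartRing} (hf : f ∈ monomialSpan p (q + 1) c) :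
    (𝕏 2 - 𝕏 0) * f ∈ monomialSpan (p + 1) q (c + 1) := by
  have : monomialSpan p (q + 1) c ≤
      (monomialSpan (p + 1) q (c + 1)).comap (LinearMap.mulLeft ℂ (𝕏 2 - 𝕏 0)) := by
    refine Submodule.span_le.2 ?_
    rintro _ ⟨i, j, k, l, hi, hj, hk, rfl⟩
    rw [SetLike.mem_coe, Submodule.mem_comap, LinearMap.mulLeft_apply]
    rcases Nat.lt_or_ge q j with h | h
    · obtain rfl : j = q + 1 := le_antisymm hj h
      have h1 := monomial_mem_monomialSpan (i := i) (j := q) (k := k) (l := l + 1)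
        (p := p + 1) (q := q) (c := c + 1) (by omega) le_rfl (by omega)
      have h2 := monomial_mem_monomialSpan (i := i + 1) (j := q) (k := k + 1) (l := l)
        (p := p + 1) (q := q) (c := c + 1) (by omega) le_rfl (by omega)
      have h3 : (𝕏 2 - 𝕏 0) * (𝕏 0 ^ i * 𝕏 1 ^ (q + 1) * 𝕏 2 ^ k * veePoly ^ l) =
          𝕏 0 ^ i * 𝕏 1 ^ q * 𝕏 2 ^ k * veePoly ^ (l + 1) -
          𝕏 0 ^ (i + 1) * 𝕏 1 ^ q * 𝕏 2 ^ (k + 1) * veePoly ^ l := by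
        have hv : veePoly = (𝕏 0 + 𝕏 1) * 𝕏 2 - 𝕏 0 * 𝕏 1 := rfl
        rw [pow_succ veePoly]
        linear_combination (-(𝕏 0 ^ i * 𝕏 1 ^ q * 𝕏 2 ^ k * veePoly ^ l)) * hv
      rw [h3]
      exact sub_mem h1 h2
    · have h1 := monomial_mem_monomialSpan (i := i) (j := j) (k := k + 1) (l := l)
        (p := p + 1) (q := q) (c := c + 1) (by omega) h (by omega)
      have h2 := monomial_mem_monomialSpan (i := i + 1) (j := j) (k := k) (l := l)
        (p := p + 1) (q := q) (c := c + 1) (by omega) h (by omega)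
      have h3 : (𝕏 2 - 𝕏 0) * (𝕏 0 ^ i * 𝕏 1 ^ j * 𝕏 2 ^ k * veePoly ^ l) =
          𝕏 0 ^ i * 𝕏 1 ^ j * 𝕏 2 ^ (k + 1) * veePoly ^ l -
          𝕏 0 ^ (i + 1) * 𝕏 1 ^ j * 𝕏 2 ^ k * veePoly ^ l := by ring
      rw [h3]
      exact sub_mem h1 h2
  exact this hf

/-- The polynomials in `x, y` of degrees at most `p` and `q`. -/
def bidegreeLE (p q : ℕ) : Submodule ℂ ChartRing :=
  Submodule.span ℂ (((Finset.range (p + 1) ×ˢ Finset.range (q + 1)).image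
    fun t : ℕ × ℕ => 𝕏 0 ^ t.1 * 𝕏 1 ^ t.2 : Finset ChartRing) : Set ChartRing)

lemma rank_bidegreeLE (p q : ℕ) :
    Module.rank ℂ (bidegreeLE p q) ≤ ((p + 1) * (q + 1) : ℕ) := by
  refine (rank_span_finset_le _).trans ?_
  rw [Nat.cast_le]
  exact Finset.card_image_le.trans (by simp)

lemma mem_bidegreeLE {p q : ℕ} {f : ChartRing} (h2 : degreeOf 2 f ≤ 0) (h1 : degreeOf 1 f ≤ q)
    (h0 : degreeOf 0 f ≤ p) : f ∈ bidegreeLE p q := by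
  rw [f.as_sum]
  refine Submodule.sum_mem _ fun d hd => ?_
  have h2' := degreeOf_le_iff.1 h2 d hd
  have h1' := degreeOf_le_iff.1 h1 d hd
  have h0' := degreeOf_le_iff.1 h0 d hd
  have h : monomial d (coeff d f) = coeff d f • (𝕏 0 ^ d 0 * 𝕏 1 ^ d 1) := by
    rw [monomial_eq, Finsupp.prod_fintype _ _ (fun _ => pow_zero _), Fin.prod_univ_three,
      smul_eq_C_mul]
    simp [Nat.le_zero.1 h2']
  rw [h]
  refine Submodule.smul_mem _ _ (Submodule.subset_span ?_)
  rw [Finset.mem_coe, Finset.mem_image]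
  exact ⟨(d 0, d 1), by simp; omega, rfl⟩

lemma resE_mem_bidegreeLE {p q c : ℕ} {f : ChartRing} (h : f ∈ sec hξ p q c) :
    resE f ∈ bidegreeLE (p + 2 * c) q := by
  obtain ⟨h2, h1, h0⟩ := degreeOf_resE hξ h
  exact mem_bidegreeLE h2 h1 h0

/-- On `z = x` the functions `z` and `v` restrict to `x` and `x²`. Powers of `v` reach even degrees
up to `2c`; the hypothesis on `p` supplies one factor `x` for the odd ones. -/
lemma bidegreeLE_le_map (p q c : ℕ) (hp : 1 ≤ p) :
    bidegreeLE (p + 2 * c) q ≤ (monomialSpan p q c).map resE.toLinearMap := by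
  refine Submodule.span_le.2 ?_
  intro f hf
  rw [Finset.mem_coe, Finset.mem_image] at hf
  obtain ⟨⟨i, j⟩, hij, rfl⟩ := hf
  simp only [Finset.mem_product, Finset.mem_range] at hij
  obtain ⟨e, k, l, he, hk, rfl⟩ : ∃ e k l, e ≤ p ∧ k + l ≤ c ∧ i = e + k + 2 * l := by
    rcases Nat.lt_or_ge i (2 * c) with h | h
    · exact ⟨i % 2, 0, i / 2, by omega, by omega, by omega⟩
    · exact ⟨i - 2 * c, 0, c, by omega, by omega, by omega⟩
  refine ⟨_, monomial_mem_monomialSpan he (show j ≤ q by omega) hk, ?_⟩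
  simp [resE, veePoly]
  ring

/-- Subtract a combination of monomials with the same restriction to `z = x`; the difference is
divisible by `z - x`, and the quotient falls under the case `c - 1`. -/
lemma sec_le_monomialSpan_aux {p q c : ℕ}
    (ih : ∀ c', c = c' + 1 → sec hξ p (q + 1) c' ≤ monomialSpan p (q + 1) c') :
    sec hξ (p + 1) q c ≤ monomialSpan (p + 1) q c := by
  intro f hf
  obtain ⟨g, hg, hgf⟩ := bidegreeLE_le_map _ _ _ (by omega) (resE_mem_bidegreeLE hξ hf)
  have h1 : resE (f - g) = 0 := by
    rw [map_sub, sub_eq_zero]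
    exact hgf.symm
  obtain ⟨f', hf'⟩ := exists_eq_mul_of_resE_eq_zero h1
  have h2 : (𝕏 2 - 𝕏 0) * f' ∈ sec hξ (p + 1) q c := by
    rw [← hf']
    exact sub_mem hf (monomialSpan_le_sec hξ _ _ _ hg)
  have h3 := sec_of_mul hξ h2
  suffices h : f - g ∈ monomialSpan (p + 1) q c by simpa using add_mem h hg
  rw [hf']
  rcases c with - | c
  · rw [zDegreeLE_neg (by simp) h3.2.2, mul_zero]
    exact zero_mem _
  · rw [show ((c + 1 : ℕ) : ℤ) - 1 = (c : ℕ) by simp] at h3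
    exact mul_mem_monomialSpan (ih c rfl h3)

/-- The sections are spanned by the monomials. -/
lemma sec_le_monomialSpan (c : ℕ) : ∀ {ξ : Fin 3 → K} (hξ : IsCoord ξ) (p q : ℕ), 1 ≤ p + q →
    sec hξ p q c ≤ monomialSpan p q c := by
  induction c with
  | zero =>
    intro ξ hξ p q hpq
    -- Division by `z - x` needs `p ≥ 1`. If `p = 0`, then `q ≥ 1` and the interchange of `x` and
    -- `y` brings the other surface into play.
    rcases p with - | p
    · obtain ⟨q, rfl⟩ : ∃ k, q = k + 1 := ⟨q - 1, by omega⟩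
      intro f hf
      rw [← swapVars_swapVars f] at hf ⊢
      refine swapVars_mem_monomialSpan (sec_le_monomialSpan_aux hξ.swap (by simp) ?_)
      exact (sec_swap hξ).2 hf
    · exact sec_le_monomialSpan_aux hξ (by simp)
  | succ c ih =>
    intro ξ hξ p q hpq
    rcases p with - | p
    · obtain ⟨q, rfl⟩ : ∃ k, q = k + 1 := ⟨q - 1, by omega⟩
      intro f hf
      rw [← swapVars_swapVars f] at hf ⊢
      refine swapVars_mem_monomialSpan (sec_le_monomialSpan_aux hξ.swap ?_ ((sec_swap hξ).2 hf))
      rintro c' hc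
      obtain rfl : c = c' := by omega
      exact ih hξ.swap _ _ (by omega)
    · refine sec_le_monomialSpan_aux hξ ?_
      rintro c' hc
      obtain rfl : c = c' := by omega
      exact ih hξ _ _ (by omega)

lemma finite_sec {p q c : ℕ} (h : 1 ≤ p + q) : Module.Finite ℂ (sec hξ p q c) :=
  have := finite_monomialSpan p q c
  Submodule.finiteDimensional_of_le (sec_le_monomialSpan c hξ p q h)

lemma sec_mono {p p' q : ℕ} {c c' : ℤ} (hp : p ≤ p') (hc : c ≤ c') :
    sec hξ p q c ≤ sec hξ p' q c' := by
  rintro f ⟨h1, h2, h3⟩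
  refine ⟨h1, ?_, fun d hd => (h3 d hd).trans hc⟩
  obtain ⟨s, rfl⟩ := Nat.exists_eq_add_of_le hp
  have := Subring.mul_mem _ (Subring.pow_mem _ (inv_coord_mem_yPt hξ.swap).1 s) h2
  convert this using 1
  rw [Nat.cast_add, neg_add, zpow_add₀ (hξ.ne_zero 0), show swapCoord ξ 1 = ξ 0 from rfl]
  simp
  ring

/-- Rank and nullity of the restriction to `z = x`, whose kernel consists of multiples of `z - x`.
Cardinal ranks need no finiteness beforehand. -/
lemma rank_sec_le_add {p p' q c : ℕ} (hp : p ≤ p' + 1) :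
    Module.rank ℂ (sec hξ p q c) ≤
      ((p + 2 * c + 1) * (q + 1) : ℕ) + Module.rank ℂ (sec hξ p' (q + 1) (c - 1)) := by
  let L : sec hξ p q c →ₗ[ℂ] ChartRing := resE.toLinearMap.domRestrict _
  rw [← LinearMap.rank_range_add_rank_ker L]
  refine add_le_add ?_ ?_
  · refine (Submodule.rank_mono (t := bidegreeLE (p + 2 * c) q) ?_).trans (rank_bidegreeLE _ _)
    rintro _ ⟨f, rfl⟩
    exact resE_mem_bidegreeLE hξ f.2
  · have h1 : (LinearMap.ker L).map (sec hξ p q c).subtype ≤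
        (sec hξ p' (q + 1) (c - 1)).map (LinearMap.mulLeft ℂ (𝕏 2 - 𝕏 0)) := by
      rintro _ ⟨f, hf, rfl⟩
      obtain ⟨g, hg⟩ := exists_eq_mul_of_resE_eq_zero (f := f.1) hf
      refine ⟨g, sec_of_mul hξ ?_, hg.symm⟩
      rw [← hg]
      exact sec_mono hξ hp le_rfl f.2
    have h2 := (LinearMap.ker L).equivMapOfInjective _ (sec hξ p q c).injective_subtype
    rw [h2.rank_eq]
    exact (Submodule.rank_mono h1).trans (rank_map_le _ _)

lemma rank_sec_eq_zero {p q : ℕ} {c : ℤ} (hc : c < 0) : Module.rank ℂ (sec hξ p q c) = 0 := by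
  have : sec hξ p q c = ⊥ := (Submodule.eq_bot_iff _).2 fun f hf => zDegreeLE_neg hc hf.2.2
  rw [this, rank_bot]

/-- The first and third bounds descend together while `q` rises, so `B` is the sum of the dimensions
of the successive restrictions. -/
lemma rank_sec_le (j : ℕ) : ∀ q : ℕ, ∃ B : ℕ, Module.rank ℂ (sec hξ j q j) ≤ B ∧
    2 * B = (j + 1) * (j ^ 2 + 3 * j * q + 3 * j + 2 * q + 2) := by
  induction j with
  | zero =>
    intro q
    refine ⟨q + 1, ?_, by ring⟩
    refine (rank_sec_le_add hξ (p' := 0) (Nat.zero_le _)).trans ?_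
    rw [rank_sec_eq_zero hξ (by simp)]
    simp
  | succ j ih =>
    intro q
    obtain ⟨B, hB, h⟩ := ih (q + 1)
    refine ⟨(j + 1 + 2 * (j + 1) + 1) * (q + 1) + B, ?_, ?_⟩
    · rw [show (j : ℤ) = ((j + 1 : ℕ) : ℤ) - 1 by simp] at hB
      refine (rank_sec_le_add hξ (p' := j) le_rfl).trans ((add_le_add_right hB _).trans ?_)
      rw [← Nat.cast_add]
    · rw [mul_add, h]
      ring

/-- The leading term `2 m³` amounts to volume `12`, which has to stay below the `13` of
`thirteen_le_finrank`. -/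
lemma finrank_sec_le (m : ℕ) :
    2 * Module.finrank ℂ (sec hξ m m m) ≤ (m + 1) * (4 * m ^ 2 + 5 * m + 2) := by
  obtain ⟨B, hB, h⟩ := rank_sec_le hξ m m
  have h1 : Module.finrank ℂ (sec hξ m m m) ≤ B := Module.finrank_le_of_rank_le hB
  nlinarith

end Generators

end Fano
end

noncomputable section

namespace Fano

local notation "𝕏" => MvPolynomial.X (R := ℂ) (σ := Fin 3)

/-! ### Orders of vanishing along the curve -/

section Jets

open MvPolynomial

variable {K : Type*} [Field K] [Algebra ℂ K] {ξ : Fin 3 → K}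

/-- The ideal of the curve. -/
def curveIdeal : Ideal ChartRing := Ideal.span {𝕏 2 - 𝕏 0, 𝕏 0 - 𝕏 1}

lemma uPoly_mem_curveIdeal : 𝕏 2 - 𝕏 0 ∈ curveIdeal := Ideal.subset_span (by simp)
lemma rPoly_mem_curveIdeal : 𝕏 0 - 𝕏 1 ∈ curveIdeal := Ideal.subset_span (by simp)

/-- The expression of a polynomial in the coordinates `x, u, r`. -/
def curveVars : ChartRing →ₐ[ℂ] ChartRing := aeval ![𝕏 0, 𝕏 0 - 𝕏 2, 𝕏 0 + 𝕏 1]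

lemma aeval_curveVars (f : ChartRing) : aeval (curveCoord ξ) (curveVars f) = aeval ξ f := by
  rw [curveVars, aeval_aeval]
  congr 2
  funext i
  fin_cases i <;> simp [curveCoord, uu, rr]

lemma aeval_curveVars_self (f : ChartRing) :
    aeval ![𝕏 0, 𝕏 2 - 𝕏 0, 𝕏 0 - 𝕏 1] (curveVars f) = f := by
  rw [curveVars, aeval_aeval]
  conv_rhs => rw [← aeval_X_left_apply f]
  congr 2
  funext i
  fin_cases i <;> simp

variable (hξ : IsCoord ξ)

lemma order_blowE_of_mem_pow (d : ℕ) : ∀ {f : ChartRing}, f ∈ curveIdeal ^ d →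
    uu ξ ^ (-d : ℤ) * aeval ξ f ∈ (divPt hξ.blowE).toSubring := by
  have hm := coord_mem_divPt hξ.blowE
  have hu0 := hξ.uu_ne_zero
  have hmem : ∀ f : ChartRing, aeval ξ f ∈ (divPt hξ.blowE).toSubring := fun f =>
    (locOf_pt hξ.blowE _).hasConst.adjoin_le (fun i => (mem_of_blowE hξ hm).1 i)
      (aeval_mem_adjoin ξ f)
  have h1 : ∀ f ∈ curveIdeal, (uu ξ)⁻¹ * aeval ξ f ∈ (divPt hξ.blowE).toSubring := by
    intro f hf
    induction hf using Submodule.span_induction with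
    | mem f hf =>
      rcases hf with rfl | rfl
      · rw [show aeval ξ (𝕏 2 - 𝕏 0) = uu ξ by simp [uu], inv_mul_cancel₀ hu0]
        exact Subring.one_mem _
      · rw [show aeval ξ (𝕏 0 - 𝕏 1) = rr ξ by simp [rr], mul_comm, ← div_eq_mul_inv]
        exact hm 2
    | zero => simp
    | add f g _ _ hf hg =>
      rw [map_add, mul_add]
      exact Subring.add_mem _ hf hg
    | smul a f _ hf =>
      rw [smul_eq_mul, map_mul, mul_left_comm]
      exact Subring.mul_mem _ (hmem a) hf
  induction d with
  | zero => intro f _; simpa using hmem f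
  | succ d ih =>
    intro f hf
    rw [pow_succ] at hf
    induction hf using Submodule.mul_induction_on' with
    | mem_mul_mem f hf g hg =>
      convert Subring.mul_mem _ (ih hf) (h1 g hg) using 1
      rw [map_mul, Nat.cast_succ, neg_add, zpow_add₀ hu0]
      simp
      ring
    | add f _ g _ hf hg =>
      rw [map_add, mul_add]
      exact Subring.add_mem _ hf hg

/-- Since `r = u ρ`, the order along `E` of a monomial is its total degree in `u, r`, and
`monomial_order` excludes cancellation. -/
lemma order_blowE_iff (d : ℕ) (f : ChartRing) :
    uu ξ ^ (-d : ℤ) * aeval ξ f ∈ (divPt hξ.blowE).toSubring ↔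
      ∀ e ∈ (curveVars f).support, d ≤ e 1 + e 2 := by
  have hM : (!![1, 0, 0; 0, 1, 0; 0, 1, 1] : Matrix (Fin 3) (Fin 3) ℤ).det ≠ 0 := by
    rw [Matrix.det_fin_three]
    simp
  have hu0 := hξ.uu_ne_zero
  have hα : ∀ i, curveCoord ξ i = ∏ j, blowE ξ j ^
      (!![1, 0, 0; 0, 1, 0; 0, 1, 1] : Matrix (Fin 3) (Fin 3) ℤ) i j := by
    intro i
    rw [Fin.prod_univ_three]
    fin_cases i <;> simp [curveCoord, blowE_eq]
    field_simp
  have h := monomial_order hξ.blowE hM hα (curveVars f) d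
  rw [aeval_curveVars] at h
  rw [show uu ξ = blowE ξ 1 from rfl, h]
  refine forall₂_congr fun e _ => ?_
  rw [Fin.sum_univ_three]
  simp only [Matrix.of_apply, Matrix.cons_val]
  constructor <;> intro h <;> omega

lemma mem_curveIdeal_pow_of_support {d : ℕ} {f : ChartRing}
    (h : ∀ e ∈ (curveVars f).support, d ≤ e 1 + e 2) : f ∈ curveIdeal ^ d := by
  rw [← aeval_curveVars_self f, aeval_def, eval₂_eq']
  refine Ideal.sum_mem _ fun e he => Ideal.mul_mem_left _ _ ?_
  rw [Fin.prod_univ_three, mul_assoc]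
  refine Ideal.mul_mem_left _ _ (Ideal.pow_le_pow_right (h e he) ?_)
  rw [pow_add]
  exact Ideal.mul_mem_mul (Ideal.pow_mem_pow uPoly_mem_curveIdeal _)
    (Ideal.pow_mem_pow rPoly_mem_curveIdeal _)

include hξ in
lemma mem_curveIdeal_pow_iff {d : ℕ} {f : ChartRing} :
    f ∈ curveIdeal ^ d ↔ ∀ e ∈ (curveVars f).support, d ≤ e 1 + e 2 :=
  ⟨fun h => (order_blowE_iff hξ d f).1 (order_blowE_of_mem_pow hξ d h),
    mem_curveIdeal_pow_of_support⟩

include hξ in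
-- The powers of the ideal are detected by the order along `E`, for which `z - x` has order one.
lemma mem_curveIdeal_pow_of_mul {d : ℕ} {f : ChartRing}
    (h : (𝕏 2 - 𝕏 0) * f ∈ curveIdeal ^ (d + 1)) : f ∈ curveIdeal ^ d := by
  refine mem_curveIdeal_pow_of_support ((order_blowE_iff hξ d f).1 ?_)
  have h1 := order_blowE_of_mem_pow hξ _ h
  convert h1 using 1
  rw [map_mul, show aeval ξ (𝕏 2 - 𝕏 0) = uu ξ by simp [uu], Nat.cast_succ, neg_add,
    zpow_add₀ hξ.uu_ne_zero, zpow_neg_one]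
  have := hξ.uu_ne_zero
  field_simp

lemma swapVars_mem_curveIdeal_pow {d : ℕ} {f : ChartRing} (h : f ∈ curveIdeal ^ d) :
    swapVars f ∈ curveIdeal ^ d := by
  have h1 : curveIdeal.map swapVars ≤ curveIdeal := by
    rw [curveIdeal, Ideal.map_span, Ideal.span_le, ← curveIdeal]
    rintro _ ⟨g, hg, rfl⟩
    rcases hg with rfl | rfl
    · have := add_mem uPoly_mem_curveIdeal rPoly_mem_curveIdeal
      simpa using this
    · have := neg_mem rPoly_mem_curveIdeal
      simpa using this
  have h2 := Ideal.mem_map_of_mem swapVars h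
  rw [Ideal.map_pow] at h2
  exact Ideal.pow_right_mono h1 d h2

lemma dvd_resE {d : ℕ} {f : ChartRing} (h : f ∈ curveIdeal ^ d) :
    (𝕏 0 - 𝕏 1) ^ d ∣ resE f := by
  have h1 : curveIdeal.map resE ≤ Ideal.span {𝕏 0 - 𝕏 1} := by
    rw [curveIdeal, Ideal.map_span, Ideal.span_le]
    rintro _ ⟨g, hg, rfl⟩
    rcases hg with rfl | rfl
    · simp [resE]
    · exact Ideal.subset_span (by simp [resE])
  have h2 := Ideal.mem_map_of_mem resE h
  rw [Ideal.map_pow] at h2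
  have h3 := Ideal.pow_right_mono h1 d h2
  rwa [Ideal.span_singleton_pow, Ideal.mem_span_singleton] at h3

/-- The restriction to `E₁` has degree at most `q` in `y` and is divisible by `(x - y) ^ (d + 1)`
with `d ≥ q`, so it is zero. -/
lemma exists_eq_uPoly_mul {p q d : ℕ} {c : ℤ} {f : ChartRing} (hf : f ∈ sec hξ (p + 1) q c)
    (hd : f ∈ curveIdeal ^ (d + 1)) (hq : q ≤ d) :
    ∃ g ∈ sec hξ p (q + 1) (c - 1), g ∈ curveIdeal ^ d ∧ f = (𝕏 2 - 𝕏 0) * g := by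
  rcases lt_or_ge c 0 with hc | hc
  · exact ⟨0, zero_mem _, zero_mem _, by rw [zDegreeLE_neg hc hf.2.2, mul_zero]⟩
  lift c to ℕ using hc
  have h1 := (degreeOf_resE hξ hf).2.1
  have h2 : resE f = 0 := by
    obtain ⟨k, hk⟩ := dvd_resE hd
    by_contra h0
    have hr : (𝕏 0 - 𝕏 1) ^ (d + 1) ≠ 0 := by rintro h; simp [hk, h] at h0
    have hk0 : k ≠ 0 := by rintro rfl; simp [hk] at h0
    have hdeg : 1 ≤ degreeOf 1 (𝕏 0 - 𝕏 1) := by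
      have : Finsupp.single 1 1 ∈ (𝕏 0 - 𝕏 1).support := by
        simp [coeff_X, Finsupp.single_left_inj]
      simpa using le_degreeOf_of_mem_support 1 this
    rw [hk, degreeOf_mul_eq hr hk0, degreeOf_pow_eq _ _ _ (by rintro h; simp [h] at hdeg)] at h1
    nlinarith
  obtain ⟨g, rfl⟩ := exists_eq_mul_of_resE_eq_zero h2
  exact ⟨g, sec_of_mul hξ hf, mem_curveIdeal_pow_of_mul hξ hd, rfl⟩

lemma exists_eq_wPoly_mul {p q d : ℕ} {c : ℤ} {f : ChartRing} (hf : f ∈ sec hξ p (q + 1) c)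
    (hd : f ∈ curveIdeal ^ (d + 1)) (hp : p ≤ d) :
    ∃ g ∈ sec hξ (p + 1) q (c - 1), g ∈ curveIdeal ^ d ∧ f = (𝕏 2 - 𝕏 1) * g := by
  have h1 : swapVars f ∈ sec hξ.swap (q + 1) p c := by
    rwa [sec_swap, swapVars_swapVars]
  obtain ⟨g, hg, hgd, hfg⟩ := exists_eq_uPoly_mul hξ.swap h1 (swapVars_mem_curveIdeal_pow hd) hp
  refine ⟨swapVars g, (sec_swap hξ).1 hg, swapVars_mem_curveIdeal_pow hgd, ?_⟩
  rw [← swapVars_swapVars f, hfg]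
  simp

/-- The equation of `E₁ + E₂`. -/
def uwPoly : ChartRing := (𝕏 2 - 𝕏 0) * (𝕏 2 - 𝕏 1)

/-- The classes `(1, -1, 1)` and `(-1, 1, 1)` of `E₁` and `E₂` add up to `(0, 0, 2)`, so dividing by
both keeps the first two bounds and the step can be repeated. -/
lemma exists_eq_uwPoly_mul {m d : ℕ} (hm : 1 ≤ m) {c : ℤ} {f : ChartRing} (hf : f ∈ sec hξ m m c)
    (hd : f ∈ curveIdeal ^ (d + 2)) (hmd : m ≤ d + 1) :
    ∃ g ∈ sec hξ m m (c - 2), g ∈ curveIdeal ^ d ∧ f = uwPoly * g := by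
  obtain ⟨m, rfl⟩ : ∃ k, m = k + 1 := ⟨m - 1, by omega⟩
  obtain ⟨g, hg, hgd, rfl⟩ := exists_eq_uPoly_mul hξ hf hd hmd
  obtain ⟨h, hh, hhd, rfl⟩ := exists_eq_wPoly_mul hξ hg hgd (by omega)
  exact ⟨h, by rwa [show c - 2 = c - 1 - 1 by ring], hhd, by rw [uwPoly]; ring⟩

lemma exists_eq_uwPoly_pow_mul {m : ℕ} (hm : 1 ≤ m) (k : ℕ) : ∀ {d : ℕ} {c : ℤ} {f : ChartRing},
    f ∈ sec hξ m m c → f ∈ curveIdeal ^ (d + 2 * k) → m ≤ d + 1 →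
    ∃ g ∈ sec hξ m m (c - 2 * k), g ∈ curveIdeal ^ d ∧ f = uwPoly ^ k * g := by
  induction k with
  | zero => exact fun {d c f} hf hd _ => ⟨f, by simpa using hf, hd, by simp⟩
  | succ k ih =>
    intro d c f hf hd hmd
    obtain ⟨g, hg, hgd, rfl⟩ := ih (d := d + 2) hf
      (by rwa [show d + 2 + 2 * k = d + 2 * (k + 1) by ring]) (by omega)
    obtain ⟨h, hh, hhd, rfl⟩ := exists_eq_uwPoly_mul hξ hm hg hgd hmd
    refine ⟨h, ?_, hhd, by ring⟩
    rwa [show c - 2 * ((k + 1 : ℕ) : ℤ) = c - 2 * (k : ℤ) - 2 by push_cast; ring]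

/-- The sections of `-m K_X` vanishing to order `d` along the curve. -/
def jetSec (m d : ℕ) : Submodule ℂ ChartRing :=
  sec hξ m m (2 * m : ℕ) ⊓ (curveIdeal ^ d).restrictScalars ℂ

/-- Multiplicity `3m + 1 = (m - 1) + 2 (m + 1)` allows `m + 1` divisions, each lowering the bound
`2m` on the degree in `z` by two. -/
lemma jetSec_eq_bot {m d : ℕ} (hm : 1 ≤ m) (hd : 3 * m < d) : jetSec hξ m d = ⊥ := by
  refine (Submodule.eq_bot_iff _).2 ?_
  rintro f ⟨h1, h2⟩
  obtain ⟨g, hg, -, rfl⟩ := exists_eq_uwPoly_pow_mul hξ hm (m + 1) (d := m - 1) h1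
    (Ideal.pow_le_pow_right (by omega) h2) (by omega)
  rw [zDegreeLE_neg (by push_cast; linarith) hg.2.2, mul_zero]

/-- Half of `m`, rounded up, divisions by the equation of `E₁ + E₂` bring the bound `2m` on the
degree in `z` down to at most `m`. -/
lemma finrank_jetSec_two_mul {m : ℕ} (hm : 1 ≤ m) :
    Module.finrank ℂ (jetSec hξ m (2 * m)) ≤ Module.finrank ℂ (sec hξ m m m) := by
  have := finite_sec hξ (p := m) (q := m) (c := m) (by omega)
  have h : jetSec hξ m (2 * m) ≤
      (sec hξ m m m).map (LinearMap.mulLeft ℂ (uwPoly ^ ((m + 1) / 2))) := by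
    rintro f ⟨h1, h2⟩
    obtain ⟨g, hg, -, rfl⟩ := exists_eq_uwPoly_pow_mul hξ hm ((m + 1) / 2) (d := m - 1) h1
      (Ideal.pow_le_pow_right (by omega) h2) (by omega)
    exact ⟨g, sec_mono hξ le_rfl (by omega) hg, rfl⟩
  exact (Submodule.finrank_mono h).trans (Submodule.finrank_map_le _ _)

lemma finite_jetSec {m : ℕ} (hm : 1 ≤ m) (d : ℕ) : Module.Finite ℂ (jetSec hξ m d) :=
  have := finite_sec hξ (p := m) (q := m) (c := 2 * m) (by omega)
  Submodule.finiteDimensional_of_le inf_le_left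

lemma jetSec_anti (m : ℕ) {d e : ℕ} (h : d ≤ e) : jetSec hξ m e ≤ jetSec hξ m d :=
  inf_le_inf_left _ fun _ hf => Ideal.pow_le_pow_right h hf

/-! ### Counting jets -/

lemma coeff_single_zero (G : ChartRing) (n : ℕ) :
    coeff (Finsupp.single 0 n) G = (aeval ![Polynomial.X, 0, 0] G : Polynomial ℂ).coeff n := by
  induction G using MvPolynomial.induction_on' with
  | monomial e c =>
    rw [aeval_monomial, Finsupp.prod_fintype _ _ (fun _ => pow_zero _), Fin.prod_univ_three,
      coeff_monomial]
    simp only [Matrix.cons_val]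
    by_cases h1 : e 1 = 0
    · by_cases h2 : e 2 = 0
      · have : e = Finsupp.single 0 n ↔ n = e 0 := by
          rw [Finsupp.ext_iff, Fin.forall_fin_succ, Fin.forall_fin_succ, Fin.forall_fin_succ]
          simp [h1, h2, eq_comm]
        simp [h1, h2, this, Polynomial.coeff_X_pow]
      · have : e ≠ Finsupp.single 0 n := by rintro rfl; simp at h2
        simp [h2, this]
    · have : e ≠ Finsupp.single 0 n := by rintro rfl; simp at h1
      simp [h1, this]
  | add f g hf hg => rw [coeff_add, hf, hg, map_add, Polynomial.coeff_add]

/-- The exponent of `xⁿ uʲ rⁱ`. -/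
def expo (n j i : ℕ) : Fin 3 →₀ ℕ := Finsupp.single 0 n + (Finsupp.single 1 j + Finsupp.single 2 i)

/-- In total degree `i + j` in `u, r` only the restriction of `G` to `u = r = 0` contributes. -/
lemma coeff_expo {G : ChartRing} {n n' j j' i d : ℕ} (hij : i + j = d) (hj' : j' ≤ d)
    (hG : (aeval ![Polynomial.X, 0, 0] G : Polynomial ℂ) = Polynomial.X ^ n) :
    coeff (expo n' j' (d - j')) (𝕏 2 ^ i * 𝕏 1 ^ j * G) = if n' = n ∧ j' = j then 1 else 0 := by
  have h1 : 𝕏 2 ^ i * 𝕏 1 ^ j = monomial (Finsupp.single 1 j + Finsupp.single 2 i) 1 := by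
    rw [X_pow_eq_monomial, X_pow_eq_monomial, monomial_mul, one_mul, add_comm]
  rw [h1, coeff_monomial_mul']
  by_cases hj : j' = j
  · subst hj
    obtain rfl : i = d - j' := by omega
    rw [if_pos (by rw [expo]; exact le_add_self), one_mul, expo, add_tsub_cancel_right,
      coeff_single_zero, hG, Polynomial.coeff_X_pow]
    simp
  · rw [if_neg, if_neg (fun h => hj h.2)]
    intro h
    have h1 := h 1
    have h2 := h 2
    simp [expo] at h1 h2
    omega

/-- The coefficients of the leading forms in `u, r` of degree `d`. -/
def leadingCoeffs (d N : ℕ) : ChartRing →ₗ[ℂ] (Fin (d + 1) × Fin N → ℂ) :=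
  LinearMap.pi fun t => (lcoeff ℂ (expo t.2 t.1 (d - t.1))).comp curveVars.toLinearMap

lemma leadingCoeffs_apply (d N : ℕ) (f : ChartRing) (t : Fin (d + 1) × Fin N) :
    leadingCoeffs d N f t = coeff (expo t.2 t.1 (d - t.1)) (curveVars f) := rfl

/-- On `C` the functions `y, z, v` become `x, x, x²`, so `rⁱ uʲ yᵇ zᵏ vˡ` has leading form `x ^ (b +
k + 2 l) uʲ rⁱ`. The pole bounds let the exponent of `x` reach `(m - i + j) + 2 (2m - j) = 5m - d`.
-/
lemma exists_leadingCoeffs {m d : ℕ} (hd : d < m) (t : Fin (d + 1) × Fin (5 * m - d + 1)) :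
    ∃ f ∈ jetSec hξ m d, leadingCoeffs d (5 * m - d + 1) f = Pi.single t 1 := by
  obtain ⟨⟨j, hj⟩, ⟨n, hn⟩⟩ := t
  obtain ⟨i, hij⟩ : ∃ i, d = i + j := ⟨d - j, by omega⟩
  -- Powers of `y` are used up first, then powers of `z`, and finally factors `z` are exchanged for
  -- `v`.
  obtain ⟨b, k, l, hb, hkl, hbkl⟩ : ∃ b k l, i + b ≤ m + j ∧ j + k + l ≤ 2 * m ∧
      b + k + 2 * l = n := by
    rcases Nat.lt_or_ge n (m - i + j + (2 * m - j)) with h | h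
    · rcases Nat.lt_or_ge n (m - i + j) with h' | h'
      · exact ⟨n, 0, 0, by omega, by omega, by omega⟩
      · exact ⟨m - i + j, n - (m - i + j), 0, by omega, by omega, by omega⟩
    · exact ⟨m - i + j, 2 * (2 * m - j) - (n - (m - i + j)), (n - (m - i + j)) - (2 * m - j),
        by omega, by omega, by omega⟩
  refine ⟨𝕏 0 ^ 0 * (𝕏 0 - 𝕏 1) ^ i * (𝕏 2 - 𝕏 0) ^ j * 𝕏 1 ^ b * 𝕏 2 ^ k * veePoly ^ l,
    ⟨prod_mem_sec hξ (by omega) (by omega) (by omega), ?_⟩, ?_⟩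
  · have h1 := Ideal.mul_mem_mul (Ideal.pow_mem_pow rPoly_mem_curveIdeal i)
      (Ideal.pow_mem_pow uPoly_mem_curveIdeal j)
    rw [← pow_add, ← hij] at h1
    have h2 := Ideal.mul_mem_right (𝕏 1 ^ b * 𝕏 2 ^ k * veePoly ^ l) _ h1
    rw [SetLike.mem_coe, Submodule.restrictScalars_mem]
    convert h2 using 1
    ring
  · funext ⟨⟨j', hj'⟩, ⟨n', hn'⟩⟩
    rw [leadingCoeffs_apply]
    have h1 : curveVars (𝕏 0 ^ 0 * (𝕏 0 - 𝕏 1) ^ i * (𝕏 2 - 𝕏 0) ^ j * 𝕏 1 ^ b * 𝕏 2 ^ k *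
        veePoly ^ l) = 𝕏 2 ^ i * 𝕏 1 ^ j * curveVars (𝕏 1 ^ b * 𝕏 2 ^ k * veePoly ^ l) := by
      simp [curveVars]
      ring
    rw [h1, coeff_expo (n := n) hij.symm (by omega)]
    · simp [Pi.single_apply, Prod.ext_iff, and_comm]
    · rw [curveVars, aeval_aeval]
      rw [← hbkl]
      simp [veePoly]
      ring

lemma leadingCoeffs_eq_zero {m d N : ℕ} {f : ChartRing} (hf : f ∈ jetSec hξ m (d + 1)) :
    leadingCoeffs d N f = 0 := by
  funext t
  rw [leadingCoeffs_apply, Pi.zero_apply]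
  by_contra h
  have h1 := (mem_curveIdeal_pow_iff hξ).1 hf.2 _ (mem_support_iff.2 h)
  have h2 := t.1.2
  simp [expo] at h1
  omega

/-- The leading coefficients map the sections of multiplicity `d` onto a space of dimension `(d +
1)(5m - d + 1)` and kill those of multiplicity `d + 1`. -/
lemma finrank_jetSec_succ_add {m d : ℕ} (hd : d < m) :
    Module.finrank ℂ (jetSec hξ m (d + 1)) + (d + 1) * (5 * m - d + 1) ≤
      Module.finrank ℂ (jetSec hξ m d) := by
  have := finite_jetSec hξ (m := m) (by omega) d
  let L := (leadingCoeffs d (5 * m - d + 1)).domRestrict (jetSec hξ m d)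
  have hL : LinearMap.range L = ⊤ := by
    rw [eq_top_iff, ← (Pi.basisFun ℂ (Fin (d + 1) × Fin (5 * m - d + 1))).span_eq,
      Submodule.span_le]
    rintro _ ⟨t, rfl⟩
    obtain ⟨f, hf, h⟩ := exists_leadingCoeffs hξ hd t
    exact ⟨⟨f, hf⟩, by rw [Pi.basisFun_apply]; exact h⟩
  have h1 := LinearMap.finrank_range_add_finrank_ker L
  rw [hL, finrank_top, Module.finrank_pi, Fintype.card_prod, Fintype.card_fin,
    Fintype.card_fin] at h1
  have h2 : jetSec hξ m (d + 1) ≤ (LinearMap.ker L).map (jetSec hξ m d).subtype := fun f hf =>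
    ⟨⟨f, jetSec_anti hξ m (Nat.le_succ d) hf⟩, leadingCoeffs_eq_zero hξ hf, rfl⟩
  have h3 := (Submodule.finrank_mono h2).trans (Submodule.finrank_map_le _ _)
  omega

lemma finrank_jetSec_add {m k : ℕ} (hk : k ≤ m) :
    6 * Module.finrank ℂ (jetSec hξ m k) + k * (k + 1) * (15 * m + 5) ≤
      6 * Module.finrank ℂ (jetSec hξ m 0) + 2 * k ^ 2 * (k + 1) := by
  induction k with
  | zero => simp
  | succ k ih =>
    have h1 := ih (by omega)
    have h2 := finrank_jetSec_succ_add hξ (show k < m by omega)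
    obtain ⟨s, hs⟩ : ∃ s, 5 * m = k + s := ⟨5 * m - k, by omega⟩
    rw [hs, add_tsub_cancel_left] at h2
    zify at *
    have h3 : (15 * m : ℤ) = 3 * (k + s) := by linarith
    rw [h3] at h1 ⊢
    nlinarith

/-- Six times the sum of `(d + 1)(5m - d + 1)` over `d < m` is `m (m + 1)(13 m + 5)`. -/
lemma thirteen_le_finrank (m : ℕ) :
    6 * Module.finrank ℂ (jetSec hξ m m) + 13 * m ^ 3 ≤ 6 * Module.finrank ℂ (jetSec hξ m 0) := by
  have := finrank_jetSec_add hξ (le_refl m)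
  nlinarith

/-! ### Orders of vanishing along the divisor -/

/-- For `d ≤ m` a lowest term `uʲ rⁱ` has order `a (i + j) + b i`, and `i ≤ m`. For larger `d` that
would only give `b d`; instead `E₁ + E₂` is split off, with multiplicity `2` along `C` and order
`2a` along `F`. -/
lemma order_le_of_notMem (w : Weights) {m : ℕ} (hm : 1 ≤ m) (d : ℕ) :
    ∀ {c : ℤ} {n : ℕ} {f : ChartRing}, f ∈ sec hξ m m c → f ∈ curveIdeal ^ d →
    f ∉ curveIdeal ^ (d + 1) →
    divCoord w ξ 1 ^ (-n : ℤ) * aeval ξ f ∈ (divF w hξ).toSubring → n ≤ w.a * d + w.b * m := by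
  induction d using Nat.strong_induction_on with
  | _ d ih =>
  intro c n f hf hd hd' hn
  rcases Nat.lt_or_ge m d with hmd | hmd
  · obtain ⟨d, rfl⟩ : ∃ k, d = k + 2 := ⟨d - 2, by omega⟩
    obtain ⟨g, hg, hgd, rfl⟩ := exists_eq_uwPoly_mul hξ hm hf hd (by omega)
    have hgd' : g ∉ curveIdeal ^ (d + 1) := by
      intro h
      apply hd'
      have h1 : uwPoly ∈ curveIdeal ^ 2 := by
        rw [pow_two]
        refine Ideal.mul_mem_mul uPoly_mem_curveIdeal ?_
        have := add_mem uPoly_mem_curveIdeal rPoly_mem_curveIdeal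
        simpa using this
      have := Ideal.mul_mem_mul h1 h
      rwa [← pow_add, show 2 + (d + 1) = d + 2 + 1 by ring] at this
    rcases Nat.lt_or_ge n (2 * w.a) with hna | hna
    · nlinarith
    obtain ⟨n, rfl⟩ := Nat.exists_eq_add_of_le hna
    have h2 := ih d (by omega) hg hgd hgd' (n := n) ?_
    · nlinarith
    have ht := tt_ne_zero w hξ
    have hu := (order_uu w hξ).2
    -- Since `z - y = u + r = u (1 + ρ)` with `1 + ρ` a unit along `F`, the equation of `E₁ + E₂`
    -- has order exactly `2a`.
    have hρ : (1 + rho ξ)⁻¹ ∈ (divF w hξ).toSubring := by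
      have h1 := rho_mem_mx_divF w hξ
      refine inv_mem_of_notMem_mx (Subring.add_mem _ (Subring.one_mem _) h1.1) fun h => ?_
      exact one_notMem_mx _ (by simpa using sub_mem_mx h h1)
    have h3 := Subring.mul_mem _ (Subring.mul_mem _ (Subring.mul_mem _ hu hu) hρ) hn
    convert h3 using 1
    have h4 : aeval ξ uwPoly = uu ξ * (uu ξ * (1 + rho ξ)) := by
      rw [mul_add, uu_mul_rho hξ]
      simp [uwPoly, uu, rr]
    have h5 : 1 + rho ξ ≠ 0 := by
      intro h
      apply one_notMem_mx (divF w hξ)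
      rw [eq_neg_of_add_eq_zero_left h]
      exact neg_mem_mx (rho_mem_mx_divF w hξ)
    have hu0 := hξ.uu_ne_zero
    rw [map_mul, h4]
    simp only [zpow_neg, zpow_natCast, Nat.cast_add, neg_add, zpow_add₀ ht,
      two_mul]
    field_simp
  · obtain ⟨e, he, hde⟩ : ∃ e ∈ (curveVars f).support, e 1 + e 2 ≤ d := by
      by_contra! h
      exact hd' (mem_curveIdeal_pow_of_support fun e he => h e he)
    -- The last row is `r = u ρ`; the determinant is again `a q - b p = 1`.
    have hM : (!![1, 0, 0; 0, (w.a : ℤ), (w.p : ℤ);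
        0, (w.a + w.b : ℤ), (w.p + w.q : ℤ)]).det ≠ 0 := by
      rw [Matrix.det_fin_three]
      have := w.bezout
      zify at this
      simp
      intro h
      linarith
    have hα : ∀ i, curveCoord ξ i = ∏ j, divCoord w ξ j ^
        (!![1, 0, 0; 0, (w.a : ℤ), (w.p : ℤ); 0, (w.a + w.b : ℤ), (w.p + w.q : ℤ)]) i j := by
      intro i
      have h1 := (hξ.div w).ne_zero 1
      have h2 := (hξ.div w).ne_zero 2
      rw [Fin.prod_univ_three]
      fin_cases i
      · simp [curveCoord, divCoord]
      · have := uu_eq w hξ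
        simpa [curveCoord] using this
      · have h3 := uu_eq w hξ
        have h4 := rho_eq w hξ
        have h5 := uu_mul_rho hξ
        change rr ξ = divCoord w ξ 0 ^ (0 : ℤ) * divCoord w ξ 1 ^ (w.a + w.b : ℤ) *
          divCoord w ξ 2 ^ (w.p + w.q : ℤ)
        rw [zpow_zero, one_mul, zpow_add₀ h1, zpow_add₀ h2, ← h5, h4, h3]
        simp only [zpow_natCast]
        ring
    have h := (monomial_order (hξ.div w) hM hα (curveVars f) n).1 (by rwa [aeval_curveVars]) e he
    rw [Fin.sum_univ_three] at h
    simp only [Matrix.of_apply, Matrix.cons_val] at h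
    have h6 : n ≤ w.a * (e 1 + e 2) + w.b * e 2 := by
      zify
      linarith
    nlinarith [Nat.mul_le_mul_left w.a hde, Nat.mul_le_mul_left w.b (show e 2 ≤ m by omega)]

/-- The numerical hypothesis is `a (d - 1) + b m < n` without natural subtraction: multiplicity `d -
1` or less is excluded by `order_le_of_notMem`. -/
lemma mem_curveIdeal_pow_of_order (w : Weights) {m n d : ℕ} (hm : 1 ≤ m) {c : ℤ} {f : ChartRing}
    (hf : f ∈ sec hξ m m c)
    (hn : divCoord w ξ 1 ^ (-n : ℤ) * aeval ξ f ∈ (divF w hξ).toSubring)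
    (h : w.a * d + w.b * m < n + w.a) : f ∈ curveIdeal ^ d := by
  induction d with
  | zero => simp
  | succ d ih =>
    by_contra h1
    have := order_le_of_notMem hξ w hm d hf (ih (by nlinarith)) h1 hn
    nlinarith

end Jets

end Fano
end

noncomputable section

namespace Fano

local notation "𝕏" => MvPolynomial.X (R := ℂ) (σ := Fin 3)

/-! ### Regular differential forms on the charts of the threefold -/

section Forms

variable {K : Type*} [Field K] [Algebra ℂ K] {ξ : Fin 3 → K}

/-- The coordinates on the chart of `X` that meets the divisor at infinity of the third factor. -/
def zCoord (ξ : Fin 3 → K) : Fin 3 → K := ![ξ 0, (ξ 2)⁻¹, ξ 1]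

lemma IsCoord.z (hξ : IsCoord ξ) : IsCoord (zCoord ξ) := by
  have hm := coord_mem_adjoin (zCoord ξ)
  refine hξ.of_mem fun i => ?_
  fin_cases i
  · exact hm 0
  · exact hm 2
  · have := inv_mem (hm 1)
    rwa [show (zCoord ξ 1)⁻¹ = ξ 2 from inv_inv _] at this

lemma coordForm_yCoord (hξ : IsCoord ξ) :
    coordForm (yCoord ξ) = (-(ξ 1)⁻¹) • coordForm ξ := by
  have h1 := hξ.ne_zero 1
  rw [coordForm_eq_det_smul (τ := yCoord ξ) (σ := ξ)
    !![1, 0, 0; 0, -(ξ 1)⁻¹ ^ 2, 0; -ξ 1, uu ξ, ξ 1]]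
  · congr 1
    rw [Matrix.det_fin_three]
    simp
    field_simp
  · intro i
    rw [Fin.sum_univ_three]
    fin_cases i
    · simp [yCoord]
    · simp [yCoord, Derivation.leibniz_inv]
    · simp [yCoord, Derivation.leibniz, uu, smul_sub]
      abel

lemma coordForm_zCoord : coordForm (zCoord ξ) = ((ξ 2)⁻¹ ^ 2) • coordForm ξ := by
  rw [coordForm_eq_det_smul (τ := zCoord ξ) (σ := ξ) !![1, 0, 0; 0, 0, -(ξ 2)⁻¹ ^ 2; 0, 1, 0]]
  · congr 1
    rw [Matrix.det_fin_three]
    simp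
  · intro i
    rw [Fin.sum_univ_three]
    fin_cases i <;> simp [zCoord, Derivation.leibniz_inv]

lemma coordForm_swapCoord : coordForm (swapCoord ξ) = (-1 : K) • coordForm ξ := by
  rw [coordForm_eq_det_smul (τ := swapCoord ξ) (σ := ξ) !![0, 1, 0; 1, 0, 0; 0, 0, 1]]
  · congr 1
    rw [Matrix.det_fin_three]
    simp
  · intro i
    rw [Fin.sum_univ_three]
    fin_cases i <;> simp [swapCoord]

lemma D_div_vee (hv : vee ξ ≠ 0) : KaehlerDifferential.D ℂ K (ξ 2 / vee ξ) =
    (-(ξ 2 * (ξ 2 - ξ 1)) / vee ξ ^ 2) • KaehlerDifferential.D ℂ K (ξ 0) +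
    (-(ξ 2 * (ξ 2 - ξ 0)) / vee ξ ^ 2) • KaehlerDifferential.D ℂ K (ξ 1) +
    (-(ξ 0 * ξ 1) / vee ξ ^ 2) • KaehlerDifferential.D ℂ K (ξ 2) := by
  have h2 : KaehlerDifferential.D ℂ K (vee ξ) =
      (ξ 2 - ξ 1) • KaehlerDifferential.D ℂ K (ξ 0) +
      (ξ 2 - ξ 0) • KaehlerDifferential.D ℂ K (ξ 1) +
      (ξ 0 + ξ 1) • KaehlerDifferential.D ℂ K (ξ 2) := by
    rw [vee, map_sub, Derivation.leibniz, Derivation.leibniz, map_add]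
    module
  have h3 : -(ξ 0 * ξ 1) / vee ξ ^ 2 = (vee ξ)⁻¹ - ξ 2 * (ξ 0 + ξ 1) / vee ξ ^ 2 := by
    field_simp
    rw [vee]
    ring
  rw [h3, div_eq_mul_inv, Derivation.leibniz, Derivation.leibniz_inv, h2]
  simp only [div_eq_mul_inv, inv_pow]
  generalize (vee ξ)⁻¹ = v
  generalize KaehlerDifferential.D ℂ K (ξ 0) = e0
  generalize KaehlerDifferential.D ℂ K (ξ 1) = e1
  generalize KaehlerDifferential.D ℂ K (ξ 2) = e2
  generalize (vee ξ ^ 2)⁻¹ = s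
  module

lemma coordForm_invCoord (hξ : IsCoord ξ) :
    coordForm (invCoord ξ) = (-(ξ 0 * ξ 1 * vee ξ ^ 2)⁻¹) • coordForm ξ := by
  have h0 := hξ.ne_zero 0
  have h1 := hξ.ne_zero 1
  have hv := hξ.vee_ne_zero
  rw [coordForm_eq_det_smul (τ := invCoord ξ) (σ := ξ) !![-(ξ 0)⁻¹ ^ 2, 0, 0;
    0, -(ξ 1)⁻¹ ^ 2, 0; -(ξ 2 * (ξ 2 - ξ 1)) / vee ξ ^ 2, -(ξ 2 * (ξ 2 - ξ 0)) / vee ξ ^ 2,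
    -(ξ 0 * ξ 1) / vee ξ ^ 2]]
  · congr 1
    rw [Matrix.det_fin_three]
    simp
    field_simp
  · intro i
    rw [Fin.sum_univ_three]
    fin_cases i
    · simp [invCoord, Derivation.leibniz_inv]
    · simp [invCoord, Derivation.leibniz_inv]
    · have := D_div_vee hv
      simpa [invCoord] using this

/-- Near `P` the regular forms are spanned by a monomial multiple of `dx ∧ dy ∧ dz`. -/
def HasForms (ξ : Fin 3 → K) (P : LocalSubring K) : Prop :=
  ∃ i j k, RegAt (hx ξ) i P ∧ RegAt (hy ξ) j P ∧ RegAt (hz ξ) k P ∧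
    ∀ ω ∈ regularForms P, ∃ c ∈ P.toSubring,
      ω = (c / (hx ξ i * hy ξ j * hz ξ k ^ 2)) • coordForm ξ

variable {P : LocalSubring K}

lemma HasForms.of_swapCoord (h : HasForms (swapCoord ξ) P) : HasForms ξ P := by
  obtain ⟨i, j, k, hi, hj, hk, h⟩ := h
  rw [hx_swapCoord] at hi h
  rw [hy_swapCoord] at hj h
  rw [hz_swapCoord] at hk h
  refine ⟨j, i, k, hj, hi, hk, fun ω hω => ?_⟩
  obtain ⟨c, hc, rfl⟩ := h ω hω
  refine ⟨-c, Subring.neg_mem _ hc, ?_⟩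
  rw [coordForm_swapCoord, smul_smul, mul_comm (hy ξ i)]
  congr 1
  ring

lemma HasForms.of_invCoord (hξ : IsCoord ξ) (h : HasForms (invCoord ξ) P) : HasForms ξ P := by
  have h0 := hξ.ne_zero 0
  have h1 := hξ.ne_zero 1
  have hv := hξ.vee_ne_zero
  obtain ⟨i, j, k, hi, hj, hk, h⟩ := h
  refine ⟨_, _, _, (regAt_invCoord (inv_ne_zero h0) (hx_invCoord hξ)).1 hi,
    (regAt_invCoord (inv_ne_zero h1) (hy_invCoord hξ)).1 hj,
    (regAt_invCoord (inv_ne_zero hv) (hz_invCoord hξ)).1 hk, fun ω hω => ?_⟩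
  obtain ⟨c, hc, rfl⟩ := h ω hω
  refine ⟨-c, Subring.neg_mem _ hc, ?_⟩
  rw [coordForm_invCoord hξ, smul_smul, hx_invCoord hξ, hy_invCoord hξ, hz_invCoord hξ]
  congr 1
  have := hξ.hx_ne_zero i.rev
  have := hξ.hy_ne_zero j.rev
  have := hξ.hz_ne_zero k.rev
  field_simp

lemma adjoin_quotients_le {A : Subalgebra ℂ K} {i j k} (hx' : ∀ l, hx ξ l / hx ξ i ∈ A)
    (hy' : ∀ l, hy ξ l / hy ξ j ∈ A) (hz' : ∀ l, hz ξ l / hz ξ k ∈ A) :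
    (Algebra.adjoin ℂ (quotients (hx ξ) i ∪ quotients (hy ξ) j ∪
      quotients (hz ξ) k)).toSubring ≤ A.toSubring := by
  refine adjoin_le_of A.algebraMap_mem ?_
  rintro _ ((⟨l, rfl⟩ | ⟨l, rfl⟩) | ⟨l, rfl⟩)
  exacts [hx' l, hy' l, hz' l]

lemma hasForms_000 (hξ : IsCoord ξ) (h : IsX ξ P) (hi : RegAt (hx ξ) 0 P) (hj : RegAt (hy ξ) 0 P)
    (hk : RegAt (hz ξ) 0 P) : HasForms ξ P := by
  refine ⟨0, 0, 0, hi, hj, hk, fun ω hω => ?_⟩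
  have hl := h.locOf_adjoin hξ fun l => by
    fin_cases l
    exacts [regAt_hx_zero.1 hi, regAt_hy_zero.1 hj, (regAt_hz_zero.1 hk).1]
  obtain ⟨c, hc, rfl⟩ := exists_smul_of_mem_regularForms hl hω
  exact ⟨c, hc, by simp [hx, hy, hz]⟩

lemma hasForms_001 (hξ : IsCoord ξ) (h : IsX ξ P) (hi : RegAt (hx ξ) 0 P) (hj : RegAt (hy ξ) 0 P)
    (hk : RegAt (hz ξ) 1 P) : HasForms ξ P := by
  refine ⟨0, 0, 1, hi, hj, hk, fun ω hω => ?_⟩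
  have h2 := hξ.ne_zero 2
  have hm : ∀ i, zCoord ξ i ∈ Algebra.adjoin ℂ (Set.range (zCoord ξ)) :=
    fun i => Algebra.subset_adjoin ⟨i, rfl⟩
  have hl : LocOf (Algebra.adjoin ℂ (Set.range (zCoord ξ))).toSubring P := by
    refine (h.locOf hξ hi hj hk).mono (adjoin_quotients_le ?_ ?_ ?_) (h.hasConst.adjoin_le ?_)
    · intro l
      fin_cases l
      · simp [hx, one_mem]
      · simpa [hx, zCoord] using hm 0
    · intro l
      fin_cases l
      · simp [hy, one_mem]
      · simpa [hy, zCoord] using hm 2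
    · intro l
      fin_cases l
      · simpa [hz, zCoord] using hm 1
      · simp [hz, h2, one_mem]
      · have := sub_mem (add_mem (hm 0) (hm 2)) (mul_mem (mul_mem (hm 0) (hm 2)) (hm 1))
        convert this using 1
        simp [hz, zCoord, vee]
        field_simp
    · intro l
      fin_cases l
      · exact regAt_hx_zero.1 hi
      · simpa [hz, zCoord] using hk 0
      · exact regAt_hy_zero.1 hj
  obtain ⟨c, hc, rfl⟩ := exists_smul_of_mem_regularForms hl hω
  refine ⟨c, hc, ?_⟩
  rw [coordForm_zCoord, smul_smul]
  congr 1
  simp [hx, hy, hz]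
  rw [div_eq_mul_inv]

lemma hasForms_010 (hξ : IsCoord ξ) (h : IsX ξ P) (hi : RegAt (hx ξ) 0 P) (hj : RegAt (hy ξ) 1 P)
    (hk : RegAt (hz ξ) 0 P) : HasForms ξ P := by
  refine ⟨0, 1, 0, hi, hj, hk, fun ω hω => ?_⟩
  have h2 := hξ.ne_zero 1
  have hm : ∀ i, yCoord ξ i ∈ Algebra.adjoin ℂ (Set.range (yCoord ξ)) :=
    fun i => Algebra.subset_adjoin ⟨i, rfl⟩
  have hl : LocOf (Algebra.adjoin ℂ (Set.range (yCoord ξ))).toSubring P := by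
    have hz' : ξ 2 ∈ Algebra.adjoin ℂ (Set.range (yCoord ξ)) := by
      convert add_mem (mul_mem (hm 1) (hm 2)) (hm 0) using 1
      simp [yCoord, uu, h2]
    refine (h.locOf hξ hi hj hk).mono (adjoin_quotients_le ?_ ?_ ?_) (h.hasConst.adjoin_le ?_)
    · intro l
      fin_cases l
      · simp [hx, one_mem]
      · simpa [hx, yCoord] using hm 0
    · intro l
      fin_cases l
      · simpa [hy, yCoord] using hm 1
      · simp [hy, h2, one_mem]
    · intro l
      fin_cases l
      · simp [hz, one_mem]
      · simpa [hz] using hz'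
      · have := add_mem (hm 2) (mul_mem (hm 0) hz')
        convert this using 1
        simp [hz, yCoord, vee, uu]
        ring
    · intro l
      have hx' := regAt_hx_zero.1 hi
      have hz' := regAt_hz_zero.1 hk
      fin_cases l
      · exact hx'
      · simpa [hy, yCoord] using hj 0
      · have := Subring.sub_mem _ hz'.2 (Subring.mul_mem _ hx' hz'.1)
        convert this using 1
        simp [yCoord, vee, uu]
        ring
  obtain ⟨c, hc, rfl⟩ := exists_smul_of_mem_regularForms hl hω
  refine ⟨-c, Subring.neg_mem _ hc, ?_⟩
  rw [coordForm_yCoord hξ, smul_smul]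
  congr 1
  simp [hx, hy, hz]
  rw [div_eq_mul_inv]
  ring

lemma inv_mem_or_inv_mem_of_add_eq_one {a b : K} (ha : a ∈ P.toSubring) (hb : b ∈ P.toSubring)
    {k l : K} (hk : k ∈ P.toSubring) (hl : l ∈ P.toSubring) (h : k * a + l * b = 1) :
    a⁻¹ ∈ P.toSubring ∨ b⁻¹ ∈ P.toSubring := by
  by_contra! hc
  have h1 : a ∈ mx P := by
    by_contra h
    exact hc.1 (inv_mem_of_notMem_mx ha h)
  have h2 : b ∈ mx P := by
    by_contra h
    exact hc.2 (inv_mem_of_notMem_mx hb h)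
  exact one_notMem_mx P (h ▸ add_mem_mx (mul_mem_mx hk h1) (mul_mem_mx hl h2))

lemma RegAt.of_inv_mem {n : ℕ} {v : Fin n → K} (hv : ∀ l, v l ≠ 0) {i j : Fin n}
    (h : RegAt v i P) (hj : (v j / v i)⁻¹ ∈ P.toSubring) : RegAt v j P := by
  intro l
  have := P.toSubring.mul_mem (h l) hj
  convert this using 1
  have := hv i
  have := hv j
  field_simp

/-- Three charts are affine spaces with explicit coordinates. In the other cases treated here the
equation of `X` is a relation `k a + l b = 1` that moves the point into one of these three. -/
lemma hasForms_zero (hξ : IsCoord ξ) (h : IsX ξ P) (hi : RegAt (hx ξ) 0 P) {j : Fin 2} {k : Fin 3}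
    (hj : RegAt (hy ξ) j P) (hk : RegAt (hz ξ) k P) (hjk : j = 0 ∨ k ≠ 2) : HasForms ξ P := by
  have hx' := regAt_hx_zero.1 hi
  fin_cases j
  · have hy' := regAt_hy_zero.1 hj
    fin_cases k
    · exact hasForms_000 hξ h hi hj hk
    · exact hasForms_001 hξ h hi hj hk
    · have hv := hξ.vee_ne_zero
      rcases inv_mem_or_inv_mem_of_add_eq_one (hk 0) (hk 1)
        (Subring.neg_mem _ (Subring.mul_mem _ hx' hy')) (Subring.add_mem _ hx' hy')
        (by simp [hz]; field_simp; rw [vee]; ring) with h1 | h1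
      · exact hasForms_000 hξ h hi hj (hk.of_inv_mem hξ.hz_ne_zero h1)
      · exact hasForms_001 hξ h hi hj (hk.of_inv_mem hξ.hz_ne_zero h1)
  · fin_cases k
    · exact hasForms_010 hξ h hi hj hk
    · have h1 := hξ.ne_zero 1
      have h2 := hξ.ne_zero 2
      rcases inv_mem_or_inv_mem_of_add_eq_one (hj 0) (hk 0)
        (Subring.sub_mem _ (hk 2) hx') hx'
        (by simp [hz, hy]; field_simp; rw [vee]; ring) with h1 | h1
      · exact hasForms_001 hξ h hi (hj.of_inv_mem hξ.hy_ne_zero h1) hk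
      · exact hasForms_010 hξ h hi hj (hk.of_inv_mem hξ.hz_ne_zero h1)
    · simp at hjk

lemma IsX.hasForms (hξ : IsCoord ξ) (h : IsX ξ P) : HasForms ξ P := by
  have key : ∀ {ξ : Fin 3 → K}, IsCoord ξ → IsX ξ P → ∀ {i j : Fin 2} {k : Fin 3},
      RegAt (hx ξ) i P → RegAt (hy ξ) j P → RegAt (hz ξ) k P →
      ((i = 0 ∧ j = 0) ∨ ((i = 0 ∨ j = 0) ∧ k ≠ 2)) → HasForms ξ P := by
    intro ξ hξ h i j k hi hj hk hijk
    by_cases hi0 : i = 0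
    · subst hi0
      exact hasForms_zero hξ h hi hj hk (by tauto)
    · obtain ⟨rfl, hk2⟩ : j = 0 ∧ k ≠ 2 := by tauto
      refine HasForms.of_swapCoord (hasForms_zero hξ.swap (isX_swapCoord.2 h) (j := i) (k := k)
        ?_ ?_ ?_ (Or.inr hk2))
      · rwa [hx_swapCoord]
      · rwa [hy_swapCoord]
      · rwa [hz_swapCoord]
  obtain ⟨i, j, k, hi, hj, hk⟩ := h.exists_regAt
  -- Reversing all three indices brings every remaining triple into this range.
  by_cases hijk : (i = 0 ∧ j = 0) ∨ ((i = 0 ∨ j = 0) ∧ k ≠ 2)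
  · exact key hξ h hi hj hk hijk
  · refine HasForms.of_invCoord hξ (key hξ.inv ((isX_invCoord hξ).2 h) (i := i.rev) (j := j.rev)
      (k := k.rev) ?_ ?_ ?_ ?_)
    · rwa [regAt_invCoord (inv_ne_zero (hξ.ne_zero 0)) (hx_invCoord hξ), Fin.rev_rev]
    · rwa [regAt_invCoord (inv_ne_zero (hξ.ne_zero 1)) (hy_invCoord hξ), Fin.rev_rev]
    · rwa [regAt_invCoord (inv_ne_zero hξ.vee_ne_zero) (hz_invCoord hξ), Fin.rev_rev]
    · revert hijk
      clear hi hj hk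
      decide +revert

lemma isX_of_locOf_yCoord (hξ : IsCoord ξ)
    (h : LocOf (Algebra.adjoin ℂ (Set.range (yCoord ξ))).toSubring P) : IsX ξ P := by
  have h1 := hξ.ne_zero 1
  have hm : ∀ i, yCoord ξ i ∈ P.toSubring := fun i => h.1 (mem_adjoin_range _ i)
  have hz' : ξ 2 ∈ P.toSubring := by
    convert Subring.add_mem _ (Subring.mul_mem _ (hm 1) (hm 2)) (hm 0) using 1
    simp [yCoord, uu, h1]
  refine ⟨0, 1, 0, h.mono (adjoin_le_of (Subalgebra.algebraMap_mem _) ?_)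
    (adjoin_le_of h.hasConst ?_)⟩
  · set A := Algebra.adjoin ℂ (quotients (hx ξ) 0 ∪ quotients (hy ξ) 1 ∪ quotients (hz ξ) 0)
    have hA0 : ∀ l, hx ξ l / hx ξ 0 ∈ A := fun l => Algebra.subset_adjoin (Or.inl (Or.inl ⟨l, rfl⟩))
    have hA1 : ∀ l, hy ξ l / hy ξ 1 ∈ A := fun l => Algebra.subset_adjoin (Or.inl (Or.inr ⟨l, rfl⟩))
    have hA2 : ∀ l, hz ξ l / hz ξ 0 ∈ A := fun l => Algebra.subset_adjoin (Or.inr ⟨l, rfl⟩)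
    rintro _ ⟨i, rfl⟩
    fin_cases i
    · simpa [hx, yCoord] using hA0 1
    · simpa [hy, yCoord] using hA1 0
    · have := sub_mem (hA2 2) (mul_mem (hA0 1) (hA2 1))
      change _ ∈ A
      convert this using 1
      simp [yCoord, hz, hx, vee, uu]
      ring
  · rintro _ ((⟨l, rfl⟩ | ⟨l, rfl⟩) | ⟨l, rfl⟩)
    · fin_cases l
      · simp [hx]
      · simpa [hx, yCoord] using hm 0
    · fin_cases l
      · simpa [hy, yCoord] using hm 1
      · simp [hy, h1]
    · fin_cases l
      · simp [hz]
      · simpa [hz] using hz'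
      · have := Subring.add_mem _ (hm 2) (Subring.mul_mem _ (hm 0) hz')
        convert this using 1
        simp [hz, yCoord, vee, uu]
        ring

lemma isX_of_locOf_zCoord (hξ : IsCoord ξ)
    (h : LocOf (Algebra.adjoin ℂ (Set.range (zCoord ξ))).toSubring P) : IsX ξ P := by
  have h2 := hξ.ne_zero 2
  have hm : ∀ i, zCoord ξ i ∈ P.toSubring := fun i => h.1 (mem_adjoin_range _ i)
  refine ⟨0, 0, 1, h.mono (adjoin_le_of (Subalgebra.algebraMap_mem _) ?_)
    (adjoin_le_of h.hasConst ?_)⟩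
  · set A := Algebra.adjoin ℂ (quotients (hx ξ) 0 ∪ quotients (hy ξ) 0 ∪ quotients (hz ξ) 1)
    have hA0 : ∀ l, hx ξ l / hx ξ 0 ∈ A := fun l => Algebra.subset_adjoin (Or.inl (Or.inl ⟨l, rfl⟩))
    have hA1 : ∀ l, hy ξ l / hy ξ 0 ∈ A := fun l => Algebra.subset_adjoin (Or.inl (Or.inr ⟨l, rfl⟩))
    have hA2 : ∀ l, hz ξ l / hz ξ 1 ∈ A := fun l => Algebra.subset_adjoin (Or.inr ⟨l, rfl⟩)
    rintro _ ⟨i, rfl⟩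
    fin_cases i
    · simpa [hx, zCoord] using hA0 1
    · simpa [hz, zCoord] using hA2 0
    · simpa [hy, zCoord] using hA1 1
  · rintro _ ((⟨l, rfl⟩ | ⟨l, rfl⟩) | ⟨l, rfl⟩)
    · fin_cases l
      · simp [hx]
      · simpa [hx, zCoord] using hm 0
    · fin_cases l
      · simp [hy]
      · simpa [hy, zCoord] using hm 2
    · fin_cases l
      · simpa [hz, zCoord] using hm 1
      · simp [hz, h2]
      · have := Subring.sub_mem _ (Subring.add_mem _ (hm 0) (hm 2))
          (Subring.mul_mem _ (Subring.mul_mem _ (hm 0) (hm 2)) (hm 1))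
        convert this using 1
        simp [hz, zCoord, vee]
        field_simp

/-- The order along the divisor at infinity of the third factor is the degree in `z`. -/
lemma mem_zDegreeLE_of_order (hξ : IsCoord ξ) {c : ℤ} {f : ChartRing}
    (h : ξ 2 ^ (-c) * MvPolynomial.aeval ξ f ∈ (divPt hξ.z).toSubring) : f ∈ zDegreeLE c := by
  have hM : (!![1, 0, 0; 0, 0, 1; 0, -1, 0] : Matrix (Fin 3) (Fin 3) ℤ).det ≠ 0 := by
    rw [Matrix.det_fin_three]
    simp
  have hα : ∀ i, ξ i = ∏ j, zCoord ξ j ^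
      (!![1, 0, 0; 0, 0, 1; 0, -1, 0] : Matrix (Fin 3) (Fin 3) ℤ) i j := by
    intro i
    rw [Fin.prod_univ_three]
    fin_cases i <;> simp [zCoord]
  intro e he
  have h1 := (monomial_order hξ.z hM hα f (-c)).1 (by simpa [zCoord] using h) e he
  rw [Fin.sum_univ_three] at h1
  simp only [Matrix.of_apply, Matrix.cons_val] at h1
  linarith

end Forms

end Fano
end

noncomputable section

namespace Fano

local notation "𝕏" => MvPolynomial.X (R := ℂ) (σ := Fin 3)

/-! ### Anticanonical sections as polynomials -/

section Polynomials

open MvPolynomial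

/-- In the coordinates `x, u, r` the two polynomials are distinct variables. This is the codimension
two property of `C`. -/
lemma not_dvd_uPoly_and_rPoly {π : ChartRing} (hπ : ¬ IsUnit π) (h1 : π ∣ 𝕏 2 - 𝕏 0)
    (h2 : π ∣ 𝕏 0 - 𝕏 1) : False := by
  have h3 : curveVars π ∣ 𝕏 1 := by
    have := map_dvd curveVars h1
    simpa [curveVars] using this
  have h4 : curveVars π ∣ 𝕏 2 := by
    have := map_dvd curveVars h2
    simpa [curveVars] using this
  have h5 : ¬ IsUnit (curveVars π) := by
    intro h
    apply hπ
    rw [← aeval_curveVars_self π]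
    exact h.map _
  obtain ⟨k, hk⟩ := h3
  have hX : Irreducible (𝕏 1) := X_prime.irreducible
  rcases hX.isUnit_or_isUnit hk with h | h
  · exact h5 h
  · have h6 : 𝕏 1 ∣ 𝕏 2 := by
      refine dvd_trans ?_ h4
      rw [hk]
      exact (IsUnit.mul_right_dvd h).2 dvd_rfl
    rw [X_dvd_X] at h6
    simp at h6

end Polynomials

section

variable {P : LocalSubring FunctionField}

/-- On `C` the first two points of `ℙ¹` agree, so one cannot be infinite while the other is finite.
-/
lemma notMem_C_of_inv_mem_mx {i j : Fin 3} (hij : (i = 0 ∧ j = 1) ∨ (i = 1 ∧ j = 0))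
    (hi : (xi i)⁻¹ ∈ mx P) (hj : xi j ∈ P.toSubring) : P ∉ C := by
  intro hC
  have hne := fun i => isCoord_xi.ne_zero i
  have key : ∀ l, (xi l)⁻¹ ∈ mx P → xi l ∉ P.toSubring := fun l h h' =>
    notMem_mx_of_inv_mem (inv_ne_zero (hne l)) (by rwa [inv_inv]) h
  obtain ⟨χ, hχ, hc⟩ := exists_isChart hC
  have hr := ((hχ.mem_C_iff (mem_X_of_mem_C hC) hc).1 hC).2
  rcases hχ with rfl | rfl
  · exact key i hi (hc i)
  · refine key j ?_ hj
    change (xi 0)⁻¹ - (xi 1)⁻¹ ∈ mx P at hr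
    rcases hij with ⟨rfl, rfl⟩ | ⟨rfl, rfl⟩
    · have := sub_mem_mx hi hr
      rwa [sub_sub_cancel] at this
    · have := add_mem_mx hr hi
      rwa [sub_add_cancel] at this

lemma divPt_z_notMem_C : divPt isCoord_xi.z ∉ C := by
  intro hC
  have hne := fun i => isCoord_xi.ne_zero i
  have hm := coord_mem_divPt isCoord_xi.z
  obtain ⟨χ, hχ, hc⟩ := exists_isChart hC
  have hr := ((hχ.mem_C_iff (mem_X_of_mem_C hC) hc).1 hC).2
  rcases hχ with rfl | rfl
  · refine notMem_mx_of_inv_mem (inv_ne_zero (hne 2)) ?_ (coord_one_mem_mx isCoord_xi.z)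
    rw [inv_inv]
    exact hc 2
  · change (xi 0)⁻¹ - (xi 1)⁻¹ ∈ mx _ at hr
    have h1 := mul_mem_mx (Subring.mul_mem _ (hm 0) (hm 2)) hr
    have h2 : zCoord xi 0 * zCoord xi 2 * ((xi 0)⁻¹ - (xi 1)⁻¹) =
        MvPolynomial.aeval (zCoord xi) (𝕏 2 - 𝕏 0) := by
      have h0 := hne 0
      have h1 := hne 1
      simp only [map_sub, MvPolynomial.aeval_X]
      change xi 0 * xi 1 * ((xi 0)⁻¹ - (xi 1)⁻¹) = xi 1 - xi 0
      field_simp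
    rw [h2] at h1
    have h3 := mem_coordIdeal_singleton.1 ((aeval_mem_mx_pt isCoord_xi.z _).1 h1)
    obtain ⟨k, hk⟩ := h3
    have := congrArg (MvPolynomial.eval ![0, 0, 1]) hk
    simp at this

lemma aeval_xi (f : ChartRing) :
    MvPolynomial.aeval xi f = algebraMap ChartRing FunctionField f := by
  have : (MvPolynomial.aeval xi : ChartRing →ₐ[ℂ] FunctionField) =
      IsScalarTower.toAlgHom ℂ ChartRing FunctionField := by
    ext i
    simp [xi]
  rw [this]
  rfl

lemma notMem_C_of_isPrime {π : ChartRing} (hπ : ¬ IsUnit π) [(Ideal.span {π}).IsPrime] :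
    pt isCoord_xi (Ideal.span {π}) ∉ C := by
  intro hC
  have hl := locOf_pt isCoord_xi (Ideal.span {π})
  obtain ⟨h1, h2⟩ := (IsChart.mem_C_iff (Or.inl rfl) (mem_X_of_mem_C hC)
    fun i => hl.1 (mem_adjoin_range xi i)).1 hC
  rw [show uu xi = MvPolynomial.aeval xi (𝕏 2 - 𝕏 0) by simp [uu], aeval_mem_mx_pt,
    Ideal.mem_span_singleton] at h1
  rw [show rr xi = MvPolynomial.aeval xi (𝕏 0 - 𝕏 1) by simp [rr], aeval_mem_mx_pt,
    Ideal.mem_span_singleton] at h2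
  exact not_dvd_uPoly_and_rPoly hπ h1 h2

/-- A rational function regular in codimension one on the affine chart is a polynomial. -/
lemma exists_aeval_eq {g : FunctionField}
    (h : ∀ P ∈ X.points, P ∉ C → (∀ i, xi i ∈ P.toSubring) → g ∈ P.toSubring) :
    ∃ f : ChartRing, MvPolynomial.aeval xi f = g := by
  obtain ⟨n, e, hne, hg⟩ := IsFractionRing.exists_reduced_fraction (A := ChartRing) g
  by_cases he : IsUnit (e : ChartRing)
  · obtain ⟨u, hu⟩ := he
    refine ⟨n * ↑u⁻¹, ?_⟩
    rw [aeval_xi, ← hg, IsFractionRing.mk'_eq_div, ← hu, map_mul, eq_div_iff, mul_assoc, ← map_mul,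
      Units.inv_mul, map_one, mul_one]
    rw [← aeval_xi]
    exact isCoord_xi.aeval_ne_zero u.ne_zero
  · exfalso
    -- A prime factor of the reduced denominator defines a divisor not contained in `C`, along which
    -- `g` is not regular.
    obtain ⟨π, hπ, hπe⟩ := WfDvdMonoid.exists_irreducible_factor he
      (nonZeroDivisors.ne_zero e.2)
    have : (Ideal.span {π}).IsPrime := (Ideal.span_singleton_prime hπ.ne_zero).2 hπ.prime
    have hl := locOf_pt isCoord_xi (Ideal.span {π})
    have h1 := h _ (mem_X.2 (isX_of_locOf hl)) (notMem_C_of_isPrime hπ.not_isUnit)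
      fun i => hl.1 (mem_adjoin_range xi i)
    obtain ⟨f, s, hs, hfs⟩ := (mem_pt isCoord_xi _).1 h1
    have hs0 : MvPolynomial.aeval xi s ≠ 0 :=
      isCoord_xi.aeval_ne_zero fun h0 => hs (h0 ▸ Ideal.zero_mem _)
    have he0 : MvPolynomial.aeval xi (e : ChartRing) ≠ 0 :=
      isCoord_xi.aeval_ne_zero (nonZeroDivisors.ne_zero e.2)
    rw [← hg, IsFractionRing.mk'_eq_div, ← aeval_xi, ← aeval_xi, div_eq_div_iff he0 hs0,
      ← map_mul, ← map_mul] at hfs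
    have h2 : n * s = f * e := isCoord_xi.indep hfs
    rw [Ideal.mem_span_singleton] at hs
    have h3 : π ∣ n := (hπ.prime.dvd_or_dvd (h2 ▸ hπe.mul_left f)).resolve_right hs
    exact hπ.not_isUnit (hne h3 hπe)

/-- The section of `-m K_X` given by a polynomial. -/
def polySection (m : ℕ) : ChartRing →ₗ[ℂ] (Form3 FunctionField → FunctionField) where
  toFun f ω := coeffForm ω ^ m * MvPolynomial.aeval xi f
  map_add' f g := by
    funext ω
    rw [map_add, mul_add]
    rfl
  map_smul' c f := by
    funext ω
    rw [map_smul, RingHom.id_apply, Pi.smul_apply, mul_smul_comm]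

lemma polySection_apply (m : ℕ) (f : ChartRing) (ω : Form3 FunctionField) :
    polySection m f ω = coeffForm ω ^ m * MvPolynomial.aeval xi f := rfl

lemma polySection_injective (m : ℕ) : Function.Injective (polySection m) := by
  intro f g h
  have := congrFun h (coordForm xi)
  rw [polySection_apply, polySection_apply, coeffForm_coordForm_xi, one_pow, one_mul,
    one_mul] at this
  exact isCoord_xi.indep this

lemma pow_mul_inv_pow_mem {h : FunctionField} (hh : h ≠ 0) {s : FunctionField} {i m : ℕ}
    (him : i ≤ m) (h1 : 1 / h ∈ P.toSubring) (h2 : s / h ∈ P.toSubring) :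
    s ^ i * (h ^ m)⁻¹ ∈ P.toSubring := by
  obtain ⟨k, rfl⟩ := Nat.exists_eq_add_of_le him
  convert Subring.mul_mem _ (Subring.pow_mem _ h2 i) (Subring.pow_mem _ h1 k) using 1
  rw [div_pow, div_pow, pow_add, one_pow]
  field_simp

/-- A regular form at `P` is a regular multiple of `dx ∧ dy ∧ dz` divided by the local equation `xᵢ
yⱼ z_k²`; its `m`-th power absorbs the monomials of degrees `m, m, 2m`. This is where generators of
the space of sections are needed. -/
lemma polySection_mem_of_monomialSpan {m : ℕ} {f : ChartRing}
    (hf : f ∈ monomialSpan m m (2 * m)) (hP : P ∈ X.points) {ω : Form3 FunctionField}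
    (hω : ω ∈ regularForms P) : polySection m f ω ∈ P.toSubring := by
  obtain ⟨i, j, k, hi, hj, hk, h⟩ := (mem_X.1 hP).hasForms isCoord_xi
  obtain ⟨c, hc, rfl⟩ := h ω hω
  have hi0 := isCoord_xi.hx_ne_zero i
  have hj0 := isCoord_xi.hy_ne_zero j
  have hk0 := isCoord_xi.hz_ne_zero k
  rw [polySection_apply, map_smul, coeffForm_coordForm_xi, smul_eq_mul, mul_one]
  induction hf using Submodule.span_induction with
  | mem f hf =>
    obtain ⟨n, n', l, l', hn, hn', hl, rfl⟩ := hf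
    have h1 := pow_mul_inv_pow_mem hi0 hn (hi 0) (hi 1)
    have h2 := pow_mul_inv_pow_mem hj0 hn' (hj 0) (hj 1)
    have h3 := pow_mul_inv_pow_mem hk0 (show l ≤ 2 * m - l' by omega) (hk 0) (hk 1)
    have h4 := pow_mul_inv_pow_mem hk0 (le_refl l') (hk 0) (hk 2)
    convert Subring.mul_mem _ (Subring.pow_mem _ hc m) (Subring.mul_mem _ (Subring.mul_mem _
      (Subring.mul_mem _ h1 h2) h3) h4) using 1
    have h5 : hz xi k ^ (2 * m) = hz xi k ^ (2 * m - l') * hz xi k ^ l' := by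
      rw [← pow_add]
      congr 1
      omega
    simp only [map_mul, map_pow, MvPolynomial.aeval_X, aeval_veePoly]
    rw [show hx xi 1 = xi 0 from rfl, show hy xi 1 = xi 1 from rfl, show hz xi 1 = xi 2 from rfl,
      show hz xi 2 = vee xi from rfl, div_pow, mul_pow, mul_pow, ← pow_mul, h5]
    simp only [div_eq_mul_inv, mul_inv]
    ring
  | zero => simp
  | add f g _ _ hf hg =>
    rw [map_add, mul_add]
    exact Subring.add_mem _ hf hg
  | smul a f _ hf =>
    rw [map_smul, Algebra.smul_def, mul_left_comm]
    exact Subring.mul_mem _ (X.algebraMap_mem P hP a) hf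

lemma polySection_mem {m : ℕ} (hm : 1 ≤ m) {f : ChartRing}
    (hf : f ∈ sec isCoord_xi m m (2 * m : ℕ)) :
    polySection m f ∈ anticanonicalSections X X m := by
  have h := sec_le_monomialSpan (2 * m) isCoord_xi m m (by omega) hf
  refine ⟨fun c ω => ?_, fun Q _ P hP hPQ ω hω =>
    (domination_iff.1 hPQ).1 (polySection_mem_of_monomialSpan h hP hω)⟩
  rw [polySection_apply, polySection_apply, map_smul, smul_eq_mul, mul_pow, mul_assoc]

variable {V : Model FunctionField}

/-- Points of `X` off `C` are points of `V`. They include all prime divisors of the affine chart,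
which makes the section a polynomial, and the three divisors at infinity, which bound its poles. -/
lemma exists_polySection (hV : ∀ P ∈ X.points, P ∉ C → P ∈ V.points) {m : ℕ}
    {φ : Form3 FunctionField → FunctionField} (hφ : φ ∈ anticanonicalSections V X m) :
    ∃ f ∈ sec isCoord_xi m m (2 * m : ℕ), polySection m f = φ := by
  obtain ⟨h1, h2⟩ := hφ
  have h3 : ∀ P ∈ X.points, P ∉ C → ∀ ω ∈ regularForms P, φ ω ∈ P.toSubring :=
    fun P hP hC => h2 P (hV P hP hC) P hP le_rfl
  obtain ⟨f, hf⟩ := exists_aeval_eq (g := φ (coordForm xi)) fun P hP hC hc =>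
    h3 P hP hC _ (coordForm_mem_regularForms hc)
  have hne := fun i => isCoord_xi.ne_zero i
  refine ⟨f, ⟨?_, ?_, ?_⟩, ?_⟩
  · have hX := isX_of_locOf_yCoord isCoord_xi (locOf_pt isCoord_xi.y (coordIdeal {1}))
    have h4 := h3 (divPt isCoord_xi.y) (mem_X.2 hX)
      (notMem_C_of_inv_mem_mx (Or.inr ⟨rfl, rfl⟩) (coord_one_mem_mx isCoord_xi.y)
        (coord_mem_divPt isCoord_xi.y 0)) _
      (coordForm_mem_regularForms (coord_mem_divPt isCoord_xi.y))
    rw [coordForm_yCoord isCoord_xi, h1, ← hf] at h4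
    have h5 := Subring.mul_mem _
      (Subring.pow_mem _ (Subring.neg_mem _ (Subring.one_mem (divPt isCoord_xi.y).toSubring)) m) h4
    convert h5 using 1
    rw [← mul_assoc, ← mul_pow, zpow_neg, zpow_natCast, ← inv_pow]
    simp
  · have hX := isX_of_locOf_yCoord isCoord_xi.swap (locOf_pt isCoord_xi.swap.y (coordIdeal {1}))
    have h4 := h3 (divPt isCoord_xi.swap.y) (mem_X.2 (isX_swapCoord.1 hX))
      (notMem_C_of_inv_mem_mx (Or.inl ⟨rfl, rfl⟩) (coord_one_mem_mx isCoord_xi.swap.y)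
        (coord_mem_divPt isCoord_xi.swap.y 0)) _
      (coordForm_mem_regularForms (coord_mem_divPt isCoord_xi.swap.y))
    rw [coordForm_yCoord isCoord_xi.swap, coordForm_swapCoord, smul_smul, h1, ← hf] at h4
    convert h4 using 1
    rw [zpow_neg, zpow_natCast, ← inv_pow]
    simp [swapCoord]
  · have hX := isX_of_locOf_zCoord isCoord_xi (locOf_pt isCoord_xi.z (coordIdeal {1}))
    have h4 := h3 (divPt isCoord_xi.z) (mem_X.2 hX) divPt_z_notMem_C _
      (coordForm_mem_regularForms (coord_mem_divPt isCoord_xi.z))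
    rw [coordForm_zCoord, h1, ← hf] at h4
    refine mem_zDegreeLE_of_order isCoord_xi ?_
    convert h4 using 1
    rw [zpow_neg, zpow_natCast, ← pow_mul, inv_pow]
  · funext ω
    conv_rhs => rw [eq_coeffForm_smul ω, h1, ← hf]
    rfl

lemma jetSec_zero (m : ℕ) : jetSec isCoord_xi m 0 = sec isCoord_xi m m (2 * m : ℕ) := by
  refine inf_eq_left.2 fun f _ => ?_
  rw [Submodule.restrictScalars_mem, pow_zero, Ideal.one_eq_top]
  exact Submodule.mem_top

lemma anticanonicalSections_X {m : ℕ} (hm : 1 ≤ m) :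
    anticanonicalSections X X m = (jetSec isCoord_xi m 0).map (polySection m) := by
  rw [jetSec_zero]
  apply le_antisymm
  · intro φ hφ
    obtain ⟨f, hf, rfl⟩ := exists_polySection (fun P hP _ => hP) hφ
    exact ⟨f, hf, rfl⟩
  · rintro _ ⟨f, hf, rfl⟩
    exact polySection_mem hm hf

lemma finrank_anticanonicalSections_X {m : ℕ} (hm : 1 ≤ m) :
    Module.finrank ℂ (anticanonicalSections X X m) =
      Module.finrank ℂ (jetSec isCoord_xi m 0) := by
  rw [anticanonicalSections_X hm]
  exact ((Submodule.equivMapOfInjective _ (polySection_injective m) _).finrank_eq).symm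

variable {w : Weights}

lemma vanishingSections_le {m n d : ℕ} (hm : 1 ≤ m) (h : w.a * d + w.b * m < n + w.a) :
    vanishingSections (Y (w.g * w.a) (w.g * w.b)) X (divF w isCoord_xi) m n ≤
      (jetSec isCoord_xi m d).map (polySection m) := by
  refine Submodule.span_le.2 ?_
  rintro φ ⟨hφ, hF⟩
  obtain ⟨f, hf, rfl⟩ := exists_polySection (fun P hP hC => mem_Y_of_mem_X hP hC) hφ
  refine ⟨f, ⟨hf, mem_curveIdeal_pow_of_order isCoord_xi w hm hf ?_ h⟩, rfl⟩
  have hle := (hasConst_divF w isCoord_xi).adjoin_le (coord_mem_divF w isCoord_xi)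
  have hl : LocOf _ (center _ _ hle) := locOf_center hle
  obtain ⟨k, hk, hkf⟩ := hF _ (mem_X.2 (isX_of_locOf hl)) (center_le hle) (coordForm xi)
    (coordForm_mem_regularForms fun i => hl.1 (mem_adjoin_range xi i))
  have h1 := (mem_maximalIdeal_pow (isCoord_xi.div w) k).1 hk
  rwa [hkf, polySection_apply, coeffForm_coordForm_xi, one_pow, one_mul] at h1

lemma finrank_vanishingSections_le {m n d : ℕ} (hm : 1 ≤ m)
    (h : w.a * d + w.b * m < n + w.a) :
    Module.finrank ℂ
      (vanishingSections (Y (w.g * w.a) (w.g * w.b)) X (divF w isCoord_xi) m n) ≤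
      Module.finrank ℂ (jetSec isCoord_xi m d) := by
  have := finite_jetSec isCoord_xi hm d
  exact (Submodule.finrank_mono (vanishingSections_le hm h)).trans (Submodule.finrank_map_le _ _)

lemma finrank_vanishingSections_le_zero {m : ℕ} (hm : 1 ≤ m) (n : ℕ) :
    Module.finrank ℂ
      (vanishingSections (Y (w.g * w.a) (w.g * w.b)) X (divF w isCoord_xi) m n) ≤
      Module.finrank ℂ (jetSec isCoord_xi m 0) := by
  have := finite_jetSec isCoord_xi hm 0
  have h : vanishingSections (Y (w.g * w.a) (w.g * w.b)) X (divF w isCoord_xi) m n ≤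
      (jetSec isCoord_xi m 0).map (polySection m) := by
    refine Submodule.span_le.2 ?_
    rintro φ ⟨hφ, -⟩
    obtain ⟨f, hf, rfl⟩ := exists_polySection (fun P hP hC => mem_Y_of_mem_X hP hC) hφ
    exact ⟨f, by rwa [jetSec_zero], rfl⟩
  exact (Submodule.finrank_mono h).trans (Submodule.finrank_map_le _ _)

end

end Fano
end

noncomputable section

namespace Fano

/-! ### Volumes -/

section Volumes

lemma density_eq {m : ℕ} (hm : 1 ≤ m) (n : ℕ) :
    (n : ℝ≥0∞) / ((m : ℝ≥0∞) ^ 3 / 6) = ENNReal.ofReal (6 * n / m ^ 3) := by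
  have hm' : (0 : ℝ) < m := by exact_mod_cast hm
  have h1 : (m : ℝ≥0∞) ^ 3 / 6 = ENNReal.ofReal ((m : ℝ) ^ 3 / 6) := by
    rw [ENNReal.ofReal_div_of_pos (by norm_num), ENNReal.ofReal_pow hm'.le, ENNReal.ofReal_natCast]
    simp
  rw [h1, ← ENNReal.ofReal_natCast, ← ENNReal.ofReal_div_of_pos (by positivity)]
  congr 1
  field_simp

lemma density_le {m n N : ℕ} (hm : 1 ≤ m) {c : ℝ} (hc : 0 ≤ c)
    (h : 6 * (n : ℝ) + c * m ^ 3 ≤ 6 * N) :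
    (n : ℝ≥0∞) / ((m : ℝ≥0∞) ^ 3 / 6) + ENNReal.ofReal c ≤ (N : ℝ≥0∞) / ((m : ℝ≥0∞) ^ 3 / 6) := by
  have hm' : (0 : ℝ) < (m : ℝ) ^ 3 := by positivity
  rw [density_eq hm, density_eq hm, ← ENNReal.ofReal_add (by positivity) hc]
  refine ENNReal.ofReal_le_ofReal ?_
  rw [div_add' _ _ _ hm'.ne']
  gcongr

lemma density_le_const {m n : ℕ} (hm : 1 ≤ m) {c : ℝ} (h : 6 * (n : ℝ) ≤ c * m ^ 3) :
    (n : ℝ≥0∞) / ((m : ℝ≥0∞) ^ 3 / 6) ≤ ENNReal.ofReal c := by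
  rw [density_eq hm]
  refine ENNReal.ofReal_le_ofReal ?_
  rw [div_le_iff₀ (by positivity)]
  exact h

variable {K : Type*} [Field K] [Algebra ℂ K] {ξ : Fin 3 → K}

/-- A crude bound, keeping `p` fixed in the recursion; it serves only to make the anticanonical
degree finite. -/
lemma rank_sec_le_mul (hξ : IsCoord ξ) (p c : ℕ) : ∀ q : ℕ,
    Module.rank ℂ (sec hξ p q c) ≤ ((c + 1) * (p + 2 * c + 1) * (q + c + 1) : ℕ) := by
  induction c with
  | zero =>
    intro q
    refine (rank_sec_le_add hξ (p' := p) (Nat.le_succ p)).trans ?_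
    rw [rank_sec_eq_zero hξ (by simp), add_zero]
    simp
  | succ c ih =>
    intro q
    have h := ih (q + 1)
    rw [show (c : ℤ) = ((c + 1 : ℕ) : ℤ) - 1 by simp] at h
    refine (rank_sec_le_add hξ (p' := p) (Nat.le_succ p)).trans ((add_le_add_right h _).trans ?_)
    rw [← Nat.cast_add, Nat.cast_le]
    nlinarith

lemma finrank_jetSec_zero_le (hξ : IsCoord ξ) (m : ℕ) : Module.finrank ℂ (jetSec hξ m 0) ≤
    (2 * m + 1) * (m + 2 * (2 * m) + 1) * (m + 2 * m + 1) :=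
  Module.finrank_le_of_rank_le ((Submodule.rank_mono inf_le_left).trans
    (rank_sec_le_mul hξ m (2 * m) m))

end Volumes

/-! ### Bounds for the volume, its integral and the conclusion. -/

section

variable (w : Weights)

lemma anticanonicalDegree_eq : anticanonicalDegree X = Filter.limsup (fun m : ℕ =>
    (Module.finrank ℂ (jetSec isCoord_xi m 0) : ℝ≥0∞) / ((m : ℝ≥0∞) ^ 3 / 6)) Filter.atTop := by
  refine Filter.limsup_congr ?_
  filter_upwards [Filter.eventually_ge_atTop 1] with m hm
  rw [finrank_anticanonicalSections_X hm]

lemma anticanonicalDegree_lt_top : anticanonicalDegree X < ⊤ := by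
  rw [anticanonicalDegree_eq]
  -- The constant is `6 · 3 · 6 · 4`, from the crude dimension bound.
  refine lt_of_le_of_lt (b := ENNReal.ofReal 432) (Filter.limsup_le_of_le (by isBoundedDefault) ?_)
    ENNReal.ofReal_lt_top
  filter_upwards [Filter.eventually_ge_atTop 1] with m hm
  refine density_le_const hm ?_
  have h := finrank_jetSec_zero_le isCoord_xi m
  have h1 : (2 * m + 1) * (m + 2 * (2 * m) + 1) * (m + 2 * m + 1) ≤
      (3 * m) * (6 * m) * (4 * m) := by gcongr <;> omega
  have h2 := h.trans h1
  have h3 : ((Module.finrank ℂ (jetSec isCoord_xi m 0) : ℕ) : ℝ) ≤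
      (3 * m) * (6 * m) * (4 * m) := by exact_mod_cast h2
  nlinarith

/-- Needed so that the truncated subtraction of `13` from the degree is an honest one. -/
lemma thirteen_le_anticanonicalDegree : ENNReal.ofReal 13 ≤ anticanonicalDegree X := by
  rw [anticanonicalDegree_eq]
  refine Filter.le_limsup_of_frequently_le (Filter.Eventually.frequently ?_) (by isBoundedDefault)
  filter_upwards [Filter.eventually_ge_atTop 1] with m hm
  have h := thirteen_le_finrank isCoord_xi m
  have h1 : 6 * ((Module.finrank ℂ (jetSec isCoord_xi m m) : ℕ) : ℝ) + 13 * m ^ 3 ≤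
      6 * (Module.finrank ℂ (jetSec isCoord_xi m 0) : ℕ) := by exact_mod_cast h
  exact le_add_self.trans (density_le hm (by norm_num) h1)

/-- The order of vanishing corresponding to a ray. -/
lemma lt_ceil_add {x : ℝ} {m d : ℕ} (h : (w.a : ℝ) * d + w.b * m < m * x + w.a) :
    w.a * d + w.b * m < ⌈(m : ℝ) * x⌉₊ + w.a := by
  have h1 := Nat.le_ceil ((m : ℝ) * x)
  have h2 : ((w.a * d + w.b * m : ℕ) : ℝ) < ((⌈(m : ℝ) * x⌉₊ + w.a : ℕ) : ℝ) := by
    push_cast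
    linarith
  exact_mod_cast h2

lemma vol_le (x : ℝ) :
    vol (Y (w.g * w.a) (w.g * w.b)) X (divF w isCoord_xi) x ≤ anticanonicalDegree X := by
  rw [anticanonicalDegree_eq, vol]
  refine Filter.limsup_le_limsup ?_ (by isBoundedDefault) (by isBoundedDefault)
  filter_upwards [Filter.eventually_ge_atTop 1] with m hm
  gcongr
  exact finrank_vanishingSections_le_zero hm _

/-- Order above `(a + b) m` along `F` forces multiplicity `m` along `C`. -/
lemma vol_add_thirteen_le {x : ℝ} (hx : (w.a + w.b : ℝ) < x) :
    vol (Y (w.g * w.a) (w.g * w.b)) X (divF w isCoord_xi) x + ENNReal.ofReal 13 ≤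
      anticanonicalDegree X := by
  have ha : (0 : ℝ) < w.a := by exact_mod_cast w.a_pos
  rw [anticanonicalDegree_eq, vol, ← limsup_add_const _ _ _ (by isBoundedDefault)
    (by isBoundedDefault)]
  refine Filter.limsup_le_limsup ?_ (by isBoundedDefault) (by isBoundedDefault)
  filter_upwards [Filter.eventually_ge_atTop 1] with m hm
  have hm' : (0 : ℝ) < m := by exact_mod_cast hm
  have h1 : Module.finrank ℂ (vanishingSections (Y (w.g * w.a) (w.g * w.b)) X
      (divF w isCoord_xi) m ⌈(m : ℝ) * x⌉₊) ≤ Module.finrank ℂ (jetSec isCoord_xi m m) :=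
    finrank_vanishingSections_le hm (lt_ceil_add w (by nlinarith))
  have h := thirteen_le_finrank isCoord_xi m
  refine density_le hm (by norm_num) ?_
  have h2 : 6 * Module.finrank ℂ (vanishingSections (Y (w.g * w.a) (w.g * w.b)) X
      (divF w isCoord_xi) m ⌈(m : ℝ) * x⌉₊) + 13 * m ^ 3 ≤
      6 * Module.finrank ℂ (jetSec isCoord_xi m 0) := by omega
  exact_mod_cast h2

lemma vol_le_const {x : ℝ} (hx : (2 * w.a + w.b : ℝ) < x) :
    vol (Y (w.g * w.a) (w.g * w.b)) X (divF w isCoord_xi) x ≤ ENNReal.ofReal (25 / 2) := by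
  have ha : (0 : ℝ) < w.a := by exact_mod_cast w.a_pos
  rw [vol]
  refine Filter.limsup_le_of_le (by isBoundedDefault) ?_
  -- Six times the dimension is at most `12 m³` plus lower terms, which `25/2 m³` absorbs from `m =
  -- 100` on.
  filter_upwards [Filter.eventually_ge_atTop 100] with m hm
  have hm' : (100 : ℝ) ≤ m := by exact_mod_cast hm
  have h1 : Module.finrank ℂ (vanishingSections (Y (w.g * w.a) (w.g * w.b)) X
      (divF w isCoord_xi) m ⌈(m : ℝ) * x⌉₊) ≤ Module.finrank ℂ (jetSec isCoord_xi m (2 * m)) :=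
    finrank_vanishingSections_le (by omega) (lt_ceil_add w (by push_cast; nlinarith))
  have h2 := finrank_jetSec_two_mul isCoord_xi (show 1 ≤ m by omega)
  have h3 := finrank_sec_le isCoord_xi m
  refine density_le_const (by omega) ?_
  have h4 : 2 * Module.finrank ℂ (vanishingSections (Y (w.g * w.a) (w.g * w.b)) X
      (divF w isCoord_xi) m ⌈(m : ℝ) * x⌉₊) ≤ (m + 1) * (4 * m ^ 2 + 5 * m + 2) := by omega
  have h5 : 2 * ((Module.finrank ℂ (vanishingSections (Y (w.g * w.a) (w.g * w.b)) X
      (divF w isCoord_xi) m ⌈(m : ℝ) * x⌉₊) : ℕ) : ℝ) ≤ (m + 1) * (4 * m ^ 2 + 5 * m + 2) := by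
    exact_mod_cast h4
  have h6 : (100 : ℝ) * m ^ 2 ≤ m ^ 3 := by nlinarith [sq_nonneg (m : ℝ)]
  nlinarith

lemma vol_eq_zero {x : ℝ} (hx : (3 * w.a + w.b : ℝ) < x) :
    vol (Y (w.g * w.a) (w.g * w.b)) X (divF w isCoord_xi) x = 0 := by
  have ha : (0 : ℝ) < w.a := by exact_mod_cast w.a_pos
  rw [← nonpos_iff_eq_zero, vol]
  refine Filter.limsup_le_of_le (by isBoundedDefault) ?_
  filter_upwards [Filter.eventually_ge_atTop 1] with m hm
  have hm' : (0 : ℝ) < m := by exact_mod_cast hm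
  have h1 : Module.finrank ℂ (vanishingSections (Y (w.g * w.a) (w.g * w.b)) X
      (divF w isCoord_xi) m ⌈(m : ℝ) * x⌉₊) ≤
      Module.finrank ℂ (jetSec isCoord_xi m (3 * m + 1)) :=
    finrank_vanishingSections_le hm (lt_ceil_add w (by push_cast; nlinarith))
  rw [jetSec_eq_bot isCoord_xi hm (Nat.lt_succ_self _), finrank_bot, Nat.le_zero] at h1
  rw [h1]
  simp

/-- The volume is dominated by a step function with jumps at `a + b`, `2a + b` and `3a + b`.
Subadditivity over intervals suffices, so measurability of `vol` is never needed. -/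
lemma lintegral_vol_le :
    ∫⁻ x in Set.Ioi (0 : ℝ), vol (Y (w.g * w.a) (w.g * w.b)) X (divF w isCoord_xi) x ≤
      anticanonicalDegree X * ENNReal.ofReal (w.a + w.b) +
        ((anticanonicalDegree X - ENNReal.ofReal 13) * ENNReal.ofReal w.a +
          ENNReal.ofReal (25 / 2) * ENNReal.ofReal w.a) := by
  have ha : (0 : ℝ) < w.a := by exact_mod_cast w.a_pos
  have hb : (0 : ℝ) < w.b := by exact_mod_cast w.b_pos
  set v := vol (Y (w.g * w.a) (w.g * w.b)) X (divF w isCoord_xi)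
  have key : ∀ {s t : ℝ} {c : ℝ≥0∞}, (∀ x ∈ Set.Ioc s t, v x ≤ c) →
      ∫⁻ x in Set.Ioc s t, v x ≤ c * ENNReal.ofReal (t - s) := fun {s t c} h => by
    refine (setLIntegral_mono' measurableSet_Ioc h).trans ?_
    rw [setLIntegral_const, Real.volume_Ioc]
  have split : ∀ {s t : ℝ}, s ≤ t →
      ∫⁻ x in Set.Ioi s, v x ≤ (∫⁻ x in Set.Ioc s t, v x) + ∫⁻ x in Set.Ioi t, v x :=
    fun {s t} h => by
      rw [← Set.Ioc_union_Ioi_eq_Ioi h]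
      exact lintegral_union_le _ _ _
  refine (split (t := w.a + w.b) (by positivity)).trans (add_le_add ?_
    ((split (t := 2 * w.a + w.b) (by linarith)).trans (add_le_add ?_
      ((split (t := 3 * w.a + w.b) (by linarith)).trans ?_))))
  · have := key (s := 0) (t := w.a + w.b) fun x _ => vol_le w x
    rwa [sub_zero] at this
  · have := key (s := w.a + w.b) (t := 2 * w.a + w.b) fun x hx =>
      ENNReal.le_sub_of_add_le_right ENNReal.ofReal_ne_top (vol_add_thirteen_le w hx.1)
    rwa [show (2 * w.a + w.b : ℝ) - (w.a + w.b) = w.a by ring] at this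
  · have h1 := key (s := 2 * w.a + w.b) (t := 3 * w.a + w.b) fun x hx => vol_le_const w hx.1
    rw [show (3 * w.a + w.b : ℝ) - (2 * w.a + w.b) = w.a by ring] at h1
    have h2 : ∫⁻ x in Set.Ioi (3 * w.a + w.b : ℝ), v x = 0 := by
      rw [setLIntegral_congr_fun measurableSet_Ioi (g := fun _ => 0) fun x hx => vol_eq_zero w hx]
      simp
    rw [h2, add_zero]
    exact h1

/-- The bound for the integral is `D (2a + b) - a / 2`: the gain `13` on one interval of length `a`
exceeds the loss `25/2` on the next. -/
theorem expectedVanishing_lt :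
    expectedVanishing (Y (w.g * w.a) (w.g * w.b)) X (divF w isCoord_xi) <
      ((2 * w.a + w.b : ℕ) : ℝ≥0∞) := by
  have ha : (0 : ℝ) < w.a := by exact_mod_cast w.a_pos
  have hb : (0 : ℝ) < w.b := by exact_mod_cast w.b_pos
  have h13 := thirteen_le_anticanonicalDegree
  have htop := anticanonicalDegree_lt_top.ne
  have hI := lintegral_vol_le w
  rw [expectedVanishing]
  generalize (∫⁻ x in Set.Ioi (0 : ℝ), vol (Y (w.g * w.a) (w.g * w.b)) X
    (divF w isCoord_xi) x) = I at *
  generalize anticanonicalDegree X = D at *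
  have hD : D = ENNReal.ofReal D.toReal := (ENNReal.ofReal_toReal htop).symm
  generalize D.toReal = δ at hD
  subst hD
  have hδ : 13 ≤ δ := by
    by_contra! h
    exact absurd h13 (not_le.2 ((ENNReal.ofReal_lt_ofReal_iff (by norm_num)).2 h))
  rw [ENNReal.div_lt_iff (Or.inl (by simp; linarith)) (Or.inl ENNReal.ofReal_ne_top)]
  refine hI.trans_lt ?_
  rw [← ENNReal.ofReal_sub _ (by norm_num), ← ENNReal.ofReal_mul (by linarith),
    ← ENNReal.ofReal_mul (by linarith), ← ENNReal.ofReal_mul (by norm_num),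
    ← ENNReal.ofReal_add (by nlinarith) (by positivity),
    ← ENNReal.ofReal_add (by positivity) (by nlinarith), ← ENNReal.ofReal_natCast,
    ← ENNReal.ofReal_mul (by positivity), ENNReal.ofReal_lt_ofReal_iff
      (mul_pos (by push_cast; positivity) (by linarith))]
  push_cast
  nlinarith

theorem beta_pos : 0 < beta (Y (w.g * w.a) (w.g * w.b)) X (divF w isCoord_xi) := by
  rw [beta, EReal.sub_pos]
  refine lt_of_lt_of_le (EReal.coe_ennreal_lt_coe_ennreal_iff.2 (expectedVanishing_lt w)) ?_
  have h := EReal.natCast_le_iff.2 (le_logDiscrepancy (w := w))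
  refine le_trans (le_of_eq ?_) h
  rfl

end

end Fano
end

theorem mainTheorem4 (a b : ℕ) (ha : 0 < a) (hb : 0 < b) :
    (∃! F, Fano.IsExceptionalPrimeDivisor (Fano.Y a b) Fano.Xtilde F) ∧
      ∀ F, Fano.IsExceptionalPrimeDivisor (Fano.Y a b) Fano.Xtilde F →
        0 < Fano.beta (Fano.Y a b) Fano.X F := by
  obtain ⟨w, rfl, rfl⟩ := Fano.exists_weights ha hb
  refine ⟨⟨_, Fano.isExceptionalPrimeDivisor_iff.2 rfl,
    fun F hF => Fano.isExceptionalPrimeDivisor_iff.1 hF⟩, fun F hF => ?_⟩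
  rw [Fano.isExceptionalPrimeDivisor_iff.1 hF]
  exact Fano.beta_pos w
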